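/- **Conventions.** Manifolds are smooth, Hausdorff, second countable and without boundary; complex manifolds are viewed as smooth manifolds with an integrable almost complex structure $J$. For a connection $D$, $R^D_{X,Y}=[D_X,D_Y]-D_{[X,Y]}$ and $Ric^D(Y,Z)=\mathrm{Tr}(X\mapsto R^D_{X,Y}Z)$. For a $(0,2)$-tensor $l$ and a $(1,1)$-tensor $K$: $l^s,l^a$ are the (anti-)symmetrizations (with factor $\frac12$), $l_J(X,Y)=l(X,JY)$, $(J^*l)(X,Y)=l(JX,JY)$, $(l\wedge K)_{X,Y}Z=l(X,Z)KY-l(Y,Z)KX$. For a one-form $\gamma$ and a tensor $T$ in two arguments, $(\gamma\wedge T)(X,Y,Z)=\gamma(X)T(Y,Z)-\gamma(Y)T(X,Z)$; further $(d^DT)(X,Y,Z)=(D_XT)(Y,Z)-(D_YT)(X,Z)$ and $d\eta(X,Y)=X\eta(Y)-Y\eta(X)-\eta([X,Y])$. For a $(1,2)$-tensor $B$ write $B_XY=B(X,Y)$ and $[B,B]_{X,Y}=[B_X,B_Y]$. Torsion-free complex connections $D$ ($DJ=0$) on a complex manifold are *c-projectively related* if they have the same $J$-planar curves, i.e. smooth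 curves $c$ with $D_{c'}c'\in\langle c',Jc'\rangle$; a *c-projective structure* is an equivalence class. In real dimension $2n\ge4$ put $$P^D=\tfrac1{n+1}\Big(Ric^D+\tfrac1{n-1}\big((Ric^D)^s-J^*(Ric^D)^s\big)\Big),$$ $$W^{[D]}=R^D+(P^D)^a\otimes\mathrm{Id}-(P^D_J)^a\otimes J+\tfrac12P^D\wedge\mathrm{Id}-\tfrac12P^D_J\wedge J ;$$ $W^{[D]}$ depends only on the c-projective structure. A *conical special complex structure* $(J,\nabla,\xi)$ on a manifold $M$ consists of a complex structure $J$, a flat torsion-free connection $\nabla$ with $\nabla J$ symmetric, and a nowhere vanishing vector field $\xi$ with $\nabla\xi=\mathrm{Id}$ and $L_\xi J=0$. If $\xi-\sqrt{-1}J\xi$ generates a principal $\mathbb C^*$-action (that is, the fundamental vector fields of $1$ and $\sqrt{-1}$ are $\xi$ and $J\xi$) with corresponding holomorphic principal $\mathbb C^*$-bundle $\pi:M\to(\bar M,\bar J)$, then $(\bar M,\bar J)$ is a *projective special complex manifold*. In this case let $D=\nabla-\frac12J(\nabla J)$. For every principal connection form $\omega$ on $\pi$ with $J$-invariant kernel,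 $D$ projects to a torsion-free complex connection $D^{(\omega)}$ on $\bar M$: $\pi_*(D_{\tilde X}\tilde Y)=D^{(\omega)}_XY$, with $\tilde X,\tilde Y$ the $\omega$-horizontal lifts. Its c-projective class, which does not depend on $\omega$, is the *canonical c-projective structure* $\bar{\mathcal P}(\pi)$. **PSCB type.** Let $(\bar M,\bar J,\mathcal P)$ be a complex manifold of real dimension $2n\ge4$ with a c-projective structure, and let $\pi_S:S\to\bar M$ be a principal $S^1$-bundle with a (real-valued) connection form $\eta$, normalized to be $1$ on the fundamental vector field of $\sqrt{-1}$. Let $\{\bar U_\alpha\}_{\alpha\in\Lambda}$ be an open covering of $\bar M$ with local sections $\sigma_\alpha$ of $S$ over $\bar U_\alpha$, with transition functions $e^{\sqrt{-1}f_{\alpha\beta}}$ given by $\sigma_\beta=\sigma_\alpha e^{\sqrt{-1}f_{\alpha\beta}}$, and put $\gamma^\alpha=\sigma_\alpha^*\eta$. The bundle with its connection is of *PSCB type* with collections $\{\bar B^\alpha\}$, $\{\bar c^\alpha\}$ of smooth tensor fields on the $\bar U_\alpha$ if 1. $\bar B^\alpha$ is a symmetric $(1,2)$-tensor that anti-commutes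 with $\bar J$; 2. $\bar B^\beta=e^{-2f_{\alpha\beta}\bar J}\bar B^\alpha$ on $\bar U_\alpha\cap\bar U_\beta$; 3. $\bar c^\alpha$ is a symmetric $(0,2)$-tensor with $\bar J^*\bar c^\alpha=-\bar c^\alpha$; 4. $\bar c^\beta+\sqrt{-1}\,\bar c^\beta_{\bar J}=e^{-2\sqrt{-1}f_{\alpha\beta}}(\bar c^\alpha+\sqrt{-1}\,\bar c^\alpha_{\bar J})$ on $\bar U_\alpha\cap\bar U_\beta$; 5. with $\bar{\mathcal B}(Y,Z)=\mathrm{Tr}(\bar B^\alpha_Y\bar B^\alpha_Z)$, $$W^{\mathcal P}=-\tfrac14[\bar B^\alpha,\bar B^\alpha]-\tfrac1{4(n+1)}\bar{\mathcal B}_{\bar J}\otimes\bar J+\tfrac1{8(n+1)}\bar{\mathcal B}\wedge\mathrm{Id}-\tfrac1{8(n+1)}\bar{\mathcal B}_{\bar J}\wedge\bar J ;$$ 6. there is a connection $\bar D\in\mathcal P$ such that, with $\bar a=\frac1{8(n+1)}\bar{\mathcal B}-\frac12P^{\bar D}$, for all $\alpha$ and all $X,Y,Z$: - $d\eta=2\pi_S^*\big((\bar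 a_{\bar J})^a\big)$, - $(d^{\bar D}\bar a)(X,Y,Z)=-\frac14\big(\bar c^\alpha(X,\bar B^\alpha_YZ)-\bar c^\alpha(Y,\bar B^\alpha_XZ)\big)$, - $d^{\bar D}\bar B^\alpha=-2\gamma^\alpha\wedge\bar J\bar B^\alpha+\bar c^\alpha\wedge\mathrm{Id}+\bar c^\alpha_{\bar J}\wedge\bar J$, - $\bar a(X,\bar B^\alpha_YZ)-\bar a(Y,\bar B^\alpha_XZ)+(d^{\bar D}\bar c^\alpha)(X,Y,Z)=2(\gamma^\alpha\wedge\bar c^\alpha_{\bar J})(X,Y,Z)$. **Theorem.** Let $(\bar M,\bar J,\mathcal P)$ be a complex manifold with $\dim_{\mathbb R}\bar M=2n\ge4$ and a c-projective structure $\mathcal P$, and let $\pi_S:S\to\bar M$ be a principal $S^1$-bundle with a connection $\eta$ of PSCB type. Let $\mathbb C^*=S^1\times\mathbb R^{>0}$ act on $M:=S\times\mathbb R^{>0}$ in the natural way, and let $\pi=\pi_S\circ\pi_1:M\to\bar M$, where $\pi_1:M\to S$ is the projection onto the first factor. Then $M$ admits a conical special complex structure $(J,\nabla,\xi)$ such that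 $(\bar M,\bar J)$ is a projective special complex manifold with corresponding principal $\mathbb C^*$-bundle $\pi:M\to\bar M$, and the canonical c-projective structure $\bar{\mathcal P}(\pi)$ coincides with $\mathcal P$. -/

import Mathlib

open Bundle
open scoped Manifold ContDiff

noncomputable section

namespace PSC

section Tensors

variable {E : Type*} [NormedAddCommGroup E] [NormedSpace ℝ E]
  {H : Type*} [TopologicalSpace H] (I : ModelWithCorners ℝ E H)
  (M : Type*) [TopologicalSpace M] [ChartedSpace H M]

/-! ### Tensor fields (without regularity) -/

/-- Vector fields. -/
abbrev VField := Π x : M, TangentSpace I x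

/-- Fields of endomorphisms, i.e. (1,1)-tensor fields. -/
abbrev EndField := Π x : M, TangentSpace I x →L[ℝ] TangentSpace I x

/-- (1,2)-tensor fields `B`, with `B x v w` standing for `B_v w`. -/
abbrev Tensor12 := Π x : M, TangentSpace I x →L[ℝ] TangentSpace I x →L[ℝ] TangentSpace I x

/-- (0,2)-tensor fields. -/
abbrev Tensor02 := Π x : M, TangentSpace I x →L[ℝ] TangentSpace I x →L[ℝ] ℝ

/-- Functions of two tangent vectors at a common point. They are used for (0,2)-tensor fields given
by a formula whose bilinearity is not needed in order to write the formula down. -/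
abbrev Form2 := Π x : M, TangentSpace I x → TangentSpace I x → ℝ

/-- One-forms with values in a normed space. -/
abbrev OneForm (F : Type*) [NormedAddCommGroup F] [NormedSpace ℝ F] :=
  Π x : M, TangentSpace I x →L[ℝ] F

end Tensors

section Calculus

variable {E : Type*} [NormedAddCommGroup E] [NormedSpace ℝ E]
  {H : Type*} [TopologicalSpace H] {I : ModelWithCorners ℝ E H}
  {M : Type*} [TopologicalSpace M] [ChartedSpace H M] [IsManifold I ∞ M]

/-! ### Smoothness, complex structures -/

/-- `X` is a smooth vector field. -/
def SmoothVF (X : VField I M) : Prop :=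
  ContMDiff I I.tangent ∞ (fun x => (⟨x, X x⟩ : TangentBundle I M))

/-- `X` is smooth on the set `U`. -/
def SmoothVFOn (U : Set M) (X : VField I M) : Prop :=
  ContMDiffOn I I.tangent ∞ (fun x => (⟨x, X x⟩ : TangentBundle I M)) U

/-- The vector field `J Y`. -/
def appEnd (J : EndField I M) (Y : VField I M) : VField I M := fun x => J x (Y x)

/-- The vector field `B_Y Z`. -/
def app12 (B : Tensor12 I M) (Y Z : VField I M) : VField I M := fun x => B x (Y x) (Z x)

/-- A complex structure on a smooth manifold: a smooth field of endomorphisms with `J ^ 2 = -1`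
and vanishing Nijenhuis tensor (smoothness of a tensor field is tested on smooth vector fields). -/
structure IsComplexStructure (J : EndField I M) : Prop where
  smooth : ∀ Y : VField I M, SmoothVF Y → SmoothVF (appEnd J Y)
  sq : ∀ (x : M) (v : TangentSpace I x), J x (J x v) = -v
  integrable : ∀ X Y : VField I M, SmoothVF X → SmoothVF Y → ∀ x : M,
    VectorField.mlieBracket I (appEnd J X) (appEnd J Y) x
      - J x (VectorField.mlieBracket I (appEnd J X) Y x)
      - J x (VectorField.mlieBracket I X (appEnd J Y) x)
      - VectorField.mlieBracket I X Y x = 0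

/-! ### Affine connections -/

variable (I M) in
/-- Affine connections, i.e. covariant derivatives on the tangent bundle.
`D Y x v` stands for the covariant derivative of `Y` at `x` in the direction `v`. -/
abbrev AffConn := CovariantDerivative I E (TangentSpace I : M → Type _)

/-- The vector field `D_X Y`. -/
def covD (D : AffConn I M) (X Y : VField I M) : VField I M := fun x => D Y x (X x)

/-- A smooth torsion-free connection. -/
structure IsSmoothTorsionFree [FiniteDimensional ℝ E] [CompleteSpace E] (D : AffConn I M) :
    Prop where
  smooth : CovariantDerivative.ContMDiffCovariantDerivative D ∞
  torsion_eq_zero : D.torsion = 0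

/-- A (smooth) torsion-free complex connection: `D` is torsion-free and `D J = 0`. -/
structure IsTorsionFreeComplex [FiniteDimensional ℝ E] [CompleteSpace E]
    (J : EndField I M) (D : AffConn I M) : Prop extends IsSmoothTorsionFree D where
  parallel : ∀ X Y : VField I M, SmoothVF X → SmoothVF Y → ∀ x : M,
    covD D X (appEnd J Y) x = J x (covD D X Y x)

/-- `R(X, Y) Z = D_X D_Y Z - D_Y D_X Z - D_[X,Y] Z`. -/
def curv (D : AffConn I M) (X Y Z : VField I M) : VField I M := fun x =>
  covD D X (covD D Y Z) x - covD D Y (covD D X Z) x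
    - covD D (VectorField.mlieBracket I X Y) Z x

/-- The curvature tensor at a point, computed with (locally smooth) extensions of the three tangent
vectors to vector fields; for a smooth connection the choice of the extensions is irrelevant. -/
def curvAt (D : AffConn I M) (x : M) (u v w : TangentSpace I x) : TangentSpace I x :=
  curv D (FiberBundle.extend E u) (FiberBundle.extend E v) (FiberBundle.extend E w) x

variable [FiniteDimensional ℝ E]

instance (x : M) : FiniteDimensional ℝ (TangentSpace I x) :=
  inferInstanceAs (FiniteDimensional ℝ E)

/-- The Ricci tensor `Ric(v, w)`, the trace of `u ↦ R(u, v) w`, written out in a basis. -/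
def ricci (D : AffConn I M) : Form2 I M := fun x v w =>
  ∑ i, (Module.finBasis ℝ (TangentSpace I x)).coord i
    (curvAt D x (Module.finBasis ℝ (TangentSpace I x) i) v w)

/-- Antisymmetrization `(l(u, v) - l(v, u)) / 2`. -/
def antisymm (l : Form2 I M) : Form2 I M := fun x u v => (l x u v - l x v u) / 2

/-- Symmetrization `(l(u, v) + l(v, u)) / 2`. -/
def symm (l : Form2 I M) : Form2 I M := fun x u v => (l x u v + l x v u) / 2

/-- `l_J (u, v) = l(u, J v)`. -/
def twist (J : EndField I M) (l : Form2 I M) : Form2 I M := fun x u v => l x u (J x v)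

/-- `(l ∧ K)_{u,v} w = l(u, w) K v - l(v, w) K u` for a form `l` and an endomorphism `K` of the
tangent space at `x`. -/
def wedge (l : Form2 I M) (x : M) (K : TangentSpace I x →L[ℝ] TangentSpace I x)
    (u v w : TangentSpace I x) : TangentSpace I x :=
  l x u w • K v - l x v w • K u

/-- The Rho tensor of a connection on a complex manifold of real dimension `2 n`:
`P = (Ric + (Ric^s - J^* Ric^s) / (n - 1)) / (n + 1)`. -/
def rho (n : ℕ) (J : EndField I M) (D : AffConn I M) : Form2 I M := fun x u v =>
  (ricci D x u v
    + (symm (ricci D) x u v - symm (ricci D) x (J x u) (J x v)) / ((n : ℝ) - 1)) / ((n : ℝ) + 1)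

/-- The c-projective Weyl curvature
`W = R + P^a ⊗ Id - (P_J)^a ⊗ J + (1/2) P ∧ Id - (1/2) P_J ∧ J`. -/
def weyl (n : ℕ) (J : EndField I M) (D : AffConn I M) (x : M) (u v w : TangentSpace I x) :
    TangentSpace I x :=
  curvAt D x u v w
    + antisymm (rho n J D) x u v • w
    - antisymm (twist J (rho n J D)) x u v • J x w
    + (1 / 2 : ℝ) • wedge (rho n J D) x (ContinuousLinearMap.id ℝ (TangentSpace I x)) u v w
    - (1 / 2 : ℝ) • wedge (twist J (rho n J D)) x (J x) u v w

/-! ### c-projective structures -/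

/-- The coordinate vector field, near `x`, with constant components `e` in the preferred chart
at `x`. -/
def chartField (x : M) (e : E) : VField I M := fun y =>
  (trivializationAt E (TangentSpace I : M → Type _) x).symm y e

/-- The velocity of a curve, in the chart at `x`. -/
def chartVel (x : M) (c : ℝ → M) (t : ℝ) : E := deriv (fun s => extChartAt I x (c s)) t

/-- The covariant derivative `D_{c'} c'` of the velocity along the curve `c`, at time `t`. In the
chart at `c t`, where `c' = ∑ uᵢ ∂ᵢ`, it is `∑ uᵢ' ∂ᵢ + ∑ uᵢ D_{c'} ∂ᵢ`. -/
def accel (D : AffConn I M) (c : ℝ → M) (t : ℝ) : TangentSpace I (c t) :=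
  chartField (c t) (deriv (chartVel (I := I) (c t) c) t) (c t)
    + D (chartField (c t) (chartVel (I := I) (c t) c t)) (c t)
        (mfderiv 𝓘(ℝ, ℝ) I c t (1 : ℝ))

/-- A smooth curve is `J`-planar with respect to `D` if `D_{c'} c'` lies in the span of `c'` and
`J c'`. -/
def IsJPlanar (J : EndField I M) (D : AffConn I M) (c : ℝ → M) : Prop :=
  ContMDiff 𝓘(ℝ, ℝ) I ∞ c ∧ ∀ t : ℝ, ∃ a b : ℝ,
    accel D c t = a • (mfderiv 𝓘(ℝ, ℝ) I c t (1 : ℝ) : TangentSpace I (c t))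
      + b • J (c t) (mfderiv 𝓘(ℝ, ℝ) I c t (1 : ℝ))

/-- Two connections are c-projectively related if they have the same `J`-planar curves. -/
def CProjRelated (J : EndField I M) (D₁ D₂ : AffConn I M) : Prop :=
  ∀ c : ℝ → M, IsJPlanar J D₁ c ↔ IsJPlanar J D₂ c

variable [CompleteSpace E]

/-- The c-projective class of `D`. -/
def cprojClass (J : EndField I M) (D : AffConn I M) : Set (AffConn I M) :=
  {D' | IsTorsionFreeComplex J D' ∧ CProjRelated J D' D}

/-- A c-projective structure: the c-projective class of some torsion-free complex connection. -/
def IsCProjStructure (J : EndField I M) (P : Set (AffConn I M)) : Prop :=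
  ∃ D : AffConn I M, IsTorsionFreeComplex J D ∧ P = cprojClass J D

/-! ### Conical special complex manifolds -/

/-- `(∇_X J) Y`. -/
def covEnd (D : AffConn I M) (J : EndField I M) (X Y : VField I M) : VField I M := fun x =>
  covD D X (appEnd J Y) x - J x (covD D X Y x)

/-- `(J, ∇, ξ)` is a conical special complex structure. -/
structure IsConicalSpecialComplex (J : EndField I M) (D : AffConn I M) (ξ : VField I M) :
    Prop where
  complex : IsComplexStructure J
  torsionFree : IsSmoothTorsionFree D
  flat : ∀ X Y Z : VField I M, SmoothVF X → SmoothVF Y → SmoothVF Z → ∀ x : M,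
    curv D X Y Z x = 0
  symmetric : ∀ X Y : VField I M, SmoothVF X → SmoothVF Y → ∀ x : M,
    covEnd D J X Y x = covEnd D J Y X x
  smooth_euler : SmoothVF ξ
  euler_ne_zero : ∀ x : M, ξ x ≠ 0
  cov_euler : ∀ (x : M) (v : TangentSpace I x), D ξ x v = v
  lie_euler : ∀ Y : VField I M, SmoothVF Y → ∀ x : M,
    VectorField.mlieBracket I ξ (appEnd J Y) x = J x (VectorField.mlieBracket I ξ Y x)

/-- `D_X Y` for the complex connection `D = ∇ - (1/2) J (∇ J)` of a special complex manifold. -/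
def specialCovD (J : EndField I M) (D : AffConn I M) (X Y : VField I M) : VField I M := fun x =>
  covD D X Y x - (1 / 2 : ℝ) • J x (covEnd D J X Y x)

/-! ### Exterior and covariant derivatives of tensor fields, evaluated on vector fields -/

/-- `dη(X, Y) = X(η(Y)) - Y(η(X)) - η([X, Y])`. -/
def extD (η : OneForm I M ℝ) (X Y : VField I M) (x : M) : ℝ :=
  mvfderiv I (fun y => η y (Y y)) x (X x) - mvfderiv I (fun y => η y (X y)) x (Y x)
    - η x (VectorField.mlieBracket I X Y x)

/-- `(D_X a)(Y, Z)` for a (0,2)-tensor field. -/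
def cov02 (D : AffConn I M) (a : Form2 I M) (X Y Z : VField I M) (x : M) : ℝ :=
  mvfderiv I (fun y => a y (Y y) (Z y)) x (X x) - a x (covD D X Y x) (Z x)
    - a x (Y x) (covD D X Z x)

/-- `(d^D a)(X, Y, Z) = (D_X a)(Y, Z) - (D_Y a)(X, Z)` for a (0,2)-tensor field. -/
def extCov02 (D : AffConn I M) (a : Form2 I M) (X Y Z : VField I M) (x : M) : ℝ :=
  cov02 D a X Y Z x - cov02 D a Y X Z x

/-- `(D_X B)_Y Z` for a (1,2)-tensor field. -/
def cov12 (D : AffConn I M) (B : Tensor12 I M) (X Y Z : VField I M) : VField I M := fun x =>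
  covD D X (app12 B Y Z) x - B x (covD D X Y x) (Z x) - B x (Y x) (covD D X Z x)

/-- `(d^D B)(X, Y) Z = (D_X B)_Y Z - (D_Y B)_X Z` for a (1,2)-tensor field. -/
def extCov12 (D : AffConn I M) (B : Tensor12 I M) (X Y Z : VField I M) : VField I M := fun x =>
  cov12 D B X Y Z x - cov12 D B Y X Z x

/-- `ℬ(v, w) = Tr (B_v B_w)`. -/
def traceSq (B : Tensor12 I M) : Form2 I M := fun x v w =>
  LinearMap.trace ℝ (TangentSpace I x) ((B x v ∘L B x w : TangentSpace I x →L[ℝ] _) :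
    TangentSpace I x →ₗ[ℝ] TangentSpace I x)

/-- A (0,2)-tensor field regarded as a `Form2`. -/
def toForm (c : Tensor02 I M) : Form2 I M := fun x v w => c x v w

/-- `a = ℬ / (8 (n + 1)) - P / 2`, where `P` is the Rho tensor of `D`. -/
def fundTensor (n : ℕ) (J : EndField I M) (D : AffConn I M) (B : Tensor12 I M) : Form2 I M :=
  fun x v w => traceSq B x v w / (8 * ((n : ℝ) + 1)) - rho n J D x v w / 2

end Calculus

section Principal

variable {E : Type*} [NormedAddCommGroup E] [NormedSpace ℝ E]
  {H : Type*} [TopologicalSpace H] (I : ModelWithCorners ℝ E H)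
  {M : Type*} [TopologicalSpace M] [ChartedSpace H M]
  {E' : Type*} [NormedAddCommGroup E'] [NormedSpace ℝ E']
  {H' : Type*} [TopologicalSpace H'] (I' : ModelWithCorners ℝ E' H')
  {S : Type*} [TopologicalSpace S] [ChartedSpace H' S]
  {EG : Type*} [NormedAddCommGroup EG] [NormedSpace ℝ EG]
  {HG : Type*} [TopologicalSpace HG] (IG : ModelWithCorners ℝ EG HG)
  (G : Type*) [TopologicalSpace G] [ChartedSpace HG G] [CommGroup G] [MulAction G S]

/-! ### Principal bundles with commutative structure group

Since the group is commutative, its right action on the total space is written on the left. -/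

/-- A local trivialization over the open set `U`: a smooth local section `sec` together with the
smooth group coordinate `coord`, such that `(x, g) ↦ g • sec x` and `p ↦ (pr p, coord p)` are mutually
inverse maps between `U × G` and the part of the total space over `U`. Values outside of these sets
are irrelevant. -/
structure LocalTriv (pr : S → M) where
  U : Set M
  isOpen : IsOpen U
  sec : M → S
  coord : S → G
  smooth_sec : ContMDiffOn I I' ∞ sec U
  smooth_coord : ContMDiffOn I' IG ∞ coord (pr ⁻¹' U)
  proj_smul_sec : ∀ x ∈ U, ∀ g : G, pr (g • sec x) = x
  coord_smul_sec : ∀ x ∈ U, ∀ g : G, coord (g • sec x) = g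
  coord_smul : ∀ p : S, pr p ∈ U → coord p • sec (pr p) = p

/-- `pr : S → M` is a smooth principal bundle with structure group `G`. -/
structure IsPrincipalBundle (pr : S → M) : Prop where
  smooth_proj : ContMDiff I' I ∞ pr
  smooth_action : ContMDiff (IG.prod I') I' ∞ (fun q : G × S => q.1 • q.2)
  proj_smul : ∀ (g : G) (p : S), pr (g • p) = pr p
  locallyTrivial : ∀ x : M, ∃ τ : LocalTriv I I' IG G pr, x ∈ τ.U

variable {G}
variable {F : Type*} [NormedAddCommGroup F] [NormedSpace ℝ F]

/-- The fundamental vector field of the Lie algebra element `ζ`: the velocity at `t = 0` of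
`t ↦ exp (t ζ) • p`. Here `F` is the Lie algebra and `ex` the exponential map of the group. -/
def fundVF (ex : F → G) (ζ : F) : VField I' S := fun p =>
  (mfderiv 𝓘(ℝ, ℝ) I' (fun t : ℝ => ex (t • ζ) • p) 0 (1 : ℝ) : E')

/-- A principal connection form: smooth, invariant, and reproducing the Lie algebra elements on
fundamental vector fields. -/
structure IsPrincipalConnection [IsManifold I' ∞ S] (ex : F → G) (θ : OneForm I' S F) : Prop where
  smooth : ∀ V : VField I' S, SmoothVF V → ContMDiff I' 𝓘(ℝ, F) ∞ (fun p => θ p (V p))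
  invariant : ∀ (g : G) (p : S) (v : TangentSpace I' p),
    θ (g • p) (mfderiv I' I' (fun q => g • q) p v) = θ p v
  reproduces : ∀ (ζ : F) (p : S), θ p (fundVF I' ex ζ p) = ζ

end Principal

/-- The exponential map of the multiplicative group of the complex numbers. -/
def expUnits (z : ℂ) : ℂˣ := Units.mk0 (Complex.exp z) (Complex.exp_ne_zero z)

/-! ### Projective special complex manifolds and their canonical c-projective structure -/

section Quotient

variable {E : Type*} [NormedAddCommGroup E] [NormedSpace ℝ E] [FiniteDimensional ℝ E]
  [CompleteSpace E]
  {H : Type*} [TopologicalSpace H] {I : ModelWithCorners ℝ E H}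
  {M : Type*} [TopologicalSpace M] [ChartedSpace H M] [IsManifold I ∞ M]
  {E' : Type*} [NormedAddCommGroup E'] [NormedSpace ℝ E'] [FiniteDimensional ℝ E']
  [CompleteSpace E']
  {H' : Type*} [TopologicalSpace H'] {I' : ModelWithCorners ℝ E' H'}
  {N : Type*} [TopologicalSpace N] [ChartedSpace H' N] [IsManifold I' ∞ N]
  [MulAction ℂˣ N]

/-- `(M, Jb)` is the projective special complex manifold given by the principal `ℂˣ`-bundle
`pr : N → M` whose total space is the conical special complex manifold `(N, J, ∇, ξ)`: the holomorphic
vector field `ξ - i J ξ` generates the action (that is, `ξ` and `J ξ` are the fundamental vector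
fields of `1` and `i`), which is holomorphic, and so is `pr`. -/
structure IsProjectiveSpecialComplex (Jb : EndField I M) (pr : N → M)
    (J : EndField I' N) (D : AffConn I' N) (ξ : VField I' N) : Prop where
  conical : IsConicalSpecialComplex J D ξ
  principal : IsPrincipalBundle I I' 𝓘(ℝ, ℂ) ℂˣ pr
  fund_one : ∀ p : N, fundVF I' expUnits (1 : ℂ) p = ξ p
  fund_I : ∀ p : N, fundVF I' expUnits Complex.I p = J p (ξ p)
  holomorphic_action : ∀ (g : ℂˣ) (p : N) (v : TangentSpace I' p),
    mfderiv I' I' (fun q => g • q) p (J p v) = J (g • p) (mfderiv I' I' (fun q => g • q) p v)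
  complexBase : IsComplexStructure Jb
  holomorphic_proj : ∀ (p : N) (v : TangentSpace I' p),
    mfderiv I' I pr p (J p v) = Jb (pr p) (mfderiv I' I pr p v)

/-- `Xt` is the horizontal lift of `X` with respect to `θ`. -/
def IsHorizontalLift (pr : N → M) (θ : OneForm I' N ℂ) (X : VField I M) (Xt : VField I' N) : Prop :=
  ∀ p : N, θ p (Xt p) = 0 ∧ mfderiv I' I pr p (Xt p) = X (pr p)

/-- A principal connection form with `J`-invariant kernel. -/
def IsConnectionOfType (J : EndField I' N) (θ : OneForm I' N ℂ) : Prop :=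
  IsPrincipalConnection I' expUnits θ ∧
    ∀ (p : N) (v : TangentSpace I' p), θ p v = 0 → θ p (J p v) = 0

/-- `Db` is the connection on the base obtained by projecting `D = ∇ - (1/2) J (∇ J)` by means of
`θ`: the projection of `D_{X~} Y~` is `Db_X Y`, where `X~`, `Y~` are the horizontal lifts. -/
def IsProjectedConnection (pr : N → M) (J : EndField I' N) (D : AffConn I' N) (θ : OneForm I' N ℂ)
    (Db : AffConn I M) : Prop :=
  ∀ (X Y : VField I M) (Xt Yt : VField I' N), SmoothVF X → SmoothVF Y → SmoothVF Xt →
    SmoothVF Yt → IsHorizontalLift pr θ X Xt → IsHorizontalLift pr θ Y Yt →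
    ∀ p : N, mfderiv I' I pr p (specialCovD J D Xt Yt p) = covD Db X Y (pr p)

/-- `P` is the canonical c-projective structure of the projective special complex manifold
`(M, Jb)`: principal connections with `J`-invariant kernel exist, and the c-projective class of the
projected connection is `P` for each of them. -/
def IsCanonicalCProj (Jb : EndField I M) (pr : N → M) (J : EndField I' N) (D : AffConn I' N)
    (P : Set (AffConn I M)) : Prop :=
  (∃ θ : OneForm I' N ℂ, IsConnectionOfType J θ) ∧
  ∀ θ : OneForm I' N ℂ, IsConnectionOfType J θ →
    ∃ Db : AffConn I M, IsTorsionFreeComplex Jb Db ∧ IsProjectedConnection pr J D θ Db ∧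
      P = cprojClass Jb Db

end Quotient

/-! ### Circle bundles of projective special complex base type -/

section PSCB

variable {E : Type*} [NormedAddCommGroup E] [NormedSpace ℝ E] [FiniteDimensional ℝ E]
  [CompleteSpace E]
  {H : Type*} [TopologicalSpace H] {I : ModelWithCorners ℝ E H}
  {M : Type*} [TopologicalSpace M] [ChartedSpace H M] [IsManifold I ∞ M]
  {E' : Type*} [NormedAddCommGroup E'] [NormedSpace ℝ E']
  {H' : Type*} [TopologicalSpace H'] {I' : ModelWithCorners ℝ E' H'}
  {S : Type*} [TopologicalSpace S] [ChartedSpace H' S] [IsManifold I' ∞ S] [MulAction Circle S]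

/-- The local connection form `sec^* η`. -/
def localForm {pr : S → M} (τ : LocalTriv I I' (𝓡 1) Circle pr) (η : OneForm I' S ℝ) (x : M)
    (v : TangentSpace I x) : ℝ :=
  η (τ.sec x) (mfderiv I I' τ.sec x v)

/-- The transition function `g` from `τ₁` to `τ₂`, determined by `τ₂.sec = g • τ₁.sec`. -/
def transition {pr : S → M} (τ₁ τ₂ : LocalTriv I I' (𝓡 1) Circle pr) (x : M) : Circle :=
  τ₁.coord (τ₂.sec x)

/-- `g⁻²`, which is `exp (-2 i f)` if `g = exp (i f)` is the transition function. -/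
def transFactor {pr : S → M} (τ₁ τ₂ : LocalTriv I I' (𝓡 1) Circle pr) (x : M) : ℂ :=
  (((transition τ₁ τ₂ x)⁻¹ ^ 2 : Circle) : ℂ)

/-- The circle bundle `pr : S → M` with connection form `η` over the complex manifold `(M, J)` of real
dimension `2 n` with c-projective structure `P` is of projective special complex base type with
respect to the local trivializations `τ α` and the collections of local tensor fields `B α` and
`c α`, defined on `(τ α).U`. -/
structure IsPSCB (n : ℕ) (J : EndField I M) (P : Set (AffConn I M)) (pr : S → M)
    (η : OneForm I' S ℝ) {Λ : Type*} (τ : Λ → LocalTriv I I' (𝓡 1) Circle pr)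
    (B : Λ → Tensor12 I M) (c : Λ → Tensor02 I M) : Prop where
  cover : ∀ x : M, ∃ α, x ∈ (τ α).U
  smooth_B : ∀ α, ∀ Y Z : VField I M, SmoothVF Y → SmoothVF Z →
    SmoothVFOn (τ α).U (app12 (B α) Y Z)
  smooth_c : ∀ α, ∀ Y Z : VField I M, SmoothVF Y → SmoothVF Z →
    ContMDiffOn I 𝓘(ℝ, ℝ) ∞ (fun x => c α x (Y x) (Z x)) (τ α).U
  B_symm : ∀ α, ∀ x ∈ (τ α).U, ∀ v w : TangentSpace I x, B α x v w = B α x w v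
  B_anti : ∀ α, ∀ x ∈ (τ α).U, ∀ v w : TangentSpace I x, B α x v (J x w) = -J x (B α x v w)
  B_trans : ∀ α β, ∀ x ∈ (τ α).U ∩ (τ β).U, ∀ v w : TangentSpace I x,
    B β x v w = (transFactor (τ α) (τ β) x).re • B α x v w
      + (transFactor (τ α) (τ β) x).im • J x (B α x v w)
  c_symm : ∀ α, ∀ x ∈ (τ α).U, ∀ v w : TangentSpace I x, c α x v w = c α x w v
  c_anti : ∀ α, ∀ x ∈ (τ α).U, ∀ v w : TangentSpace I x, c α x (J x v) (J x w) = -c α x v w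
  c_trans : ∀ α β, ∀ x ∈ (τ α).U ∩ (τ β).U, ∀ v w : TangentSpace I x,
    ((c β x v w : ℂ) + Complex.I * (c β x v (J x w) : ℂ))
      = transFactor (τ α) (τ β) x * ((c α x v w : ℂ) + Complex.I * (c α x v (J x w) : ℂ))
  weyl_eq : ∀ D ∈ P, ∀ α, ∀ x ∈ (τ α).U, ∀ u v w : TangentSpace I x,
    weyl n J D x u v w =
      -(1 / 4 : ℝ) • (B α x u (B α x v w) - B α x v (B α x u w))
      - (1 / (4 * ((n : ℝ) + 1))) • twist J (traceSq (B α)) x u v • J x w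
      + (1 / (8 * ((n : ℝ) + 1))) •
          wedge (traceSq (B α)) x (ContinuousLinearMap.id ℝ (TangentSpace I x)) u v w
      - (1 / (8 * ((n : ℝ) + 1))) • wedge (twist J (traceSq (B α))) x (J x) u v w
  -- One connection in the class satisfies four conditions, in each of which `fundTensor` is formed
  -- with this connection.
  exists_connection : ∃ D ∈ P,
    (∀ α, ∀ V W : VField I' S, SmoothVF V → SmoothVF W → ∀ s : S, pr s ∈ (τ α).U →
      extD η V W s = 2 * antisymm (twist J (fundTensor n J D (B α))) (pr s)
        (mfderiv I' I pr s (V s)) (mfderiv I' I pr s (W s))) ∧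
    (∀ α, ∀ X Y Z : VField I M, SmoothVF X → SmoothVF Y → SmoothVF Z → ∀ x ∈ (τ α).U,
      extCov02 D (fundTensor n J D (B α)) X Y Z x
        = -(1 / 4) * (c α x (X x) (B α x (Y x) (Z x)) - c α x (Y x) (B α x (X x) (Z x)))) ∧
    (∀ α, ∀ X Y Z : VField I M, SmoothVF X → SmoothVF Y → SmoothVF Z → ∀ x ∈ (τ α).U,
      extCov12 D (B α) X Y Z x
        = -(2 : ℝ) • (localForm (τ α) η x (X x) • J x (B α x (Y x) (Z x))
            - localForm (τ α) η x (Y x) • J x (B α x (X x) (Z x)))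
          + wedge (toForm (c α)) x (ContinuousLinearMap.id ℝ (TangentSpace I x)) (X x) (Y x) (Z x)
          + wedge (twist J (toForm (c α))) x (J x) (X x) (Y x) (Z x)) ∧
    (∀ α, ∀ X Y Z : VField I M, SmoothVF X → SmoothVF Y → SmoothVF Z → ∀ x ∈ (τ α).U,
      fundTensor n J D (B α) x (X x) (B α x (Y x) (Z x))
        - fundTensor n J D (B α) x (Y x) (B α x (X x) (Z x))
        + extCov02 D (toForm (c α)) X Y Z x
        = 2 * (localForm (τ α) η x (X x) * c α x (Y x) (J x (Z x))
            - localForm (τ α) η x (Y x) * c α x (X x) (J x (Z x))))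

end PSCB

/-! ### The cone over a circle bundle -/

/-- The positive real numbers, as an open subset of the real line. -/
abbrev PosReal : TopologicalSpace.Opens ℝ := ⟨Set.Ioi 0, isOpen_Ioi⟩

/-- The phase `z / |z|`. -/
def phase (z : ℂˣ) : Circle :=
  ⟨(z : ℂ) / (‖(z : ℂ)‖ : ℂ), mem_sphere_zero_iff_norm.2 (by simp)⟩

lemma phase_one : phase 1 = 1 := by
  apply Circle.ext; simp [phase]

lemma phase_mul (z w : ℂˣ) : phase (z * w) = phase z * phase w := by
  apply Circle.ext
  rw [Circle.coe_mul]
  change ((z * w : ℂˣ) : ℂ) / (‖((z * w : ℂˣ) : ℂ)‖ : ℂ) = (z : ℂ) / (‖(z : ℂ)‖ : ℂ) * ((w : ℂ) / (‖(w : ℂ)‖ : ℂ))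
  simp [mul_div_mul_comm]

/-- `ℂˣ = S¹ × ℝ_{>0}` acts on `S × ℝ_{>0}` by `r e^{i t} • (s, ρ) = (e^{i t} • s, r ρ)`. -/
instance coneAction {S : Type*} [MulAction Circle S] : MulAction ℂˣ (S × PosReal) where
  smul z p := (phase z • p.1,
    ⟨‖(z : ℂ)‖ * (p.2 : ℝ), mul_pos (norm_pos_iff.2 z.ne_zero) p.2.2⟩)
  one_smul p := by
    apply Prod.ext
    · change phase 1 • p.1 = p.1
      rw [phase_one, one_smul]
    · apply Subtype.ext
      change ‖((1 : ℂˣ) : ℂ)‖ * (p.2 : ℝ) = p.2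
      simp
  mul_smul z w p := by
    apply Prod.ext
    · change phase (z * w) • p.1 = phase z • phase w • p.1
      rw [phase_mul, mul_smul]
    · apply Subtype.ext
      change ‖((z * w : ℂˣ) : ℂ)‖ * (p.2 : ℝ) = ‖(z : ℂ)‖ * (‖(w : ℂ)‖ * (p.2 : ℝ))
      simp [mul_assoc]

end PSC

end

open scoped Topology

set_option linter.unusedSectionVars false

set_option synthInstance.maxHeartbeats 200000

noncomputable section

namespace PSC

section VectorValuedCalculus

variable {E : Type*} [NormedAddCommGroup E] [NormedSpace ℝ E]
  {H : Type*} [TopologicalSpace H] {I : ModelWithCorners ℝ E H}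
  {M : Type*} [TopologicalSpace M] [ChartedSpace H M]
  {F F₁ F₂ F₃ : Type*} [NormedAddCommGroup F] [NormedSpace ℝ F]
  [NormedAddCommGroup F₁] [NormedSpace ℝ F₁] [NormedAddCommGroup F₂] [NormedSpace ℝ F₂]
  [NormedAddCommGroup F₃] [NormedSpace ℝ F₃]

lemma mvfderiv_fderiv_comp {b : F₁ → F₂} {f : M → F₁} {x : M}
    (hb : DifferentiableAt ℝ b (f x)) (hf : MDifferentiableAt I 𝓘(ℝ, F₁) f x)
    (v : TangentSpace I x) :
    mvfderiv I (fun y => b (f y)) x v = fderiv ℝ b (f x) (mvfderiv I f x v) := by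
  have := mfderiv_comp_apply (I := I) (I' := 𝓘(ℝ, F₁)) (I'' := 𝓘(ℝ, F₂)) (g := b) (f := f) x
    hb.mdifferentiableAt hf v
  rw [mfderiv_eq_fderiv] at this
  exact this

lemma mvfderiv_clm_comp (L : F₁ →L[ℝ] F₂) {f : M → F₁} {x : M}
    (hf : MDifferentiableAt I 𝓘(ℝ, F₁) f x) (v : TangentSpace I x) :
    mvfderiv I (fun y => L (f y)) x v = L (mvfderiv I f x v) := by
  rw [mvfderiv_fderiv_comp L.differentiableAt hf, L.fderiv]

lemma mvfderiv_prodMk {f : M → F₁} {g : M → F₂} {x : M}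
    (hf : MDifferentiableAt I 𝓘(ℝ, F₁) f x) (hg : MDifferentiableAt I 𝓘(ℝ, F₂) g x)
    (v : TangentSpace I x) :
    mvfderiv I (fun y => (f y, g y)) x v = (mvfderiv I f x v, mvfderiv I g x v) := by
  have h := hf.prodMk_space hg
  refine Prod.ext ?_ ?_
  · exact (mvfderiv_clm_comp (ContinuousLinearMap.fst ℝ F₁ F₂) h v).symm
  · exact (mvfderiv_clm_comp (ContinuousLinearMap.snd ℝ F₁ F₂) h v).symm

lemma mvfderiv_bilin (b : F₁ →L[ℝ] F₂ →L[ℝ] F₃) {f : M → F₁} {g : M → F₂} {x : M}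
    (hf : MDifferentiableAt I 𝓘(ℝ, F₁) f x) (hg : MDifferentiableAt I 𝓘(ℝ, F₂) g x)
    (v : TangentSpace I x) :
    mvfderiv I (fun y => b (f y) (g y)) x v
      = b (mvfderiv I f x v) (g x) + b (f x) (mvfderiv I g x v) := by
  have h := mvfderiv_fderiv_comp (I := I) (b := fun p : F₁ × F₂ => b p.1 p.2)
    (f := fun y => (f y, g y)) (x := x)
    (b.isBoundedBilinearMap.differentiableAt _) (hf.prodMk_space hg) v
  rw [b.isBoundedBilinearMap.fderiv, mvfderiv_prodMk hf hg] at h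
  rw [h]
  simp [IsBoundedBilinearMap.deriv_apply, add_comm]

lemma mvfderiv_clm_apply {A : M → F₁ →L[ℝ] F₂} {f : M → F₁} {x : M}
    (hA : MDifferentiableAt I 𝓘(ℝ, F₁ →L[ℝ] F₂) A x) (hf : MDifferentiableAt I 𝓘(ℝ, F₁) f x)
    (v : TangentSpace I x) :
    mvfderiv I (fun y => A y (f y)) x v = mvfderiv I A x v (f x) + A x (mvfderiv I f x v) :=
  mvfderiv_bilin (ContinuousLinearMap.id ℝ (F₁ →L[ℝ] F₂)) hA hf v

lemma mvfderiv_congr {f g : M → F} {x : M} (h : f =ᶠ[𝓝 x] g) :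
    mvfderiv I f x = mvfderiv I g x := by
  have h1 : mfderiv I 𝓘(ℝ, F) f x = mfderiv I 𝓘(ℝ, F) g x := h.mfderiv_eq
  ext v
  exact congrArg (fun L : TangentSpace I x →L[ℝ] F => L v) h1

lemma mvfderiv_mcomp {E' : Type*} [NormedAddCommGroup E'] [NormedSpace ℝ E']
    {H' : Type*} [TopologicalSpace H'] {I' : ModelWithCorners ℝ E' H'}
    {N : Type*} [TopologicalSpace N] [ChartedSpace H' N]
    {g : M → F} {f : N → M} {x : N}
    (hg : MDifferentiableAt I 𝓘(ℝ, F) g (f x)) (hf : MDifferentiableAt I' I f x)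
    (v : TangentSpace I' x) :
    mvfderiv I' (fun y => g (f y)) x v = mvfderiv I g (f x) (mfderiv I' I f x v) :=
  mfderiv_comp_apply x hg hf v

variable [FiniteDimensional ℝ F₁]

/-- A function with values in linear maps on a finite-dimensional space is smooth if its values on
fixed vectors are. -/
lemma contMDiffAt_clm_of_apply {A : M → F₁ →L[ℝ] F₂} {x : M} {m : ℕ∞ω}
    (h : ∀ e, ContMDiffAt I 𝓘(ℝ, F₂) m (fun y => A y e) x) :
    ContMDiffAt I 𝓘(ℝ, F₁ →L[ℝ] F₂) m A x := by
  let b := Module.finBasis ℝ F₁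
  let c : Fin _ → F₁ →L[ℝ] ℝ := fun i => LinearMap.toContinuousLinearMap (b.coord i)
  have hA : A = fun y => ∑ i, ContinuousLinearMap.smulRightL ℝ F₁ F₂ (c i) (A y (b i)) := by
    funext y
    ext v
    conv_lhs => rw [← b.sum_repr v, map_sum]
    simp [c]
  rw [hA]
  refine contMDiffAt_finsetSum fun i _ => ?_
  exact (ContinuousLinearMap.smulRightL ℝ F₁ F₂ (c i)).contMDiff.contMDiffAt.comp x (h (b i))

lemma contMDiffAt_clm_of_apply₂ {F₁' : Type*} [NormedAddCommGroup F₁'] [NormedSpace ℝ F₁']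
    [FiniteDimensional ℝ F₁'] {A : M → F₁ →L[ℝ] F₁' →L[ℝ] F₂} {x : M} {m : ℕ∞ω}
    (h : ∀ e e', ContMDiffAt I 𝓘(ℝ, F₂) m (fun y => A y e e') x) :
    ContMDiffAt I 𝓘(ℝ, F₁ →L[ℝ] F₁' →L[ℝ] F₂) m A x :=
  contMDiffAt_clm_of_apply fun e => contMDiffAt_clm_of_apply fun e' => h e e'

end VectorValuedCalculus

section Charts

variable {E : Type*} [NormedAddCommGroup E] [NormedSpace ℝ E]
  {H : Type*} [TopologicalSpace H] {I : ModelWithCorners ℝ E H}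
  {M : Type*} [TopologicalSpace M] [ChartedSpace H M] [IsManifold I ∞ M]
  {F : Type*} [NormedAddCommGroup F] [NormedSpace ℝ F]

/-- The components, in the preferred chart at `x₀`, of tangent vectors at `y`. -/
def toChart (x₀ y : M) : TangentSpace I y →L[ℝ] E :=
  (trivializationAt E (TangentSpace I : M → Type _) x₀).continuousLinearMapAt ℝ y

/-- The tangent vector at `y` with given components in the preferred chart at `x₀`. -/
def ofChart (x₀ y : M) : E →L[ℝ] TangentSpace I y :=
  (trivializationAt E (TangentSpace I : M → Type _) x₀).symmL ℝ y

lemma chartField_eq {x₀ y : M} (hy : y ∈ (chartAt H x₀).source) (e : E) :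
    chartField (I := I) x₀ e y = ofChart x₀ y e :=
  ((trivializationAt E (TangentSpace I : M → Type _) x₀).symmL_apply (R := ℝ) hy e).symm

lemma toChart_ofChart {x₀ y : M} (hy : y ∈ (chartAt H x₀).source) (e : E) :
    toChart (I := I) x₀ y (ofChart x₀ y e) = e :=
  (trivializationAt E (TangentSpace I : M → Type _) x₀).continuousLinearMapAt_symmL (R := ℝ)
    (b := y) hy e

lemma ofChart_toChart {x₀ y : M} (hy : y ∈ (chartAt H x₀).source) (v : TangentSpace I y) :
    ofChart (I := I) x₀ y (toChart x₀ y v) = v :=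
  (trivializationAt E (TangentSpace I : M → Type _) x₀).symmL_continuousLinearMapAt (R := ℝ)
    (b := y) hy v

lemma toChart_apply {x₀ y : M} (hy : y ∈ (chartAt H x₀).source) (v : TangentSpace I y) :
    toChart (I := I) x₀ y v = ((trivializationAt E (TangentSpace I : M → Type _) x₀) ⟨y, v⟩).2 := by
  have := (trivializationAt E (TangentSpace I : M → Type _) x₀).coe_linearMapAt_of_mem (R := ℝ)
    (b := y) hy
  exact congrFun this v

lemma toChart_self (x : M) (v : TangentSpace I x) : toChart (I := I) x x v = v := by
  have h := TangentBundle.continuousLinearMapAt_trivializationAt_eq_core (I := I) (M := M) (𝕜 := ℝ)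
    (mem_chart_source H x)
  unfold toChart
  rw [h]
  exact (tangentBundleCore I M).coordChange_self (achart H x) x (mem_chart_source H x) v

lemma ofChart_self (x : M) (e : E) : ofChart (I := I) x x e = e := by
  have h := toChart_ofChart (I := I) (mem_chart_source H x) e
  rw [toChart_self] at h
  exact h

lemma toChart_eq_mvfderiv {x₀ y : M} (hy : y ∈ (chartAt H x₀).source) :
    toChart (I := I) x₀ y = mvfderiv I (extChartAt I x₀) y := by
  unfold toChart
  rw [TangentBundle.continuousLinearMapAt_trivializationAt hy]
  rfl

lemma contMDiffAt_vf_iff {X : VField I M} {x₀ y : M} (hy : y ∈ (chartAt H x₀).source) :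
    ContMDiffAt I I.tangent ∞ (fun x => (⟨x, X x⟩ : TangentBundle I M)) y
      ↔ ContMDiffAt I 𝓘(ℝ, E) ∞ (fun q => toChart (I := I) x₀ q (X q)) y := by
  have h1 := (trivializationAt E (TangentSpace I : M → Type _) x₀).contMDiffAt_section_iff
    (IB := I) (n := ∞) (s := X) (x₀ := y) hy
  refine h1.trans ?_
  have h2 : (fun q => toChart (I := I) x₀ q (X q)) =ᶠ[𝓝 y]
      fun q => ((trivializationAt E (TangentSpace I : M → Type _) x₀) ⟨q, X q⟩).2 := by
    filter_upwards [(chartAt H x₀).open_source.mem_nhds hy] with q hq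
    exact toChart_apply hq _
  exact ⟨fun h => h.congr_of_eventuallyEq h2, fun h => h.congr_of_eventuallyEq h2.symm⟩

lemma mdifferentiableAt_vf_iff {X : VField I M} {x₀ y : M} (hy : y ∈ (chartAt H x₀).source) :
    MDifferentiableAt I I.tangent (fun x => (⟨x, X x⟩ : TangentBundle I M)) y
      ↔ MDifferentiableAt I 𝓘(ℝ, E) (fun q => toChart (I := I) x₀ q (X q)) y := by
  have h1 := (trivializationAt E (TangentSpace I : M → Type _) x₀).mdifferentiableAt_section_iff
    (IB := I) (s := X) (b₀ := y) hy
  refine h1.trans ?_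
  have h2 : (fun q => toChart (I := I) x₀ q (X q)) =ᶠ[𝓝 y]
      fun q => ((trivializationAt E (TangentSpace I : M → Type _) x₀) ⟨q, X q⟩).2 := by
    filter_upwards [(chartAt H x₀).open_source.mem_nhds hy] with q hq
    exact toChart_apply hq _
  exact ⟨fun h => h.congr_of_eventuallyEq h2, fun h => h.congr_of_eventuallyEq h2.symm⟩

lemma contMDiffAt_ofChart {f : M → E} {x₀ y : M} (hy : y ∈ (chartAt H x₀).source)
    (hf : ContMDiffAt I 𝓘(ℝ, E) ∞ f y) :
    ContMDiffAt I I.tangent ∞ (fun x => (⟨x, ofChart x₀ x (f x)⟩ : TangentBundle I M)) y := by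
  rw [contMDiffAt_vf_iff hy]
  refine hf.congr_of_eventuallyEq ?_
  filter_upwards [(chartAt H x₀).open_source.mem_nhds hy] with q hq
  exact toChart_ofChart hq _

lemma mdifferentiableAt_ofChart {f : M → E} {x₀ y : M} (hy : y ∈ (chartAt H x₀).source)
    (hf : MDifferentiableAt I 𝓘(ℝ, E) f y) :
    MDifferentiableAt I I.tangent (fun x => (⟨x, ofChart x₀ x (f x)⟩ : TangentBundle I M)) y := by
  rw [mdifferentiableAt_vf_iff hy]
  refine hf.congr_of_eventuallyEq ?_
  filter_upwards [(chartAt H x₀).open_source.mem_nhds hy] with q hq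
  exact toChart_ofChart hq _

variable [I.Boundaryless]

lemma mvfderiv_eq_fderiv_chart {g : M → F} {x₀ y : M} (hy : y ∈ (chartAt H x₀).source)
    (hg : MDifferentiableAt I 𝓘(ℝ, F) g y) (v : TangentSpace I y) :
    mvfderiv I g y v
      = fderiv ℝ (g ∘ (extChartAt I x₀).symm) (extChartAt I x₀ y) (toChart x₀ y v) := by
  have hy' : y ∈ (extChartAt I x₀).source := by rwa [extChartAt_source]
  have h1 : (fun q => (g ∘ (extChartAt I x₀).symm) (extChartAt I x₀ q)) =ᶠ[𝓝 y] g := by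
    filter_upwards [(isOpen_extChartAt_source (I := I) x₀).mem_nhds hy'] with q hq
    exact congrArg g ((extChartAt I x₀).left_inv hq)
  have hd : DifferentiableAt ℝ (g ∘ (extChartAt I x₀).symm) (extChartAt I x₀ y) := by
    have h2 : MDifferentiableAt 𝓘(ℝ, E) I (extChartAt I x₀).symm (extChartAt I x₀ y) := by
      have h3 := mdifferentiableWithinAt_extChartAt_symm (I := I) (x := x₀)
        ((extChartAt I x₀).map_source hy')
      rwa [I.range_eq_univ, mdifferentiableWithinAt_univ] at h3
    have h4 : MDifferentiableAt 𝓘(ℝ, E) 𝓘(ℝ, F) (g ∘ (extChartAt I x₀).symm)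
        (extChartAt I x₀ y) := by
      refine MDifferentiableAt.comp _ ?_ h2
      rwa [(extChartAt I x₀).left_inv hy']
    exact h4.differentiableAt
  rw [← mvfderiv_congr h1, toChart_eq_mvfderiv hy,
    mvfderiv_fderiv_comp hd (mdifferentiableAt_extChartAt hy)]

end Charts

section Bracket

variable {E : Type*} [NormedAddCommGroup E] [NormedSpace ℝ E]
  {H : Type*} [TopologicalSpace H] {I : ModelWithCorners ℝ E H}
  {M : Type*} [TopologicalSpace M] [ChartedSpace H M] [IsManifold I ∞ M]
  {F : Type*} [NormedAddCommGroup F] [NormedSpace ℝ F]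

/-- `X` is smooth at `x`. -/
abbrev SmoothVFAt (X : VField I M) (x : M) : Prop :=
  ContMDiffAt I I.tangent ∞ (fun x => (⟨x, X x⟩ : TangentBundle I M)) x

/-- `X` is differentiable at `x`. -/
abbrev DiffVFAt (X : VField I M) (x : M) : Prop :=
  MDifferentiableAt I I.tangent (fun x => (⟨x, X x⟩ : TangentBundle I M)) x

lemma SmoothVFAt.diff {X : VField I M} {x : M} (h : SmoothVFAt X x) : DiffVFAt X x :=
  ContMDiffAt.mdifferentiableAt h (by simp)

lemma SmoothVF.at {X : VField I M} (h : SmoothVF X) (x : M) : SmoothVFAt X x := h x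

lemma inverse_mfderivWithin_symm {x₀ y : M} (hy : y ∈ (chartAt H x₀).source) :
    (mfderivWithin 𝓘(ℝ, E) I (extChartAt I x₀).symm (Set.range I) (extChartAt I x₀ y)
      : E →L[ℝ] E).inverse = (toChart (I := I) x₀ y : E →L[ℝ] E) := by
  have h1 := TangentBundle.symmL_trivializationAt (I := I) (𝕜 := ℝ) hy
  refine ContinuousLinearMap.inverse_eq ?_ ?_
  · ext v
    have := ofChart_toChart (I := I) hy v
    unfold ofChart at this
    rw [h1] at this
    exact this
  · ext v
    have := toChart_ofChart (I := I) hy v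
    unfold ofChart at this
    rw [h1] at this
    exact this

variable [I.Boundaryless]

lemma toChart_mlieBracket {X Y : VField I M} {p : M} (hX : DiffVFAt X p) (hY : DiffVFAt Y p) :
    (VectorField.mlieBracket I X Y p : E)
      = mvfderiv I (fun q => toChart (I := I) p q (Y q)) p (X p)
        - mvfderiv I (fun q => toChart (I := I) p q (X q)) p (Y p) := by
  have hp := mem_chart_source H p
  have hX' := (mdifferentiableAt_vf_iff hp).1 hX
  have hY' := (mdifferentiableAt_vf_iff hp).1 hY
  rw [mvfderiv_eq_fderiv_chart hp hX', mvfderiv_eq_fderiv_chart hp hY', toChart_self, toChart_self]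
  rw [← VectorField.mlieBracketWithin_univ, VectorField.mlieBracketWithin_apply]
  have hinv : ((mfderiv I 𝓘(ℝ, E) (extChartAt I p) p : E →L[ℝ] E)).inverse
      = ContinuousLinearMap.id ℝ E := by
    have h1 : (mfderiv I 𝓘(ℝ, E) (extChartAt I p) p : E →L[ℝ] E)
        = ContinuousLinearMap.id ℝ E := by
      have h2 := toChart_eq_mvfderiv (I := I) hp
      ext v
      have h3 : (toChart (I := I) p p : E →L[ℝ] E) v = mfderiv I 𝓘(ℝ, E) (extChartAt I p) p v := by
        rw [h2]; rfl
      exact h3.symm.trans (toChart_self p v)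
    rw [h1]
    exact ContinuousLinearMap.inverse_id
  refine Eq.trans (b := (ContinuousLinearMap.id ℝ E) _) (congrArg (fun L : E →L[ℝ] E => L _) hinv) ?_
  rw [ContinuousLinearMap.id_apply, I.range_eq_univ]
  simp only [Set.preimage_univ, Set.univ_inter]
  have key : ∀ Z : VField I M,
      (VectorField.mpullbackWithin 𝓘(ℝ, E) I (extChartAt I p).symm Z Set.univ)
        =ᶠ[𝓝 (extChartAt I p p)]
        ((fun q => toChart (I := I) p q (Z q)) ∘ (extChartAt I p).symm) := by
    intro Z
    filter_upwards [extChartAt_target_mem_nhds (I := I) p] with u hu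
    have hs : (extChartAt I p).symm u ∈ (chartAt H p).source := by
      rw [← extChartAt_source I]; exact (extChartAt I p).map_target hu
    have h1 := inverse_mfderivWithin_symm (I := I) hs
    rw [(extChartAt I p).right_inv hu, I.range_eq_univ] at h1
    exact congrArg (fun L : E →L[ℝ] E => L (Z ((extChartAt I p).symm u))) h1
  refine (congrFun VectorField.lieBracketWithin_univ _).trans ?_
  refine (Filter.EventuallyEq.lieBracket_vectorField_eq (key X) (key Y)).trans ?_
  unfold VectorField.lieBracket
  have h4 : (extChartAt I p).symm (extChartAt I p p) = p := extChartAt_to_inv p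
  have hval : ∀ Z : VField I M,
      (((fun q => toChart (I := I) p q (Z q)) ∘ (extChartAt I p).symm) (extChartAt I p p) : E)
        = Z p := by
    intro Z
    simp only [Function.comp]
    rw [h4]
    exact toChart_self p (Z p)
  rw [hval, hval]

/-- Second derivatives commute: `X(Y h) - Y(X h) = [X, Y] h`. -/
lemma mvfderiv_mlieBracket {h : M → F} {X Y : VField I M} {p : M}
    (hh : ContMDiffAt I 𝓘(ℝ, F) 2 h p) (hX : DiffVFAt X p) (hY : DiffVFAt Y p) :
    mvfderiv I (fun q => mvfderiv I h q (Y q)) p (X p)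
      - mvfderiv I (fun q => mvfderiv I h q (X q)) p (Y p)
      = mvfderiv I h p (VectorField.mlieBracket I X Y p) := by
  have hp := mem_chart_source H p
  set φ := extChartAt I p with hφ
  set g : E → F := h ∘ φ.symm with hg
  have hgc : ContDiffAt ℝ 2 g (φ p) := by
    have h1 := (contMDiffAt_iff_source_of_mem_source (I := I) (x := p) (x' := p) hp).1 hh
    rw [I.range_eq_univ, contMDiffWithinAt_univ] at h1
    exact h1.contDiffAt
  have hgd : DifferentiableAt ℝ (fderiv ℝ g) (φ p) :=
    ((hgc.fderiv_right (m := 1) (by norm_num)).differentiableAt (by norm_num))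
  have hev : ∀ᶠ q in 𝓝 p, MDifferentiableAt I 𝓘(ℝ, F) h q := by
    filter_upwards [(contMDiffAt_iff_contMDiffAt_nhds (by simp)).1 hh] with q hq
    exact hq.mdifferentiableAt (by simp)
  have hφd : MDifferentiableAt I 𝓘(ℝ, E) φ p := mdifferentiableAt_extChartAt hp
  have key : ∀ Z : VField I M, (fun q => mvfderiv I h q (Z q)) =ᶠ[𝓝 p]
      fun q => fderiv ℝ g (φ q) (toChart (I := I) p q (Z q)) := by
    intro Z
    filter_upwards [hev, (chartAt H p).open_source.mem_nhds hp] with q hq hqs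
    exact mvfderiv_eq_fderiv_chart hqs hq _
  have hX' := (mdifferentiableAt_vf_iff hp).1 hX
  have hY' := (mdifferentiableAt_vf_iff hp).1 hY
  have hA : MDifferentiableAt I 𝓘(ℝ, E →L[ℝ] F) (fun q => fderiv ℝ g (φ q)) p :=
    hgd.comp_mdifferentiableAt hφd
  have hφp : ∀ v : TangentSpace I p, mvfderiv I φ p v = v := by
    intro v
    rw [hφ, ← toChart_eq_mvfderiv hp, toChart_self]
  rw [mvfderiv_congr (key X), mvfderiv_congr (key Y), mvfderiv_clm_apply hA hX',
    mvfderiv_clm_apply hA hY', mvfderiv_fderiv_comp hgd hφd, mvfderiv_fderiv_comp hgd hφd,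
    hφp, hφp, toChart_self, toChart_self,
    mvfderiv_eq_fderiv_chart hp (hev.self_of_nhds) (VectorField.mlieBracket I X Y p),
    toChart_self, toChart_mlieBracket hX hY, map_sub]
  have hsym := hgc.isSymmSndFDerivAt (by simp) (X p) (Y p)
  rw [show fderiv ℝ (fderiv ℝ g) (φ p) (X p) (Y p) = fderiv ℝ (fderiv ℝ g) (φ p) (Y p) (X p)
    from hsym]
  abel

end Bracket

section Extension

variable {E : Type*} [NormedAddCommGroup E] [NormedSpace ℝ E] [FiniteDimensional ℝ E]
  {H : Type*} [TopologicalSpace H] {I : ModelWithCorners ℝ E H}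
  {M : Type*} [TopologicalSpace M] [ChartedSpace H M] [IsManifold I ∞ M] [T2Space M]

/-- A local smooth vector field coincides near a given point with a global one. -/
lemma exists_smoothVF_eventuallyEq {X : VField I M} {x : M} (hX : ∀ᶠ y in 𝓝 x, SmoothVFAt X y) :
    ∃ Z : VField I M, SmoothVF Z ∧ ∀ᶠ y in 𝓝 x, Z y = X y := by
  obtain ⟨f, -, hf⟩ := (SmoothBumpFunction.nhds_basis_tsupport (I := I) x).mem_iff.1 hX
  refine ⟨fun y => f y • X y, fun y => ?_, ?_⟩
  · by_cases hy : y ∈ tsupport f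
    · exact ContMDiffAt.smul_section (f.contMDiff.contMDiffAt) (hf hy)
    · have h0 : ContMDiffAt I I.tangent ∞
          (fun y => (⟨y, 0⟩ : TangentBundle I M)) y :=
        (Bundle.contMDiff_zeroSection ℝ (TangentSpace I : M → Type _)).contMDiffAt
      refine h0.congr_of_eventuallyEq ?_
      filter_upwards [(isClosed_tsupport f).isOpen_compl.mem_nhds hy] with z hz
      have : f z = 0 := image_eq_zero_of_notMem_tsupport hz
      simp [this]
  · filter_upwards [f.eventuallyEq_one] with y hy
    simp [hy]

lemma exists_smoothVF_chart {x₀ x : M} (hx : x ∈ (chartAt H x₀).source) (e : E) :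
    ∃ Z : VField I M, SmoothVF Z ∧ ∀ᶠ y in 𝓝 x, Z y = ofChart x₀ y e := by
  refine exists_smoothVF_eventuallyEq (X := fun y => ofChart x₀ y e) ?_
  filter_upwards [(chartAt H x₀).open_source.mem_nhds hx] with y hy
  exact contMDiffAt_ofChart hy contMDiffAt_const

lemma exists_smoothVF_apply (x : M) (v : TangentSpace I x) :
    ∃ Z : VField I M, SmoothVF Z ∧ Z x = v := by
  obtain ⟨Z, hZ, hZe⟩ := exists_smoothVF_chart (E := E) (I := I) (mem_chart_source H x) v
  exact ⟨Z, hZ, hZe.self_of_nhds.trans (ofChart_self (E := E) (I := I) x v)⟩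

end Extension

section Coframes

variable {E : Type*} [NormedAddCommGroup E] [NormedSpace ℝ E]
  {H : Type*} [TopologicalSpace H] {I : ModelWithCorners ℝ E H}
  {M : Type*} [TopologicalSpace M] [ChartedSpace H M] [IsManifold I ∞ M]
  {F : Type*} [NormedAddCommGroup F] [NormedSpace ℝ F]

/-- A one-form with values in a normed space is smooth at a point. -/
def SmoothFormAt (θ : OneForm I M F) (x : M) : Prop :=
  ContMDiffAt I 𝓘(ℝ, E →L[ℝ] F) ∞ (fun y => (θ y ∘L ofChart x y : E →L[ℝ] F)) x

lemma SmoothFormAt.apply {θ : OneForm I M F} {x : M} (hθ : SmoothFormAt θ x) {V : VField I M}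
    (hV : SmoothVFAt V x) : ContMDiffAt I 𝓘(ℝ, F) ∞ (fun y => θ y (V y)) x := by
  have h1 := ContMDiffAt.clm_apply hθ ((contMDiffAt_vf_iff (mem_chart_source H x)).1 hV)
  refine h1.congr_of_eventuallyEq ?_
  filter_upwards [(chartAt H x).open_source.mem_nhds (mem_chart_source H x)] with y hy
  simp [ofChart_toChart hy]

lemma SmoothFormAt.diff_apply {θ : OneForm I M F} {x : M} (hθ : SmoothFormAt θ x) {V : VField I M}
    (hV : DiffVFAt V x) : MDifferentiableAt I 𝓘(ℝ, F) (fun y => θ y (V y)) x := by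
  have h1 := MDifferentiableAt.clm_apply (ContMDiffAt.mdifferentiableAt hθ (by simp))
    ((mdifferentiableAt_vf_iff (mem_chart_source H x)).1 hV)
  refine h1.congr_of_eventuallyEq ?_
  filter_upwards [(chartAt H x).open_source.mem_nhds (mem_chart_source H x)] with y hy
  simp [ofChart_toChart hy]

lemma smoothFormAt_of_apply [FiniteDimensional ℝ E] {θ : OneForm I M F} {x : M}
    (h : ∀ V : VField I M, (∀ᶠ y in 𝓝 x, SmoothVFAt V y) →
      ContMDiffAt I 𝓘(ℝ, F) ∞ (fun y => θ y (V y)) x) :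
    SmoothFormAt θ x := by
  refine contMDiffAt_clm_of_apply fun e => h (fun y => ofChart x y e) ?_
  filter_upwards [(chartAt H x).open_source.mem_nhds (mem_chart_source H x)] with y hy
  exact contMDiffAt_ofChart hy contMDiffAt_const

/-- Smoothness of a one-form may be tested on global vector fields. -/
lemma smoothFormAt_of_global [FiniteDimensional ℝ E] [T2Space M] {θ : OneForm I M F} {x : M}
    (h : ∀ V : VField I M, SmoothVF V → ContMDiffAt I 𝓘(ℝ, F) ∞ (fun y => θ y (V y)) x) :
    SmoothFormAt θ x := by
  refine smoothFormAt_of_apply fun V hV => ?_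
  obtain ⟨Z, hZ, hZV⟩ := exists_smoothVF_eventuallyEq hV
  refine (h Z hZ).congr_of_eventuallyEq ?_
  filter_upwards [hZV] with y hy
  rw [hy]

/-- A smooth coframe `ϑ` on an open set, with values in a normed space, and the dual frame `ε`. -/
structure IsCoframe (ϑ : OneForm I M F) (ε : Π x : M, F →L[ℝ] TangentSpace I x) (U : Set M) :
    Prop where
  isOpen : IsOpen U
  left_inv : ∀ q ∈ U, ∀ v, ε q (ϑ q v) = v
  right_inv : ∀ q ∈ U, ∀ f, ϑ q (ε q f) = f
  smooth : ∀ q ∈ U, SmoothFormAt ϑ q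

lemma IsCoframe.smooth_frame [CompleteSpace E] {ϑ : OneForm I M F}
    {ε : Π x : M, F →L[ℝ] TangentSpace I x}
    {U : Set M} (h : IsCoframe ϑ ε U) {q : M} (hq : q ∈ U) :
    ContMDiffAt I 𝓘(ℝ, F →L[ℝ] E) ∞ (fun y => (toChart q y ∘L ε y : F →L[ℝ] E)) q := by
  have hinv : ∀ y ∈ U ∩ (chartAt H q).source,
      (∀ f, (ϑ y ∘L ofChart q y : E →L[ℝ] F) ((toChart q y ∘L ε y : F →L[ℝ] E) f) = f) ∧
      (∀ e, (toChart q y ∘L ε y : F →L[ℝ] E) ((ϑ y ∘L ofChart q y : E →L[ℝ] F) e) = e) := by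
    rintro y ⟨hy, hys⟩
    refine ⟨fun f => ?_, fun e => ?_⟩
    · simp [ofChart_toChart hys, h.right_inv y hy]
    · simp [toChart_ofChart hys, h.left_inv y hy]
  have hq' : q ∈ U ∩ (chartAt H q).source := ⟨hq, mem_chart_source H q⟩
  let e : E ≃L[ℝ] F := ContinuousLinearEquiv.equivOfInverse (ϑ q ∘L ofChart q q : E →L[ℝ] F)
    (toChart q q ∘L ε q : F →L[ℝ] E) (hinv q hq').2 (hinv q hq').1
  have h1 : ContDiffAt ℝ ∞ (ContinuousLinearMap.inverse : (E →L[ℝ] F) → (F →L[ℝ] E))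
      (ϑ q ∘L ofChart q q : E →L[ℝ] F) := contDiffAt_map_inverse e
  have h2 := h1.contMDiffAt.comp q (h.smooth q hq)
  refine h2.congr_of_eventuallyEq ?_
  filter_upwards [(h.isOpen.inter (chartAt H q).open_source).mem_nhds hq'] with y hy
  refine (ContinuousLinearMap.inverse_eq ?_ ?_).symm
  · ext f; exact (hinv y hy).1 f
  · ext f; exact (hinv y hy).2 f

lemma IsCoframe.smoothVFAt [CompleteSpace E] {ϑ : OneForm I M F}
    {ε : Π x : M, F →L[ℝ] TangentSpace I x}
    {U : Set M} (h : IsCoframe ϑ ε U) {q : M} (hq : q ∈ U) {f : M → F}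
    (hf : ContMDiffAt I 𝓘(ℝ, F) ∞ f q) : SmoothVFAt (I := I) (fun y => ε y (f y)) q :=
  (contMDiffAt_vf_iff (mem_chart_source H q)).2 ((h.smooth_frame hq).clm_apply hf)

lemma IsCoframe.smoothVFAt_of_form [CompleteSpace E] {ϑ : OneForm I M F}
    {ε : Π x : M, F →L[ℝ] TangentSpace I x}
    {U : Set M} (h : IsCoframe ϑ ε U) {q : M} (hq : q ∈ U) {V : VField I M}
    (hf : ContMDiffAt I 𝓘(ℝ, F) ∞ (fun y => ϑ y (V y)) q) : SmoothVFAt V q := by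
  refine (h.smoothVFAt hq hf).congr_of_eventuallyEq ?_
  filter_upwards [h.isOpen.mem_nhds hq] with y hy
  rw [h.left_inv y hy]

lemma IsCoframe.injective {ϑ : OneForm I M F} {ε : Π x : M, F →L[ℝ] TangentSpace I x}
    {U : Set M} (h : IsCoframe ϑ ε U) {q : M} (hq : q ∈ U) {v w : TangentSpace I q}
    (hvw : ϑ q v = ϑ q w) : v = w := by
  rw [← h.left_inv q hq v, hvw, h.left_inv q hq]

lemma smoothFormAt_toChart [FiniteDimensional ℝ E] {x₀ q : M} (hq : q ∈ (chartAt H x₀).source) :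
    SmoothFormAt (fun y => toChart (I := I) x₀ y) q :=
  smoothFormAt_of_apply fun _ hV => (contMDiffAt_vf_iff hq).1 hV.self_of_nhds

lemma isCoframe_toChart [FiniteDimensional ℝ E] (x₀ : M) :
    IsCoframe (fun y => toChart (I := I) x₀ y) (fun y => ofChart x₀ y) (chartAt H x₀).source where
  isOpen := (chartAt H x₀).open_source
  left_inv _ hq _ := ofChart_toChart hq _
  right_inv _ hq _ := toChart_ofChart hq _
  smooth _ hq := smoothFormAt_toChart hq

/-- `dθ(X, Y) = X(θ(Y)) - Y(θ(X)) - θ([X, Y])` for vector-valued one-forms. -/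
def extForm (θ : OneForm I M F) (X Y : VField I M) (x : M) : F :=
  mvfderiv I (fun y => θ y (Y y)) x (X x) - mvfderiv I (fun y => θ y (X y)) x (Y x)
    - θ x (VectorField.mlieBracket I X Y x)

lemma extForm_mvfderiv [I.Boundaryless] {h : M → F} {X Y : VField I M} {p : M}
    (hh : ContMDiffAt I 𝓘(ℝ, F) 2 h p) (hX : DiffVFAt X p) (hY : DiffVFAt Y p) :
    extForm (fun q => mvfderiv I h q) X Y p = 0 := by
  unfold extForm
  rw [mvfderiv_mlieBracket hh hX hY, sub_self]

lemma extForm_congr {θ θ' : OneForm I M F} {X Y : VField I M} {p : M}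
    (h : ∀ᶠ q in 𝓝 p, θ q = θ' q) : extForm θ X Y p = extForm θ' X Y p := by
  have h1 : ∀ Z : VField I M, (fun y => θ y (Z y)) =ᶠ[𝓝 p] fun y => θ' y (Z y) := by
    intro Z
    filter_upwards [h] with q hq
    rw [hq]
  unfold extForm
  rw [mvfderiv_congr (h1 X), mvfderiv_congr (h1 Y), h.self_of_nhds]

variable [I.Boundaryless]

lemma extForm_toChart {X Y : VField I M} {x₀ p : M} (hp : p ∈ (chartAt H x₀).source)
    (hX : DiffVFAt X p) (hY : DiffVFAt Y p) :
    extForm (fun q => toChart (I := I) x₀ q) X Y p = 0 := by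
  rw [extForm_congr (θ' := fun q => mvfderiv I (extChartAt I x₀) q)]
  · exact extForm_mvfderiv (contMDiffAt_extChartAt' hp) hX hY
  · filter_upwards [(chartAt H x₀).open_source.mem_nhds hp] with q hq
    exact toChart_eq_mvfderiv hq

/-- `d(k α) = dk ∧ α + k dα`. -/
lemma extForm_clm_comp {F₁ F₂ : Type*} [NormedAddCommGroup F₁] [NormedSpace ℝ F₁]
    [NormedAddCommGroup F₂] [NormedSpace ℝ F₂] {k : M → F₁ →L[ℝ] F₂} {α : OneForm I M F₁}
    {X Y : VField I M} {p : M}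
    (hk : MDifferentiableAt I 𝓘(ℝ, F₁ →L[ℝ] F₂) k p)
    (hαX : MDifferentiableAt I 𝓘(ℝ, F₁) (fun q => α q (X q)) p)
    (hαY : MDifferentiableAt I 𝓘(ℝ, F₁) (fun q => α q (Y q)) p) :
    extForm (fun q => k q ∘L α q) X Y p
      = mvfderiv I k p (X p) (α p (Y p)) - mvfderiv I k p (Y p) (α p (X p))
        + k p (extForm α X Y p) := by
  unfold extForm
  simp only [ContinuousLinearMap.comp_apply]
  rw [mvfderiv_clm_apply hk hαY, mvfderiv_clm_apply hk hαX, map_sub, map_sub]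
  abel

lemma contMDiffAt_mvfderiv_apply {f : M → F} {X : VField I M} {q : M}
    (hf : ContMDiffAt I 𝓘(ℝ, F) ∞ f q) (hX : SmoothVFAt X q) :
    ContMDiffAt I 𝓘(ℝ, F) ∞ (fun y => mvfderiv I f y (X y)) q := by
  have hp := mem_chart_source H q
  set φ := extChartAt I q with hφ
  set g : E → F := f ∘ φ.symm with hg
  have hgc : ContDiffAt ℝ ∞ g (φ q) := by
    have h1 := (contMDiffAt_iff_source_of_mem_source (I := I) (x := q) (x' := q) hp).1 hf
    rw [I.range_eq_univ, contMDiffWithinAt_univ] at h1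
    exact h1.contDiffAt
  have hgd : ContDiffAt ℝ ∞ (fderiv ℝ g) (φ q) := hgc.fderiv_right (by simp)
  have hφd : ContMDiffAt I 𝓘(ℝ, E) ∞ φ q := contMDiffAt_extChartAt
  have h1 := (hgd.contMDiffAt.comp q hφd).clm_apply ((contMDiffAt_vf_iff hp).1 hX)
  refine h1.congr_of_eventuallyEq ?_
  have hf1 : ContMDiffAt I 𝓘(ℝ, F) 1 f q := hf.of_le (by simp)
  filter_upwards [(contMDiffAt_iff_contMDiffAt_nhds (by simp)).1 hf1,
    (chartAt H q).open_source.mem_nhds hp] with y hy hys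
  exact mvfderiv_eq_fderiv_chart hys (hy.mdifferentiableAt (by simp)) _

end Coframes

section Representation

variable {E : Type*} [NormedAddCommGroup E] [NormedSpace ℝ E]
  {H : Type*} [TopologicalSpace H] {I : ModelWithCorners ℝ E H}
  {M : Type*} [TopologicalSpace M] [ChartedSpace H M] [IsManifold I ∞ M]
  {F : Type*} [NormedAddCommGroup F] [NormedSpace ℝ F]

/-- In the coframe `ϑ`, the connection `D` is given by `d + Ψ` on the set `U`; the first vector
argument of `Ψ` is the direction of differentiation. -/
structure IsConnForm (D : AffConn I M) (ϑ : OneForm I M F) (Ψ : M → F →L[ℝ] F →L[ℝ] F)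
    (U : Set M) : Prop where
  eq : ∀ q ∈ U, ∀ V : VField I M, DiffVFAt V q → ∀ v : TangentSpace I q,
    ϑ q (D V q v) = mvfderiv I (fun y => ϑ y (V y)) q v + Ψ q (ϑ q v) (ϑ q (V q))
  smooth : ∀ q ∈ U, ContMDiffAt I 𝓘(ℝ, F →L[ℝ] F →L[ℝ] F) ∞ Ψ q

variable {D : AffConn I M} {ϑ : OneForm I M F} {ε : Π x : M, F →L[ℝ] TangentSpace I x}
  {Ψ : M → F →L[ℝ] F →L[ℝ] F} {U : Set M}

lemma IsConnForm.extForm_eq (hD : IsConnForm D ϑ Ψ U) {q : M} (hq : q ∈ U) {X Y : VField I M}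
    (hX : DiffVFAt X q) (hY : DiffVFAt Y q) :
    ϑ q (covD D X Y q - covD D Y X q - VectorField.mlieBracket I X Y q)
      = extForm ϑ X Y q + Ψ q (ϑ q (X q)) (ϑ q (Y q)) - Ψ q (ϑ q (Y q)) (ϑ q (X q)) := by
  unfold extForm covD
  rw [map_sub, map_sub, hD.eq q hq Y hY, hD.eq q hq X hX]
  abel

variable [I.Boundaryless]

lemma IsConnForm.smooth_form_covD (hD : IsConnForm D ϑ Ψ U) (hϑ : IsCoframe ϑ ε U)
    {q : M} (hq : q ∈ U) {X Y : VField I M} (hX : SmoothVFAt X q)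
    (hY : ∀ᶠ y in 𝓝 q, SmoothVFAt Y y) :
    ContMDiffAt I 𝓘(ℝ, F) ∞ (fun y => ϑ y (covD D X Y y)) q := by
  have hϑX := (hϑ.smooth q hq).apply hX
  have hϑY := (hϑ.smooth q hq).apply hY.self_of_nhds
  have h1 := (contMDiffAt_mvfderiv_apply hϑY hX).add (((hD.smooth q hq).clm_apply hϑX).clm_apply hϑY)
  refine h1.congr_of_eventuallyEq ?_
  filter_upwards [hϑ.isOpen.mem_nhds hq, hY] with y hy hYy
  exact hD.eq y hy Y hYy.diff (X y)

lemma IsConnForm.smooth_covD [CompleteSpace E] (hD : IsConnForm D ϑ Ψ U) (hϑ : IsCoframe ϑ ε U)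
    {q : M} (hq : q ∈ U) {X Y : VField I M} (hX : SmoothVFAt X q)
    (hY : ∀ᶠ y in 𝓝 q, SmoothVFAt Y y) :
    SmoothVFAt (covD D X Y) q :=
  hϑ.smoothVFAt_of_form hq (hD.smooth_form_covD hϑ hq hX hY)

/-- The curvature of `d + Ψ`. -/
lemma IsConnForm.curv_eq [CompleteSpace E] (hD : IsConnForm D ϑ Ψ U) (hϑ : IsCoframe ϑ ε U)
    {q : M} (hq : q ∈ U) {X Y Z : VField I M} (hX : ∀ᶠ y in 𝓝 q, SmoothVFAt X y)
    (hY : ∀ᶠ y in 𝓝 q, SmoothVFAt Y y) (hZ : ∀ᶠ y in 𝓝 q, SmoothVFAt Z y) :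
    ϑ q (curv D X Y Z q)
      = mvfderiv I Ψ q (X q) (ϑ q (Y q)) (ϑ q (Z q)) - mvfderiv I Ψ q (Y q) (ϑ q (X q)) (ϑ q (Z q))
        + Ψ q (extForm ϑ X Y q) (ϑ q (Z q))
        + Ψ q (ϑ q (X q)) (Ψ q (ϑ q (Y q)) (ϑ q (Z q)))
        - Ψ q (ϑ q (Y q)) (Ψ q (ϑ q (X q)) (ϑ q (Z q))) := by
  have hZq := hZ.self_of_nhds
  have hz := (hϑ.smooth q hq).apply hZq
  have hzd := hz.mdifferentiableAt (n := ∞) (by simp)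
  have hΨ := (hD.smooth q hq).mdifferentiableAt (n := ∞) (by simp)
  -- the derivative of `D_Y Z` in the direction `X`
  have key : ∀ {X Y : VField I M}, (∀ᶠ y in 𝓝 q, SmoothVFAt X y) → (∀ᶠ y in 𝓝 q, SmoothVFAt Y y) →
      ϑ q (covD D X (covD D Y Z) q)
        = mvfderiv I (fun y => mvfderiv I (fun y' => ϑ y' (Z y')) y (Y y)) q (X q)
          + (mvfderiv I Ψ q (X q) (ϑ q (Y q)) (ϑ q (Z q))
            + Ψ q (mvfderiv I (fun y => ϑ y (Y y)) q (X q)) (ϑ q (Z q))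
            + Ψ q (ϑ q (Y q)) (mvfderiv I (fun y => ϑ y (Z y)) q (X q)))
          + Ψ q (ϑ q (X q)) (mvfderiv I (fun y => ϑ y (Z y)) q (Y q)
              + Ψ q (ϑ q (Y q)) (ϑ q (Z q))) := by
    intro X Y hX hY
    have hs := hD.smooth_covD hϑ hq hY.self_of_nhds hZ
    have hy := ((hϑ.smooth q hq).apply hY.self_of_nhds).mdifferentiableAt (n := ∞) (by simp)
    have hyz := (contMDiffAt_mvfderiv_apply hz hY.self_of_nhds).mdifferentiableAt (n := ∞) (by simp)
    have hΨy := hΨ.clm_apply hy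
    have hev : (fun y => ϑ y (covD D Y Z y)) =ᶠ[𝓝 q] fun y =>
        mvfderiv I (fun y' => ϑ y' (Z y')) y (Y y) + Ψ y (ϑ y (Y y)) (ϑ y (Z y)) := by
      filter_upwards [hϑ.isOpen.mem_nhds hq, hZ] with y hy hZy
      exact hD.eq y hy Z hZy.diff (Y y)
    have h1 := hD.eq q hq (covD D Y Z) hs.diff (X q)
    rw [mvfderiv_congr hev, mvfderiv_fun_add hyz (hΨy.clm_apply hzd),
      add_apply, mvfderiv_clm_apply hΨy hzd, mvfderiv_clm_apply hΨ hy] at h1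
    have hv : ϑ q (covD D Y Z q) = _ := hev.self_of_nhds
    refine h1.trans ?_
    rw [hv, add_apply]
  have hdd := mvfderiv_mlieBracket (hz.of_le (WithTop.coe_le_coe.2 le_top)) hX.self_of_nhds.diff
    hY.self_of_nhds.diff
  have h3 := hD.eq q hq Z hZq.diff (VectorField.mlieBracket I X Y q)
  unfold curv
  rw [map_sub, map_sub, key hX hY, key hY hX]
  refine (congrArg _ h3).trans ?_
  rw [← hdd]
  unfold extForm
  simp only [map_sub, map_add, sub_apply]
  abel

/-- A connection which is given by smooth connection forms is smooth. -/
lemma contMDiffCovariantDerivative_of_connForm [FiniteDimensional ℝ E] [CompleteSpace E]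
    (h : ∀ q : M, ∃ (ϑ : OneForm I M F) (ε : Π x : M, F →L[ℝ] TangentSpace I x)
      (Ψ : M → F →L[ℝ] F →L[ℝ] F) (U : Set M), q ∈ U ∧ IsCoframe ϑ ε U ∧ IsConnForm D ϑ Ψ U) :
    CovariantDerivative.ContMDiffCovariantDerivative D ∞ := by
  refine ⟨⟨fun {σ} hσ => ?_⟩⟩
  intro q _
  refine ContMDiffAt.contMDiffWithinAt ?_
  have hσ' : SmoothVF σ := fun y => by
    have := (hσ y trivial).contMDiffAt Filter.univ_mem
    exact this
  obtain ⟨ϑ, ε, Ψ, U, hq, hϑ, hD⟩ := h q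
  rw [contMDiffAt_hom_bundle]
  refine ⟨contMDiffAt_id, ?_⟩
  refine contMDiffAt_clm_of_apply (F₁ := E) (F₂ := E) fun e => ?_
  have hX : SmoothVFAt (I := I) (fun y => ofChart q y e) q :=
    contMDiffAt_ofChart (mem_chart_source H q) contMDiffAt_const
  have h1 := hD.smooth_covD hϑ hq hX (Filter.Eventually.of_forall hσ')
  exact (contMDiffAt_vf_iff (mem_chart_source H q)).1 h1

/-- A connection which is given by connection forms satisfying the structure equation is
torsion-free. -/
lemma torsion_eq_zero_of_connForm [FiniteDimensional ℝ E] [CompleteSpace E]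
    (h : ∀ q : M, ∃ (ϑ : OneForm I M F) (ε : Π x : M, F →L[ℝ] TangentSpace I x)
      (Ψ : M → F →L[ℝ] F →L[ℝ] F) (U : Set M), q ∈ U ∧ IsCoframe ϑ ε U ∧ IsConnForm D ϑ Ψ U ∧
        ∀ X Y : VField I M, DiffVFAt X q → DiffVFAt Y q →
          extForm ϑ X Y q + Ψ q (ϑ q (X q)) (ϑ q (Y q)) - Ψ q (ϑ q (Y q)) (ϑ q (X q)) = 0) :
    D.torsion = 0 := by
  rw [CovariantDerivative.torsion_eq_zero_iff]
  intro X Y q hX hY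
  obtain ⟨ϑ, ε, Ψ, U, hq, hϑ, hD, h0⟩ := h q
  have h1 := hD.extForm_eq hq hX hY
  rw [h0 X Y hX hY] at h1
  have h2 := hϑ.injective hq (h1.trans (map_zero _).symm)
  exact sub_eq_zero.1 h2

end Representation

section Christoffel

variable {E : Type*} [NormedAddCommGroup E] [NormedSpace ℝ E]
  {H : Type*} [TopologicalSpace H] {I : ModelWithCorners ℝ E H}
  {M : Type*} [TopologicalSpace M] [ChartedSpace H M] [IsManifold I ∞ M]

lemma affConn_congr (D : AffConn I M) {V W : VField I M} {x : M} (hV : DiffVFAt V x)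
    (h : ∀ᶠ y in 𝓝 x, V y = W y) : D V x = D W x := by
  have hW : DiffVFAt W x := by
    refine hV.congr_of_eventuallyEq ?_
    filter_upwards [h] with y hy
    rw [hy]
  exact D.isCovariantDerivativeOnUniv.congr_of_eventuallyEq hV hW Filter.univ_mem h

lemma diffVFAt_sum {ι : Type*} (s : Finset ι) {f : ι → M → ℝ} {Z : ι → VField I M} {x : M}
    (hf : ∀ i, MDifferentiableAt I 𝓘(ℝ, ℝ) (f i) x) (hZ : ∀ i, DiffVFAt (Z i) x) :
    DiffVFAt (I := I) (fun q => ∑ i ∈ s, f i q • Z i q) x := by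
  exact MDifferentiableAt.sum_section fun i _ => MDifferentiableAt.smul_section (hf i) (hZ i)

lemma affConn_sum (D : AffConn I M) {ι : Type*} (s : Finset ι) {f : ι → M → ℝ}
    {Z : ι → VField I M} {x : M}
    (hf : ∀ i, MDifferentiableAt I 𝓘(ℝ, ℝ) (f i) x) (hZ : ∀ i, DiffVFAt (Z i) x)
    (v : TangentSpace I x) :
    D (fun q => ∑ i ∈ s, f i q • Z i q) x v
      = ∑ i ∈ s, (f i x • D (Z i) x v + mvfderiv I (f i) x v • Z i x) := by
  classical
  induction s using Finset.induction_on with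
  | empty =>
    have := congrFun D.zero x
    simp only [Finset.sum_empty]
    exact congrArg (fun L : TangentSpace I x →L[ℝ] TangentSpace I x => L v) this
  | insert a s ha ih =>
    simp only [Finset.sum_insert ha]
    rw [← ih]
    have h1 := D.isCovariantDerivativeOnUniv.add (x := x) (σ := f a • Z a)
      (σ' := fun q => ∑ i ∈ s, f i q • Z i q) (MDifferentiableAt.smul_section (hf a) (hZ a))
      (diffVFAt_sum s hf hZ)
    have h2 := D.isCovariantDerivativeOnUniv.leibniz (x := x) (hZ a) (hf a)
    rw [h2] at h1
    exact congrArg (fun L : TangentSpace I x →L[ℝ] TangentSpace I x => L v) h1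

lemma smoothVF_covD [FiniteDimensional ℝ E] [CompleteSpace E] {D : AffConn I M}
    (hD : CovariantDerivative.ContMDiffCovariantDerivative D ∞) {X Y : VField I M}
    (hX : SmoothVF X) (hY : SmoothVF Y) : SmoothVF (covD D X Y) := by
  intro x
  have h1 := hD.contMDiff.contMDiff (σ := Y) (fun y _ => (hY y).contMDiffWithinAt)
  have h2 := (h1 x trivial).contMDiffAt Filter.univ_mem
  exact ContMDiffAt.clm_bundle_apply h2 (hX x)

variable [FiniteDimensional ℝ E]

/-- The Christoffel symbols of `D` in the preferred chart at `x₀`, at the point `y`; the first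
argument is the direction of differentiation. -/
def christoffel (D : AffConn I M) (x₀ y : M) : E →L[ℝ] E →L[ℝ] E :=
  (∑ i, (LinearMap.toContinuousLinearMap ((Module.finBasis ℝ E).coord i)).smulRight
    (toChart x₀ y ∘L D (fun q => ofChart x₀ q (Module.finBasis ℝ E i)) y ∘L ofChart x₀ y
      : E →L[ℝ] E)).flip

lemma christoffel_eq_sum (D : AffConn I M) (x₀ y : M) (u w : E) :
    christoffel D x₀ y u w = ∑ i, (Module.finBasis ℝ E).repr w i •
      toChart x₀ y (D (fun q => ofChart x₀ q (Module.finBasis ℝ E i)) y (ofChart x₀ y u)) := by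
  simp [christoffel]

lemma toChart_affConn (D : AffConn I M) {x₀ q : M} (hq : q ∈ (chartAt H x₀).source)
    {V : VField I M} (hV : DiffVFAt V q) (v : TangentSpace I q) :
    toChart x₀ q (D V q v) = mvfderiv I (fun y => toChart x₀ y (V y)) q v
      + christoffel D x₀ q (toChart x₀ q v) (toChart x₀ q (V q)) := by
  let b := Module.finBasis ℝ E
  let c : Fin _ → E →L[ℝ] ℝ := fun i => LinearMap.toContinuousLinearMap (b.coord i)
  have hV' := (mdifferentiableAt_vf_iff hq).1 hV
  let f : Fin (Module.finrank ℝ E) → M → ℝ := fun i y => c i (toChart x₀ y (V y))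
  have hf : ∀ i, MDifferentiableAt I 𝓘(ℝ, ℝ) (f i) q := fun i =>
    (c i).differentiableAt.comp_mdifferentiableAt hV'
  have hZ : ∀ i, DiffVFAt (I := I) (fun y => ofChart x₀ y (b i)) q := fun i =>
    mdifferentiableAt_ofChart hq mdifferentiableAt_const
  have hev : ∀ᶠ y in 𝓝 q, V y = ∑ i, f i y • ofChart x₀ y (b i) := by
    filter_upwards [(chartAt H x₀).open_source.mem_nhds hq] with y hy
    conv_lhs => rw [← ofChart_toChart hy (V y), ← b.sum_repr (toChart x₀ y (V y)), map_sum]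
    simp [f, c]
  rw [affConn_congr D hV hev, affConn_sum D Finset.univ hf hZ v]
  have hd : mvfderiv I (fun y => toChart x₀ y (V y)) q v = ∑ i, mvfderiv I (f i) q v • b i := by
    conv_lhs => rw [← b.sum_repr (mvfderiv I (fun y => toChart x₀ y (V y)) q v)]
    refine Finset.sum_congr rfl fun i _ => ?_
    rw [mvfderiv_clm_comp (c i) hV']
    rfl
  rw [hd, christoffel_eq_sum, ofChart_toChart hq, Finset.sum_add_distrib, map_add, map_sum,
    map_sum, add_comm]
  congr 1
  · refine Finset.sum_congr rfl fun i _ => ?_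
    rw [map_smul, toChart_ofChart hq]
  · refine Finset.sum_congr rfl fun i _ => ?_
    rw [map_smul]
    rfl

lemma christoffel_apply (D : AffConn I M) {x₀ y : M} (hy : y ∈ (chartAt H x₀).source) (u w : E) :
    christoffel D x₀ y u w
      = toChart x₀ y (D (fun q => ofChart x₀ q w) y (ofChart x₀ y u)) := by
  have hZ : DiffVFAt (I := I) (fun y => ofChart x₀ y w) y :=
    mdifferentiableAt_ofChart hy mdifferentiableAt_const
  rw [toChart_affConn D hy hZ, toChart_ofChart hy, toChart_ofChart hy]
  have : mvfderiv I (fun y => toChart x₀ y (ofChart (I := I) x₀ y w)) y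
      = mvfderiv I (fun _ => w) y := by
    refine mvfderiv_congr ?_
    filter_upwards [(chartAt H x₀).open_source.mem_nhds hy] with z hz
    exact toChart_ofChart hz w
  rw [this, mvfderiv_const]
  simp

variable [T2Space M] [CompleteSpace E]

lemma contMDiffAt_christoffel {D : AffConn I M}
    (hD : CovariantDerivative.ContMDiffCovariantDerivative D ∞) {x₀ y : M}
    (hy : y ∈ (chartAt H x₀).source) :
    ContMDiffAt I 𝓘(ℝ, E →L[ℝ] E →L[ℝ] E) ∞ (christoffel D x₀) y := by
  refine contMDiffAt_clm_of_apply₂ fun u w => ?_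
  obtain ⟨X, hX, hXe⟩ := exists_smoothVF_chart (I := I) hy u
  obtain ⟨Z, hZ, hZe⟩ := exists_smoothVF_chart (I := I) hy w
  have h1 := (contMDiffAt_vf_iff hy).1 (smoothVF_covD hD hX hZ y)
  refine h1.congr_of_eventuallyEq ?_
  filter_upwards [hXe, hZe.eventually_nhds, (chartAt H x₀).open_source.mem_nhds hy]
    with z hXz hZz hz
  rw [christoffel_apply D hz, covD, hXz, affConn_congr D (hZ.at z).diff hZz]

lemma isConnForm_christoffel {D : AffConn I M}
    (hD : CovariantDerivative.ContMDiffCovariantDerivative D ∞) (x₀ : M) :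
    IsConnForm D (fun y => toChart x₀ y) (christoffel D x₀) (chartAt H x₀).source where
  eq _ hq _ hV v := toChart_affConn D hq hV v
  smooth _ hq := contMDiffAt_christoffel hD hq

variable [I.Boundaryless]

lemma christoffel_symm {D : AffConn I M} (hD : IsSmoothTorsionFree D) {x₀ y : M}
    (hy : y ∈ (chartAt H x₀).source) (u w : E) :
    christoffel D x₀ y u w = christoffel D x₀ y w u := by
  have hX : DiffVFAt (I := I) (fun q => ofChart x₀ q u) y :=
    mdifferentiableAt_ofChart hy mdifferentiableAt_const
  have hY : DiffVFAt (I := I) (fun q => ofChart x₀ q w) y :=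
    mdifferentiableAt_ofChart hy mdifferentiableAt_const
  have h1 := (isConnForm_christoffel hD.smooth x₀).extForm_eq hy hX hY
  have h2 := (CovariantDerivative.torsion_eq_zero_iff (cov := D)).1 hD.torsion_eq_zero hX hY
  rw [extForm_toChart hy hX hY, toChart_ofChart hy, toChart_ofChart hy] at h1
  have h3 : covD D (fun q => ofChart x₀ q u) (fun q => ofChart x₀ q w) y
      - covD D (fun q => ofChart x₀ q w) (fun q => ofChart x₀ q u) y
      - VectorField.mlieBracket I (fun q => ofChart x₀ q u) (fun q => ofChart x₀ q w) y = 0 :=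
    sub_eq_zero.2 h2
  rw [h3, map_zero, zero_add] at h1
  exact (sub_eq_zero.1 h1.symm)

/-- The curvature tensor in the preferred chart at `x₀`. -/
def curvCoef (D : AffConn I M) (x₀ y : M) (u v w : E) : E :=
  mvfderiv I (christoffel D x₀) y (ofChart x₀ y u) v w
    - mvfderiv I (christoffel D x₀) y (ofChart x₀ y v) u w
    + christoffel D x₀ y u (christoffel D x₀ y v w)
    - christoffel D x₀ y v (christoffel D x₀ y u w)

lemma toChart_curv {D : AffConn I M}
    (hD : CovariantDerivative.ContMDiffCovariantDerivative D ∞) {x₀ q : M}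
    (hq : q ∈ (chartAt H x₀).source)
    {X Y Z : VField I M} (hX : ∀ᶠ y in 𝓝 q, SmoothVFAt X y)
    (hY : ∀ᶠ y in 𝓝 q, SmoothVFAt Y y) (hZ : ∀ᶠ y in 𝓝 q, SmoothVFAt Z y) :
    toChart x₀ q (curv D X Y Z q)
      = curvCoef D x₀ q (toChart x₀ q (X q)) (toChart x₀ q (Y q)) (toChart x₀ q (Z q)) := by
  have h := (isConnForm_christoffel hD x₀).curv_eq (isCoframe_toChart x₀) hq hX hY hZ
  rw [extForm_toChart hq hX.self_of_nhds.diff hY.self_of_nhds.diff] at h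
  rw [h]
  simp [curvCoef, ofChart_toChart hq]

lemma eventually_smooth_extend (y : M) (u : TangentSpace I y) :
    ∀ᶠ q in 𝓝 y, SmoothVFAt (I := I) (FiberBundle.extend E u) q := by
  have h : ∀ᶠ q in 𝓝 y, (FiberBundle.extend E u : VField I M) q = ofChart y q (toChart y y u) := by
    filter_upwards [(chartAt H y).open_source.mem_nhds (mem_chart_source H y)] with q hq
    rw [← chartField_eq hq, toChart_apply (mem_chart_source H y)]
    rfl
  filter_upwards [h.eventually_nhds, (chartAt H y).open_source.mem_nhds (mem_chart_source H y)]
    with q hq hqs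
  refine (contMDiffAt_ofChart (f := fun _ => toChart y y u) hqs
    contMDiffAt_const).congr_of_eventuallyEq ?_
  filter_upwards [hq] with z hz
  rw [hz]

lemma toChart_curvAt {D : AffConn I M}
    (hD : CovariantDerivative.ContMDiffCovariantDerivative D ∞) {x₀ y : M}
    (hy : y ∈ (chartAt H x₀).source) (u v w : TangentSpace I y) :
    toChart x₀ y (curvAt D y u v w)
      = curvCoef D x₀ y (toChart x₀ y u) (toChart x₀ y v) (toChart x₀ y w) := by
  unfold curvAt
  rw [toChart_curv hD hy (eventually_smooth_extend y u) (eventually_smooth_extend y v)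
    (eventually_smooth_extend y w)]
  simp only [FiberBundle.extend_apply_self]

end Christoffel

section Algebra

variable {V W F : Type*} [NormedAddCommGroup V] [NormedSpace ℝ V] [NormedAddCommGroup W]
  [NormedSpace ℝ W] [NormedAddCommGroup F] [NormedSpace ℝ F]

/-- `f` is a continuous bilinear map. -/
def IsBilin (f : V → W → F) : Prop := ∃ L : V →L[ℝ] W →L[ℝ] F, ∀ u v, f u v = L u v

lemma IsBilin.add {f g : V → W → F} (hf : IsBilin f) (hg : IsBilin g) :
    IsBilin (fun u v => f u v + g u v) := by
  obtain ⟨L, hL⟩ := hf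
  obtain ⟨L', hL'⟩ := hg
  exact ⟨L + L', fun u v => by simp [hL, hL']⟩

lemma IsBilin.sub {f g : V → W → F} (hf : IsBilin f) (hg : IsBilin g) :
    IsBilin (fun u v => f u v - g u v) := by
  obtain ⟨L, hL⟩ := hf
  obtain ⟨L', hL'⟩ := hg
  exact ⟨L - L', fun u v => by simp [hL, hL']⟩

lemma IsBilin.div_const {f : V → W → ℝ} (hf : IsBilin f) (r : ℝ) :
    IsBilin (fun u v => f u v / r) := by
  obtain ⟨L, hL⟩ := hf
  exact ⟨r⁻¹ • L, fun u v => by simp [hL, div_eq_inv_mul]⟩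

lemma IsBilin.flip {f : V → W → F} (hf : IsBilin f) : IsBilin (fun u v => f v u) := by
  obtain ⟨L, hL⟩ := hf
  exact ⟨L.flip, fun u v => by simp [hL]⟩

lemma IsBilin.comp {f : V → W → F} (hf : IsBilin f) (A : V →L[ℝ] V) (B : W →L[ℝ] W) :
    IsBilin (fun u v => f (A u) (B v)) := by
  obtain ⟨L, hL⟩ := hf
  exact ⟨L.bilinearComp A B, fun u v => by simp [hL]⟩

lemma isBilin_of [FiniteDimensional ℝ V] [FiniteDimensional ℝ W] {f : V → W → F}
    (h₁ : ∀ u u' v, f (u + u') v = f u v + f u' v) (h₂ : ∀ (r : ℝ) u v, f (r • u) v = r • f u v)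
    (h₃ : ∀ u v v', f u (v + v') = f u v + f u v') (h₄ : ∀ (r : ℝ) u v, f u (r • v) = r • f u v) :
    IsBilin f := by
  let L : V →ₗ[ℝ] W →L[ℝ] F :=
    { toFun := fun u => LinearMap.toContinuousLinearMap
        { toFun := f u, map_add' := h₃ u, map_smul' := fun r => h₄ r u }
      map_add' := fun u u' => by ext v; exact h₁ u u' v
      map_smul' := fun r u => by ext v; exact h₂ r u v }
  exact ⟨LinearMap.toContinuousLinearMap L, fun u v => rfl⟩

variable (V) in
/-- The trace of an endomorphism of a finite-dimensional normed space. -/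
def trL [FiniteDimensional ℝ V] : (V →L[ℝ] V) →L[ℝ] ℝ :=
  LinearMap.toContinuousLinearMap (LinearMap.trace ℝ V ∘ₗ ContinuousLinearMap.coeLM ℝ)

variable [FiniteDimensional ℝ V]

lemma trL_apply (A : V →L[ℝ] V) : trL V A = LinearMap.trace ℝ V (A : V →ₗ[ℝ] V) := rfl

lemma trL_comm (A B : V →L[ℝ] V) : trL V (A ∘L B) = trL V (B ∘L A) :=
  LinearMap.trace_mul_comm ℝ (A : V →ₗ[ℝ] V) (B : V →ₗ[ℝ] V)

lemma trL_eq_sum (A : V →L[ℝ] V) :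
    trL V A = ∑ i, (Module.finBasis ℝ V).coord i (A (Module.finBasis ℝ V i)) := by
  rw [trL_apply, LinearMap.trace_eq_matrix_trace ℝ (Module.finBasis ℝ V), Matrix.trace]
  simp [LinearMap.toMatrix_apply]

end Algebra

section RicciTensor

variable {E : Type*} [NormedAddCommGroup E] [NormedSpace ℝ E]
  {H : Type*} [TopologicalSpace H] {I : ModelWithCorners ℝ E H}
  {M : Type*} [TopologicalSpace M] [ChartedSpace H M] [IsManifold I ∞ M]
  [FiniteDimensional ℝ E]

/-- The form `l` is smooth at `x`, tested on smooth vector fields. -/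
def SmoothForm2At (l : Form2 I M) (x : M) : Prop :=
  ∀ Y Z : VField I M, SmoothVF Y → SmoothVF Z →
    ContMDiffAt I 𝓘(ℝ, ℝ) ∞ (fun y => l y (Y y) (Z y)) x

/-- Trilinear maps, as functions. -/
structure IsTrilin (f : E → E → E → E) : Prop where
  add₁ : ∀ u u' v w, f (u + u') v w = f u v w + f u' v w
  smul₁ : ∀ (r : ℝ) u v w, f (r • u) v w = r • f u v w
  add₂ : ∀ u v v' w, f u (v + v') w = f u v w + f u v' w
  smul₂ : ∀ (r : ℝ) u v w, f u (r • v) w = r • f u v w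
  add₃ : ∀ u v w w', f u v (w + w') = f u v w + f u v w'
  smul₃ : ∀ (r : ℝ) u v w, f u v (r • w) = r • f u v w

lemma isTrilin_of_clm {A : E → E →L[ℝ] E →L[ℝ] E} (h₁ : ∀ u u', A (u + u') = A u + A u')
    (h₂ : ∀ (r : ℝ) u, A (r • u) = r • A u) : IsTrilin (fun u v w => A u v w) where
  add₁ u u' v w := by rw [h₁]; rfl
  smul₁ r u v w := by rw [h₂]; rfl
  add₂ u v v' w := by rw [map_add]; rfl
  smul₂ r u v w := by rw [map_smul]; rfl
  add₃ u v w w' := by rw [map_add]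
  smul₃ r u v w := by rw [map_smul]

lemma isTrilin_comp (G : E →L[ℝ] E →L[ℝ] E) : IsTrilin (fun u v w => G u (G v w)) where
  add₁ u u' v w := by rw [map_add]; rfl
  smul₁ r u v w := by rw [map_smul]; rfl
  add₂ u v v' w := by rw [map_add, add_apply, map_add]
  smul₂ r u v w := by rw [map_smul, smul_apply, map_smul]
  add₃ u v w w' := by rw [map_add, map_add]
  smul₃ r u v w := by rw [map_smul, map_smul]

lemma isTrilin_curvCoef (D : AffConn I M) (x₀ y : M) : IsTrilin (curvCoef D x₀ y) := by
  let L := fun u v w : E => mvfderiv I (christoffel D x₀) y (ofChart x₀ y u) v w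
  let K := fun u v w : E => christoffel D x₀ y u (christoffel D x₀ y v w)
  have hL : IsTrilin L := isTrilin_of_clm (A := fun u => mvfderiv I (christoffel D x₀) y
    (ofChart x₀ y u)) (fun u u' => by rw [map_add, map_add]) (fun r u => by rw [map_smul, map_smul])
  have hK : IsTrilin K := isTrilin_comp (christoffel D x₀ y)
  have h : curvCoef D x₀ y = fun u v w => L u v w - L v u w + K u v w - K v u w := rfl
  rw [h]
  constructor <;> intros <;> simp only [hL.add₁, hL.add₂, hL.add₃, hK.add₁, hK.add₂, hK.add₃,
    hL.smul₁, hL.smul₂, hL.smul₃, hK.smul₁, hK.smul₂, hK.smul₃] <;> module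

/-- The curvature tensor in the preferred chart at `x₀`, as a linear map in its first argument. -/
def curvL (D : AffConn I M) (x₀ y : M) (v w : E) : E →L[ℝ] E :=
  LinearMap.toContinuousLinearMap
    { toFun := fun u => curvCoef D x₀ y u v w
      map_add' := fun u u' => (isTrilin_curvCoef D x₀ y).add₁ u u' v w
      map_smul' := fun r u => (isTrilin_curvCoef D x₀ y).smul₁ r u v w }

lemma curvL_apply (D : AffConn I M) (x₀ y : M) (u v w : E) :
    curvL D x₀ y v w u = curvCoef D x₀ y u v w := rfl

lemma curvL_add_left (D : AffConn I M) (x₀ y : M) (v v' w : E) :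
    curvL D x₀ y (v + v') w = curvL D x₀ y v w + curvL D x₀ y v' w := by
  ext u
  exact (isTrilin_curvCoef D x₀ y).add₂ u v v' w

lemma curvL_smul_left (D : AffConn I M) (x₀ y : M) (r : ℝ) (v w : E) :
    curvL D x₀ y (r • v) w = r • curvL D x₀ y v w := by
  ext u
  exact (isTrilin_curvCoef D x₀ y).smul₂ r u v w

lemma curvL_add_right (D : AffConn I M) (x₀ y : M) (v w w' : E) :
    curvL D x₀ y v (w + w') = curvL D x₀ y v w + curvL D x₀ y v w' := by
  ext u
  exact (isTrilin_curvCoef D x₀ y).add₃ u v w w'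

lemma curvL_smul_right (D : AffConn I M) (x₀ y : M) (r : ℝ) (v w : E) :
    curvL D x₀ y v (r • w) = r • curvL D x₀ y v w := by
  ext u
  exact (isTrilin_curvCoef D x₀ y).smul₃ r u v w

variable [T2Space M] [CompleteSpace E] [I.Boundaryless]

lemma curvCoef_smooth {D : AffConn I M}
    (hD : CovariantDerivative.ContMDiffCovariantDerivative D ∞) {x₀ y : M}
    (hy : y ∈ (chartAt H x₀).source) {u v w : M → E} (hu : ContMDiffAt I 𝓘(ℝ, E) ∞ u y)
    (hv : ContMDiffAt I 𝓘(ℝ, E) ∞ v y) (hw : ContMDiffAt I 𝓘(ℝ, E) ∞ w y) :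
    ContMDiffAt I 𝓘(ℝ, E) ∞ (fun q => curvCoef D x₀ q (u q) (v q) (w q)) y := by
  have hΓ := contMDiffAt_christoffel hD hy
  have hd : ∀ {e : M → E}, ContMDiffAt I 𝓘(ℝ, E) ∞ e y →
      ContMDiffAt I 𝓘(ℝ, E →L[ℝ] E →L[ℝ] E) ∞
        (fun q => mvfderiv I (christoffel D x₀) q (ofChart x₀ q (e q))) y := fun he =>
    contMDiffAt_mvfderiv_apply hΓ (contMDiffAt_ofChart hy he)
  unfold curvCoef
  refine ContMDiffAt.sub (ContMDiffAt.add (ContMDiffAt.sub ?_ ?_) ?_) ?_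
  · exact ((hd hu).clm_apply hv).clm_apply hw
  · exact ((hd hv).clm_apply hu).clm_apply hw
  · exact (hΓ.clm_apply hu).clm_apply ((hΓ.clm_apply hv).clm_apply hw)
  · exact (hΓ.clm_apply hv).clm_apply ((hΓ.clm_apply hu).clm_apply hw)

lemma ricci_eq_trL {D : AffConn I M}
    (hD : CovariantDerivative.ContMDiffCovariantDerivative D ∞) {x₀ y : M}
    (hy : y ∈ (chartAt H x₀).source) (v w : TangentSpace I y) :
    ricci D y v w = trL E (curvL D x₀ y (toChart x₀ y v) (toChart x₀ y w)) := by
  let A : E →L[ℝ] E := toChart (I := I) x₀ y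
  let A' : E →L[ℝ] E := ofChart (I := I) x₀ y
  have hA : A ∘L A' = ContinuousLinearMap.id ℝ E := by
    ext e
    exact toChart_ofChart (I := I) hy e
  have h1 : ricci D y v w
      = trL E (A' ∘L (curvL D x₀ y (toChart x₀ y v) (toChart x₀ y w) ∘L A)) := by
    rw [trL_eq_sum]
    refine Finset.sum_congr rfl fun i _ => ?_
    have h2 := toChart_curvAt hD hy (Module.finBasis ℝ (TangentSpace I y) i) v w
    have h3 := congrArg (ofChart (I := I) x₀ y) h2
    rw [ofChart_toChart hy] at h3
    rw [h3]
    rfl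
  rw [h1, trL_comm, ContinuousLinearMap.comp_assoc, hA]
  rfl

lemma isBilin_ricci {D : AffConn I M}
    (hD : CovariantDerivative.ContMDiffCovariantDerivative D ∞) (y : M) :
    IsBilin (V := E) (W := E) (ricci D y) := by
  have h : ∀ v w : E, ricci D y v w = trL E (curvL D y y v w) := fun v w => by
    exact (ricci_eq_trL hD (mem_chart_source H y) v w).trans
      (congrArg₂ (fun a b : E => trL E (curvL D y y a b)) (toChart_self y v) (toChart_self y w))
  refine isBilin_of ?_ ?_ ?_ ?_ <;> intros <;> simp only [h]
  · rw [curvL_add_left, map_add]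
  · rw [curvL_smul_left, map_smul]
  · rw [curvL_add_right, map_add]
  · rw [curvL_smul_right, map_smul]

lemma smooth_ricci {D : AffConn I M}
    (hD : CovariantDerivative.ContMDiffCovariantDerivative D ∞) (x : M) :
    SmoothForm2At (ricci D) x := by
  intro Y Z hY hZ
  have hx := mem_chart_source H x
  have h1 : ContMDiffAt I 𝓘(ℝ, E →L[ℝ] E) ∞
      (fun y => curvL D x y (toChart x y (Y y)) (toChart x y (Z y))) x :=
    contMDiffAt_clm_of_apply fun e => curvCoef_smooth hD hx contMDiffAt_const
      ((contMDiffAt_vf_iff hx).1 (hY x)) ((contMDiffAt_vf_iff hx).1 (hZ x))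
  refine ((trL E).contMDiff.contMDiffAt.comp x h1).congr_of_eventuallyEq ?_
  filter_upwards [(chartAt H x).open_source.mem_nhds hx] with y hy
  exact ricci_eq_trL hD hy _ _

lemma dchristoffel_symm {D : AffConn I M} (hD : IsSmoothTorsionFree D) {x₀ y : M}
    (hy : y ∈ (chartAt H x₀).source) (t : TangentSpace I y) (u w : E) :
    mvfderiv I (christoffel D x₀) y t u w = mvfderiv I (christoffel D x₀) y t w u := by
  have hΓ := (contMDiffAt_christoffel hD.smooth hy).mdifferentiableAt (n := ∞) (by simp)
  have hc : ∀ e : E, MDifferentiableAt I 𝓘(ℝ, E) (fun _ : M => e) y :=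
    fun e => mdifferentiableAt_const
  have h : ∀ u w : E, mvfderiv I (christoffel D x₀) y t u w
      = mvfderiv I (fun q => christoffel D x₀ q u w) y t := fun u w => by
    rw [mvfderiv_clm_apply (hΓ.clm_apply (hc u)) (hc w), mvfderiv_clm_apply hΓ (hc u)]
    simp [mvfderiv_const]
  rw [h, h]
  have : (fun q => christoffel D x₀ q u w) =ᶠ[𝓝 y] fun q => christoffel D x₀ q w u := by
    filter_upwards [(chartAt H x₀).open_source.mem_nhds hy] with q hq
    exact christoffel_symm hD hq u w
  rw [mvfderiv_congr this]

/-- The first Bianchi identity. -/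
lemma curvCoef_bianchi {D : AffConn I M} (hD : IsSmoothTorsionFree D) {x₀ y : M}
    (hy : y ∈ (chartAt H x₀).source) (u v w : E) :
    curvCoef D x₀ y u v w - curvCoef D x₀ y u w v = - curvCoef D x₀ y v w u := by
  unfold curvCoef
  rw [dchristoffel_symm hD hy _ u w, dchristoffel_symm hD hy _ v w,
    dchristoffel_symm hD hy _ v u, christoffel_symm hD hy u w, christoffel_symm hD hy v w,
    christoffel_symm hD hy v u]
  abel

/-- The trace of the curvature endomorphism `R(u, v)`. -/
def trCurv (D : AffConn I M) (x₀ y : M) (u v : E) : ℝ :=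
  ∑ i, (Module.finBasis ℝ E).coord i (curvCoef D x₀ y u v (Module.finBasis ℝ E i))

lemma antisymm_ricci {D : AffConn I M} (hD : IsSmoothTorsionFree D) {x₀ y : M}
    (hy : y ∈ (chartAt H x₀).source) (v w : TangentSpace I y) :
    antisymm (ricci D) y v w = - trCurv D x₀ y (toChart x₀ y v) (toChart x₀ y w) / 2 := by
  unfold antisymm trCurv
  rw [ricci_eq_trL hD.smooth hy, ricci_eq_trL hD.smooth hy, trL_eq_sum, trL_eq_sum,
    ← Finset.sum_sub_distrib, ← Finset.sum_neg_distrib]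
  congr 1
  refine Finset.sum_congr rfl fun i _ => ?_
  rw [← map_sub, ← map_neg, curvL_apply, curvL_apply, curvCoef_bianchi hD hy]

lemma antisymm_rho (n : ℕ) (J : EndField I M) (D : AffConn I M) (y : M) (v w : TangentSpace I y) :
    antisymm (rho n J D) y v w = antisymm (ricci D) y v w / ((n : ℝ) + 1) := by
  unfold antisymm rho symm
  ring

lemma isBilin_rho (n : ℕ) (J : EndField I M) {D : AffConn I M}
    (hD : CovariantDerivative.ContMDiffCovariantDerivative D ∞) (y : M) :
    IsBilin (V := E) (W := E) (rho n J D y) := by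
  have h := isBilin_ricci hD y
  have hs : IsBilin (V := E) (W := E) (symm (ricci D) y) := (h.add h.flip).div_const 2
  exact (h.add ((hs.sub (hs.comp (J y) (J y))).div_const _)).div_const _

lemma smooth_rho (n : ℕ) {J : EndField I M} (hJ : ∀ Y : VField I M, SmoothVF Y → SmoothVF (appEnd J Y))
    {D : AffConn I M} (hD : CovariantDerivative.ContMDiffCovariantDerivative D ∞) (x : M) :
    SmoothForm2At (rho n J D) x := by
  intro Y Z hY hZ
  have h := smooth_ricci hD x
  have hc : ∀ r : ℝ, ContMDiffAt I 𝓘(ℝ, ℝ) ∞ (fun _ : M => r) x := fun r => contMDiffAt_const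
  have hs : ∀ Y Z, SmoothVF Y → SmoothVF Z →
      ContMDiffAt I 𝓘(ℝ, ℝ) ∞ (fun y => symm (ricci D) y (Y y) (Z y)) x := fun Y Z hY hZ => by
    simp only [symm, div_eq_mul_inv]
    exact ((h Y Z hY hZ).add (h Z Y hZ hY)).mul (hc _)
  simp only [rho, div_eq_mul_inv]
  exact ((h Y Z hY hZ).add (((hs Y Z hY hZ).sub (hs _ _ (hJ Y hY) (hJ Z hZ))).mul (hc _))).mul
    (hc _)

end RicciTensor

section ConeAlgebra

variable {E : Type*} [NormedAddCommGroup E] [NormedSpace ℝ E]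

/-- The complex multiple `z ⋆ v = Re z v + Im z J v`. -/
def cmul (J : E →L[ℝ] E) (z : ℂ) (v : E) : E := z.re • v + z.im • J v

lemma cmul_add (J : E →L[ℝ] E) (z : ℂ) (v w : E) : cmul J z (v + w) = cmul J z v + cmul J z w := by
  simp only [cmul, map_add]; module

lemma add_cmul (J : E →L[ℝ] E) (z z' : ℂ) (v : E) : cmul J (z + z') v = cmul J z v + cmul J z' v := by
  simp only [cmul, Complex.add_re, Complex.add_im]; module

lemma cmul_smul (J : E →L[ℝ] E) (z : ℂ) (r : ℝ) (v : E) : cmul J z (r • v) = r • cmul J z v := by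
  simp only [cmul, map_smul]; module

lemma smul_cmul (J : E →L[ℝ] E) (r : ℝ) (z : ℂ) (v : E) : cmul J (r • z) v = r • cmul J z v := by
  simp only [cmul, Complex.smul_re, Complex.smul_im, smul_eq_mul]; module

lemma cmul_cmul {J : E →L[ℝ] E} (hJ : ∀ v, J (J v) = -v) (z z' : ℂ) (v : E) :
    cmul J z (cmul J z' v) = cmul J (z * z') v := by
  simp only [cmul, map_add, map_smul, hJ, Complex.mul_re, Complex.mul_im]; module

lemma map_cmul (J : E →L[ℝ] E) (z : ℂ) (v : E) : J (cmul J z v) = cmul J z (J v) := by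
  simp only [cmul, map_add, map_smul]

lemma cmul_neg (J : E →L[ℝ] E) (z : ℂ) (v : E) : cmul J z (-v) = - cmul J z v := by
  simp only [cmul, map_neg]; module

lemma cmul_I (J : E →L[ℝ] E) (v : E) : cmul J Complex.I v = J v := by simp [cmul]

lemma cmul_one (J : E →L[ℝ] E) (v : E) : cmul J 1 v = v := by simp [cmul]

lemma cmul_zero (J : E →L[ℝ] E) (z : ℂ) : cmul J z 0 = 0 := by simp [cmul]

variable [FiniteDimensional ℝ E]

lemma isBilin_coneForm (G : E →L[ℝ] E →L[ℝ] E) (J : E →L[ℝ] E) (l : E →L[ℝ] E →L[ℝ] ℂ) :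
    IsBilin (fun X Y : E × ℂ => ((G X.1 Y.1 + cmul J X.2 Y.1 + cmul J Y.2 X.1,
      X.2 * Y.2 + l X.1 Y.1) : E × ℂ)) := by
  refine isBilin_of ?_ ?_ ?_ ?_
  · intro X X' Y
    refine Prod.ext ?_ ?_
    · simp only [Prod.fst_add, Prod.snd_add, map_add, add_apply, add_cmul, cmul_add]; abel
    · simp only [Prod.fst_add, Prod.snd_add, map_add, add_apply]; ring
  · intro r X Y
    refine Prod.ext ?_ ?_
    · simp only [Prod.smul_fst, Prod.smul_snd, map_smul, smul_apply, smul_cmul, cmul_smul, smul_add]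
    · simp only [Prod.smul_fst, Prod.smul_snd, map_smul, smul_apply, smul_add, smul_mul_assoc]
  · intro X Y Y'
    refine Prod.ext ?_ ?_
    · simp only [Prod.fst_add, Prod.snd_add, map_add, add_cmul, cmul_add]; abel
    · simp only [Prod.fst_add, Prod.snd_add, map_add]; ring
  · intro r X Y
    refine Prod.ext ?_ ?_
    · simp only [Prod.smul_fst, Prod.smul_snd, map_smul, smul_cmul, cmul_smul, smul_add]
    · simp only [Prod.smul_fst, Prod.smul_snd, map_smul, smul_add, mul_smul_comm]

/-- The connection form of the cone connection. -/
def coneForm (G : E →L[ℝ] E →L[ℝ] E) (J : E →L[ℝ] E) (l : E →L[ℝ] E →L[ℝ] ℂ) :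
    (E × ℂ) →L[ℝ] (E × ℂ) →L[ℝ] (E × ℂ) :=
  (isBilin_coneForm G J l).choose

lemma coneForm_apply (G : E →L[ℝ] E →L[ℝ] E) (J : E →L[ℝ] E) (l : E →L[ℝ] E →L[ℝ] ℂ)
    (X Y : E × ℂ) :
    coneForm G J l X Y = (G X.1 Y.1 + cmul J X.2 Y.1 + cmul J Y.2 X.1,
      X.2 * Y.2 + l X.1 Y.1) :=
  ((isBilin_coneForm G J l).choose_spec X Y).symm

/-- The horizontal part of the curvature of the cone connection vanishes. -/
lemma cone_flat_horizontal {J : E →L[ℝ] E} {Γ b : E →L[ℝ] E →L[ℝ] E} {h k : E →L[ℝ] E →L[ℝ] ℂ}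
    {Γ₁ Γ₂ b₁ b₂ : E →L[ℝ] E →L[ℝ] E} {J₁ J₂ : E →L[ℝ] E} {u v y : E} {f g s t : ℂ}
    (hJ : ∀ v, J (J v) = -v) (hΓ : ∀ v w, Γ v w = Γ w v)
    (hbs : ∀ v w, b v w = b w v) (hbJ : ∀ v w, b v (J w) = - J (b v w))
    (hJ₁ : ∀ w, J₁ w = J (Γ u w) - Γ u (J w)) (hJ₂ : ∀ w, J₂ w = J (Γ v w) - Γ v (J w))
    (hR : Γ₁ v y - Γ₂ u y + Γ u (Γ v y) - Γ v (Γ u y)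
      = - cmul J t y - cmul J (h v y) u + cmul J (h u y) v - b u (b v y) + b v (b u y))
    (hb : b₁ v y - b₂ u y + Γ u (b v y) - b v (Γ u y) - Γ v (b u y) + b u (Γ v y)
      = - (2 * f.im) • J (b v y) + (2 * g.im) • J (b u y) + cmul J (k u y) v - cmul J (k v y) u) :
    (Γ₁ v y + b₁ v y + g.im • J₁ y + s.im • J₁ v) - (Γ₂ u y + b₂ u y + f.im • J₂ y + s.im • J₂ u)
      + cmul J t y
      + (((Γ + b) u (((Γ + b) v y) + cmul J g y + cmul J s v)
          + cmul J f ((Γ + b) v y + cmul J g y + cmul J s v)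
          + cmul J (g * s + (h + k) v y) u)
        - ((Γ + b) v (((Γ + b) u y) + cmul J f y + cmul J s u)
          + cmul J g ((Γ + b) u y + cmul J f y + cmul J s u)
          + cmul J (f * s + (h + k) u y) v)) = 0 := by
  have e1 := hJ₁ y
  have e2 := hJ₂ y
  have e3 := hJ₁ v
  have e4 := hJ₂ u
  have e5 := hΓ u v
  have e6 : J (Γ u v) = J (Γ v u) := by rw [e5]
  have e7 := hbs u v
  have e8 : J (b u v) = J (b v u) := by rw [e7]
  simp only [add_cmul, add_apply, map_add]
  simp only [cmul, map_add, map_smul, hJ, hbJ, Complex.mul_re, Complex.mul_im] at hR hb ⊢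
  linear_combination (norm := module) hR + hb + g.im • e1 - f.im • e2 + s.im • e3 - s.im • e4 + s.re • e5
    + s.im • e6 + s.re • e7 - s.im • e8

/-- The vertical part of the curvature of the cone connection vanishes. -/
lemma cone_flat_vertical {J : E →L[ℝ] E} {Γ b : E →L[ℝ] E →L[ℝ] E} {h k : E →L[ℝ] E →L[ℝ] ℂ}
    {h₁ h₂ k₁ k₂ : E →L[ℝ] E →L[ℝ] ℂ} {u v y : E} {f g s t : ℂ}
    (hk : ∀ v w, k v w = k w v)
    (hhJ : ∀ v w, h v (J w) = Complex.I * h v w)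
    (hkJ : ∀ v w, k v (J w) = - (Complex.I * k v w))
    (ht : t = h v u - h u v)
    (hh : h₁ v y - h₂ u y - h v (Γ u y) + h u (Γ v y) = - (k u (b v y) - k v (b u y)))
    (hk' : k₁ v y - k₂ u y - k v (Γ u y) + k u (Γ v y)
      = - (2 * Complex.I * f.im * k v y) + 2 * Complex.I * g.im * k u y
        - (h u (b v y) - h v (b u y))) :
    (h₁ + k₁) v y - (h₂ + k₂) u y + t * s
      + ((f * (g * s + (h + k) v y) + (h + k) u ((Γ + b) v y + cmul J g y + cmul J s v))
        - (g * (f * s + (h + k) u y) + (h + k) v ((Γ + b) u y + cmul J f y + cmul J s u))) = 0 := by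
  have e1 := hk u v
  have hf := Complex.re_add_im f
  have hg := Complex.re_add_im g
  have hs := Complex.re_add_im s
  simp only [add_apply, map_add]
  simp only [cmul, map_add, map_smul, hhJ, hkJ, Complex.real_smul]
  rw [ht]
  set fr : ℂ := Complex.ofReal f.re
  set fi : ℂ := Complex.ofReal f.im
  set gr : ℂ := Complex.ofReal g.re
  set gi : ℂ := Complex.ofReal g.im
  set sr : ℂ := Complex.ofReal s.re
  set si : ℂ := Complex.ofReal s.im
  rw [← hf, ← hg, ← hs]
  linear_combination hh + hk' + (sr - si * Complex.I) * e1

end ConeAlgebra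

section Glueing

variable {E : Type*} [NormedAddCommGroup E] [NormedSpace ℝ E]
  {H : Type*} [TopologicalSpace H] {I : ModelWithCorners ℝ E H}
  {M : Type*} [TopologicalSpace M] [ChartedSpace H M] [IsManifold I ∞ M]
  {F : Type*} [NormedAddCommGroup F] [NormedSpace ℝ F] {ι : Type*}

/-- Local connection forms with respect to local coframes, which are compatible with each other. -/
structure IsConnAtlas (ϑ : ι → OneForm I M F) (ε : ι → Π x : M, F →L[ℝ] TangentSpace I x)
    (Ψ : ι → M → F →L[ℝ] F →L[ℝ] F) (U : ι → Set M) (i₀ : M → ι) : Prop where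
  coframe : ∀ i, IsCoframe (ϑ i) (ε i) (U i)
  mem : ∀ p, p ∈ U (i₀ p)
  smooth : ∀ i, ∀ q ∈ U i, ContMDiffAt I 𝓘(ℝ, F →L[ℝ] F →L[ℝ] F) ∞ (Ψ i) q
  compat : ∀ i j p, p ∈ U i → p ∈ U j → ∃ k : M → F →L[ℝ] F,
    MDifferentiableAt I 𝓘(ℝ, F →L[ℝ] F) k p ∧ (∀ᶠ q in 𝓝 p, ∀ v, ϑ j q v = k q (ϑ i q v)) ∧
    ∀ v Y, Ψ j p (ϑ j p v) (k p Y) = k p (Ψ i p (ϑ i p v) Y) - mvfderiv I k p v Y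

variable {ϑ : ι → OneForm I M F} {ε : ι → Π x : M, F →L[ℝ] TangentSpace I x}
  {Ψ : ι → M → F →L[ℝ] F →L[ℝ] F} {U : ι → Set M} {i₀ : M → ι}

/-- The covariant derivative given by connection forms. -/
def glueFun (ϑ : ι → OneForm I M F) (ε : ι → Π x : M, F →L[ℝ] TangentSpace I x)
    (Ψ : ι → M → F →L[ℝ] F →L[ℝ] F) (i₀ : M → ι) (V : VField I M) (p : M) :
    TangentSpace I p →L[ℝ] TangentSpace I p :=
  ε (i₀ p) p ∘L (mvfderiv I (fun y => ϑ (i₀ p) y (V y)) p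
    + (Ψ (i₀ p) p).flip (ϑ (i₀ p) p (V p)) ∘L ϑ (i₀ p) p)

lemma glueFun_apply (V : VField I M) (p : M) (v : TangentSpace I p) :
    glueFun ϑ ε Ψ i₀ V p v = ε (i₀ p) p (mvfderiv I (fun y => ϑ (i₀ p) y (V y)) p v
      + Ψ (i₀ p) p (ϑ (i₀ p) p v) (ϑ (i₀ p) p (V p))) := rfl

/-- The connection given by compatible connection forms. -/
def glueConn (h : IsConnAtlas ϑ ε Ψ U i₀) : AffConn I M where
  toFun := glueFun ϑ ε Ψ i₀
  isCovariantDerivativeOnUniv :=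
    { add := by
        intro V W x hV hW _
        have hd : ∀ {V : VField I M}, DiffVFAt V x →
            MDifferentiableAt I 𝓘(ℝ, F) (fun y => ϑ (i₀ x) y (V y)) x := fun hV =>
          ((h.coframe (i₀ x)).smooth x (h.mem x)).diff_apply hV
        have h1 : mvfderiv I (fun y => ϑ (i₀ x) y ((V + W) y)) x
            = mvfderiv I (fun y => ϑ (i₀ x) y (V y)) x
              + mvfderiv I (fun y => ϑ (i₀ x) y (W y)) x := by
          rw [← mvfderiv_fun_add (hd hV) (hd hW)]
          refine mvfderiv_congr (Filter.Eventually.of_forall fun y => ?_)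
          exact map_add (ϑ (i₀ x) y) (V y) (W y)
        ext v
        have h2 : ϑ (i₀ x) x ((V + W) x) = ϑ (i₀ x) x (V x) + ϑ (i₀ x) x (W x) := map_add _ _ _
        rw [add_apply, glueFun_apply, glueFun_apply, glueFun_apply, h1, h2]
        refine (congrArg (ε (i₀ x) x) ?_).trans (map_add _ _ _)
        rw [add_apply, map_add]
        abel
      leibniz := by
        intro V g x hV hg _
        have hd : MDifferentiableAt I 𝓘(ℝ, F) (fun y => ϑ (i₀ x) y (V y)) x :=
          ((h.coframe (i₀ x)).smooth x (h.mem x)).diff_apply hV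
        ext v
        have h1 : mvfderiv I (fun y => ϑ (i₀ x) y ((g • V) y)) x v
            = mvfderiv I g x v • ϑ (i₀ x) x (V x)
              + g x • mvfderiv I (fun y => ϑ (i₀ x) y (V y)) x v := by
          refine Eq.trans ?_ (mvfderiv_bilin (ContinuousLinearMap.lsmul ℝ ℝ) hg hd v)
          refine congrArg (fun L : TangentSpace I x →L[ℝ] F => L v) (mvfderiv_congr
            (Filter.Eventually.of_forall fun y => ?_))
          exact map_smul (ϑ (i₀ x) y) (g y) (V y)
        have h2 : ϑ (i₀ x) x ((g • V) x) = g x • ϑ (i₀ x) x (V x) := map_smul _ _ _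
        have h3 := (h.coframe (i₀ x)).left_inv x (h.mem x) (V x)
        rw [add_apply, smul_apply, glueFun_apply, glueFun_apply, h1, h2, map_smul,
          add_assoc, ← smul_add, map_add, map_smul, map_smul, h3, add_comm]
        rfl }

lemma isConnForm_glueConn (h : IsConnAtlas ϑ ε Ψ U i₀) (i : ι) :
    IsConnForm (glueConn h) (ϑ i) (Ψ i) (U i) where
  smooth := h.smooth i
  eq q hq V hV v := by
    obtain ⟨k, hk, hϑ, hΨ⟩ := h.compat (i₀ q) i q (h.mem q) hq
    have hd : MDifferentiableAt I 𝓘(ℝ, F) (fun y => ϑ (i₀ q) y (V y)) q :=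
      ((h.coframe (i₀ q)).smooth q (h.mem q)).diff_apply hV
    have h1 : mvfderiv I (fun y => ϑ i y (V y)) q v
        = mvfderiv I k q v (ϑ (i₀ q) q (V q))
          + k q (mvfderiv I (fun y => ϑ (i₀ q) y (V y)) q v) := by
      rw [← mvfderiv_clm_apply hk hd]
      refine congrArg (fun L : TangentSpace I q →L[ℝ] F => L v) (mvfderiv_congr ?_)
      filter_upwards [hϑ] with y hy
      exact hy (V y)
    have h2 := hϑ.self_of_nhds
    have h3 : glueConn h V q v = glueFun ϑ ε Ψ i₀ V q v := rfl
    rw [h3, glueFun_apply, h2, (h.coframe (i₀ q)).right_inv q (h.mem q), map_add, h1, h2 (V q), hΨ]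
    abel

end Glueing

section Transition

variable {E : Type*} [NormedAddCommGroup E] [NormedSpace ℝ E]
  {H : Type*} [TopologicalSpace H] {I : ModelWithCorners ℝ E H}
  {M : Type*} [TopologicalSpace M] [ChartedSpace H M] [IsManifold I ∞ M]
  {F : Type*} [NormedAddCommGroup F] [NormedSpace ℝ F]

variable (I) in
/-- The derivative of the change of charts from the chart at `x₀` to the chart at `x₁`, at `y`. -/
def transMap (x₀ x₁ y : M) : E →L[ℝ] E := toChart (I := I) x₁ y ∘L ofChart (I := I) x₀ y

lemma transMap_toChart {x₀ x₁ y : M} (hy : y ∈ (chartAt H x₀).source) (v : TangentSpace I y) :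
    transMap I x₀ x₁ y (toChart x₀ y v) = toChart x₁ y v := by
  simp [transMap, ofChart_toChart hy]

lemma ofChart_transMap {x₀ x₁ y : M} (hy : y ∈ (chartAt H x₁).source) (e : E) :
    ofChart (I := I) x₁ y (transMap I x₀ x₁ y e) = ofChart x₀ y e := by
  simp [transMap, ofChart_toChart hy]

lemma contMDiffAt_transMap [FiniteDimensional ℝ E] {x₀ x₁ y : M} (hy : y ∈ (chartAt H x₀).source)
    (hy' : y ∈ (chartAt H x₁).source) :
    ContMDiffAt I 𝓘(ℝ, E →L[ℝ] E) ∞ (transMap I x₀ x₁) y :=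
  contMDiffAt_clm_of_apply fun _ => (contMDiffAt_vf_iff hy').1
    (contMDiffAt_ofChart hy contMDiffAt_const)

lemma christoffel_transMap [FiniteDimensional ℝ E] (D : AffConn I M) {x₀ x₁ y : M}
    (hy : y ∈ (chartAt H x₀).source) (hy' : y ∈ (chartAt H x₁).source) (u w : E) :
    christoffel D x₁ y (transMap I x₀ x₁ y u) (transMap I x₀ x₁ y w)
      = transMap I x₀ x₁ y (christoffel D x₀ y u w)
        - mvfderiv I (transMap I x₀ x₁) y (ofChart x₀ y u) w := by
  have hZ : DiffVFAt (I := I) (fun y => ofChart x₀ y w) y :=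
    mdifferentiableAt_ofChart hy mdifferentiableAt_const
  have h1 := toChart_affConn D hy' hZ (ofChart x₀ y u)
  have h2 := mvfderiv_clm_apply ((contMDiffAt_transMap hy hy').mdifferentiableAt (n := ∞) (by simp))
    (mdifferentiableAt_const (I := I) (c := w)) (ofChart x₀ y u)
  rw [mvfderiv_const, zero_apply, map_zero, add_zero] at h2
  rw [christoffel_apply D hy, transMap_toChart hy, h1, ← h2]
  simp [transMap]

variable (I) in
/-- The coefficient, in the preferred chart at `x₀`, of a form on the tangent space at `y`. -/
def pull₂ (x₀ y : M) (l : E →L[ℝ] E →L[ℝ] F) : E →L[ℝ] E →L[ℝ] F :=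
  l.bilinearComp (ofChart (I := I) x₀ y) (ofChart (I := I) x₀ y)

lemma pull₂_self (x : M) (l : E →L[ℝ] E →L[ℝ] F) (u v : E) : pull₂ I x x l u v = l u v :=
  congrArg₂ (fun a b : E => l a b) (ofChart_self (E := E) (I := I) x u)
    (ofChart_self (E := E) (I := I) x v)

lemma pull₂_toChart {x₀ y : M} (hy : y ∈ (chartAt H x₀).source) (l : E →L[ℝ] E →L[ℝ] F)
    (u v : TangentSpace I y) : pull₂ I x₀ y l (toChart x₀ y u) (toChart x₀ y v) = l u v :=
  congrArg₂ (fun a b : E => l a b) (ofChart_toChart (I := I) hy u) (ofChart_toChart (I := I) hy v)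

lemma pull₂_transMap {x₀ x₁ y : M} (hy : y ∈ (chartAt H x₁).source)
    (l : E →L[ℝ] E →L[ℝ] F) (u v : E) :
    pull₂ I x₁ y l (transMap I x₀ x₁ y u) (transMap I x₀ x₁ y v) = pull₂ I x₀ y l u v :=
  congrArg₂ (fun a b : E => l a b) (ofChart_transMap (I := I) hy u) (ofChart_transMap (I := I) hy v)

variable (I) in
/-- The coefficient, in the preferred chart at `x₀`, of a (1,2)-tensor on the tangent space at
`y`. -/
def conj₂ (x₀ y : M) (b : E →L[ℝ] E →L[ℝ] E) : E →L[ℝ] E →L[ℝ] E :=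
  ContinuousLinearMap.compL ℝ E E E (toChart (I := I) x₀ y) ∘L pull₂ I x₀ y b

lemma conj₂_apply (x₀ y : M) (b : E →L[ℝ] E →L[ℝ] E) (u v : E) :
    conj₂ I x₀ y b u v = toChart (I := I) x₀ y (pull₂ I x₀ y b u v) := rfl

lemma conj₂_self (x : M) (b : E →L[ℝ] E →L[ℝ] E) (u v : E) : conj₂ I x x b u v = b u v :=
  (toChart_self (E := E) (I := I) x _).trans (pull₂_self x b u v)

lemma conj₂_toChart {x₀ y : M} (hy : y ∈ (chartAt H x₀).source) (b : E →L[ℝ] E →L[ℝ] E)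
    (u v : TangentSpace I y) :
    conj₂ I x₀ y b (toChart x₀ y u) (toChart x₀ y v) = toChart (I := I) x₀ y (b u v) :=
  congrArg (fun a : E => toChart (I := I) x₀ y a) (pull₂_toChart hy b u v)

lemma conj₂_transMap {x₀ x₁ y : M} (hy : y ∈ (chartAt H x₀).source)
    (hy' : y ∈ (chartAt H x₁).source) (b : E →L[ℝ] E →L[ℝ] E) (u v : E) :
    conj₂ I x₁ y b (transMap I x₀ x₁ y u) (transMap I x₀ x₁ y v)
      = transMap I x₀ x₁ y (conj₂ I x₀ y b u v) := by
  rw [conj₂_apply, conj₂_apply, pull₂_transMap hy']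
  exact (transMap_toChart (I := I) hy _).symm

/-- The coefficient of an endomorphism in the preferred chart at `x₀`. -/
def conj₁ (x₀ y : M) (J : TangentSpace I y →L[ℝ] TangentSpace I y) : E →L[ℝ] E :=
  toChart (I := I) x₀ y ∘L J ∘L ofChart (I := I) x₀ y

lemma conj₁_apply (x₀ y : M) (J : TangentSpace I y →L[ℝ] TangentSpace I y) (u : E) :
    conj₁ x₀ y J u = toChart x₀ y (J (ofChart x₀ y u)) := rfl

lemma conj₁_self (x : M) (J : TangentSpace I x →L[ℝ] TangentSpace I x) (u : TangentSpace I x) :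
    conj₁ x x J u = J u :=
  (toChart_self (E := E) (I := I) x _).trans (congrArg (fun a : TangentSpace I x => J a) (ofChart_self (E := E) x u))

lemma conj₁_transMap {x₀ x₁ y : M} (hy : y ∈ (chartAt H x₀).source)
    (hy' : y ∈ (chartAt H x₁).source) (J : TangentSpace I y →L[ℝ] TangentSpace I y) (u : E) :
    conj₁ x₁ y J (transMap I x₀ x₁ y u) = transMap I x₀ x₁ y (conj₁ x₀ y J u) := by
  rw [conj₁_apply, conj₁_apply, ofChart_transMap hy', transMap_toChart hy]

lemma conj₁_toChart {x₀ y : M} (hy : y ∈ (chartAt H x₀).source)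
    (J : TangentSpace I y →L[ℝ] TangentSpace I y) (v : TangentSpace I y) :
    conj₁ x₀ y J (toChart x₀ y v) = toChart x₀ y (J v) := by
  rw [conj₁_apply, ofChart_toChart hy]

lemma contMDiffAt_conj₁ [FiniteDimensional ℝ E] [T2Space M] {J : EndField I M}
    (hJ : ∀ Y : VField I M, SmoothVF Y → SmoothVF (appEnd J Y)) {x₀ y : M}
    (hy : y ∈ (chartAt H x₀).source) :
    ContMDiffAt I 𝓘(ℝ, E →L[ℝ] E) ∞ (fun q => conj₁ x₀ q (J q)) y := by
  refine contMDiffAt_clm_of_apply fun u => ?_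
  obtain ⟨X, hX, hXe⟩ := exists_smoothVF_chart (I := I) hy u
  refine ((contMDiffAt_vf_iff hy).1 (hJ X hX y)).congr_of_eventuallyEq ?_
  filter_upwards [hXe] with z hz
  rw [conj₁_apply, appEnd, hz]

lemma mvfderiv_conj₁ [FiniteDimensional ℝ E] [CompleteSpace E] [T2Space M] {J : EndField I M}
    (hJ : ∀ Y : VField I M, SmoothVF Y → SmoothVF (appEnd J Y)) {D : AffConn I M}
    (hD : IsTorsionFreeComplex J D) {x₀ y : M} (hy : y ∈ (chartAt H x₀).source) (u w : E) :
    mvfderiv I (fun q => conj₁ x₀ q (J q)) y (ofChart x₀ y u) w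
      = conj₁ x₀ y (J y) (christoffel D x₀ y u w)
        - christoffel D x₀ y u (conj₁ x₀ y (J y) w) := by
  obtain ⟨X, hX, hXe⟩ := exists_smoothVF_chart (I := I) hy u
  obtain ⟨Z, hZ, hZe⟩ := exists_smoothVF_chart (I := I) hy w
  have h1 := hD.parallel X Z hX hZ y
  have h2 := congrArg (toChart x₀ y) h1
  have hJs := (contMDiffAt_conj₁ hJ hy).mdifferentiableAt (n := ∞) (by simp)
  have h3 := mvfderiv_clm_apply hJs (mdifferentiableAt_const (I := I) (c := w)) (ofChart x₀ y u)
  rw [mvfderiv_const, zero_apply, map_zero, add_zero] at h3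
  have hev : (fun q => toChart x₀ q (appEnd J Z q)) =ᶠ[𝓝 y] fun q => conj₁ x₀ q (J q) w := by
    filter_upwards [hZe] with q hq
    rw [conj₁_apply, appEnd, hq]
  have hev' : (fun q => toChart x₀ q (Z q)) =ᶠ[𝓝 y] fun _ => w := by
    filter_upwards [hZe, (chartAt H x₀).open_source.mem_nhds hy] with q hq hqs
    rw [hq, toChart_ofChart hqs]
  have h4 : toChart x₀ y (appEnd J Z y) = conj₁ x₀ y (J y) w := hev.self_of_nhds
  have h5 : toChart x₀ y (Z y) = w := hev'.self_of_nhds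
  unfold covD at h2
  rw [← conj₁_toChart hy (J y), toChart_affConn D hy (SmoothVF.at (hJ Z hZ) y).diff,
    toChart_affConn D hy (hZ.at y).diff, mvfderiv_congr hev, mvfderiv_congr hev', mvfderiv_const,
    h4, h5, hXe.self_of_nhds, toChart_ofChart hy, zero_apply, zero_add, h3] at h2
  rw [← h2]
  abel

end Transition

section Cone

variable {E : Type*} [NormedAddCommGroup E] [NormedSpace ℝ E] [FiniteDimensional ℝ E]
  [CompleteSpace E] {H : Type*} [TopologicalSpace H] {I : ModelWithCorners ℝ E H} [I.Boundaryless]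
  {M : Type*} [TopologicalSpace M] [T2Space M] [ChartedSpace H M] [IsManifold I ∞ M]
  {E' : Type*} [NormedAddCommGroup E'] [NormedSpace ℝ E'] [FiniteDimensional ℝ E']
  [CompleteSpace E'] {H' : Type*} [TopologicalSpace H'] {I' : ModelWithCorners ℝ E' H'}
  [I'.Boundaryless]
  {N : Type*} [TopologicalSpace N] [T2Space N] [ChartedSpace H' N] [IsManifold I' ∞ N]

variable (I I') in
/-- The derivative of `pr : N → M`, with values in the model space. -/
def dproj (pr : N → M) (p : N) : TangentSpace I' p →L[ℝ] E := mfderiv I' I pr p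

/-- The endomorphism `J x` of the model space. -/
abbrev endAt (J : EndField I M) (x : M) : E →L[ℝ] E := J x

/-- The data which define a conical special complex structure on `N`, lying over `M`: a connection
form `θ`, the frame `ε` given by horizontal and vertical lifts, a form `h` on the base and tensor
fields `b` and `k` along the projection. -/
structure ConeData (pr : N → M) (θ : OneForm I' N ℂ)
    (ε : Π p : N, (E × ℂ) →L[ℝ] TangentSpace I' p) (J : EndField I M) (D : AffConn I M)
    (h : M → E →L[ℝ] E →L[ℝ] ℂ) (b : N → E →L[ℝ] E →L[ℝ] E) (k : N → E →L[ℝ] E →L[ℝ] ℂ) : Prop where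
  smooth_proj : ContMDiff I' I ∞ pr
  smooth_form : ∀ p, SmoothFormAt θ p
  left_inv : ∀ p (v : TangentSpace I' p), ε p (dproj I I' pr p v, θ p v) = v
  proj_frame : ∀ p (z : E × ℂ), dproj I I' pr p (ε p z) = z.1
  form_frame : ∀ p (z : E × ℂ), θ p (ε p z) = z.2
  complexBase : IsComplexStructure J
  conn : IsTorsionFreeComplex J D
  smooth_h : ∀ x₀ y, y ∈ (chartAt H x₀).source →
    ContMDiffAt I 𝓘(ℝ, E →L[ℝ] E →L[ℝ] ℂ) ∞ (fun q => pull₂ I x₀ q (h q)) y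
  smooth_b : ∀ x₀ p, pr p ∈ (chartAt H x₀).source →
    ContMDiffAt I' 𝓘(ℝ, E →L[ℝ] E →L[ℝ] E) ∞ (fun q => conj₂ I x₀ (pr q) (b q)) p
  smooth_k : ∀ x₀ p, pr p ∈ (chartAt H x₀).source →
    ContMDiffAt I' 𝓘(ℝ, E →L[ℝ] E →L[ℝ] ℂ) ∞ (fun q => pull₂ I x₀ (pr q) (k q)) p
  h_J : ∀ x (v w : E), h x v (endAt J x w) = Complex.I * h x v w
  b_symm : ∀ p v w, b p v w = b p w v
  b_J : ∀ p (v w : E), b p v (endAt J (pr p) w) = - endAt J (pr p) (b p v w)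
  k_symm : ∀ p v w, k p v w = k p w v
  k_J : ∀ p (v w : E), k p v (endAt J (pr p) w) = - (Complex.I * k p v w)
  extForm_form : ∀ p (X Y : VField I' N), DiffVFAt X p → DiffVFAt Y p →
    extForm θ X Y p = h (pr p) (dproj I I' pr p (Y p)) (dproj I I' pr p (X p))
      - h (pr p) (dproj I I' pr p (X p)) (dproj I I' pr p (Y p))
  curv_eq : ∀ p (u v w : E), (curvAt D (pr p) u v w : E)
    = - cmul (endAt J (pr p)) (h (pr p) v u - h (pr p) u v) w
      - cmul (endAt J (pr p)) (h (pr p) v w) u + cmul (endAt J (pr p)) (h (pr p) u w) v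
      - b p u (b p v w) + b p v (b p u w)
  d_h : ∀ p (u v w : E), mvfderiv I (fun q => pull₂ I (pr p) q (h q)) (pr p) u v w
      - mvfderiv I (fun q => pull₂ I (pr p) q (h q)) (pr p) v u w
      - h (pr p) v (christoffel D (pr p) (pr p) u w)
      + h (pr p) u (christoffel D (pr p) (pr p) v w)
    = - (k p u (b p v w) - k p v (b p u w))
  d_b : ∀ p (X Y : TangentSpace I' p) (u v w : E), u = dproj I I' pr p X →
    v = dproj I I' pr p Y →
    mvfderiv I' (fun q => conj₂ I (pr p) (pr q) (b q)) p X v w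
      - mvfderiv I' (fun q => conj₂ I (pr p) (pr q) (b q)) p Y u w
      + christoffel D (pr p) (pr p) u (b p v w) - b p v (christoffel D (pr p) (pr p) u w)
      - christoffel D (pr p) (pr p) v (b p u w) + b p u (christoffel D (pr p) (pr p) v w)
    = - (2 * (θ p X).im) • endAt J (pr p) (b p v w) + (2 * (θ p Y).im) • endAt J (pr p) (b p u w)
      + cmul (endAt J (pr p)) (k p u w) v - cmul (endAt J (pr p)) (k p v w) u
  d_k : ∀ p (X Y : TangentSpace I' p) (u v w : E), u = dproj I I' pr p X →
    v = dproj I I' pr p Y →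
    mvfderiv I' (fun q => pull₂ I (pr p) (pr q) (k q)) p X v w
      - mvfderiv I' (fun q => pull₂ I (pr p) (pr q) (k q)) p Y u w
      - k p v (christoffel D (pr p) (pr p) u w) + k p u (christoffel D (pr p) (pr p) v w)
    = - (2 * Complex.I * (θ p X).im * k p v w) + 2 * Complex.I * (θ p Y).im * k p u w
      - (h (pr p) u (b p v w) - h (pr p) v (b p u w))

variable (I) in
/-- The coframe on the total space defined by the connection form and the chart at `x₀`. -/
def coneCoframe (pr : N → M) (θ : OneForm I' N ℂ) (x₀ : M) :
    OneForm I' N (E × ℂ) :=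
  fun q => (toChart (I := I) x₀ (pr q) ∘L dproj I I' pr q).prod (θ q)

lemma coneCoframe_apply (pr : N → M) (θ : OneForm I' N ℂ) (x₀ : M) (q : N)
    (v : TangentSpace I' q) : coneCoframe I pr θ x₀ q v
      = (toChart (I := I) x₀ (pr q) (mfderiv I' I pr q v), θ q v) := rfl

lemma coneCoframe_self (pr : N → M) (θ : OneForm I' N ℂ) (q : N) (v : TangentSpace I' q) :
    coneCoframe I pr θ (pr q) q v = (dproj I I' pr q v, θ q v) :=
  Prod.ext (toChart_self (E := E) (I := I) (pr q) _) rfl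

variable (I) in
/-- The frame dual to the coframe on the total space. -/
def coneFrame (pr : N → M)
    (ε : Π p : N, (E × ℂ) →L[ℝ] TangentSpace I' p) (x₀ : M) (q : N) :
    (E × ℂ) →L[ℝ] TangentSpace I' q :=
  ε q ∘L (ContinuousLinearMap.prodMap (M₂ := E) (ofChart (I := I) x₀ (pr q))
    (ContinuousLinearMap.id ℝ ℂ))

lemma coneFrame_apply (pr : N → M)
    (ε : Π p : N, (E × ℂ) →L[ℝ] TangentSpace I' p) (x₀ : M) (q : N) (z : E × ℂ) :
    coneFrame I pr ε x₀ q z = ε q ((ofChart (I := I) x₀ (pr q) z.1 : E), z.2) := rfl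

/-- The connection form of the cone connection with respect to `coneCoframe`. -/
def coneConnForm (pr : N → M) (J : EndField I M) (D : AffConn I M)
    (h : M → E →L[ℝ] E →L[ℝ] ℂ) (b : N → E →L[ℝ] E →L[ℝ] E) (k : N → E →L[ℝ] E →L[ℝ] ℂ) (x₀ : M) (q : N) :
    (E × ℂ) →L[ℝ] (E × ℂ) →L[ℝ] (E × ℂ) :=
  coneForm (christoffel D x₀ (pr q) + conj₂ I x₀ (pr q) (b q)) (conj₁ x₀ (pr q) (J (pr q)))
    (pull₂ I x₀ (pr q) (h (pr q)) + pull₂ I x₀ (pr q) (k q))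

/-- The complex structure on the total space. -/
def coneJ (pr : N → M) (θ : OneForm I' N ℂ) (ε : Π p : N, (E × ℂ) →L[ℝ] TangentSpace I' p)
    (J : EndField I M) : EndField I' N := fun p =>
  ε p ∘L ((endAt J (pr p) ∘L dproj I I' pr p).prod (Complex.I • ContinuousLinearMap.id ℝ ℂ ∘L θ p))

lemma coneJ_apply (pr : N → M) (θ : OneForm I' N ℂ) (ε : Π p : N, (E × ℂ) →L[ℝ] TangentSpace I' p)
    (J : EndField I M) (p : N) (v : TangentSpace I' p) :
    coneJ pr θ ε J p v = ε p (endAt J (pr p) (dproj I I' pr p v), Complex.I * θ p v) := rfl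

end Cone

section ConeConnection

variable {E : Type*} [NormedAddCommGroup E] [NormedSpace ℝ E] [FiniteDimensional ℝ E]
  [CompleteSpace E] {H : Type*} [TopologicalSpace H] {I : ModelWithCorners ℝ E H} [I.Boundaryless]
  {M : Type*} [TopologicalSpace M] [T2Space M] [ChartedSpace H M] [IsManifold I ∞ M]
  {E' : Type*} [NormedAddCommGroup E'] [NormedSpace ℝ E'] [FiniteDimensional ℝ E']
  [CompleteSpace E'] {H' : Type*} [TopologicalSpace H'] {I' : ModelWithCorners ℝ E' H'}
  [I'.Boundaryless]
  {N : Type*} [TopologicalSpace N] [T2Space N] [ChartedSpace H' N] [IsManifold I' ∞ N]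

lemma toChart_mfderiv_proj {pr : N → M} (hpr : ContMDiff I' I ∞ pr) {x₀ : M} {q : N}
    (hq : pr q ∈ (chartAt H x₀).source) (v : TangentSpace I' q) :
    toChart (I := I) x₀ (pr q) (mfderiv I' I pr q v)
      = mvfderiv I' (fun y => extChartAt I x₀ (pr y)) q v := by
  rw [toChart_eq_mvfderiv hq, mvfderiv_mcomp (mdifferentiableAt_extChartAt hq)
    ((hpr q).mdifferentiableAt (by simp))]

lemma eventually_toChart_mfderiv_proj {pr : N → M} (hpr : ContMDiff I' I ∞ pr) {x₀ : M} {q : N}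
    (hq : pr q ∈ (chartAt H x₀).source) :
    ∀ᶠ y in 𝓝 q, ∀ v : TangentSpace I' y, toChart (I := I) x₀ (pr y) (mfderiv I' I pr y v)
      = mvfderiv I' (fun y => extChartAt I x₀ (pr y)) y v := by
  filter_upwards [((chartAt H x₀).open_source.preimage hpr.continuous).mem_nhds hq] with y hy v
  exact toChart_mfderiv_proj hpr hy v

lemma contMDiffAt_toChart_mfderiv {pr : N → M} (hpr : ContMDiff I' I ∞ pr) {x₀ : M} {q : N}
    (hq : pr q ∈ (chartAt H x₀).source) {V : VField I' N} (hV : SmoothVFAt V q) :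
    ContMDiffAt I' 𝓘(ℝ, E) ∞ (fun y => toChart (I := I) x₀ (pr y) (mfderiv I' I pr y (V y))) q := by
  have hc : ContMDiffAt I' 𝓘(ℝ, E) ∞ (fun y => extChartAt I x₀ (pr y)) q :=
    (contMDiffAt_extChartAt' hq).comp q (hpr q)
  refine (contMDiffAt_mvfderiv_apply hc hV).congr_of_eventuallyEq ?_
  filter_upwards [eventually_toChart_mfderiv_proj hpr hq] with y hy
  exact hy _

lemma extForm_toChart_mfderiv {pr : N → M} (hpr : ContMDiff I' I ∞ pr) {x₀ : M} {q : N}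
    (hq : pr q ∈ (chartAt H x₀).source) {X Y : VField I' N} (hX : DiffVFAt X q)
    (hY : DiffVFAt Y q) :
    extForm (fun y => (toChart (I := I) x₀ (pr y) ∘L mfderiv I' I pr y : _ →L[ℝ] E)) X Y q = 0 := by
  have hc : ContMDiffAt I' 𝓘(ℝ, E) ∞ (fun y => extChartAt I x₀ (pr y)) q :=
    (contMDiffAt_extChartAt' hq).comp q (hpr q)
  rw [extForm_congr (θ' := fun y => mvfderiv I' (fun z => extChartAt I x₀ (pr z)) y)]
  · exact extForm_mvfderiv (hc.of_le (WithTop.coe_le_coe.2 le_top)) hX hY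
  · filter_upwards [eventually_toChart_mfderiv_proj hpr hq] with y hy
    ext v
    exact hy v

variable {pr : N → M} {θ : OneForm I' N ℂ} {ε : Π p : N, (E × ℂ) →L[ℝ] TangentSpace I' p}
  {J : EndField I M} {D : AffConn I M} {h : M → E →L[ℝ] E →L[ℝ] ℂ} {b : N → E →L[ℝ] E →L[ℝ] E}
  {k : N → E →L[ℝ] E →L[ℝ] ℂ}

lemma ConeData.frame_injective (C : ConeData pr θ ε J D h b k) {p : N} {v w : TangentSpace I' p}
    (h₁ : dproj I I' pr p v = dproj I I' pr p w) (h₂ : θ p v = θ p w) : v = w := by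
  rw [← C.left_inv p v, ← C.left_inv p w, h₁, h₂]

lemma ConeData.isCoframe (C : ConeData pr θ ε J D h b k) (x₀ : M) :
    IsCoframe (coneCoframe I pr θ x₀) (coneFrame I pr ε x₀) (pr ⁻¹' (chartAt H x₀).source) where
  isOpen := (chartAt H x₀).open_source.preimage C.smooth_proj.continuous
  left_inv q hq v := by
    rw [coneFrame_apply, coneCoframe_apply]
    simp only
    rw [ofChart_toChart hq]
    exact C.left_inv q v
  right_inv q hq z := by
    rw [coneFrame_apply]
    refine Prod.ext ?_ (C.form_frame q _)
    exact (congrArg (fun e : E => toChart (I := I) x₀ (pr q) e) (C.proj_frame q _)).trans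
      (toChart_ofChart (I := I) hq z.1)
  smooth q hq := smoothFormAt_of_apply fun V hV =>
    (contMDiffAt_toChart_mfderiv C.smooth_proj hq hV.self_of_nhds).prodMk_space
      ((C.smooth_form q).apply hV.self_of_nhds)

lemma ConeData.extForm_coframe (C : ConeData pr θ ε J D h b k) {x₀ : M} {q : N}
    (hq : pr q ∈ (chartAt H x₀).source) {X Y : VField I' N} (hX : DiffVFAt X q)
    (hY : DiffVFAt Y q) :
    extForm (coneCoframe I pr θ x₀) X Y q = (0, extForm θ X Y q) := by
  have h1 : ∀ {V : VField I' N}, DiffVFAt V q → MDifferentiableAt I' 𝓘(ℝ, E)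
      (fun y => toChart (I := I) x₀ (pr y) (mfderiv I' I pr y (V y))) q := fun hV =>
    (ContinuousLinearMap.fst ℝ E ℂ).differentiableAt.comp_mdifferentiableAt
      (((C.isCoframe x₀).smooth q hq).diff_apply hV)
  have h2 : ∀ {V : VField I' N}, DiffVFAt V q →
      MDifferentiableAt I' 𝓘(ℝ, ℂ) (fun y => θ y (V y)) q :=
    fun hV => (C.smooth_form q).diff_apply hV
  have h3 := extForm_toChart_mfderiv C.smooth_proj hq hX hY
  unfold extForm at h3 ⊢
  simp only [coneCoframe_apply]
  rw [mvfderiv_prodMk (h1 hX) (h2 hX), mvfderiv_prodMk (h1 hY) (h2 hY)]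
  exact Prod.ext h3 rfl

lemma coneConnForm_apply (x₀ : M) (q : N) (X Y : E × ℂ) :
    coneConnForm pr J D h b k x₀ q X Y
      = (christoffel D x₀ (pr q) X.1 Y.1 + conj₂ I x₀ (pr q) (b q) X.1 Y.1
          + cmul (conj₁ x₀ (pr q) (J (pr q))) X.2 Y.1 + cmul (conj₁ x₀ (pr q) (J (pr q))) Y.2 X.1,
        X.2 * Y.2 + (pull₂ I x₀ (pr q) (h (pr q)) X.1 Y.1 + pull₂ I x₀ (pr q) (k q) X.1 Y.1)) := by
  unfold coneConnForm
  rw [coneForm_apply]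
  rfl

lemma ConeData.smooth_connForm (C : ConeData pr θ ε J D h b k) {x₀ : M} {q : N}
    (hq : pr q ∈ (chartAt H x₀).source) :
    ContMDiffAt I' 𝓘(ℝ, (E × ℂ) →L[ℝ] (E × ℂ) →L[ℝ] (E × ℂ)) ∞ (coneConnForm pr J D h b k x₀) q := by
  refine contMDiffAt_clm_of_apply₂ fun X Y => ?_
  have hc : ∀ e : E, ContMDiffAt I' 𝓘(ℝ, E) ∞ (fun _ : N => e) q := fun e => contMDiffAt_const
  have hΓ := (contMDiffAt_christoffel C.conn.smooth hq).comp q (C.smooth_proj q)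
  have hJ := (contMDiffAt_conj₁ C.complexBase.smooth hq).comp q (C.smooth_proj q)
  have hh := (C.smooth_h x₀ (pr q) hq).comp q (C.smooth_proj q)
  have hb := C.smooth_b x₀ q hq
  have hk := C.smooth_k x₀ q hq
  have hcm : ∀ (z : ℂ) (e : E), ContMDiffAt I' 𝓘(ℝ, E) ∞
      (fun y => cmul (conj₁ x₀ (pr y) (J (pr y))) z e) q := fun z e =>
    (hc _).add ((ContinuousLinearMap.lsmul ℝ ℝ (E := E) z.im).contMDiff.contMDiffAt.comp q
      (hJ.clm_apply (hc e)))
  simp only [coneConnForm_apply]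
  refine ContMDiffAt.prodMk_space ?_ ?_
  · exact ((((hΓ.clm_apply (hc _)).clm_apply (hc _)).add
      ((hb.clm_apply (hc _)).clm_apply (hc _))).add (hcm _ _)).add (hcm _ _)
  · exact contMDiffAt_const.add (((hh.clm_apply (hc _)).clm_apply (hc _)).add
      ((hk.clm_apply (hc _)).clm_apply (hc _)))

lemma cmul_intertwine {J J' A : E →L[ℝ] E} (hA : ∀ v, J' (A v) = A (J v)) (z : ℂ) (v : E) :
    cmul J' z (A v) = A (cmul J z v) := by
  simp only [cmul, hA, map_add, map_smul]

lemma ConeData.isConnAtlas (C : ConeData pr θ ε J D h b k) :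
    IsConnAtlas (coneCoframe I pr θ) (coneFrame I pr ε) (coneConnForm pr J D h b k)
      (fun x₀ => pr ⁻¹' (chartAt H x₀).source) pr where
  coframe := C.isCoframe
  mem p := mem_chart_source H (pr p)
  smooth _ _ hq := C.smooth_connForm hq
  compat x₀ x₁ p hp hp' := by
    let K : N → (E × ℂ) →L[ℝ] (E × ℂ) := fun q =>
      (transMap I x₀ x₁ (pr q)).prodMap (ContinuousLinearMap.id ℝ ℂ)
    have hA := (contMDiffAt_transMap (I := I) hp hp').mdifferentiableAt (n := ∞) (by simp)
    have hpd : MDifferentiableAt I' I pr p := (C.smooth_proj p).mdifferentiableAt (by simp)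
    have hApr : ∀ e : E, MDifferentiableAt I' 𝓘(ℝ, E) (fun q => transMap I x₀ x₁ (pr q) e) p :=
      fun e => (hA.clm_apply mdifferentiableAt_const).comp p hpd
    have hK : MDifferentiableAt I' 𝓘(ℝ, (E × ℂ) →L[ℝ] (E × ℂ)) K p := by
      refine ContMDiffAt.mdifferentiableAt (n := ∞) (contMDiffAt_clm_of_apply fun z => ?_) (by simp)
      exact ((((contMDiffAt_transMap (I := I) hp hp').comp p (C.smooth_proj p)).clm_apply
        contMDiffAt_const).prodMk_space contMDiffAt_const)
    refine ⟨K, hK, ?_, fun v Y => ?_⟩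
    · filter_upwards [((chartAt H x₀).open_source.preimage C.smooth_proj.continuous).mem_nhds hp]
        with q hq v
      exact Prod.ext (transMap_toChart (I := I) hq _).symm rfl
    · have h1 : mvfderiv I' K p v Y
          = (mvfderiv I (transMap I x₀ x₁) (pr p) (mfderiv I' I pr p v) Y.1, 0) := by
        have h2 := mvfderiv_clm_apply hK (mdifferentiableAt_const (I := I') (c := Y)) v
        rw [mvfderiv_const, zero_apply, map_zero, add_zero] at h2
        rw [← h2]
        have h3 := mvfderiv_prodMk (hApr Y.1) (mdifferentiableAt_const (I := I') (c := Y.2)) v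
        refine h3.trans ?_
        rw [mvfderiv_const, zero_apply]
        have h4 := mvfderiv_mcomp (hA.clm_apply (mdifferentiableAt_const (I := I) (c := Y.1))) hpd v
        have h5 := mvfderiv_clm_apply hA (mdifferentiableAt_const (I := I) (c := Y.1))
          (mfderiv I' I pr p v)
        rw [mvfderiv_const, zero_apply, map_zero, add_zero] at h5
        rw [← h5]
        exact congrArg (fun e => ((e, 0) : E × ℂ)) h4
      have h2 : coneCoframe I pr θ x₁ p v = K p (coneCoframe I pr θ x₀ p v) :=
        Prod.ext (transMap_toChart (I := I) hp _).symm rfl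
      have h3 : ofChart (I := I) x₀ (pr p) (coneCoframe I pr θ x₀ p v).1 = mfderiv I' I pr p v :=
        ofChart_toChart hp _
      have h4 := conj₁_transMap hp hp' (J (pr p))
      rw [h2, h1, ← h3]
      generalize coneCoframe I pr θ x₀ p v = X
      rw [coneConnForm_apply, coneConnForm_apply]
      have h5 : ∀ Y : E × ℂ, K p Y = (transMap I x₀ x₁ (pr p) Y.1, Y.2) := fun Y => rfl
      simp only [h5]
      rw [christoffel_transMap D hp hp', conj₂_transMap hp hp', pull₂_transMap hp',
        pull₂_transMap hp', cmul_intertwine h4, cmul_intertwine h4]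
      refine Prod.ext ?_ (by simp)
      simp only [map_add, Prod.fst_sub]
      abel

/-- The cone connection. -/
def coneConn (C : ConeData pr θ ε J D h b k) : AffConn I' N := glueConn C.isConnAtlas

lemma ConeData.isConnForm (C : ConeData pr θ ε J D h b k) (x₀ : M) :
    IsConnForm (coneConn C) (coneCoframe I pr θ x₀) (coneConnForm pr J D h b k x₀)
      (pr ⁻¹' (chartAt H x₀).source) :=
  isConnForm_glueConn C.isConnAtlas x₀

lemma ConeData.isSmoothTorsionFree (C : ConeData pr θ ε J D h b k) :
    IsSmoothTorsionFree (coneConn C) where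
  smooth := contMDiffCovariantDerivative_of_connForm fun q =>
    ⟨_, _, _, _, mem_chart_source H (pr q), C.isCoframe (pr q), C.isConnForm (pr q)⟩
  torsion_eq_zero := torsion_eq_zero_of_connForm fun q => by
    refine ⟨_, _, _, _, mem_chart_source H (pr q), C.isCoframe (pr q), C.isConnForm (pr q),
      fun X Y hX hY => ?_⟩
    have hq := mem_chart_source H (pr q)
    have hΓ := christoffel_symm C.conn.toIsSmoothTorsionFree hq
    rw [C.extForm_coframe hq hX hY, C.extForm_form q X Y hX hY, coneConnForm_apply,
      coneConnForm_apply, coneCoframe_self, coneCoframe_self]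
    generalize dproj I I' pr q (X q) = u
    generalize dproj I I' pr q (Y q) = v
    have h1 : ∀ l : E →L[ℝ] E →L[ℝ] ℂ, ∀ u v : E, pull₂ I (pr q) (pr q) l u v = l u v :=
      fun l u v => pull₂_self (I := I) (pr q) l u v
    have h2 : ∀ u v : E, conj₂ I (pr q) (pr q) (b q) u v = b q u v :=
      fun u v => conj₂_self (I := I) (pr q) (b q) u v
    refine Prod.ext ?_ ?_
    · simp only [Prod.fst_sub, Prod.fst_add, h2]
      rw [hΓ u v, C.b_symm q u v]
      simp
      abel
    · simp only [Prod.snd_sub, Prod.snd_add, h1]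
      rw [C.k_symm q u v]
      simp
      ring

end ConeConnection

section ConeCurvature

variable {E : Type*} [NormedAddCommGroup E] [NormedSpace ℝ E] [FiniteDimensional ℝ E]
  [CompleteSpace E] {H : Type*} [TopologicalSpace H] {I : ModelWithCorners ℝ E H} [I.Boundaryless]
  {M : Type*} [TopologicalSpace M] [T2Space M] [ChartedSpace H M] [IsManifold I ∞ M]
  {E' : Type*} [NormedAddCommGroup E'] [NormedSpace ℝ E'] [FiniteDimensional ℝ E']
  [CompleteSpace E'] {H' : Type*} [TopologicalSpace H'] {I' : ModelWithCorners ℝ E' H'}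
  [I'.Boundaryless]
  {N : Type*} [TopologicalSpace N] [T2Space N] [ChartedSpace H' N] [IsManifold I' ∞ N]
  {pr : N → M} {θ : OneForm I' N ℂ} {ε : Π p : N, (E × ℂ) →L[ℝ] TangentSpace I' p}
  {J : EndField I M} {D : AffConn I M} {h : M → E →L[ℝ] E →L[ℝ] ℂ} {b : N → E →L[ℝ] E →L[ℝ] E}
  {k : N → E →L[ℝ] E →L[ℝ] ℂ}

lemma mvfderiv_apply_const₂ {F₁ F₂ F₃ : Type*} [NormedAddCommGroup F₁] [NormedSpace ℝ F₁]
    [NormedAddCommGroup F₂] [NormedSpace ℝ F₂] [NormedAddCommGroup F₃] [NormedSpace ℝ F₃]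
    {A : M → F₁ →L[ℝ] F₂ →L[ℝ] F₃} {x : M}
    (hA : MDifferentiableAt I 𝓘(ℝ, F₁ →L[ℝ] F₂ →L[ℝ] F₃) A x) (u : F₁) (v : F₂)
    (t : TangentSpace I x) :
    mvfderiv I (fun q => A q u v) x t = mvfderiv I A x t u v := by
  rw [mvfderiv_clm_apply (hA.clm_apply mdifferentiableAt_const) mdifferentiableAt_const,
    mvfderiv_clm_apply hA mdifferentiableAt_const]
  simp [mvfderiv_const]

lemma mdifferentiableAt_apply₂ {F₁ F₂ F₃ : Type*} [NormedAddCommGroup F₁] [NormedSpace ℝ F₁]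
    [NormedAddCommGroup F₂] [NormedSpace ℝ F₂] [NormedAddCommGroup F₃] [NormedSpace ℝ F₃]
    {A : M → F₁ →L[ℝ] F₂ →L[ℝ] F₃} {x : M}
    (hA : MDifferentiableAt I 𝓘(ℝ, F₁ →L[ℝ] F₂ →L[ℝ] F₃) A x) (u : F₁) (v : F₂) :
    MDifferentiableAt I 𝓘(ℝ, F₃) (fun q => A q u v) x :=
  (hA.clm_apply mdifferentiableAt_const).clm_apply mdifferentiableAt_const

lemma mvfderiv_apply_const {F₁ F₂ : Type*} [NormedAddCommGroup F₁] [NormedSpace ℝ F₁]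
    [NormedAddCommGroup F₂] [NormedSpace ℝ F₂] {A : M → F₁ →L[ℝ] F₂} {x : M}
    (hA : MDifferentiableAt I 𝓘(ℝ, F₁ →L[ℝ] F₂) A x) (u : F₁) (t : TangentSpace I x) :
    mvfderiv I (fun q => A q u) x t = mvfderiv I A x t u := by
  rw [mvfderiv_clm_apply hA mdifferentiableAt_const]
  simp [mvfderiv_const]

lemma mvfderiv_fun_add_apply {F : Type*} [NormedAddCommGroup F] [NormedSpace ℝ F] {f g : M → F}
    {x : M} (hf : MDifferentiableAt I 𝓘(ℝ, F) f x) (hg : MDifferentiableAt I 𝓘(ℝ, F) g x)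
    (t : TangentSpace I x) :
    mvfderiv I (fun q => f q + g q) x t = mvfderiv I f x t + mvfderiv I g x t := by
  rw [mvfderiv_fun_add hf hg, add_apply]

lemma conj₁_self_eq (J : EndField I M) (x : M) : conj₁ x x (J x) = endAt J x := by
  ext v
  exact conj₁_self (E := E) (I := I) x (J x) v

lemma mvfderiv_cmul {F : Type*} [NormedAddCommGroup F] [NormedSpace ℝ F]
    {A : M → F →L[ℝ] F} {x : M} (hA : MDifferentiableAt I 𝓘(ℝ, F →L[ℝ] F) A x)
    (z : ℂ) (e : F) (t : TangentSpace I x) :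
    mvfderiv I (fun q => cmul (A q) z e) x t = z.im • mvfderiv I A x t e := by
  have h1 := mvfderiv_clm_comp (z.im • ContinuousLinearMap.id ℝ F)
    (hA.clm_apply (mdifferentiableAt_const (I := I) (c := e))) t
  rw [mvfderiv_apply_const hA] at h1
  unfold cmul
  rw [mvfderiv_fun_add_apply mdifferentiableAt_const]
  · rw [mvfderiv_const, zero_apply, zero_add]
    exact h1
  · exact (z.im • ContinuousLinearMap.id ℝ F).differentiableAt.comp_mdifferentiableAt
      (hA.clm_apply (mdifferentiableAt_const (I := I) (c := e)))

lemma mdifferentiableAt_cmul {F : Type*} [NormedAddCommGroup F] [NormedSpace ℝ F]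
    {A : M → F →L[ℝ] F} {x : M}
    (hA : MDifferentiableAt I 𝓘(ℝ, F →L[ℝ] F) A x) (z : ℂ) (e : F) :
    MDifferentiableAt I 𝓘(ℝ, F) (fun q => cmul (A q) z e) x :=
  mdifferentiableAt_const.add
    ((z.im • ContinuousLinearMap.id ℝ F).differentiableAt.comp_mdifferentiableAt
      (hA.clm_apply (mdifferentiableAt_const (I := I) (c := e))))

/-- The derivative of the connection form of the cone connection. -/
lemma ConeData.mvfderiv_connForm (C : ConeData pr θ ε J D h b k) (p : N) (X : TangentSpace I' p)
    (Y Z : E × ℂ) :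
    mvfderiv I' (coneConnForm pr J D h b k (pr p)) p X Y Z
      = (mvfderiv I (christoffel D (pr p)) (pr p) (dproj I I' pr p X) Y.1 Z.1
          + mvfderiv I' (fun q => conj₂ I (pr p) (pr q) (b q)) p X Y.1 Z.1
          + Y.2.im • mvfderiv I (fun q => conj₁ (pr p) q (J q)) (pr p) (dproj I I' pr p X) Z.1
          + Z.2.im • mvfderiv I (fun q => conj₁ (pr p) q (J q)) (pr p) (dproj I I' pr p X) Y.1,
        mvfderiv I (fun q => pull₂ I (pr p) q (h q)) (pr p) (dproj I I' pr p X) Y.1 Z.1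
          + mvfderiv I' (fun q => pull₂ I (pr p) (pr q) (k q)) p X Y.1 Z.1) := by
  have hq := mem_chart_source H (pr p)
  have hpd : MDifferentiableAt I' I pr p := (C.smooth_proj p).mdifferentiableAt (by simp)
  have hΨ := (C.smooth_connForm hq).mdifferentiableAt (n := ∞) (by simp)
  have hΓ := (contMDiffAt_christoffel C.conn.smooth hq).mdifferentiableAt (n := ∞) (by simp)
  have hJ := (contMDiffAt_conj₁ C.complexBase.smooth hq).mdifferentiableAt (n := ∞) (by simp)
  have hh := (C.smooth_h (pr p) (pr p) hq).mdifferentiableAt (n := ∞) (by simp)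
  have hb := (C.smooth_b (pr p) p hq).mdifferentiableAt (n := ∞) (by simp)
  have hk := (C.smooth_k (pr p) p hq).mdifferentiableAt (n := ∞) (by simp)
  have hΓ' : MDifferentiableAt I' 𝓘(ℝ, E →L[ℝ] E →L[ℝ] E)
    (fun q => christoffel D (pr p) (pr q)) p := hΓ.comp p hpd
  have hJ' : MDifferentiableAt I' 𝓘(ℝ, E →L[ℝ] E)
    (fun q => conj₁ (pr p) (pr q) (J (pr q))) p := MDifferentiableAt.comp p hJ hpd
  have hh' : MDifferentiableAt I' 𝓘(ℝ, E →L[ℝ] E →L[ℝ] ℂ)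
    (fun q => pull₂ I (pr p) (pr q) (h (pr q))) p := MDifferentiableAt.comp (g := fun q => pull₂ I (pr p) q (h q)) p hh hpd
  have eΓ : mvfderiv I' (fun q => christoffel D (pr p) (pr q)) p X
      = mvfderiv I (christoffel D (pr p)) (pr p) (dproj I I' pr p X) := mvfderiv_mcomp hΓ hpd X
  have eJ : mvfderiv I' (fun q => conj₁ (pr p) (pr q) (J (pr q))) p X
      = mvfderiv I (fun q => conj₁ (pr p) q (J q)) (pr p) (dproj I I' pr p X) :=
    mvfderiv_mcomp hJ hpd X
  have eh : mvfderiv I' (fun q => pull₂ I (pr p) (pr q) (h (pr q))) p X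
      = mvfderiv I (fun q => pull₂ I (pr p) q (h q)) (pr p) (dproj I I' pr p X) :=
    mvfderiv_mcomp hh hpd X
  rw [← mvfderiv_apply_const₂ hΨ, ← eΓ, ← eJ, ← eh]
  simp only [coneConnForm_apply]
  have g1 := (mdifferentiableAt_apply₂ hΓ' Y.1 Z.1).add (mdifferentiableAt_apply₂ hb Y.1 Z.1)
  have g2 := g1.add (mdifferentiableAt_cmul hJ' Y.2 Z.1)
  have g3 := (mdifferentiableAt_apply₂ hh' Y.1 Z.1).add (mdifferentiableAt_apply₂ hk Y.1 Z.1)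
  refine (mvfderiv_prodMk (g2.add (mdifferentiableAt_cmul hJ' Z.2 Y.1))
    ((mdifferentiableAt_const (c := Y.2 * Z.2)).add g3) X).trans ?_
  refine Prod.ext ?_ ?_
  · refine (mvfderiv_fun_add_apply g2 (mdifferentiableAt_cmul hJ' Z.2 Y.1) X).trans ?_
    refine (congrArg (· + _) (mvfderiv_fun_add_apply g1 (mdifferentiableAt_cmul hJ' Y.2 Z.1)
      X)).trans ?_
    refine (congrArg (· + _ + _) (mvfderiv_fun_add_apply (mdifferentiableAt_apply₂ hΓ' Y.1 Z.1) (mdifferentiableAt_apply₂ hb Y.1 Z.1)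
      X)).trans ?_
    rw [mvfderiv_cmul hJ', mvfderiv_cmul hJ', mvfderiv_apply_const₂ hΓ', mvfderiv_apply_const₂ hb]
  · refine (mvfderiv_fun_add_apply (mdifferentiableAt_const (c := Y.2 * Z.2)) g3 X).trans ?_
    refine (congrArg (_ + ·) (mvfderiv_fun_add_apply (mdifferentiableAt_apply₂ hh' Y.1 Z.1) (mdifferentiableAt_apply₂ hk Y.1 Z.1)
      X)).trans ?_
    rw [mvfderiv_const, zero_apply, zero_add, mvfderiv_apply_const₂ hh', mvfderiv_apply_const₂ hk]

lemma curvAt_eq_christoffel {D : AffConn I M}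
    (hD : CovariantDerivative.ContMDiffCovariantDerivative D ∞) (x : M) (u v w : E) :
    (curvAt D x u v w : E) = mvfderiv I (christoffel D x) x u v w
      - mvfderiv I (christoffel D x) x v u w + christoffel D x x u (christoffel D x x v w)
      - christoffel D x x v (christoffel D x x u w) := by
  have h1 := toChart_curvAt hD (mem_chart_source H x) u v w
  have hs : ∀ e : E, toChart (I := I) x x e = e := toChart_self (E := E) (I := I) x
  have ho : ∀ e : E, (ofChart (I := I) x x e : E) = e := ofChart_self (E := E) (I := I) x
  refine (hs _).symm.trans (h1.trans ?_)
  rw [hs u, hs v, hs w]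
  unfold curvCoef
  exact congrArg₂ (fun a a' : E => mvfderiv I (christoffel D x) x a v w
    - mvfderiv I (christoffel D x) x a' u w + christoffel D x x u (christoffel D x x v w)
      - christoffel D x x v (christoffel D x x u w)) (ho u) (ho v)

lemma ConeData.connForm_self (p : N) (X Y : E × ℂ) :
    coneConnForm pr J D h b k (pr p) p X Y
      = ((christoffel D (pr p) (pr p) + b p) X.1 Y.1 + cmul (endAt J (pr p)) X.2 Y.1
          + cmul (endAt J (pr p)) Y.2 X.1, X.2 * Y.2 + (h (pr p) + k p) X.1 Y.1) := by
  rw [coneConnForm_apply, conj₁_self_eq, conj₂_self, pull₂_self, pull₂_self]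
  rfl

/-- The cone connection is flat. -/
lemma ConeData.flat (C : ConeData pr θ ε J D h b k) {X Y Z : VField I' N} {p : N}
    (hX : ∀ᶠ y in 𝓝 p, SmoothVFAt X y)
    (hY : ∀ᶠ y in 𝓝 p, SmoothVFAt Y y) (hZ : ∀ᶠ y in 𝓝 p, SmoothVFAt Z y) :
    curv (coneConn C) X Y Z p = 0 := by
  have hq := mem_chart_source H (pr p)
  refine (C.isCoframe (pr p)).injective hq ?_
  have hXd := hX.self_of_nhds.diff
  have hYd := hY.self_of_nhds.diff
  rw [(C.isConnForm (pr p)).curv_eq (C.isCoframe (pr p)) hq hX hY hZ, C.extForm_coframe hq hXd hYd,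
    C.mvfderiv_connForm, C.mvfderiv_connForm, map_zero]
  simp only [ConeData.connForm_self, coneCoframe_self]
  have ho : ∀ e : E, (ofChart (I := I) (pr p) (pr p) e : E) = e :=
    ofChart_self (E := E) (I := I) (pr p)
  have hJ : ∀ u w : E, mvfderiv I (fun q => conj₁ (pr p) q (J q)) (pr p) u w
      = endAt J (pr p) (christoffel D (pr p) (pr p) u w)
        - christoffel D (pr p) (pr p) u (endAt J (pr p) w) := by
    intro u w
    have h1 := mvfderiv_conj₁ C.complexBase.smooth C.conn hq u w
    rw [conj₁_self_eq] at h1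
    rw [← h1]
    exact congrArg (fun e : E => mvfderiv I (fun q => conj₁ (pr p) q (J q)) (pr p) e w) (ho u).symm
  have hR := fun w : E => (curvAt_eq_christoffel C.conn.smooth (pr p) (dproj I I' pr p (X p))
    (dproj I I' pr p (Y p)) w).symm.trans (C.curv_eq p _ _ w)
  have hb := fun w : E => C.d_b p (X p) (Y p) _ _ w rfl rfl
  have hk := fun w : E => C.d_k p (X p) (Y p) _ _ w rfl rfl
  have hh := C.d_h p (dproj I I' pr p (X p)) (dproj I I' pr p (Y p))
  have ht := C.extForm_form p X Y hXd hYd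
  rw [← ht] at hR
  have hJ₁ := hJ (dproj I I' pr p (X p))
  have hJ₂ := hJ (dproj I I' pr p (Y p))
  refine Prod.ext ?_ ?_
  · have := cone_flat_horizontal (y := dproj I I' pr p (Z p)) (s := θ p (Z p)) (C.complexBase.sq (pr p))
      (christoffel_symm C.conn.toIsSmoothTorsionFree hq) (C.b_symm p) (C.b_J p) hJ₁ hJ₂ (hR _) (hb _)
    refine Eq.trans ?_ this
    simp [cmul_zero]
    abel
  · have := cone_flat_vertical (y := dproj I I' pr p (Z p)) (s := θ p (Z p)) (C.k_symm p)
      (C.h_J (pr p)) (C.k_J p) ht (hh _) (hk _)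
    refine Eq.trans ?_ this
    simp
    ring

end ConeCurvature

section ConeStructure

variable {E : Type*} [NormedAddCommGroup E] [NormedSpace ℝ E] [FiniteDimensional ℝ E]
  [CompleteSpace E] {H : Type*} [TopologicalSpace H] {I : ModelWithCorners ℝ E H} [I.Boundaryless]
  {M : Type*} [TopologicalSpace M] [T2Space M] [ChartedSpace H M] [IsManifold I ∞ M]
  {E' : Type*} [NormedAddCommGroup E'] [NormedSpace ℝ E'] [FiniteDimensional ℝ E']
  [CompleteSpace E'] {H' : Type*} [TopologicalSpace H'] {I' : ModelWithCorners ℝ E' H'}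
  [I'.Boundaryless]
  {N : Type*} [TopologicalSpace N] [T2Space N] [ChartedSpace H' N] [IsManifold I' ∞ N]

lemma mlieBracket_eq_covD {D : AffConn I' N} (hD : IsSmoothTorsionFree D) {X Y : VField I' N}
    {p : N} (hX : DiffVFAt X p) (hY : DiffVFAt Y p) :
    VectorField.mlieBracket I' X Y p = covD D X Y p - covD D Y X p := by
  have h := (CovariantDerivative.torsion_eq_zero_iff (cov := D)).1 hD.torsion_eq_zero hX hY
  exact h.symm

variable {pr : N → M} {θ : OneForm I' N ℂ} {ε : Π p : N, (E × ℂ) →L[ℝ] TangentSpace I' p}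
  {J : EndField I M} {D : AffConn I M} {h : M → E →L[ℝ] E →L[ℝ] ℂ} {b : N → E →L[ℝ] E →L[ℝ] E}
  {k : N → E →L[ℝ] E →L[ℝ] ℂ}

lemma ConeData.dproj_coneJ (C : ConeData pr θ ε J D h b k) (p : N) (v : TangentSpace I' p) :
    dproj I I' pr p (coneJ pr θ ε J p v) = endAt J (pr p) (dproj I I' pr p v) := by
  rw [coneJ_apply, C.proj_frame]

lemma ConeData.form_coneJ (C : ConeData pr θ ε J D h b k) (p : N) (v : TangentSpace I' p) :
    θ p (coneJ pr θ ε J p v) = Complex.I * θ p v := by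
  rw [coneJ_apply, C.form_frame]

lemma ConeData.endAt_sq (C : ConeData pr θ ε J D h b k) (x : M) (v : E) :
    endAt J x (endAt J x v) = -v := C.complexBase.sq x v

lemma ConeData.coneJ_sq (C : ConeData pr θ ε J D h b k) (p : N) (v : TangentSpace I' p) :
    coneJ pr θ ε J p (coneJ pr θ ε J p v) = -v := by
  refine C.frame_injective ?_ ?_
  · rw [C.dproj_coneJ, C.dproj_coneJ, C.endAt_sq, map_neg]
  · rw [C.form_coneJ, C.form_coneJ, ← mul_assoc, Complex.I_mul_I, map_neg, neg_one_mul]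

lemma ConeData.coframe_coneJ (C : ConeData pr θ ε J D h b k) {x₀ : M} {q : N}
    (hq : pr q ∈ (chartAt H x₀).source) (v : TangentSpace I' q) :
    coneCoframe I pr θ x₀ q (coneJ pr θ ε J q v)
      = (conj₁ x₀ (pr q) (J (pr q)) (coneCoframe I pr θ x₀ q v).1,
        Complex.I * (coneCoframe I pr θ x₀ q v).2) := by
  refine Prod.ext ?_ (C.form_coneJ q v)
  have h1 : conj₁ x₀ (pr q) (J (pr q)) (coneCoframe I pr θ x₀ q v).1
    = toChart (I := I) x₀ (pr q) (J (pr q) (mfderiv I' I pr q v)) := conj₁_toChart hq _ _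
  refine Eq.trans ?_ h1.symm
  exact congrArg (fun e : E => toChart (I := I) x₀ (pr q) e) (C.dproj_coneJ q v)

lemma ConeData.smooth_coneJ (C : ConeData pr θ ε J D h b k) {Y : VField I' N} {q : N}
    (hY : SmoothVFAt Y q) : SmoothVFAt (appEnd (coneJ pr θ ε J) Y) q := by
  have hq := mem_chart_source H (pr q)
  refine (C.isCoframe (pr q)).smoothVFAt_of_form hq ?_
  have h1 := ((C.isCoframe (pr q)).smooth q hq).apply hY
  have hJ := (contMDiffAt_conj₁ C.complexBase.smooth hq).comp q (C.smooth_proj q)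
  have h2 := (hJ.clm_apply ((ContinuousLinearMap.fst ℝ E ℂ).contMDiff.contMDiffAt.comp q
    h1)).prodMk_space ((ContinuousLinearMap.mul ℝ ℂ Complex.I).contMDiff.contMDiffAt.comp q
      ((ContinuousLinearMap.snd ℝ E ℂ).contMDiff.contMDiffAt.comp q h1))
  refine h2.congr_of_eventuallyEq ?_
  filter_upwards [(C.isCoframe (pr q)).isOpen.mem_nhds hq] with y hy
  exact C.coframe_coneJ hy _

/-- The covariant derivative of the complex structure on the cone. -/
lemma ConeData.covEnd_eq (C : ConeData pr θ ε J D h b k) {X Y : VField I' N} {p : N}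
    (hY : SmoothVFAt Y p) :
    covEnd (coneConn C) (coneJ pr θ ε J) X Y p
      = ε p ((-2 : ℝ) • endAt J (pr p) (b p (dproj I I' pr p (X p)) (dproj I I' pr p (Y p))),
        -(2 * Complex.I * k p (dproj I I' pr p (X p)) (dproj I I' pr p (Y p)))) := by
  have hq := mem_chart_source H (pr p)
  refine (C.isCoframe (pr p)).injective hq ?_
  have hJY := C.smooth_coneJ hY
  unfold covEnd covD
  rw [map_sub, C.coframe_coneJ hq, (C.isConnForm (pr p)).eq p hq _ hJY.diff,
    (C.isConnForm (pr p)).eq p hq _ hY.diff]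
  have hϑ := ((C.isCoframe (pr p)).smooth p hq).diff_apply hY.diff
  have hpd : MDifferentiableAt I' I pr p := (C.smooth_proj p).mdifferentiableAt (by simp)
  have hJ := (contMDiffAt_conj₁ C.complexBase.smooth hq).mdifferentiableAt (n := ∞) (by simp)
  have hJ' : MDifferentiableAt I' 𝓘(ℝ, E →L[ℝ] E)
    (fun q => conj₁ (pr p) (pr q) (J (pr q))) p := MDifferentiableAt.comp p hJ hpd
  have eJ : mvfderiv I' (fun q => conj₁ (pr p) (pr q) (J (pr q))) p (X p)
      = mvfderiv I (fun q => conj₁ (pr p) q (J q)) (pr p) (dproj I I' pr p (X p)) :=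
    mvfderiv_mcomp hJ hpd (X p)
  have hϑ1 : MDifferentiableAt I' 𝓘(ℝ, E) (fun q => (coneCoframe I pr θ (pr p) q (Y q)).1) p :=
    (ContinuousLinearMap.fst ℝ E ℂ).differentiableAt.comp_mdifferentiableAt hϑ
  have hϑ2 : MDifferentiableAt I' 𝓘(ℝ, ℂ) (fun q => (coneCoframe I pr θ (pr p) q (Y q)).2) p :=
    (ContinuousLinearMap.snd ℝ E ℂ).differentiableAt.comp_mdifferentiableAt hϑ
  have e1 := mvfderiv_clm_comp (ContinuousLinearMap.fst ℝ E ℂ) hϑ (X p)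
  have e2 := mvfderiv_clm_comp (ContinuousLinearMap.snd ℝ E ℂ) hϑ (X p)
  have e3 : mvfderiv I' (fun y => coneCoframe I pr θ (pr p) y
      (appEnd (coneJ pr θ ε J) Y y)) p (X p)
      = (mvfderiv I (fun q => conj₁ (pr p) q (J q)) (pr p) (dproj I I' pr p (X p))
            (dproj I I' pr p (Y p))
          + endAt J (pr p) (mvfderiv I' (fun q => coneCoframe I pr θ (pr p) q (Y q)) p (X p)).1,
        Complex.I * (mvfderiv I' (fun q => coneCoframe I pr θ (pr p) q (Y q)) p (X p)).2) := by
    have h1 : (fun y => coneCoframe I pr θ (pr p) y (appEnd (coneJ pr θ ε J) Y y)) =ᶠ[𝓝 p]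
        fun y => (conj₁ (pr p) (pr y) (J (pr y)) (coneCoframe I pr θ (pr p) y (Y y)).1,
          ContinuousLinearMap.mul ℝ ℂ Complex.I (coneCoframe I pr θ (pr p) y (Y y)).2) := by
      filter_upwards [(C.isCoframe (pr p)).isOpen.mem_nhds hq] with y hy
      exact C.coframe_coneJ hy _
    have hI : MDifferentiableAt I' 𝓘(ℝ, ℂ) (fun y => ContinuousLinearMap.mul ℝ ℂ Complex.I
        (coneCoframe I pr θ (pr p) y (Y y)).2) p :=
      (ContinuousLinearMap.mul ℝ ℂ Complex.I).differentiableAt.comp_mdifferentiableAt hϑ2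
    rw [mvfderiv_congr h1]
    refine (mvfderiv_prodMk (hJ'.clm_apply hϑ1) hI (X p)).trans ?_
    rw [mvfderiv_clm_apply hJ' hϑ1, mvfderiv_clm_comp (ContinuousLinearMap.mul ℝ ℂ Complex.I) hϑ2,
      conj₁_self_eq, eJ, coneCoframe_self]
    refine Prod.ext ?_ ?_
    · exact congrArg (fun e : E => _ + endAt J (pr p) e) e1
    · exact congrArg (fun e : ℂ => Complex.I * e) e2
  have ho : ∀ e : E, (ofChart (I := I) (pr p) (pr p) e : E) = e :=
    ofChart_self (E := E) (I := I) (pr p)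
  have hJd : ∀ u w : E, mvfderiv I (fun q => conj₁ (pr p) q (J q)) (pr p) u w
      = endAt J (pr p) (christoffel D (pr p) (pr p) u w)
        - christoffel D (pr p) (pr p) u (endAt J (pr p) w) := by
    intro u w
    have h1 := mvfderiv_conj₁ C.complexBase.smooth C.conn hq u w
    rw [conj₁_self_eq] at h1
    rw [← h1]
    exact congrArg (fun e : E => mvfderiv I (fun q => conj₁ (pr p) q (J q)) (pr p) e w) (ho u).symm
  rw [e3, hJd, conj₁_self_eq, coneCoframe_self, coneCoframe_self, coneCoframe_self,
    coneCoframe_self, ConeData.connForm_self, ConeData.connForm_self, C.proj_frame, C.form_frame]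
  have e4 : appEnd (coneJ pr θ ε J) Y p = coneJ pr θ ε J p (Y p) := rfl
  rw [e4, C.dproj_coneJ, C.form_coneJ]
  generalize mvfderiv I' (fun q => coneCoframe I pr θ (pr p) q (Y q)) p (X p) = d
  refine Prod.ext ?_ ?_
  · simp only [Prod.fst_sub, Prod.fst_add, add_apply, cmul, map_add, map_smul, C.endAt_sq, C.b_J,
      Complex.mul_re, Complex.mul_im, Complex.I_re, Complex.I_im]
    module
  · simp only [Prod.snd_sub, Prod.snd_add, add_apply, C.h_J, C.k_J]
    ring

lemma ConeData.covEnd_symm (C : ConeData pr θ ε J D h b k) {X Y : VField I' N} {p : N}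
    (hX : SmoothVFAt X p) (hY : SmoothVFAt Y p) :
    covEnd (coneConn C) (coneJ pr θ ε J) X Y p = covEnd (coneConn C) (coneJ pr θ ε J) Y X p := by
  rw [C.covEnd_eq hX, C.covEnd_eq hY, C.b_symm, C.k_symm]

lemma covD_appEnd (D : AffConn I' N) (J : EndField I' N) (X Y : VField I' N) (p : N) :
    covD D X (appEnd J Y) p = covEnd D J X Y p + J p (covD D X Y p) := by
  unfold covEnd
  abel

/-- The complex structure on the cone is integrable. -/
lemma ConeData.isComplexStructure (C : ConeData pr θ ε J D h b k) :
    IsComplexStructure (coneJ pr θ ε J) where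
  smooth _ hY q := C.smooth_coneJ (hY.at q)
  sq := C.coneJ_sq
  integrable X Y hX hY p := by
    have hT := C.isSmoothTorsionFree
    have hJX := C.smooth_coneJ (hX.at p)
    have hJY := C.smooth_coneJ (hY.at p)
    rw [mlieBracket_eq_covD hT hJX.diff hJY.diff, mlieBracket_eq_covD hT hJX.diff (hY.at p).diff,
      mlieBracket_eq_covD hT (hX.at p).diff hJY.diff,
      mlieBracket_eq_covD hT (hX.at p).diff (hY.at p).diff]
    simp only [covD_appEnd, map_sub, map_add, C.coneJ_sq]
    have h1 := C.covEnd_symm (hX.at p) (hY.at p)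
    have h2 : covEnd (coneConn C) (coneJ pr θ ε J) (appEnd (coneJ pr θ ε J) X) Y p
        = covEnd (coneConn C) (coneJ pr θ ε J) (appEnd (coneJ pr θ ε J) Y) X p := by
      rw [C.covEnd_symm hJX (hY.at p), C.covEnd_eq hJX, C.covEnd_eq (hX.at p)]
      have e : ∀ Y : VField I' N, appEnd (coneJ pr θ ε J) Y p = coneJ pr θ ε J p (Y p) :=
        fun _ => rfl
      rw [e, e, C.dproj_coneJ, C.dproj_coneJ, C.b_J, C.k_J, C.b_symm p (endAt J _ _),
        C.k_symm p (endAt J _ _), C.b_J, C.k_J, C.b_symm, C.k_symm]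
    rw [h1, h2]
    have h3 : ∀ X Y : VField I' N, covD (coneConn C) (appEnd (coneJ pr θ ε J) X) Y p
      = covD (coneConn C) (appEnd (coneJ pr θ ε J) X) Y p := fun _ _ => rfl
    abel

/-- The Euler field of the cone. -/
def coneEuler (ε : Π p : N, (E × ℂ) →L[ℝ] TangentSpace I' p) : VField I' N := fun p => ε p (0, 1)

lemma ConeData.coframe_euler (C : ConeData pr θ ε J D h b k) {x₀ : M} (q : N) :
    coneCoframe I pr θ x₀ q (coneEuler ε q) = (0, 1) := by
  refine Prod.ext ?_ (C.form_frame q _)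
  have h1 : toChart (I := I) x₀ (pr q) (dproj I I' pr q (coneEuler ε q)) = 0 := by
    rw [coneEuler, C.proj_frame]
    exact map_zero (toChart (I := I) x₀ (pr q))
  exact h1

lemma ConeData.smooth_euler (C : ConeData pr θ ε J D h b k) : SmoothVF (coneEuler ε) := by
  intro q
  have hq := mem_chart_source H (pr q)
  refine (C.isCoframe (pr q)).smoothVFAt_of_form hq ?_
  simp only [C.coframe_euler]
  exact contMDiffAt_const

lemma ConeData.cov_euler (C : ConeData pr θ ε J D h b k) (p : N) (v : TangentSpace I' p) :
    coneConn C (coneEuler ε) p v = v := by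
  have hq := mem_chart_source H (pr p)
  refine (C.isCoframe (pr p)).injective hq ?_
  rw [(C.isConnForm (pr p)).eq p hq _ (C.smooth_euler.at p).diff, C.coframe_euler,
    ConeData.connForm_self]
  simp only [C.coframe_euler, mvfderiv_const]
  refine Prod.ext ?_ ?_
  · simp [cmul_zero, cmul_one]
  · simp

lemma ConeData.isConicalSpecialComplex (C : ConeData pr θ ε J D h b k) :
    IsConicalSpecialComplex (coneJ pr θ ε J) (coneConn C) (coneEuler ε) where
  complex := C.isComplexStructure
  torsionFree := C.isSmoothTorsionFree
  flat X Y Z hX hY hZ p := C.flat (Filter.Eventually.of_forall hX) (Filter.Eventually.of_forall hY)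
    (Filter.Eventually.of_forall hZ)
  symmetric X Y hX hY p := C.covEnd_symm (hX.at p) (hY.at p)
  smooth_euler := C.smooth_euler
  euler_ne_zero p h0 := by
    have h1 := C.form_frame p (0, 1)
    have h2 : ε p (0, 1) = 0 := h0
    rw [h2, map_zero] at h1
    exact zero_ne_one h1
  cov_euler := C.cov_euler
  lie_euler Y hY p := by
    have hT := C.isSmoothTorsionFree
    have hξ := (C.smooth_euler.at p).diff
    have hJY := C.smooth_coneJ (hY.at p)
    rw [mlieBracket_eq_covD hT hξ hJY.diff, mlieBracket_eq_covD hT hξ (hY.at p).diff, map_sub,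
      covD_appEnd, C.covEnd_eq (hY.at p)]
    have h1 : ∀ Z : VField I' N, covD (coneConn C) Z (coneEuler ε) p = Z p := fun Z =>
      C.cov_euler p (Z p)
    have h2 : dproj I I' pr p (coneEuler ε p) = 0 := C.proj_frame p _
    rw [h1, h1, h2, map_zero, map_zero]
    have h3 : ((-2 : ℝ) • endAt J (pr p) ((0 : E →L[ℝ] E) (dproj I I' pr p (Y p))),
      -(2 * Complex.I * (0 : E →L[ℝ] ℂ) (dproj I I' pr p (Y p)))) = (0 : E × ℂ) := by
      simp
    rw [h3, map_zero, zero_add]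
    rfl

/-- The projection of the complex connection `∇ - (1/2) J (∇ J)`. -/
lemma ConeData.dproj_specialCovD (C : ConeData pr θ ε J D h b k) {X Y : VField I' N} {p : N}
    (hY : SmoothVFAt Y p) {Yb : VField I M} (hYb : SmoothVFAt Yb (pr p))
    (hproj : ∀ q, mfderiv I' I pr q (Y q) = Yb (pr q)) :
    dproj I I' pr p (specialCovD (coneJ pr θ ε J) (coneConn C) X Y p)
      = toChart (I := I) (pr p) (pr p) (D Yb (pr p) (mfderiv I' I pr p (X p)))
        + cmul (endAt J (pr p)) (θ p (X p)) (dproj I I' pr p (Y p))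
        + cmul (endAt J (pr p)) (θ p (Y p)) (dproj I I' pr p (X p)) := by
  have hq := mem_chart_source H (pr p)
  have hpd : MDifferentiableAt I' I pr p := (C.smooth_proj p).mdifferentiableAt (by simp)
  have hϑ := ((C.isCoframe (pr p)).smooth p hq).diff_apply hY.diff
  have e1 := mvfderiv_clm_comp (ContinuousLinearMap.fst ℝ E ℂ) hϑ (X p)
  have h1 := (C.isConnForm (pr p)).eq p hq _ hY.diff (X p)
  rw [coneCoframe_self, coneCoframe_self, coneCoframe_self, ConeData.connForm_self] at h1
  have h2 : dproj I I' pr p (coneConn C Y p (X p)) = _ := congrArg Prod.fst h1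
  have hd : mvfderiv I' (fun y => toChart (I := I) (pr p) (pr y) (Yb (pr y))) p (X p)
      = (mvfderiv I' (fun y => coneCoframe I pr θ (pr p) y (Y y)) p (X p)).1 := by
    refine Eq.trans ?_ e1
    refine congrArg (fun L : TangentSpace I' p →L[ℝ] E => L (X p)) (mvfderiv_congr ?_)
    refine Filter.Eventually.of_forall fun y => ?_
    exact congrArg (fun e : TangentSpace I (pr y) => toChart (I := I) (pr p) (pr y) e) (hproj y).symm
  have hd2 := mvfderiv_mcomp ((mdifferentiableAt_vf_iff hq).1 hYb.diff) hpd (X p)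
  have h3 := toChart_affConn D hq hYb.diff (mfderiv I' I pr p (X p))
  have hs : ∀ e : E, toChart (I := I) (pr p) (pr p) e = e := toChart_self (E := E) (I := I) (pr p)
  have hYp : dproj I I' pr p (Y p) = Yb (pr p) := hproj p
  have h4 : toChart (I := I) (pr p) (pr p) (D Yb (pr p) (mfderiv I' I pr p (X p)))
      = (mvfderiv I' (fun y => coneCoframe I pr θ (pr p) y (Y y)) p (X p)).1
        + christoffel D (pr p) (pr p) (dproj I I' pr p (X p)) (dproj I I' pr p (Y p)) := by
    refine h3.trans ?_
    rw [← hd, hd2]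
    exact congrArg₂ (fun a a' : E =>
      mvfderiv I (fun y => toChart (I := I) (pr p) y (Yb y)) (pr p) (mfderiv I' I pr p (X p))
        + christoffel D (pr p) (pr p) a a') (hs _) ((hs _).trans hYp.symm)
  have h5 : dproj I I' pr p (specialCovD (coneJ pr θ ε J) (coneConn C) X Y p)
      = dproj I I' pr p (coneConn C Y p (X p))
        - b p (dproj I I' pr p (X p)) (dproj I I' pr p (Y p)) := by
    unfold specialCovD covD
    rw [map_sub, map_smul, C.dproj_coneJ, C.covEnd_eq hY, C.proj_frame, map_smul, C.endAt_sq]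
    module
  rw [h5, h2, h4]
  simp only [Prod.fst_add, add_apply]
  abel

end ConeStructure

section CovariantExterior

variable {E : Type*} [NormedAddCommGroup E] [NormedSpace ℝ E] [FiniteDimensional ℝ E]
  [CompleteSpace E] {H : Type*} [TopologicalSpace H] {I : ModelWithCorners ℝ E H} [I.Boundaryless]
  {M : Type*} [TopologicalSpace M] [T2Space M] [ChartedSpace H M] [IsManifold I ∞ M]
  {F : Type*} [NormedAddCommGroup F] [NormedSpace ℝ F]

lemma contMDiffAt_pull₂ {L : M → E →L[ℝ] E →L[ℝ] F} {x₀ x : M} (hx : x ∈ (chartAt H x₀).source)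
    (h : ∀ Y Z : VField I M, SmoothVF Y → SmoothVF Z →
      ContMDiffAt I 𝓘(ℝ, F) ∞ (fun y => L y (Y y : E) (Z y : E)) x) :
    ContMDiffAt I 𝓘(ℝ, E →L[ℝ] E →L[ℝ] F) ∞ (fun q => pull₂ I x₀ q (L q)) x := by
  refine contMDiffAt_clm_of_apply₂ fun e e' => ?_
  obtain ⟨Y, hY, hYe⟩ := exists_smoothVF_chart (I := I) hx e
  obtain ⟨Z, hZ, hZe⟩ := exists_smoothVF_chart (I := I) hx e'
  refine (h Y Z hY hZ).congr_of_eventuallyEq ?_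
  filter_upwards [hYe, hZe] with y h1 h2
  exact (congrArg₂ (fun a b : E => L y a b) h1 h2).symm

lemma contMDiffAt_conj₂ {B : M → E →L[ℝ] E →L[ℝ] E} {x₀ x : M} (hx : x ∈ (chartAt H x₀).source)
    (h : ∀ Y Z : VField I M, SmoothVF Y → SmoothVF Z →
      SmoothVFAt (I := I) (fun y => B y (Y y : E) (Z y : E)) x) :
    ContMDiffAt I 𝓘(ℝ, E →L[ℝ] E →L[ℝ] E) ∞ (fun q => conj₂ I x₀ q (B q)) x := by
  refine contMDiffAt_clm_of_apply₂ fun e e' => ?_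
  obtain ⟨Y, hY, hYe⟩ := exists_smoothVF_chart (I := I) hx e
  obtain ⟨Z, hZ, hZe⟩ := exists_smoothVF_chart (I := I) hx e'
  refine ((contMDiffAt_vf_iff hx).1 (h Y Z hY hZ)).congr_of_eventuallyEq ?_
  filter_upwards [hYe, hZe] with y h1 h2
  exact (congrArg₂ (fun a b : E => toChart (I := I) x₀ y (B y a b)) h1 h2).symm

/-- The exterior covariant derivative of a form of degree two, in the preferred chart at `x`. -/
def extCovForm (D : AffConn I M) (L : M → E →L[ℝ] E →L[ℝ] F) (x : M) (u v w : E) : F :=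
  mvfderiv I (fun q => pull₂ I x q (L q)) x u v w
    - mvfderiv I (fun q => pull₂ I x q (L q)) x v u w
    - L x v (christoffel D x x u w) + L x u (christoffel D x x v w)

/-- The exterior covariant derivative of a (1,2)-tensor, in the preferred chart at `x`. -/
def extCovTensor (D : AffConn I M) (B : M → E →L[ℝ] E →L[ℝ] E) (x : M) (u v w : E) : E :=
  mvfderiv I (fun q => conj₂ I x q (B q)) x u v w
    - mvfderiv I (fun q => conj₂ I x q (B q)) x v u w
    + christoffel D x x u (B x v w) - B x v (christoffel D x x u w)
    - christoffel D x x v (B x u w) + B x u (christoffel D x x v w)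

lemma mvfderiv_apply₂ {A : M → E →L[ℝ] E →L[ℝ] F} {f g : M → E} {x : M}
    (hA : MDifferentiableAt I 𝓘(ℝ, E →L[ℝ] E →L[ℝ] F) A x) (hf : MDifferentiableAt I 𝓘(ℝ, E) f x)
    (hg : MDifferentiableAt I 𝓘(ℝ, E) g x) (t : TangentSpace I x) :
    mvfderiv I (fun y => A y (f y) (g y)) x t
      = mvfderiv I A x t (f x) (g x) + A x (mvfderiv I f x t) (g x)
        + A x (f x) (mvfderiv I g x t) := by
  rw [mvfderiv_clm_apply (hA.clm_apply hf) hg, mvfderiv_clm_apply hA hf, add_apply]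

/-- The covariant derivative in the chart centred at the point. -/
lemma covD_eq_chart (D : AffConn I M) {X Y : VField I M} {x : M} (hY : SmoothVFAt Y x) :
    (covD D X Y x : E) = mvfderiv I (fun y => toChart (I := I) x y (Y y)) x (X x)
      + christoffel D x x (X x) (Y x) := by
  have h := toChart_affConn D (mem_chart_source H x) hY.diff (X x)
  have hs : ∀ e : E, toChart (I := I) x x e = e := toChart_self (E := E) (I := I) x
  exact (hs _).symm.trans (h.trans (congrArg₂ (fun a a' : E =>
    mvfderiv I (fun y => toChart (I := I) x y (Y y)) x (X x) + christoffel D x x a a')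
    (hs _) (hs _)))

lemma cov02_eq {D : AffConn I M} {l : Form2 I M} {L : M → E →L[ℝ] E →L[ℝ] ℝ} {x : M}
    (hl : ∀ᶠ y in 𝓝 x, ∀ u v : E, l y u v = L y u v)
    (hL : MDifferentiableAt I 𝓘(ℝ, E →L[ℝ] E →L[ℝ] ℝ) (fun q => pull₂ I x q (L q)) x)
    {X Y Z : VField I M} (hY : SmoothVF Y) (hZ : SmoothVF Z) :
    cov02 D l X Y Z x
      = mvfderiv I (fun q => pull₂ I x q (L q)) x (X x) (Y x : E) (Z x : E)
        - L x (christoffel D x x (X x) (Y x)) (Z x : E)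
        - L x (Y x : E) (christoffel D x x (X x) (Z x)) := by
  have hx := mem_chart_source H x
  have hs : ∀ e : E, toChart (I := I) x x e = e := toChart_self (E := E) (I := I) x
  have h1 : (fun y => l y (Y y) (Z y)) =ᶠ[𝓝 x] fun y => pull₂ I x y (L y)
      (toChart (I := I) x y (Y y)) (toChart (I := I) x y (Z y)) := by
    filter_upwards [hl, (chartAt H x).open_source.mem_nhds hx] with y h2 hy
    exact (h2 _ _).trans (pull₂_toChart hy _ _ _).symm
  have h2 := mvfderiv_apply₂ hL ((mdifferentiableAt_vf_iff hx).1 (hY.at x).diff)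
    ((mdifferentiableAt_vf_iff hx).1 (hZ.at x).diff) (X x)
  have h3 : ∀ a b a' b' : E, a = a' → b = b' → L x a b = L x a' b' := by rintro _ _ _ _ rfl rfl; rfl
  have h4 := hl.self_of_nhds
  unfold cov02
  rw [mvfderiv_congr h1, h2]
  have e1 := h3 _ _ _ _ (covD_eq_chart D (X := X) (hY.at x)) (rfl : (Z x : E) = Z x)
  have e2 := h3 _ _ _ _ (rfl : (Y x : E) = Y x) (covD_eq_chart D (X := X) (hZ.at x))
  have h5 : ∀ a b c : E, L x (a + b) c = L x a c + L x b c := fun a b c => by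
    rw [map_add, add_apply]
  have e3 := ((h4 (covD D X Y x) (Z x)).trans e1).trans (h5 _ _ _)
  have e4 := ((h4 (Y x) (covD D X Z x)).trans e2).trans (map_add (L x (Y x : E)) _ _)
  have e5 : ∀ a : E, pull₂ I x x (L x) a (toChart (I := I) x x (Z x)) = L x a (Z x : E) := fun a =>
    (congrArg (fun b : E => pull₂ I x x (L x) a b) (hs _)).trans (pull₂_self x (L x) a (Z x : E))
  have e6 : ∀ a : E, pull₂ I x x (L x) (toChart (I := I) x x (Y x)) a = L x (Y x : E) a := fun a =>
    (congrArg (fun b : E => pull₂ I x x (L x) b a) (hs _)).trans (pull₂_self x (L x) (Y x : E) a)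
  have e7 : mvfderiv I (fun q => pull₂ I x q (L q)) x (X x) (toChart (I := I) x x (Y x))
      (toChart (I := I) x x (Z x))
      = mvfderiv I (fun q => pull₂ I x q (L q)) x (X x) (Y x : E) (Z x : E) :=
    congrArg₂ (fun a b : E => mvfderiv I (fun q => pull₂ I x q (L q)) x (X x) a b) (hs _) (hs _)
  rw [e5, e6, e7]
  linear_combination -e3 - e4

lemma extCov02_eq {D : AffConn I M} (hD : IsSmoothTorsionFree D) {l : Form2 I M}
    {L : M → E →L[ℝ] E →L[ℝ] ℝ} {x : M}
    (hl : ∀ᶠ y in 𝓝 x, ∀ u v : E, l y u v = L y u v)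
    (hL : MDifferentiableAt I 𝓘(ℝ, E →L[ℝ] E →L[ℝ] ℝ) (fun q => pull₂ I x q (L q)) x)
    {X Y Z : VField I M} (hX : SmoothVF X) (hY : SmoothVF Y) (hZ : SmoothVF Z) :
    extCov02 D l X Y Z x = extCovForm D L x (X x) (Y x) (Z x) := by
  unfold extCov02 extCovForm
  have hs : (christoffel D x x (X x) (Y x) : E) = christoffel D x x (Y x) (X x) :=
    christoffel_symm hD (mem_chart_source H x) _ _
  refine (congrArg₂ (fun a b : ℝ => a - b) (cov02_eq (X := X) hl hL hY hZ)
    (cov02_eq (X := Y) hl hL hX hZ)).trans ?_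
  have h3 := congrArg (fun a : E => L x a (Z x : E)) hs
  linear_combination -h3

lemma cov12_eq {D : AffConn I M} {B : M → E →L[ℝ] E →L[ℝ] E} {x : M}
    (hBs : ∀ Y Z : VField I M, SmoothVF Y → SmoothVF Z →
      SmoothVFAt (I := I) (fun y => B y (Y y : E) (Z y : E)) x)
    (hB : MDifferentiableAt I 𝓘(ℝ, E →L[ℝ] E →L[ℝ] E) (fun q => conj₂ I x q (B q)) x)
    {X Y Z : VField I M} (hY : SmoothVF Y) (hZ : SmoothVF Z) :
    (cov12 D B X Y Z x : E)
      = mvfderiv I (fun q => conj₂ I x q (B q)) x (X x) (Y x : E) (Z x : E)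
        + christoffel D x x (X x) (B x (Y x : E) (Z x : E))
        - B x (christoffel D x x (X x) (Y x)) (Z x : E)
        - B x (Y x : E) (christoffel D x x (X x) (Z x)) := by
  have hx := mem_chart_source H x
  have hs : ∀ e : E, toChart (I := I) x x e = e := toChart_self (E := E) (I := I) x
  have h1 : (fun y => toChart (I := I) x y (app12 B Y Z y)) =ᶠ[𝓝 x] fun y => conj₂ I x y (B y)
      (toChart (I := I) x y (Y y)) (toChart (I := I) x y (Z y)) := by
    filter_upwards [(chartAt H x).open_source.mem_nhds hx] with y hy
    exact (conj₂_toChart hy (B y) _ _).symm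
  have h2 := mvfderiv_apply₂ hB ((mdifferentiableAt_vf_iff hx).1 (hY.at x).diff)
    ((mdifferentiableAt_vf_iff hx).1 (hZ.at x).diff) (X x)
  have h3 : ∀ a b a' b' : E, a = a' → b = b' → B x a b = B x a' b' := by rintro _ _ _ _ rfl rfl; rfl
  have e1 := h3 _ _ _ _ (covD_eq_chart D (X := X) (hY.at x)) (rfl : (Z x : E) = Z x)
  have e2 := h3 _ _ _ _ (rfl : (Y x : E) = Y x) (covD_eq_chart D (X := X) (hZ.at x))
  have e3 := covD_eq_chart D (X := X) (Y := app12 B Y Z) (hBs Y Z hY hZ)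
  rw [mvfderiv_congr h1, h2] at e3
  have e5 : ∀ a : E, conj₂ I x x (B x) a (toChart (I := I) x x (Z x)) = B x a (Z x : E) := fun a =>
    (congrArg (fun b : E => conj₂ I x x (B x) a b) (hs _)).trans (conj₂_self x (B x) a (Z x : E))
  have e6 : ∀ a : E, conj₂ I x x (B x) (toChart (I := I) x x (Y x)) a = B x (Y x : E) a := fun a =>
    (congrArg (fun b : E => conj₂ I x x (B x) b a) (hs _)).trans (conj₂_self x (B x) (Y x : E) a)
  have e7 : mvfderiv I (fun q => conj₂ I x q (B q)) x (X x) (toChart (I := I) x x (Y x))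
      (toChart (I := I) x x (Z x))
      = mvfderiv I (fun q => conj₂ I x q (B q)) x (X x) (Y x : E) (Z x : E) :=
    congrArg₂ (fun a b : E => mvfderiv I (fun q => conj₂ I x q (B q)) x (X x) a b) (hs _) (hs _)
  rw [e5, e6, e7] at e3
  have h5 : ∀ a b c : E, B x (a + b) c = B x a c + B x b c := fun a b c => by
    rw [map_add, add_apply]
  have e8 : (covD D X (app12 B Y Z) x : E)
      = mvfderiv I (fun q => conj₂ I x q (B q)) x (X x) (Y x : E) (Z x : E)
        + B x (mvfderiv I (fun y => toChart (I := I) x y (Y y)) x (X x)) (Z x : E)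
        + B x (Y x : E) (mvfderiv I (fun y => toChart (I := I) x y (Z y)) x (X x))
        + christoffel D x x (X x) (B x (Y x : E) (Z x : E)) := e3
  unfold cov12
  refine (congrArg₂ (fun a b : E => a - b) (congrArg₂ (fun a b : E => a - b) e8
    (e1.trans (h5 _ _ _))) (e2.trans (map_add (B x (Y x : E)) _ _))).trans ?_
  abel

lemma extCov12_eq {D : AffConn I M} (hD : IsSmoothTorsionFree D)
    {B : M → E →L[ℝ] E →L[ℝ] E} {x : M}
    (hBs : ∀ Y Z : VField I M, SmoothVF Y → SmoothVF Z →
      SmoothVFAt (I := I) (fun y => B y (Y y : E) (Z y : E)) x)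
    (hB : MDifferentiableAt I 𝓘(ℝ, E →L[ℝ] E →L[ℝ] E) (fun q => conj₂ I x q (B q)) x)
    {X Y Z : VField I M} (hX : SmoothVF X) (hY : SmoothVF Y) (hZ : SmoothVF Z) :
    (extCov12 D B X Y Z x : E) = extCovTensor D B x (X x) (Y x) (Z x) := by
  unfold extCov12 extCovTensor
  have hs : (christoffel D x x (X x) (Y x) : E) = christoffel D x x (Y x) (X x) :=
    christoffel_symm hD (mem_chart_source H x) _ _
  refine (congrArg₂ (fun a b : E => a - b) (cov12_eq (X := X) hBs hB hY hZ)
    (cov12_eq (X := Y) hBs hB hX hZ)).trans ?_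
  have h3 := congrArg (fun a : E => B x a (Z x : E)) hs
  linear_combination (norm := module) -h3

/-! ### Complexification of forms -/

/-- The complex form `l + s i l_J`. -/
def complexify (s : ℝ) (J : E →L[ℝ] E) (l : E →L[ℝ] E →L[ℝ] ℝ) : E →L[ℝ] E →L[ℝ] ℂ :=
  ContinuousLinearMap.compL ℝ E ℝ ℂ Complex.ofRealCLM ∘L l
    + ContinuousLinearMap.compL ℝ E ℝ ℂ (ContinuousLinearMap.toSpanSingleton ℝ (s * Complex.I)) ∘L
      (ContinuousLinearMap.compL ℝ E E ℝ).flip J ∘L l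

lemma complexify_apply (s : ℝ) (J : E →L[ℝ] E) (l : E →L[ℝ] E →L[ℝ] ℝ) (u v : E) :
    complexify s J l u v = l u v + s * Complex.I * l u (J v) := by
  simp [complexify]
  ring

lemma complexify_J (s : ℝ) {J : E →L[ℝ] E} (hJ : ∀ v, J (J v) = -v) (hs : s ^ 2 = 1)
    (l : E →L[ℝ] E →L[ℝ] ℝ) (u v : E) :
    complexify s J l u (J v) = - (s * Complex.I * complexify s J l u v) := by
  have h : (s : ℂ) ^ 2 = 1 := by exact_mod_cast hs
  rw [complexify_apply, complexify_apply, hJ, map_neg]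
  push_cast
  linear_combination (-(l u (J v) : ℂ)) * h + (s : ℂ) ^ 2 * (l u (J v) : ℂ) * Complex.I_sq

lemma contMDiffAt_complexify {J : EndField I M}
    (hJ : ∀ Y : VField I M, SmoothVF Y → SmoothVF (appEnd J Y)) (s : ℝ)
    {L : M → E →L[ℝ] E →L[ℝ] ℝ} {x₀ x : M} (hx : x ∈ (chartAt H x₀).source)
    (h : ∀ Y Z : VField I M, SmoothVF Y → SmoothVF Z →
      ContMDiffAt I 𝓘(ℝ, ℝ) ∞ (fun y => L y (Y y : E) (Z y : E)) x) :
    ContMDiffAt I 𝓘(ℝ, E →L[ℝ] E →L[ℝ] ℂ) ∞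
      (fun q => pull₂ I x₀ q (complexify s (endAt J q) (L q))) x := by
  refine contMDiffAt_pull₂ hx fun Y Z hY hZ => ?_
  have h1 := Complex.ofRealCLM.contMDiff.contMDiffAt.comp x (h Y Z hY hZ)
  have h2 := (ContinuousLinearMap.toSpanSingleton ℝ ((s : ℂ) * Complex.I)).contMDiff.contMDiffAt.comp x
    (h Y _ hY (hJ Z hZ))
  refine (h1.add h2).congr_of_eventuallyEq (Filter.Eventually.of_forall fun y => ?_)
  refine (complexify_apply _ _ _ _ _).trans ?_
  simp only [Pi.add_apply, Function.comp_apply, Complex.ofRealCLM_apply,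
    ContinuousLinearMap.toSpanSingleton_apply, Complex.real_smul]
  exact congrArg (fun z : ℂ => _ + z) (mul_comm _ _)

lemma pull₂_complexify (J : EndField I M) (s : ℝ) (l : E →L[ℝ] E →L[ℝ] ℝ) {x₀ x : M}
    (hx : x ∈ (chartAt H x₀).source) :
    pull₂ I x₀ x (complexify s (endAt J x) l)
      = complexify s (conj₁ x₀ x (J x)) (pull₂ I x₀ x l) := by
  ext e e'
  refine (complexify_apply s (endAt J x) l (ofChart (I := I) x₀ x e)
    (ofChart (I := I) x₀ x e')).trans (Eq.trans ?_ (complexify_apply _ _ _ _ _).symm)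
  have h : (ofChart (I := I) x₀ x (toChart x₀ x (J x (ofChart x₀ x e'))) : E)
    = endAt J x (ofChart (I := I) x₀ x e') := ofChart_toChart hx _
  exact congrArg (fun a : E => (l (ofChart (I := I) x₀ x e) (ofChart (I := I) x₀ x e') : ℂ)
    + s * Complex.I * (l (ofChart (I := I) x₀ x e) a : ℝ)) h.symm

lemma mvfderiv_complexify (s : ℝ) {A : M → E →L[ℝ] E} {L : M → E →L[ℝ] E →L[ℝ] ℝ} {x : M}
    (hA : MDifferentiableAt I 𝓘(ℝ, E →L[ℝ] E) A x)
    (hL : MDifferentiableAt I 𝓘(ℝ, E →L[ℝ] E →L[ℝ] ℝ) L x) (t : TangentSpace I x) (e e' : E) :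
    mvfderiv I (fun q => complexify s (A q) (L q) e e') x t
      = mvfderiv I L x t e e' + s * Complex.I *
        (mvfderiv I L x t e (A x e') + L x e (mvfderiv I A x t e') : ℝ) := by
  have hd1 := hL.clm_apply (mdifferentiableAt_const (I := I) (c := e))
  have hd2 := hd1.clm_apply (mdifferentiableAt_const (I := I) (c := e'))
  have hd3 := hA.clm_apply (mdifferentiableAt_const (I := I) (c := e'))
  have hd4 := hd1.clm_apply hd3
  have c1 := mvfderiv_clm_comp Complex.ofRealCLM hd2 t
  have c2 := mvfderiv_clm_comp (ContinuousLinearMap.toSpanSingleton ℝ ((s : ℂ) * Complex.I)) hd4 t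
  have c3 : mvfderiv I (fun q => L q e (A q e')) x t
      = mvfderiv I L x t e (A x e') + L x e (mvfderiv I A x t e') := by
    refine (mvfderiv_clm_apply hd1 hd3 t).trans ?_
    rw [mvfderiv_apply_const hL, mvfderiv_apply_const hA]
  have c4 := mvfderiv_fun_add_apply
    (Complex.ofRealCLM.differentiableAt.comp_mdifferentiableAt hd2)
    ((ContinuousLinearMap.toSpanSingleton ℝ
      ((s : ℂ) * Complex.I)).differentiableAt.comp_mdifferentiableAt hd4) t
  have h1 : (fun q => complexify s (A q) (L q) e e') = fun q => Complex.ofRealCLM (L q e e')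
      + ContinuousLinearMap.toSpanSingleton ℝ ((s : ℂ) * Complex.I) (L q e (A q e')) := by
    funext q
    rw [complexify_apply, ContinuousLinearMap.toSpanSingleton_apply, Complex.ofRealCLM_apply,
      Complex.real_smul, mul_comm (s * Complex.I)]
  rw [h1]
  refine c4.trans ((congrArg₂ (fun a b : ℂ => a + b) c1 c2).trans ?_)
  rw [c3, mvfderiv_apply_const₂ hL, ContinuousLinearMap.toSpanSingleton_apply,
    Complex.ofRealCLM_apply, Complex.real_smul, mul_comm (s * Complex.I)]

lemma extCovForm_complexify {J : EndField I M}
    (hJ : ∀ Y : VField I M, SmoothVF Y → SmoothVF (appEnd J Y)) {D : AffConn I M}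
    (hD : IsTorsionFreeComplex J D) (s : ℝ) {L : M → E →L[ℝ] E →L[ℝ] ℝ} {x : M}
    (h : ∀ Y Z : VField I M, SmoothVF Y → SmoothVF Z →
      ContMDiffAt I 𝓘(ℝ, ℝ) ∞ (fun y => L y (Y y : E) (Z y : E)) x) (u v w : E) :
    extCovForm D (fun y => complexify s (endAt J y) (L y)) x u v w
      = extCovForm D L x u v w + s * Complex.I * extCovForm D L x u v (endAt J x w) := by
  have hx := mem_chart_source H x
  have hL := (contMDiffAt_pull₂ hx h).mdifferentiableAt (n := ∞) (by simp)
  have hCL := (contMDiffAt_complexify hJ s hx h).mdifferentiableAt (n := ∞) (by simp)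
  have hJd := (contMDiffAt_conj₁ hJ hx).mdifferentiableAt (n := ∞) (by simp)
  have hJx := conj₁_self_eq J x
  have hJu : ∀ (t : E) (e : E), mvfderiv I (fun q => conj₁ x q (J q)) x t e
      = endAt J x (christoffel D x x t e) - christoffel D x x t (endAt J x e) := fun t e => by
    have h1 := mvfderiv_conj₁ hJ hD hx t e
    rw [hJx] at h1
    refine Eq.trans ?_ h1
    exact congrArg (fun a : TangentSpace I x => mvfderiv I (fun q => conj₁ x q (J q)) x a e)
      (ofChart_self (E := E) (I := I) x t).symm
  have key : ∀ (t : E) (e e' : E),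
      mvfderiv I (fun q => pull₂ I x q (complexify s (endAt J q) (L q))) x t e e'
      = mvfderiv I (fun q => pull₂ I x q (L q)) x t e e'
        + s * Complex.I * (mvfderiv I (fun q => pull₂ I x q (L q)) x t e (endAt J x e')
          + L x e (endAt J x (christoffel D x x t e') - christoffel D x x t (endAt J x e'))
            : ℝ) := by
    intro t e e'
    refine (mvfderiv_apply_const₂ hCL e e' t).symm.trans ?_
    have h1 : (fun q => pull₂ I x q (complexify s (endAt J q) (L q)) e e') =ᶠ[𝓝 x]
        fun q => complexify s (conj₁ x q (J q)) (pull₂ I x q (L q)) e e' := by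
      filter_upwards [(chartAt H x).open_source.mem_nhds hx] with q hq
      rw [pull₂_complexify J s (L q) hq]
    rw [mvfderiv_congr h1]
    refine (mvfderiv_complexify s hJd hL t e e').trans ?_
    have h2 := hJu t e'
    rw [hJx, pull₂_self, h2]
  unfold extCovForm
  rw [key, key]
  simp only [complexify_apply, map_sub]
  push_cast
  ring

end CovariantExterior

section TraceForm

variable {E : Type*} [NormedAddCommGroup E] [NormedSpace ℝ E] [FiniteDimensional ℝ E]

lemma isBilin_trace (b : E →L[ℝ] E →L[ℝ] E) : IsBilin (fun u v => trL E (b u ∘L b v)) := by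
  refine isBilin_of ?_ ?_ ?_ ?_ <;> intros <;>
    simp only [map_add, map_smul, ContinuousLinearMap.add_comp, ContinuousLinearMap.comp_add,
      ContinuousLinearMap.smul_comp, ContinuousLinearMap.comp_smul]

lemma trace_J {b : E →L[ℝ] E →L[ℝ] E} {J : E →L[ℝ] E} (hs : ∀ v w, b v w = b w v)
    (hJ : ∀ v w, b v (J w) = - J (b v w)) (u v : E) :
    trL E (b u ∘L b (J v)) = - trL E (b v ∘L b (J u)) := by
  have h1 : ∀ u, b (J u) = - (J ∘L b u) := fun u => by
    ext w
    rw [hs, hJ, hs]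
    rfl
  have h2 : ∀ u, b u ∘L J = - (J ∘L b u) := fun u => by
    ext w
    exact hJ u w
  rw [h1, h1, ContinuousLinearMap.comp_neg, ContinuousLinearMap.comp_neg, map_neg, map_neg,
    ← ContinuousLinearMap.comp_assoc, h2, ContinuousLinearMap.neg_comp, map_neg,
    ← ContinuousLinearMap.comp_assoc, neg_neg, neg_neg, trL_comm (b v ∘L J), ← ContinuousLinearMap.comp_assoc, trL_comm _ J,
    ContinuousLinearMap.comp_assoc]

lemma comp_of_cmul {b b' : E →L[ℝ] E →L[ℝ] E} {J : E →L[ℝ] E} {z : ℂ} (hz : z * starRingEnd ℂ z = 1)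
    (hJ2 : ∀ v, J (J v) = -v)
    (hJ : ∀ v w, b v (J w) = - J (b v w)) (hb : ∀ v w, b' v w = cmul J z (b v w)) (u v w : E) :
    b' u (b' v w) = b u (b v w) := by
  have h : b u (cmul J z (b v w)) = cmul J (starRingEnd ℂ z) (b u (b v w)) := by
    simp only [cmul, map_add, map_smul, hJ, Complex.conj_re, Complex.conj_im]
    module
  rw [hb, hb, h, cmul_cmul hJ2, hz, cmul_one]

lemma trL_conj {T T' : E →L[ℝ] E} (h : ∀ v, T' (T v) = v) (A : E →L[ℝ] E) :
    trL E (T ∘L A ∘L T') = trL E A := by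
  rw [trL_comm, ContinuousLinearMap.comp_assoc]
  congr 1
  ext v
  exact congrArg A (h v)

lemma curv_of_weyl_algebra {n : ℕ} {R W Q : E} {ρ t : E → E → ℝ} {J : E → E} {u v w : E}
    (t1 : t v u = t u v) (t2 : t v (J u) = - t u (J v))
    (hW : W = R + ((ρ u v - ρ v u) / 2) • w - ((ρ u (J v) - ρ v (J u)) / 2) • J w
      + (1 / 2 : ℝ) • (ρ u w • v - ρ v w • u) - (1 / 2 : ℝ) • (ρ u (J w) • J v - ρ v (J w) • J u))
    (h : W = -(1 / 4 : ℝ) • Q - (1 / (4 * ((n : ℝ) + 1))) • t u (J v) • J w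
      + (1 / (8 * ((n : ℝ) + 1))) • (t u w • v - t v w • u)
      - (1 / (8 * ((n : ℝ) + 1))) • (t u (J w) • J v - t v (J w) • J u)) {f : E → E → ℝ}
    (hf : ∀ u v, f u v = t u v / (8 * ((n : ℝ) + 1)) - ρ u v / 2) :
    R = (f u v - f v u) • w - (f u (J v) - f v (J u)) • J w
      + f u w • v - f v w • u - f u (J w) • J v + f v (J w) • J u - (1 / 4 : ℝ) • Q := by
  have hn : (n : ℝ) + 1 ≠ 0 := by positivity
  rw [hW, ← sub_eq_zero] at h
  simp only [hf, t1, t2]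
  rw [← sub_eq_zero, ← h]
  match_scalars <;> field_simp <;> ring

end TraceForm

section Base

variable {E : Type*} [NormedAddCommGroup E] [NormedSpace ℝ E] [FiniteDimensional ℝ E]
  [CompleteSpace E] {H : Type*} [TopologicalSpace H] {I : ModelWithCorners ℝ E H} [I.Boundaryless]
  {M : Type*} [TopologicalSpace M] [T2Space M] [ChartedSpace H M] [IsManifold I ∞ M] {Λ : Type*}

/-- A (1,2)-tensor field as a function with values in a fixed space. -/
abbrev tensorAt (B : Tensor12 I M) : M → E →L[ℝ] E →L[ℝ] E := fun x => B x

/-- A (0,2)-tensor field as a function with values in a fixed space. -/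
abbrev formAt (c : Tensor02 I M) : M → E →L[ℝ] E →L[ℝ] ℝ := fun x => c x

/-- The conditions on the base under which the cone carries a conical special complex structure:
a connection `D`, a form `a` and local tensor fields `B α`, `c α` on `U α`, where `γ α` are the
local connection forms. -/
structure ConeBase (J : EndField I M) (D : AffConn I M) (U : Λ → Set M) (γ : Λ → M → E → ℝ)
    (a : M → E →L[ℝ] E →L[ℝ] ℝ) (B : Λ → M → E →L[ℝ] E →L[ℝ] E)
    (c : Λ → M → E →L[ℝ] E →L[ℝ] ℝ) : Prop where
  complexBase : IsComplexStructure J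
  conn : IsTorsionFreeComplex J D
  isOpen : ∀ α, IsOpen (U α)
  cover : ∀ x, ∃ α, x ∈ U α
  smooth_a : ∀ x, ∀ Y Z : VField I M, SmoothVF Y → SmoothVF Z →
    ContMDiffAt I 𝓘(ℝ, ℝ) ∞ (fun y => a y (Y y : E) (Z y : E)) x
  smooth_B : ∀ α, ∀ x ∈ U α, ∀ Y Z : VField I M, SmoothVF Y → SmoothVF Z →
    SmoothVFAt (I := I) (fun y => B α y (Y y : E) (Z y : E)) x
  smooth_c : ∀ α, ∀ x ∈ U α, ∀ Y Z : VField I M, SmoothVF Y → SmoothVF Z →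
    ContMDiffAt I 𝓘(ℝ, ℝ) ∞ (fun y => c α y (Y y : E) (Z y : E)) x
  B_symm : ∀ α, ∀ x ∈ U α, ∀ v w, B α x v w = B α x w v
  B_anti : ∀ α, ∀ x ∈ U α, ∀ v w, B α x v (endAt J x w) = - endAt J x (B α x v w)
  c_symm : ∀ α, ∀ x ∈ U α, ∀ v w, c α x v w = c α x w v
  c_anti : ∀ α, ∀ x ∈ U α, ∀ v w, c α x (endAt J x v) (endAt J x w) = - c α x v w
  curv_eq : ∀ α, ∀ x ∈ U α, ∀ u v w : E, (curvAt D x u v w : E)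
    = (a x u v - a x v u) • w - (a x u (endAt J x v) - a x v (endAt J x u)) • endAt J x w
      + a x u w • v - a x v w • u - a x u (endAt J x w) • endAt J x v
      + a x v (endAt J x w) • endAt J x u
      - (1 / 4 : ℝ) • (B α x u (B α x v w) - B α x v (B α x u w))
  ext_a : ∀ α, ∀ x ∈ U α, ∀ u v w : E, extCovForm D a x u v w
    = -(1 / 4) * (c α x u (B α x v w) - c α x v (B α x u w))
  ext_B : ∀ α, ∀ x ∈ U α, ∀ u v w : E, extCovTensor D (B α) x u v w
    = -(2 : ℝ) • (γ α x u • endAt J x (B α x v w) - γ α x v • endAt J x (B α x u w))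
      + (c α x u w • v - c α x v w • u)
      + (c α x u (endAt J x w) • endAt J x v - c α x v (endAt J x w) • endAt J x u)
  ext_c : ∀ α, ∀ x ∈ U α, ∀ u v w : E,
    a x u (B α x v w) - a x v (B α x u w) + extCovForm D (c α) x u v w
    = 2 * (γ α x u * c α x v (endAt J x w) - γ α x v * c α x u (endAt J x w))

lemma traceSq_eq (B : Tensor12 I M) (x : M) (u v : E) :
    traceSq B x u v = trL E (tensorAt B x u ∘L tensorAt B x v) := rfl

lemma isBilin_fundTensor (n : ℕ) (J : EndField I M) {D : AffConn I M}
    (hD : CovariantDerivative.ContMDiffCovariantDerivative D ∞) (B : Tensor12 I M) (x : M) :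
    IsBilin (V := E) (W := E) (fundTensor n J D B x) :=
  ((isBilin_trace (tensorAt B x)).div_const _).sub ((isBilin_rho n J hD x).div_const 2)

lemma smooth_traceSq {B : Tensor12 I M} {x : M}
    (hB : ∀ Y Z : VField I M, SmoothVF Y → SmoothVF Z → SmoothVFAt (app12 B Y Z) x) :
    SmoothForm2At (traceSq B) x := by
  intro Y Z hY hZ
  have hx := mem_chart_source H x
  have h := contMDiffAt_conj₂ (B := tensorAt B) hx hB
  have h1 := h.clm_apply ((contMDiffAt_vf_iff hx).1 (hY.at x))
  have h2 := h.clm_apply ((contMDiffAt_vf_iff hx).1 (hZ.at x))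
  refine ((trL E).contMDiff.contMDiffAt.comp x (h1.clm_comp h2)).congr_of_eventuallyEq ?_
  filter_upwards [(chartAt H x).open_source.mem_nhds hx] with y hy
  refine (traceSq_eq B y (Y y) (Z y)).trans ((trL_conj (E := E) (T := toChart (I := I) x y)
    (T' := ofChart (I := I) x y) (fun v => ofChart_toChart hy v) _).symm.trans ?_)
  refine congrArg (trL E) ?_
  ext e
  have e1 := conj₂_toChart (I := I) hy (tensorAt B y) (Z y) (ofChart (I := I) x y e)
  have e2 := conj₂_toChart (I := I) hy (tensorAt B y) (Y y) (tensorAt B y (Z y) (ofChart (I := I) x y e))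
  have e3 : toChart (I := I) x y (ofChart (I := I) x y e) = e := toChart_ofChart hy e
  rw [e3] at e1
  exact e2.symm.trans (congrArg (fun a : E => conj₂ I x y (tensorAt B y) (toChart (I := I) x y (Y y)) a)
    e1.symm)

lemma smooth_fundTensor (n : ℕ) {J : EndField I M}
    (hJ : ∀ Y : VField I M, SmoothVF Y → SmoothVF (appEnd J Y)) {D : AffConn I M}
    (hD : CovariantDerivative.ContMDiffCovariantDerivative D ∞) {B : Tensor12 I M} {x : M}
    (hB : ∀ Y Z : VField I M, SmoothVF Y → SmoothVF Z → SmoothVFAt (app12 B Y Z) x) :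
    SmoothForm2At (fundTensor n J D B) x := by
  intro Y Z hY hZ
  simp only [fundTensor, div_eq_mul_inv]
  exact ((smooth_traceSq hB Y Z hY hZ).mul contMDiffAt_const).sub
    ((smooth_rho n hJ hD x Y Z hY hZ).mul contMDiffAt_const)

/-- The curvature in terms of the fundamental tensor. -/
lemma curv_of_weyl {n : ℕ} {J : EndField I M} {D : AffConn I M} {B : Tensor12 I M} {x : M}
    (hs : ∀ v w : E, tensorAt B x v w = tensorAt B x w v)
    (hJ : ∀ v w : E, tensorAt B x v (endAt J x w) = - endAt J x (tensorAt B x v w)) {u v w : E}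
    (h : (weyl n J D x u v w : E) =
      -(1 / 4 : ℝ) • (tensorAt B x u (tensorAt B x v w) - tensorAt B x v (tensorAt B x u w))
      - (1 / (4 * ((n : ℝ) + 1))) • traceSq B x u (J x v) • endAt J x w
      + (1 / (8 * ((n : ℝ) + 1))) • (traceSq B x u w • v - traceSq B x v w • u)
      - (1 / (8 * ((n : ℝ) + 1))) •
        (traceSq B x u (J x w) • endAt J x v - traceSq B x v (J x w) • endAt J x u)) :
    (curvAt D x u v w : E)
    = (fundTensor n J D B x u v - fundTensor n J D B x v u) • w
      - (fundTensor n J D B x u (J x v) - fundTensor n J D B x v (J x u)) • endAt J x w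
      + fundTensor n J D B x u w • v - fundTensor n J D B x v w • u
      - fundTensor n J D B x u (J x w) • endAt J x v
      + fundTensor n J D B x v (J x w) • endAt J x u
      - (1 / 4 : ℝ) • (tensorAt B x u (tensorAt B x v w) - tensorAt B x v (tensorAt B x u w)) := by
  exact curv_of_weyl_algebra (n := n) (t := fun u v : E => traceSq B x u v)
    (ρ := fun u v : E => rho n J D x u v) (J := endAt J x) (trL_comm (V := E) _ _)
    (trace_J (E := E) (b := tensorAt B x) (J := endAt J x) hs hJ v u)
    rfl h fun _ _ => rfl

end Base

section FromBundle

variable {E : Type*} [NormedAddCommGroup E] [NormedSpace ℝ E] [FiniteDimensional ℝ E]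
  [CompleteSpace E] {H : Type*} [TopologicalSpace H] {I : ModelWithCorners ℝ E H} [I.Boundaryless]
  {M : Type*} [TopologicalSpace M] [T2Space M] [ChartedSpace H M] [IsManifold I ∞ M]
  {E' : Type*} [NormedAddCommGroup E'] [NormedSpace ℝ E']
  {H' : Type*} [TopologicalSpace H'] {I' : ModelWithCorners ℝ E' H'}
  {S : Type*} [TopologicalSpace S] [ChartedSpace H' S] [IsManifold I' ∞ S] [MulAction Circle S]
  {Λ : Type*} {n : ℕ} {J : EndField I M} {P : Set (AffConn I M)} {pr : S → M}
  {η : OneForm I' S ℝ} {τ : Λ → LocalTriv I I' (𝓡 1) Circle pr} {B : Λ → Tensor12 I M}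
  {c : Λ → Tensor02 I M}

lemma IsCProjStructure.torsionFreeComplex (hP : IsCProjStructure J P) {D : AffConn I M}
    (hD : D ∈ P) : IsTorsionFreeComplex J D := by
  obtain ⟨D₀, _, rfl⟩ := hP
  exact hD.1

lemma IsCProjStructure.eq_cprojClass (hP : IsCProjStructure J P) {D : AffConn I M}
    (hD : D ∈ P) : P = cprojClass J D := by
  obtain ⟨D₀, _, rfl⟩ := hP
  ext D'
  exact ⟨fun h => ⟨h.1, fun c => (h.2 c).trans (hD.2 c).symm⟩,
    fun h => ⟨h.1, fun c => (h.2 c).trans (hD.2 c)⟩⟩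

lemma IsPSCB.smoothVFAt_B (h : IsPSCB n J P pr η τ B c) {α : Λ} {x : M} (hx : x ∈ (τ α).U)
    (Y Z : VField I M) (hY : SmoothVF Y) (hZ : SmoothVF Z) : SmoothVFAt (app12 (B α) Y Z) x :=
  (h.smooth_B α Y Z hY hZ).contMDiffAt ((τ α).isOpen.mem_nhds hx)

lemma transFactor_mul_conj (τ₁ τ₂ : LocalTriv I I' (𝓡 1) Circle pr) (x : M) :
    transFactor τ₁ τ₂ x * starRingEnd ℂ (transFactor τ₁ τ₂ x) = 1 := by
  rw [Complex.mul_conj]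
  unfold transFactor
  rw [Circle.normSq_coe, Complex.ofReal_one]

lemma IsPSCB.fundTensor_eq (h : IsPSCB n J P pr η τ B c) (hJ : IsComplexStructure J)
    (D : AffConn I M) {α β : Λ} {x : M} (hα : x ∈ (τ α).U) (hβ : x ∈ (τ β).U) :
    fundTensor n J D (B β) x = fundTensor n J D (B α) x := by
  funext u v
  have h1 : traceSq (B β) x u v = traceSq (B α) x u v := by
    rw [traceSq_eq (B β) x u v, traceSq_eq (B α) x u v]
    refine congrArg (trL E) (ContinuousLinearMap.ext fun w => ?_)
    exact comp_of_cmul (b := tensorAt (B α) x) (b' := tensorAt (B β) x) (J := endAt J x)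
      (transFactor_mul_conj (τ α) (τ β) x) (hJ.sq x) (h.B_anti α x hα)
      (h.B_trans α β x ⟨hα, hβ⟩) u v w
  unfold fundTensor
  rw [h1]

lemma IsPSCB.exists_coneBase (h : IsPSCB n J P pr η τ B c) (hJ : IsComplexStructure J)
    (hP : IsCProjStructure J P) :
    ∃ D ∈ P, ∃ a : M → E →L[ℝ] E →L[ℝ] ℝ,
      (∀ α, ∀ x ∈ (τ α).U, ∀ u v : E, fundTensor n J D (B α) x u v = a x u v) ∧
      ConeBase J D (fun α => (τ α).U) (fun α x u => localForm (τ α) η x u) a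
        (fun α => tensorAt (B α)) (fun α => formAt (c α)) ∧
      ∀ α, ∀ V W : VField I' S, SmoothVF V → SmoothVF W → ∀ s : S, pr s ∈ (τ α).U →
        extD η V W s = 2 * antisymm (twist J (fundTensor n J D (B α))) (pr s)
          (mfderiv I' I pr s (V s)) (mfderiv I' I pr s (W s)) := by
  obtain ⟨D, hDP, h1, h2, h3, h4⟩ := h.exists_connection
  have hD := hP.torsionFreeComplex hDP
  have hDs := hD.smooth
  choose idx hidx using h.cover
  choose a ha using fun x => isBilin_fundTensor n J hDs (B (idx x)) x
  have haα : ∀ α, ∀ x ∈ (τ α).U, ∀ u v : E, fundTensor n J D (B α) x u v = a x u v :=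
    fun α x hx u v => by
      rw [h.fundTensor_eq hJ D (hidx x) hx]
      exact ha x u v
  have hev : ∀ α, ∀ x ∈ (τ α).U, ∀ᶠ y in 𝓝 x, ∀ u v : E,
      fundTensor n J D (B α) y u v = a y u v := fun α x hx => by
    filter_upwards [(τ α).isOpen.mem_nhds hx] with y hy using haα α y hy
  have hsa : ∀ x, ∀ Y Z : VField I M, SmoothVF Y → SmoothVF Z →
      ContMDiffAt I 𝓘(ℝ, ℝ) ∞ (fun y => a y (Y y : E) (Z y : E)) x := fun x Y Z hY hZ => by
    refine (smooth_fundTensor n hJ.smooth hDs (h.smoothVFAt_B (hidx x)) Y Z hY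
      hZ).congr_of_eventuallyEq ?_
    filter_upwards [hev _ _ (hidx x)] with y hy using (hy _ _).symm
  have hsc : ∀ α, ∀ x ∈ (τ α).U, ∀ Y Z : VField I M, SmoothVF Y → SmoothVF Z →
      ContMDiffAt I 𝓘(ℝ, ℝ) ∞ (fun y => formAt (c α) y (Y y : E) (Z y : E)) x :=
    fun α x hx Y Z hY hZ => (h.smooth_c α Y Z hY hZ).contMDiffAt ((τ α).isOpen.mem_nhds hx)
  refine ⟨D, hDP, a, haα, ?_, h1⟩
  constructor
  · exact hJ
  · exact hD
  · exact fun α => (τ α).isOpen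
  · exact h.cover
  · exact hsa
  · exact fun α x hx => h.smoothVFAt_B hx
  · exact hsc
  · exact h.B_symm
  · exact h.B_anti
  · exact h.c_symm
  · exact h.c_anti
  · intro α x hx u v w
    have h5 := curv_of_weyl (n := n) (J := J) (D := D) (B := B α) (x := x) (h.B_symm α x hx)
      (h.B_anti α x hx) (u := u) (v := v) (w := w) (h.weyl_eq D hDP α x hx u v w)
    have h6 := haα α x hx
    refine h5.trans ?_
    rw [h6 u v, h6 v u, h6 u w, h6 v w]
    refine congrArg₂ (fun p q : E => p - q) ?_ rfl
    have e1 := h6 u (endAt J x v)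
    have e2 := h6 v (endAt J x u)
    have e3 := h6 u (endAt J x w)
    have e4 := h6 v (endAt J x w)
    exact congrArg₂ (fun p q : E => p + q) (congrArg₂ (fun p q : E => p - q)
      (congrArg (fun t : ℝ => _ - t • endAt J x w + a x u w • v - a x v w • u)
        (congrArg₂ (fun s t : ℝ => s - t) e1 e2)) (congrArg (fun t : ℝ => t • endAt J x v) e3))
      (congrArg (fun t : ℝ => t • endAt J x u) e4)
  · intro α x hx u v w
    obtain ⟨X, hX, rfl⟩ := exists_smoothVF_apply (I := I) x u
    obtain ⟨Y, hY, rfl⟩ := exists_smoothVF_apply (I := I) x v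
    obtain ⟨Z, hZ, rfl⟩ := exists_smoothVF_apply (I := I) x w
    have hL := (contMDiffAt_pull₂ (mem_chart_source H x) (hsa x)).mdifferentiableAt (n := ∞)
      (by simp)
    exact (extCov02_eq hD.toIsSmoothTorsionFree (hev α x hx) hL hX hY hZ).symm.trans
      (h2 α X Y Z hX hY hZ x hx)
  · intro α x hx u v w
    obtain ⟨X, hX, rfl⟩ := exists_smoothVF_apply (I := I) x u
    obtain ⟨Y, hY, rfl⟩ := exists_smoothVF_apply (I := I) x v
    obtain ⟨Z, hZ, rfl⟩ := exists_smoothVF_apply (I := I) x w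
    have hB := (contMDiffAt_conj₂ (B := tensorAt (B α)) (mem_chart_source H x)
      (h.smoothVFAt_B hx)).mdifferentiableAt (n := ∞) (by simp)
    exact (extCov12_eq (B := tensorAt (B α)) hD.toIsSmoothTorsionFree (h.smoothVFAt_B hx) hB hX hY
      hZ).symm.trans (h3 α X Y Z hX hY hZ x hx)
  · intro α x hx u v w
    obtain ⟨X, hX, rfl⟩ := exists_smoothVF_apply (I := I) x u
    obtain ⟨Y, hY, rfl⟩ := exists_smoothVF_apply (I := I) x v
    obtain ⟨Z, hZ, rfl⟩ := exists_smoothVF_apply (I := I) x w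
    have hL := (contMDiffAt_pull₂ (mem_chart_source H x) (hsc α x hx)).mdifferentiableAt (n := ∞)
      (by simp)
    have h5 := h4 α X Y Z hX hY hZ x hx
    have h6 := extCov02_eq (l := toForm (c α)) (L := formAt (c α)) hD.toIsSmoothTorsionFree
      (Filter.Eventually.of_forall fun _ _ _ => rfl) hL hX hY hZ
    have e1 := haα α x hx (X x : E) (tensorAt (B α) x (Y x : E) (Z x : E))
    have e2 := haα α x hx (Y x : E) (tensorAt (B α) x (X x : E) (Z x : E))
    refine Eq.trans ?_ h5
    exact congrArg₂ (fun p q : ℝ => p + q) (congrArg₂ (fun p q : ℝ => p - q) e1.symm e2.symm)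
      h6.symm

end FromBundle

section TwistAlgebra

variable {E : Type*} [NormedAddCommGroup E] [NormedSpace ℝ E] [FiniteDimensional ℝ E]
  [CompleteSpace E]

/-- The (1,2)-tensor `(z / 2) B`, where complex numbers act by means of `J`. -/
def twistTensor (J : E →L[ℝ] E) (z : ℂ) (B : E →L[ℝ] E →L[ℝ] E) : E →L[ℝ] E →L[ℝ] E :=
  ContinuousLinearMap.compL ℝ E E E
    ((1 / 2 : ℝ) • (z.re • ContinuousLinearMap.id ℝ E + z.im • J)) ∘L B

lemma twistTensor_apply (J : E →L[ℝ] E) (z : ℂ) (B : E →L[ℝ] E →L[ℝ] E) (u v : E) :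
    twistTensor J z B u v = (1 / 2 : ℝ) • cmul J z (B u v) := by
  simp [twistTensor, cmul]

/-- The complex form `(z / 2) l`. -/
def twistForm (z : ℂ) (l : E →L[ℝ] E →L[ℝ] ℂ) : E →L[ℝ] E →L[ℝ] ℂ :=
  ContinuousLinearMap.compL ℝ E ℂ ℂ (ContinuousLinearMap.mul ℝ ℂ (z / 2)) ∘L l

lemma twistForm_apply (z : ℂ) (l : E →L[ℝ] E →L[ℝ] ℂ) (u v : E) :
    twistForm z l u v = z / 2 * l u v := by
  simp [twistForm]

lemma complexify_re (s : ℝ) (J : E →L[ℝ] E) (l : E →L[ℝ] E →L[ℝ] ℝ) (u v : E) :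
    (complexify s J l u v).re = l u v := by
  simp [complexify_apply]

lemma complexify_im (s : ℝ) (J : E →L[ℝ] E) (l : E →L[ℝ] E →L[ℝ] ℝ) (u v : E) :
    (complexify s J l u v).im = s * l u (J v) := by
  simp [complexify_apply]

lemma twistTensor_comp {b : E →L[ℝ] E →L[ℝ] E} {J : E →L[ℝ] E} {z : ℂ}
    (hz : z * starRingEnd ℂ z = 1) (hJ2 : ∀ v, J (J v) = -v)
    (hJ : ∀ v w, b v (J w) = - J (b v w)) (u v w : E) :
    twistTensor J z b u (twistTensor J z b v w) = (1 / 4 : ℝ) • b u (b v w) := by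
  have h : b u (cmul J z (b v w)) = cmul J (starRingEnd ℂ z) (b u (b v w)) := by
    simp only [cmul, map_add, map_smul, hJ, Complex.conj_re, Complex.conj_im]
    module
  rw [twistTensor_apply, twistTensor_apply, map_smul, cmul_smul, h, cmul_cmul hJ2, hz, cmul_one]
  module

lemma map_cmul_of_linear {l : E →L[ℝ] ℂ} {J : E →L[ℝ] E} (hl : ∀ v, l (J v) = Complex.I * l v)
    (z : ℂ) (v : E) : l (cmul J z v) = z * l v := by
  conv_rhs => rw [← Complex.re_add_im z]
  simp only [cmul, map_add, map_smul, hl, Complex.real_smul]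
  ring

lemma map_cmul_of_antilinear {l : E →L[ℝ] ℂ} {J : E →L[ℝ] E}
    (hl : ∀ v, l (J v) = - (Complex.I * l v)) (z : ℂ) (v : E) :
    l (cmul J z v) = starRingEnd ℂ z * l v := by
  have h : starRingEnd ℂ z = z.re - z.im * Complex.I := by
    apply Complex.ext <;> simp
  rw [h]
  simp only [cmul, map_add, map_smul, hl, Complex.real_smul]
  ring

lemma twistForm_twistTensor {J : E →L[ℝ] E} {z : ℂ} (hz : z * starRingEnd ℂ z = 1)
    (hJ2 : ∀ v, J (J v) = -v) (c : E →L[ℝ] E →L[ℝ] ℝ) (b : E →L[ℝ] E →L[ℝ] E) (u v w : E) :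
    twistForm z (complexify 1 J c) u (twistTensor J z b v w)
      = 1 / 4 * complexify 1 J c u (b v w) := by
  have h : ∀ v, complexify 1 J c u (J v) = - (Complex.I * complexify 1 J c u v) := fun v => by
    rw [complexify_J 1 hJ2 (by norm_num)]
    push_cast
    ring
  rw [twistForm_apply, twistTensor_apply, map_smul, map_cmul_of_antilinear h, Complex.real_smul]
  push_cast
  linear_combination (1 / 4) * complexify 1 J c u (b v w) * hz

end TwistAlgebra

section ConeOverBase

variable {E : Type*} [NormedAddCommGroup E] [NormedSpace ℝ E] [FiniteDimensional ℝ E]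
  [CompleteSpace E] {H : Type*} [TopologicalSpace H] {I : ModelWithCorners ℝ E H} [I.Boundaryless]
  {M : Type*} [TopologicalSpace M] [T2Space M] [ChartedSpace H M] [IsManifold I ∞ M]
  {E' : Type*} [NormedAddCommGroup E'] [NormedSpace ℝ E'] [FiniteDimensional ℝ E']
  [CompleteSpace E'] {H' : Type*} [TopologicalSpace H'] {I' : ModelWithCorners ℝ E' H'}
  [I'.Boundaryless]
  {N : Type*} [TopologicalSpace N] [T2Space N] [ChartedSpace H' N] [IsManifold I' ∞ N]
  {Λ : Type*} {pr : N → M} {θ : OneForm I' N ℂ} {ε : Π p : N, (E × ℂ) →L[ℝ] TangentSpace I' p}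
  {J : EndField I M} {D : AffConn I M} {U : Λ → Set M} {γ : Λ → M → E → ℝ}
  {a : M → E →L[ℝ] E →L[ℝ] ℝ} {B : Λ → M → E →L[ℝ] E →L[ℝ] E} {c : Λ → M → E →L[ℝ] E →L[ℝ] ℝ}
  {μ : Λ → N → ℂ}

/-- A connection form `θ` on `N` and local functions `μ α` of modulus one, compatible with the data
`ConeBase` on the base. -/
structure ConeTotal (pr : N → M) (θ : OneForm I' N ℂ)
    (ε : Π p : N, (E × ℂ) →L[ℝ] TangentSpace I' p) (J : EndField I M) (U : Λ → Set M)
    (γ : Λ → M → E → ℝ) (a : M → E →L[ℝ] E →L[ℝ] ℝ) (B : Λ → M → E →L[ℝ] E →L[ℝ] E)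
    (c : Λ → M → E →L[ℝ] E →L[ℝ] ℝ) (μ : Λ → N → ℂ) : Prop where
  smooth_proj : ContMDiff I' I ∞ pr
  smooth_form : ∀ p, SmoothFormAt θ p
  left_inv : ∀ p (v : TangentSpace I' p), ε p (dproj I I' pr p v, θ p v) = v
  proj_frame : ∀ p (z : E × ℂ), dproj I I' pr p (ε p z) = z.1
  form_frame : ∀ p (z : E × ℂ), θ p (ε p z) = z.2
  extForm_form : ∀ p (X Y : VField I' N), DiffVFAt X p → DiffVFAt Y p →
    extForm θ X Y p
      = complexify (-1) (endAt J (pr p)) (a (pr p)) (dproj I I' pr p (Y p)) (dproj I I' pr p (X p))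
        - complexify (-1) (endAt J (pr p)) (a (pr p)) (dproj I I' pr p (X p))
          (dproj I I' pr p (Y p))
  smooth_phase : ∀ α p, pr p ∈ U α → ContMDiffAt I' 𝓘(ℝ, ℂ) ∞ (μ α) p
  phase_mul_conj : ∀ α p, pr p ∈ U α → μ α p * starRingEnd ℂ (μ α p) = 1
  mvfderiv_phase : ∀ α p, pr p ∈ U α → ∀ V : TangentSpace I' p, mvfderiv I' (μ α) p V
    = -(2 * Complex.I * ((θ p V).im - γ α (pr p) (dproj I I' pr p V) : ℝ) * μ α p)
  tensor_trans : ∀ α β p, pr p ∈ U α → pr p ∈ U β → ∀ v w,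
    cmul (endAt J (pr p)) (μ β p) (B β (pr p) v w) = cmul (endAt J (pr p)) (μ α p) (B α (pr p) v w)
  form_trans : ∀ α β p, pr p ∈ U α → pr p ∈ U β → ∀ v w,
    μ β p * complexify 1 (endAt J (pr p)) (c β (pr p)) v w
      = μ α p * complexify 1 (endAt J (pr p)) (c α (pr p)) v w

lemma mvfderiv_cmul_fun {A : N → E →L[ℝ] E} {z : N → ℂ} {f : N → E} {p : N}
    (hA : MDifferentiableAt I' 𝓘(ℝ, E →L[ℝ] E) A p) (hz : MDifferentiableAt I' 𝓘(ℝ, ℂ) z p)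
    (hf : MDifferentiableAt I' 𝓘(ℝ, E) f p) (t : TangentSpace I' p) :
    mvfderiv I' (fun q => cmul (A q) (z q) (f q)) p t
      = cmul (A p) (mvfderiv I' z p t) (f p) + cmul (A p) (z p) (mvfderiv I' f p t)
        + (z p).im • mvfderiv I' A p t (f p) := by
  have hre := Complex.reCLM.differentiableAt.comp_mdifferentiableAt hz
  have him := Complex.imCLM.differentiableAt.comp_mdifferentiableAt hz
  have hAf := hA.clm_apply hf
  have h1 := mvfderiv_bilin (ContinuousLinearMap.lsmul ℝ ℝ (E := E)) hre hf t
  have h2 := mvfderiv_bilin (ContinuousLinearMap.lsmul ℝ ℝ (E := E)) him hAf t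
  have h3 := mvfderiv_fun_add_apply (hre.smul hf) (him.smul hAf) t
  have h4 : mvfderiv I' (Complex.reCLM ∘ z) p t = (mvfderiv I' z p t).re :=
    mvfderiv_clm_comp Complex.reCLM hz t
  have h5 : mvfderiv I' (Complex.imCLM ∘ z) p t = (mvfderiv I' z p t).im :=
    mvfderiv_clm_comp Complex.imCLM hz t
  have h6 := mvfderiv_clm_apply hA hf t
  rw [h4] at h1
  rw [h5, h6] at h2
  refine (h3.trans (congrArg₂ (fun a b : E => a + b) h1 h2)).trans ?_
  simp only [ContinuousLinearMap.lsmul_apply, Function.comp_apply, Complex.reCLM_apply,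
    Complex.imCLM_apply, cmul]
  module

lemma mdifferentiableAt_cmul_fun {A : N → E →L[ℝ] E} {z : N → ℂ} {f : N → E} {p : N}
    (hA : MDifferentiableAt I' 𝓘(ℝ, E →L[ℝ] E) A p) (hz : MDifferentiableAt I' 𝓘(ℝ, ℂ) z p)
    (hf : MDifferentiableAt I' 𝓘(ℝ, E) f p) :
    MDifferentiableAt I' 𝓘(ℝ, E) (fun q => cmul (A q) (z q) (f q)) p :=
  ((Complex.reCLM.differentiableAt.comp_mdifferentiableAt hz).smul hf).add
    ((Complex.imCLM.differentiableAt.comp_mdifferentiableAt hz).smul (hA.clm_apply hf))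

lemma contMDiffAt_cmul_fun {A : N → E →L[ℝ] E} {z : N → ℂ} {f : N → E} {p : N}
    (hA : ContMDiffAt I' 𝓘(ℝ, E →L[ℝ] E) ∞ A p) (hz : ContMDiffAt I' 𝓘(ℝ, ℂ) ∞ z p)
    (hf : ContMDiffAt I' 𝓘(ℝ, E) ∞ f p) :
    ContMDiffAt I' 𝓘(ℝ, E) ∞ (fun q => cmul (A q) (z q) (f q)) p :=
  ((Complex.reCLM.contMDiff.contMDiffAt.comp p hz).smul hf).add
    ((Complex.imCLM.contMDiff.contMDiffAt.comp p hz).smul (hA.clm_apply hf))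

lemma conj₂_twistTensor (J : EndField I M) (z : ℂ) (b : E →L[ℝ] E →L[ℝ] E) {x₀ x : M}
    (hx : x ∈ (chartAt H x₀).source) :
    conj₂ I x₀ x (twistTensor (endAt J x) z b)
      = twistTensor (conj₁ x₀ x (J x)) z (conj₂ I x₀ x b) := by
  ext u v
  rw [twistTensor_apply]
  have h1 := twistTensor_apply (endAt J x) z b (ofChart (I := I) x₀ x u) (ofChart (I := I) x₀ x v)
  have h2 : conj₁ x₀ x (J x) (conj₂ I x₀ x b u v)
      = toChart (I := I) x₀ x (endAt J x (b (ofChart (I := I) x₀ x u) (ofChart (I := I) x₀ x v))) :=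
    conj₁_toChart hx (J x) _
  refine (congrArg (fun e : E => toChart (I := I) x₀ x e) h1).trans ?_
  refine (map_smul (toChart (I := I) x₀ x) _ _).trans ?_
  refine congrArg (fun e : E => (1 / 2 : ℝ) • e) ?_
  unfold cmul
  rw [h2]
  refine (map_add (toChart (I := I) x₀ x) _ _).trans ?_
  exact congrArg₂ (fun e e' : E => e + e') (map_smul (toChart (I := I) x₀ x) _ _)
    (map_smul (toChart (I := I) x₀ x) _ _)

lemma pull₂_twistForm (z : ℂ) (l : E →L[ℝ] E →L[ℝ] ℂ) (x₀ x : M) :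
    pull₂ I x₀ x (twistForm z l) = twistForm z (pull₂ I x₀ x l) := by
  ext u v
  rw [twistForm_apply]
  exact twistForm_apply z l (ofChart (I := I) x₀ x u) (ofChart (I := I) x₀ x v)

lemma ConeBase.endAt_sq (hb : ConeBase J D U γ a B c) (x : M) (v : E) :
    endAt J x (endAt J x v) = - v := hb.complexBase.sq x v

lemma ConeBase.complexify_I (hb : ConeBase J D U γ a B c) (x : M) (v w : E) :
    complexify (-1) (endAt J x) (a x) v (endAt J x w)
      = Complex.I * complexify (-1) (endAt J x) (a x) v w := by
  rw [complexify_J (-1) (hb.endAt_sq x) (by norm_num)]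
  push_cast
  ring

/-- A set of the covering which contains the point. -/
def ConeBase.index (hb : ConeBase J D U γ a B c) (x : M) : Λ := (hb.cover x).choose

lemma ConeBase.mem_index (hb : ConeBase J D U γ a B c) (x : M) : x ∈ U (hb.index x) :=
  (hb.cover x).choose_spec

/-- The tensor field along the projection given by the local tensor fields `B α`. -/
def ConeBase.tensor (hb : ConeBase J D U γ a B c) (pr : N → M) (μ : Λ → N → ℂ) (p : N) :
    E →L[ℝ] E →L[ℝ] E :=
  twistTensor (endAt J (pr p)) (μ (hb.index (pr p)) p) (B (hb.index (pr p)) (pr p))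

/-- The complex form along the projection given by the local forms `c α`. -/
def ConeBase.form (hb : ConeBase J D U γ a B c) (pr : N → M) (μ : Λ → N → ℂ) (p : N) :
    E →L[ℝ] E →L[ℝ] ℂ :=
  twistForm (μ (hb.index (pr p)) p)
    (complexify 1 (endAt J (pr p)) (c (hb.index (pr p)) (pr p)))

lemma ConeTotal.tensor_eq (ht : ConeTotal pr θ ε J U γ a B c μ) (hb : ConeBase J D U γ a B c)
    {α : Λ} {p : N} (hp : pr p ∈ U α) :
    hb.tensor pr μ p = twistTensor (endAt J (pr p)) (μ α p) (B α (pr p)) := by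
  ext v w
  unfold ConeBase.tensor
  rw [twistTensor_apply, twistTensor_apply, ht.tensor_trans α _ p hp (hb.mem_index _)]

lemma ConeTotal.form_eq (ht : ConeTotal pr θ ε J U γ a B c μ) (hb : ConeBase J D U γ a B c)
    {α : Λ} {p : N} (hp : pr p ∈ U α) :
    hb.form pr μ p = twistForm (μ α p) (complexify 1 (endAt J (pr p)) (c α (pr p))) := by
  ext v w
  unfold ConeBase.form
  rw [twistForm_apply, twistForm_apply]
  linear_combination (1 / 2 : ℂ) * ht.form_trans α _ p hp (hb.mem_index _) v w

lemma ConeTotal.eventually_mem (ht : ConeTotal pr θ ε J U γ a B c μ)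
    (hb : ConeBase J D U γ a B c) {α : Λ} {p : N} (hp : pr p ∈ U α) :
    ∀ᶠ q in 𝓝 p, pr q ∈ U α :=
  ht.smooth_proj.continuous.continuousAt.eventually_mem ((hb.isOpen α).mem_nhds hp)

lemma ConeTotal.eventually_conj₂_tensor (ht : ConeTotal pr θ ε J U γ a B c μ)
    (hb : ConeBase J D U γ a B c) {α : Λ} {x₀ : M} {p : N} (hp : pr p ∈ U α)
    (hx : pr p ∈ (chartAt H x₀).source) (e e' : E) :
    (fun q => conj₂ I x₀ (pr q) (hb.tensor pr μ q) e e') =ᶠ[𝓝 p]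
      fun q => (1 / 2 : ℝ) • cmul (conj₁ x₀ (pr q) (J (pr q))) (μ α q)
        (conj₂ I x₀ (pr q) (B α (pr q)) e e') := by
  filter_upwards [ht.eventually_mem hb hp, ht.smooth_proj.continuous.continuousAt.eventually_mem
    ((chartAt H x₀).open_source.mem_nhds hx)] with q h1 h2
  rw [ht.tensor_eq hb h1, conj₂_twistTensor J _ _ h2, twistTensor_apply]

lemma ConeTotal.eventually_pull₂_form (ht : ConeTotal pr θ ε J U γ a B c μ)
    (hb : ConeBase J D U γ a B c) {α : Λ} {x₀ : M} {p : N} (hp : pr p ∈ U α) (e e' : E) :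
    (fun q => pull₂ I x₀ (pr q) (hb.form pr μ q) e e') =ᶠ[𝓝 p]
      fun q => μ α q / 2 *
        pull₂ I x₀ (pr q) (complexify 1 (endAt J (pr q)) (c α (pr q))) e e' := by
  filter_upwards [ht.eventually_mem hb hp] with q h1
  rw [ht.form_eq hb h1, pull₂_twistForm, twistForm_apply]

lemma ConeTotal.smooth_tensor (ht : ConeTotal pr θ ε J U γ a B c μ)
    (hb : ConeBase J D U γ a B c) (x₀ : M) (p : N) (hx : pr p ∈ (chartAt H x₀).source) :
    ContMDiffAt I' 𝓘(ℝ, E →L[ℝ] E →L[ℝ] E) ∞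
      (fun q => conj₂ I x₀ (pr q) (hb.tensor pr μ q)) p := by
  refine contMDiffAt_clm_of_apply₂ fun e e' => ?_
  have hp := hb.mem_index (pr p)
  refine ContMDiffAt.congr_of_eventuallyEq ?_ (ht.eventually_conj₂_tensor hb hp hx e e')
  have h1 := (contMDiffAt_conj₁ hb.complexBase.smooth hx).comp p ht.smooth_proj.contMDiffAt
  have h2 := (contMDiffAt_conj₂ hx (hb.smooth_B _ _ hp)).comp p ht.smooth_proj.contMDiffAt
  exact ((1 / 2 : ℝ) • ContinuousLinearMap.id ℝ E).contMDiff.contMDiffAt.comp p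
    (contMDiffAt_cmul_fun h1 (ht.smooth_phase _ p hp)
      ((h2.clm_apply contMDiffAt_const).clm_apply contMDiffAt_const))

lemma ConeTotal.smooth_form_along (ht : ConeTotal pr θ ε J U γ a B c μ)
    (hb : ConeBase J D U γ a B c) (x₀ : M) (p : N) (hx : pr p ∈ (chartAt H x₀).source) :
    ContMDiffAt I' 𝓘(ℝ, E →L[ℝ] E →L[ℝ] ℂ) ∞
      (fun q => pull₂ I x₀ (pr q) (hb.form pr μ q)) p := by
  refine contMDiffAt_clm_of_apply₂ fun e e' => ?_
  have hp := hb.mem_index (pr p)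
  refine ContMDiffAt.congr_of_eventuallyEq ?_ (ht.eventually_pull₂_form hb hp e e')
  have h2 := (contMDiffAt_complexify hb.complexBase.smooth 1 hx (hb.smooth_c _ _ hp)).comp p
    ht.smooth_proj.contMDiffAt
  have h3 := (ContinuousLinearMap.mul ℝ ℂ (1 / 2)).contMDiff.contMDiffAt.comp p
    (ht.smooth_phase _ p hp)
  have h4 := (h2.clm_apply (contMDiffAt_const (c := e))).clm_apply (contMDiffAt_const (c := e'))
  refine (((ContinuousLinearMap.mul ℝ ℂ).contMDiff.contMDiffAt.comp p h3).clm_apply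
    h4).congr_of_eventuallyEq (Filter.Eventually.of_forall fun q => ?_)
  simp only [Function.comp_apply, ContinuousLinearMap.mul_apply']
  ring

lemma ConeTotal.mvfderiv_tensor (ht : ConeTotal pr θ ε J U γ a B c μ)
    (hb : ConeBase J D U γ a B c) {α : Λ} {p : N} (hp : pr p ∈ U α) (X : TangentSpace I' p)
    {u : E} (hu : u = dproj I I' pr p X) (v w : E) :
    mvfderiv I' (fun q => conj₂ I (pr p) (pr q) (hb.tensor pr μ q)) p X v w
      = (1 / 2 : ℝ) • (cmul (endAt J (pr p)) (mvfderiv I' (μ α) p X) (B α (pr p) v w)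
        + cmul (endAt J (pr p)) (μ α p)
          (mvfderiv I (fun q => conj₂ I (pr p) q (B α q)) (pr p) u v w)
        + (μ α p).im • (endAt J (pr p) (christoffel D (pr p) (pr p) u (B α (pr p) v w))
          - christoffel D (pr p) (pr p) u (endAt J (pr p) (B α (pr p) v w)))) := by
  have hx := mem_chart_source H (pr p)
  have hd := (ht.smooth_tensor hb (pr p) p hx).mdifferentiableAt (n := ∞) (by simp)
  have hpd : MDifferentiableAt I' I pr p := ht.smooth_proj.mdifferentiableAt (by simp)
  have hJ := (contMDiffAt_conj₁ hb.complexBase.smooth hx).mdifferentiableAt (n := ∞) (by simp)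
  have hB := (contMDiffAt_conj₂ hx (hb.smooth_B α _ hp)).mdifferentiableAt (n := ∞) (by simp)
  have hB' := mdifferentiableAt_apply₂ hB v w
  have h1 := hJ.comp p hpd
  have h2 := hB'.comp p hpd
  have hμ := (ht.smooth_phase α p hp).mdifferentiableAt (n := ∞) (by simp)
  have e1 := mvfderiv_cmul_fun h1 hμ h2 X
  have e2 := mvfderiv_clm_comp ((1 / 2 : ℝ) • ContinuousLinearMap.id ℝ E)
    (mdifferentiableAt_cmul_fun h1 hμ h2) X
  have e3 : mvfderiv I' ((fun q => conj₁ (pr p) q (J q)) ∘ pr) p X (B α (pr p) v w)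
      = endAt J (pr p) (christoffel D (pr p) (pr p) u (B α (pr p) v w))
        - christoffel D (pr p) (pr p) u (endAt J (pr p) (B α (pr p) v w)) := by
    have h3 := mvfderiv_conj₁ hb.complexBase.smooth hb.conn hx u (B α (pr p) v w)
    rw [conj₁_self_eq] at h3
    refine Eq.trans ?_ h3
    refine congrArg (fun L : E →L[ℝ] E => L (B α (pr p) v w)) ?_
    refine (mvfderiv_mcomp hJ hpd X).trans ?_
    refine congrArg (fun t : TangentSpace I (pr p) => mvfderiv I (fun q => conj₁ (pr p) q (J q))
      (pr p) t) ?_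
    exact hu.symm.trans (ofChart_self (E := E) (I := I) (pr p) u).symm
  have e4 : mvfderiv I' ((fun q => conj₂ I (pr p) q (B α q) v w) ∘ pr) p X
      = mvfderiv I (fun q => conj₂ I (pr p) q (B α q)) (pr p) u v w := by
    refine (mvfderiv_mcomp hB' hpd X).trans ?_
    refine (mvfderiv_apply_const₂ hB v w _).trans ?_
    exact congrArg (fun t : TangentSpace I (pr p) =>
      mvfderiv I (fun q => conj₂ I (pr p) q (B α q)) (pr p) t v w) hu.symm
  rw [← mvfderiv_apply_const₂ hd, mvfderiv_congr (ht.eventually_conj₂_tensor hb hp hx v w)]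
  refine e2.trans ?_
  refine congrArg (fun e : E => (1 / 2 : ℝ) • e) (e1.trans ?_)
  rw [e4]
  have e5 : ((fun q => conj₂ I (pr p) q (B α q) v w) ∘ pr) p = B α (pr p) v w := conj₂_self _ _ _ _
  have e6 : ((fun q => conj₁ (pr p) q (J q)) ∘ pr) p = endAt J (pr p) := conj₁_self_eq J (pr p)
  rw [e5, e6, e3]

lemma ConeTotal.mvfderiv_form (ht : ConeTotal pr θ ε J U γ a B c μ)
    (hb : ConeBase J D U γ a B c) {α : Λ} {p : N} (hp : pr p ∈ U α) (X : TangentSpace I' p)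
    {u : E} (hu : u = dproj I I' pr p X) (v w : E) :
    mvfderiv I' (fun q => pull₂ I (pr p) (pr q) (hb.form pr μ q)) p X v w
      = mvfderiv I' (μ α) p X / 2 * complexify 1 (endAt J (pr p)) (c α (pr p)) v w
        + μ α p / 2 * mvfderiv I (fun q => pull₂ I (pr p) q (complexify 1 (endAt J q) (c α q)))
          (pr p) u v w := by
  have hx := mem_chart_source H (pr p)
  have hd := (ht.smooth_form_along hb (pr p) p hx).mdifferentiableAt (n := ∞) (by simp)
  have hpd : MDifferentiableAt I' I pr p := ht.smooth_proj.mdifferentiableAt (by simp)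
  have hC := (contMDiffAt_complexify hb.complexBase.smooth 1 hx
    (hb.smooth_c α _ hp)).mdifferentiableAt (n := ∞) (by simp)
  have hC' := mdifferentiableAt_apply₂ hC v w
  have hμ := (ht.smooth_phase α p hp).mdifferentiableAt (n := ∞) (by simp)
  have e1 := mvfderiv_bilin ((1 / 2 : ℝ) • ContinuousLinearMap.mul ℝ ℂ) hμ (hC'.comp p hpd) X
  have e4 : mvfderiv I' ((fun q => pull₂ I (pr p) q (complexify 1 (endAt J q) (c α q)) v w) ∘ pr) p X
      = mvfderiv I (fun q => pull₂ I (pr p) q (complexify 1 (endAt J q) (c α q))) (pr p) u v w := by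
    refine (mvfderiv_mcomp hC' hpd X).trans ?_
    refine (mvfderiv_apply_const₂ hC v w _).trans ?_
    exact congrArg (fun t : TangentSpace I (pr p) => mvfderiv I
      (fun q => pull₂ I (pr p) q (complexify 1 (endAt J q) (c α q))) (pr p) t v w) hu.symm
  rw [e4] at e1
  have e5 : ((fun q => pull₂ I (pr p) q (complexify 1 (endAt J q) (c α q)) v w) ∘ pr) p
      = complexify 1 (endAt J (pr p)) (c α (pr p)) v w := pull₂_self _ _ _ _
  rw [e5] at e1
  have h0 : (fun q => pull₂ I (pr p) (pr q) (hb.form pr μ q) v w) =ᶠ[𝓝 p]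
      fun q => ((1 / 2 : ℝ) • ContinuousLinearMap.mul ℝ ℂ) (μ α q)
        (((fun q => pull₂ I (pr p) q (complexify 1 (endAt J q) (c α q)) v w) ∘ pr) q) := by
    filter_upwards [ht.eventually_pull₂_form (x₀ := pr p) hb hp v w] with q hq
    rw [hq]
    simp
    ring
  rw [← mvfderiv_apply_const₂ hd, mvfderiv_congr h0]
  refine e1.trans ?_
  simp
  ring

lemma cone_curv_algebra {A : E →L[ℝ] E →L[ℝ] ℝ} {Jx : E →L[ℝ] E} {u v w Q₁ Q₂ : E} :
    (A u v - A v u) • w - (A u (Jx v) - A v (Jx u)) • Jx w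
      + A u w • v - A v w • u - A u (Jx w) • Jx v + A v (Jx w) • Jx u
      - (1 / 4 : ℝ) • (Q₁ - Q₂)
    = - cmul Jx (complexify (-1) Jx A v u - complexify (-1) Jx A u v) w
      - cmul Jx (complexify (-1) Jx A v w) u + cmul Jx (complexify (-1) Jx A u w) v
      - (1 / 4 : ℝ) • Q₁ + (1 / 4 : ℝ) • Q₂ := by
  simp only [cmul, Complex.sub_re, Complex.sub_im, complexify_re, complexify_im]
  module

lemma cone_tensor_algebra {Jx : E →L[ℝ] E} (hJ : ∀ v, Jx (Jx v) = -v) {C : E →L[ℝ] E →L[ℝ] ℝ}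
    {u v w G : E} {b₁ b₂ : E} {z : ℂ} {s t g₁ g₂ : ℝ}
    (hG : G = -(2 : ℝ) • (g₁ • Jx b₁ - g₂ • Jx b₂) + (C u w • v - C v w • u)
      + (C u (Jx w) • Jx v - C v (Jx w) • Jx u)) :
    (1 / 2 : ℝ) • cmul Jx (-(2 * Complex.I * (s - g₁ : ℝ) * z)) b₁
      - (1 / 2 : ℝ) • cmul Jx (-(2 * Complex.I * (t - g₂ : ℝ) * z)) b₂
      + (1 / 2 : ℝ) • cmul Jx z G
    = - (2 * s) • Jx ((1 / 2 : ℝ) • cmul Jx z b₁) + (2 * t) • Jx ((1 / 2 : ℝ) • cmul Jx z b₂)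
      + cmul Jx (z / 2 * complexify 1 Jx C u w) v - cmul Jx (z / 2 * complexify 1 Jx C v w) u := by
  subst hG
  obtain ⟨x, y⟩ := z
  have hz : (⟨x, y⟩ : ℂ) / 2 = ⟨x / 2, y / 2⟩ := by
    apply Complex.ext <;> simp
  rw [hz]
  simp only [cmul, map_add, map_sub, map_smul, hJ, Complex.mul_re, Complex.mul_im, Complex.neg_re,
    Complex.neg_im, Complex.I_re, Complex.I_im, Complex.ofReal_re, Complex.ofReal_im,
    Complex.re_ofNat, Complex.im_ofNat, complexify_re, complexify_im]
  module

/-- The data on the total space and on the base give rise to a conical special complex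
structure. -/
lemma ConeTotal.coneData (ht : ConeTotal pr θ ε J U γ a B c μ) (hb : ConeBase J D U γ a B c) :
    ConeData pr θ ε J D (fun x => complexify (-1) (endAt J x) (a x)) (hb.tensor pr μ)
      (hb.form pr μ) where
  smooth_proj := ht.smooth_proj
  smooth_form := ht.smooth_form
  left_inv := ht.left_inv
  proj_frame := ht.proj_frame
  form_frame := ht.form_frame
  complexBase := hb.complexBase
  conn := hb.conn
  smooth_h x₀ y hy := contMDiffAt_complexify hb.complexBase.smooth (-1) hy (hb.smooth_a y)
  smooth_b := ht.smooth_tensor hb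
  smooth_k := ht.smooth_form_along hb
  h_J := hb.complexify_I
  b_symm p v w := by
    unfold ConeBase.tensor
    rw [twistTensor_apply, twistTensor_apply, hb.B_symm _ _ (hb.mem_index _)]
  b_J p v w := by
    unfold ConeBase.tensor
    rw [twistTensor_apply, twistTensor_apply, hb.B_anti _ _ (hb.mem_index _), cmul_neg, map_smul,
      map_cmul, smul_neg]
  k_symm p v w := by
    have hp := hb.mem_index (pr p)
    unfold ConeBase.form
    have h1 := hb.c_anti _ _ hp (endAt J (pr p) v) w
    rw [hb.endAt_sq, map_neg, neg_apply, neg_inj] at h1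
    rw [twistForm_apply, twistForm_apply, complexify_apply, complexify_apply, hb.c_symm _ _ hp v w,
      h1, hb.c_symm _ _ hp (endAt J (pr p) v) w]
  k_J p v w := by
    unfold ConeBase.form
    rw [twistForm_apply, twistForm_apply, complexify_J 1 (hb.endAt_sq _) (by norm_num)]
    push_cast
    ring
  extForm_form := ht.extForm_form
  curv_eq p u v w := by
    have hp := hb.mem_index (pr p)
    rw [ht.tensor_eq hb hp]
    have h1 := fun u v w => twistTensor_comp (b := B (hb.index (pr p)) (pr p))
      (ht.phase_mul_conj _ p hp) (hb.endAt_sq (pr p)) (hb.B_anti _ _ hp) u v w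
    rw [h1, h1]
    exact (hb.curv_eq _ _ hp u v w).trans (cone_curv_algebra (E := E) (A := a (pr p))
      (Jx := endAt J (pr p)))
  d_h p u v w := by
    have hp := hb.mem_index (pr p)
    have h1 := extCovForm_complexify hb.complexBase.smooth hb.conn (-1) (hb.smooth_a (pr p)) u v w
    rw [hb.ext_a _ _ hp, hb.ext_a _ _ hp, hb.B_anti _ _ hp, hb.B_anti _ _ hp] at h1
    refine h1.trans ?_
    rw [ht.tensor_eq hb hp, ht.form_eq hb hp,
      twistForm_twistTensor (ht.phase_mul_conj _ p hp) (hb.endAt_sq (pr p)),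
      twistForm_twistTensor (ht.phase_mul_conj _ p hp) (hb.endAt_sq (pr p)), complexify_apply,
      complexify_apply, map_neg, map_neg]
    push_cast
    ring
  d_b p X Y u v w hu hv := by
    have hp := hb.mem_index (pr p)
    rw [ht.mvfderiv_tensor hb hp X hu, ht.mvfderiv_tensor hb hp Y hv, ht.mvfderiv_phase _ p hp,
      ht.mvfderiv_phase _ p hp, ht.tensor_eq hb hp, ht.form_eq hb hp]
    simp only [twistTensor_apply, twistForm_apply]
    rw [← cone_tensor_algebra (hb.endAt_sq (pr p)) (hb.ext_B _ _ hp u v w), ← hu, ← hv]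
    unfold extCovTensor
    simp only [cmul, map_add, map_sub, map_smul]
    module
  d_k p X Y u v w hu hv := by
    have hp := hb.mem_index (pr p)
    have h1 := extCovForm_complexify hb.complexBase.smooth hb.conn 1 (hb.smooth_c _ _ hp) u v w
    have h2 := hb.ext_c _ _ hp u v w
    have h3 := hb.ext_c _ _ hp u v (endAt J (pr p) w)
    rw [hb.B_anti _ _ hp, hb.B_anti _ _ hp, hb.endAt_sq] at h3
    have h2' := congrArg (fun r : ℝ => (r : ℂ)) h2
    have h3' := congrArg (fun r : ℝ => (r : ℂ)) h3
    simp only [map_neg] at h3'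
    push_cast at h2' h3'
    unfold extCovForm at h1
    rw [ht.mvfderiv_form hb hp X hu, ht.mvfderiv_form hb hp Y hv, ht.mvfderiv_phase _ p hp,
      ht.mvfderiv_phase _ p hp, ht.tensor_eq hb hp, ht.form_eq hb hp, ← hu, ← hv]
    simp only [twistForm_apply, twistTensor_apply, map_smul,
      map_cmul_of_linear (hb.complexify_I (pr p) _), Complex.real_smul]
    simp only [complexify_apply] at h1 ⊢
    push_cast at h1 ⊢
    unfold extCovForm at h2' h3'
    push_cast at h2' h3'
    linear_combination (μ (hb.index (pr p)) p / 2) * (h1 + h2' + Complex.I * h3')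
      + μ (hb.index (pr p)) p * (γ (hb.index (pr p)) (pr p) u
          * c (hb.index (pr p)) (pr p) v (endAt J (pr p) w)
        - γ (hb.index (pr p)) (pr p) v * c (hb.index (pr p)) (pr p) u (endAt J (pr p) w))
        * Complex.I_sq

end ConeOverBase

section Determinant

variable {E : Type*} [NormedAddCommGroup E] [NormedSpace ℝ E] [FiniteDimensional ℝ E]

lemma contDiff_det : ContDiff ℝ ∞ (fun A : E →L[ℝ] E => A.det) := by
  let b := Module.finBasis ℝ E
  have h : (fun A : E →L[ℝ] E => A.det)
      = fun A : E →L[ℝ] E => ∑ σ : Equiv.Perm (Fin (Module.finrank ℝ E)),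
        (Equiv.Perm.sign σ : ℝ) * ∏ i, b.repr (A (b i)) (σ i) := by
    funext A
    rw [ContinuousLinearMap.det, ← LinearMap.det_toMatrix b, Matrix.det_apply']
    simp only [LinearMap.toMatrix_apply]
    simp
  rw [h]
  refine ContDiff.sum fun σ _ => contDiff_const.mul (contDiff_prod fun i _ => ?_)
  have h2 : (fun A : E →L[ℝ] E => b.repr (A (b i)) (σ i))
      = fun A => LinearMap.toContinuousLinearMap (b.coord (σ i)) (ContinuousLinearMap.apply ℝ E (b i) A) := by
    funext A
    simp
  rw [h2]
  exact (ContinuousLinearMap.contDiff _).comp (ContinuousLinearMap.contDiff _)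

lemma hasDerivAt_det_one_add (H : E →L[ℝ] E) :
    HasDerivAt (fun t : ℝ => (ContinuousLinearMap.id ℝ E + t • H).det) (trL E H) 0 := by
  let b := Module.finBasis ℝ E
  have h : (fun t : ℝ => (ContinuousLinearMap.id ℝ E + t • H).det)
      = fun t : ℝ => 1 + trL E H * t + (Matrix.det (1 + (Polynomial.X : Polynomial ℝ) •
        (LinearMap.toMatrix b b (H : E →ₗ[ℝ] E)).map Polynomial.C)).divX.divX.eval t * t ^ 2 := by
    funext t
    rw [ContinuousLinearMap.det, ← LinearMap.det_toMatrix b, trL_apply,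
      LinearMap.trace_eq_matrix_trace ℝ b, ← Matrix.det_one_add_smul]
    congr 1
    rw [ContinuousLinearMap.toLinearMap_add, ContinuousLinearMap.toLinearMap_smul, map_add, map_smul]
    congr 1
    exact LinearMap.toMatrix_id b
  rw [h]
  have h1 := (((hasDerivAt_id (0 : ℝ)).const_mul (trL E H)).const_add 1).add
    ((Polynomial.hasDerivAt (Matrix.det (1 + (Polynomial.X : Polynomial ℝ) •
        (LinearMap.toMatrix b b (H : E →ₗ[ℝ] E)).map Polynomial.C)).divX.divX 0).mul
      (hasDerivAt_pow 2 (0 : ℝ)))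
  exact HasDerivAt.congr_deriv h1 (by simp)

/-- Jacobi's formula. -/
lemma fderiv_det {A A' : E →L[ℝ] E} (h : A ∘L A' = ContinuousLinearMap.id ℝ E) (H : E →L[ℝ] E) :
    fderiv ℝ (fun A : E →L[ℝ] E => A.det) A H = A.det * trL E (A' ∘L H) := by
  have h1 : HasDerivAt (fun t : ℝ => A + t • H) H 0 := by
    simpa using ((hasDerivAt_id (0 : ℝ)).smul_const H).const_add A
  have h2 : HasFDerivAt (fun A : E →L[ℝ] E => A.det)
      (fderiv ℝ (fun A : E →L[ℝ] E => A.det) A) (A + (0 : ℝ) • H) := by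
    rw [zero_smul, add_zero]
    exact (contDiff_det.differentiable (by simp) A).hasFDerivAt
  have h3 := h2.comp_hasDerivAt (0 : ℝ) h1
  have h4 : ((fun A : E →L[ℝ] E => A.det) ∘ fun t : ℝ => A + t • H)
      = fun t : ℝ => A.det * (ContinuousLinearMap.id ℝ E + t • (A' ∘L H)).det := by
    funext t
    have h5 : A + t • H = A ∘L (ContinuousLinearMap.id ℝ E + t • (A' ∘L H)) := by
      rw [ContinuousLinearMap.comp_add, ContinuousLinearMap.comp_smul,
        ← ContinuousLinearMap.comp_assoc, h, ContinuousLinearMap.id_comp,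
        ContinuousLinearMap.comp_id]
    simp only [Function.comp_apply]
    rw [h5]
    exact LinearMap.det_comp _ _
  rw [h4] at h3
  exact h3.unique ((hasDerivAt_det_one_add (A' ∘L H)).const_mul A.det)

lemma det_ne_zero_of_inverse {A A' : E →L[ℝ] E} (h : A ∘L A' = ContinuousLinearMap.id ℝ E) :
    A.det ≠ 0 := by
  have h1 : A.det * A'.det = 1 := by
    have h2 : (A ∘L A').det = A.det * A'.det := LinearMap.det_comp _ _
    rw [← h2, h]
    exact LinearMap.det_id
  exact left_ne_zero_of_mul_eq_one h1

variable {H : Type*} [TopologicalSpace H] {I : ModelWithCorners ℝ E H}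
  {M : Type*} [TopologicalSpace M] [ChartedSpace H M]

lemma contMDiffAt_logDet {A : M → E →L[ℝ] E} {x : M} (hA : ContMDiffAt I 𝓘(ℝ, E →L[ℝ] E) ∞ A x)
    {A' : E →L[ℝ] E} (h : A x ∘L A' = ContinuousLinearMap.id ℝ E) :
    ContMDiffAt I 𝓘(ℝ, ℝ) ∞ (fun y => Real.log (A y).det) x :=
  ((Real.contDiffAt_log.2 (det_ne_zero_of_inverse h)).contMDiffAt).comp x
    ((contDiff_det.contMDiff.contMDiffAt).comp x hA)

lemma mvfderiv_logDet {A : M → E →L[ℝ] E} {x : M} (hA : MDifferentiableAt I 𝓘(ℝ, E →L[ℝ] E) A x)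
    {A' : E →L[ℝ] E} (h : A x ∘L A' = ContinuousLinearMap.id ℝ E) (v : TangentSpace I x) :
    mvfderiv I (fun y => Real.log (A y).det) x v = trL E (A' ∘L mvfderiv I A x v) := by
  have hd : DifferentiableAt ℝ (fun A : E →L[ℝ] E => A.det) (A x) :=
    contDiff_det.differentiable (by simp) _
  have h0 := det_ne_zero_of_inverse h
  have h1 := mvfderiv_fderiv_comp (b := fun A : E →L[ℝ] E => Real.log A.det) (hd.log h0) hA v
  refine h1.trans ?_
  rw [fderiv.log hd h0, smul_apply, fderiv_det h, smul_eq_mul, ← mul_assoc, inv_mul_cancel₀ h0,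
    one_mul]

end Determinant

section TracePrimitive

variable {E : Type*} [NormedAddCommGroup E] [NormedSpace ℝ E] [FiniteDimensional ℝ E]
  [CompleteSpace E] {H : Type*} [TopologicalSpace H] {I : ModelWithCorners ℝ E H} [I.Boundaryless]
  {M : Type*} [TopologicalSpace M] [T2Space M] [ChartedSpace H M] [IsManifold I ∞ M]

variable (I) in
/-- The logarithm of the Jacobian determinant of the change of charts. -/
def logJac (x₀ x₁ y : M) : ℝ := Real.log (transMap I x₀ x₁ y).det

lemma transMap_comp {x₀ x₁ x₂ y : M} (hy : y ∈ (chartAt H x₁).source) :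
    transMap I x₁ x₂ y ∘L transMap I x₀ x₁ y = transMap I x₀ x₂ y := by
  ext e
  exact congrArg (fun v : TangentSpace I y => toChart (I := I) x₂ y v) (ofChart_toChart hy _)

lemma transMap_self {x₀ y : M} (hy : y ∈ (chartAt H x₀).source) :
    transMap I x₀ x₀ y = ContinuousLinearMap.id ℝ E := by
  ext e
  exact toChart_ofChart (I := I) hy e

lemma transMap_inverse {x₀ x₁ y : M} (hy : y ∈ (chartAt H x₀).source)
    (hy' : y ∈ (chartAt H x₁).source) :
    transMap I x₀ x₁ y ∘L transMap I x₁ x₀ y = ContinuousLinearMap.id ℝ E := by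
  rw [transMap_comp hy, transMap_self hy']

lemma logJac_add {x₀ x₁ x₂ y : M} (h₀ : y ∈ (chartAt H x₀).source)
    (h₁ : y ∈ (chartAt H x₁).source) (h₂ : y ∈ (chartAt H x₂).source) :
    logJac I x₀ x₂ y = logJac I x₀ x₁ y + logJac I x₁ x₂ y := by
  unfold logJac
  have h : (transMap I x₁ x₂ y ∘L transMap I x₀ x₁ y).det
    = (transMap I x₁ x₂ y).det * (transMap I x₀ x₁ y).det := LinearMap.det_comp _ _
  rw [← transMap_comp (I := I) (x₀ := x₀) (x₂ := x₂) h₁, h, Real.log_mul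
    (det_ne_zero_of_inverse (transMap_inverse h₁ h₂))
    (det_ne_zero_of_inverse (transMap_inverse h₀ h₁)), add_comm]

lemma contMDiffAt_logJac {x₀ x₁ y : M} (h₀ : y ∈ (chartAt H x₀).source)
    (h₁ : y ∈ (chartAt H x₁).source) : ContMDiffAt I 𝓘(ℝ, ℝ) ∞ (logJac I x₀ x₁) y :=
  contMDiffAt_logDet (contMDiffAt_transMap h₀ h₁) (transMap_inverse h₀ h₁)

/-- The trace of the Christoffel symbols. -/
def trChristoffel (D : AffConn I M) (x₀ y : M) : E →L[ℝ] ℝ := trL E ∘L christoffel D x₀ y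

lemma trChristoffel_transMap {D : AffConn I M} {x₀ x₁ y : M} (h₀ : y ∈ (chartAt H x₀).source)
    (h₁ : y ∈ (chartAt H x₁).source) (v : TangentSpace I y) :
    trChristoffel D x₁ y (toChart x₁ y v)
      = trChristoffel D x₀ y (toChart x₀ y v) - mvfderiv I (logJac I x₀ x₁) y v := by
  have hd := (contMDiffAt_transMap (I := I) h₀ h₁).mdifferentiableAt (n := ∞) (by simp)
  have h2 : mvfderiv I (logJac I x₀ x₁) y v = _ := mvfderiv_logDet hd (transMap_inverse h₀ h₁) v
  rw [h2, ← transMap_toChart h₀ v]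
  have h3 : christoffel D x₁ y (transMap I x₀ x₁ y (toChart x₀ y v))
      = (transMap I x₀ x₁ y ∘L christoffel D x₀ y (toChart x₀ y v)
        - (mvfderiv I (transMap I x₀ x₁) y v : E →L[ℝ] E)) ∘L transMap I x₁ x₀ y := by
    ext e
    have h4 : transMap I x₀ x₁ y (transMap I x₁ x₀ y e) = e :=
      congrArg (fun A : E →L[ℝ] E => A e) (transMap_inverse h₀ h₁)
    have h5 := christoffel_transMap D h₀ h₁ (toChart x₀ y v) (transMap I x₁ x₀ y e)
    rw [h4, ofChart_toChart h₀] at h5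
    exact h5
  unfold trChristoffel
  rw [ContinuousLinearMap.comp_apply, ContinuousLinearMap.comp_apply, h3,
    ContinuousLinearMap.sub_comp, map_sub, trL_comm, ← ContinuousLinearMap.comp_assoc,
    transMap_inverse h₁ h₀, ContinuousLinearMap.id_comp, trL_comm (transMap I x₁ x₀ y)]

lemma contMDiffAt_trChristoffel {D : AffConn I M} (hD : IsSmoothTorsionFree D) {x₀ y : M}
    (hy : y ∈ (chartAt H x₀).source) :
    ContMDiffAt I 𝓘(ℝ, E →L[ℝ] ℝ) ∞ (trChristoffel D x₀) y :=
  contMDiffAt_clm_of_apply fun _ => (trL E).contMDiff.contMDiffAt.comp y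
    ((contMDiffAt_christoffel hD.smooth hy).clm_apply contMDiffAt_const)

lemma mvfderiv_trChristoffel {D : AffConn I M} (hD : IsSmoothTorsionFree D) {x₀ y : M}
    (hy : y ∈ (chartAt H x₀).source) (t : TangentSpace I y) (e : E) :
    mvfderiv I (trChristoffel D x₀) y t e = trL E (mvfderiv I (christoffel D x₀) y t e) := by
  have hΓ := (contMDiffAt_christoffel hD.smooth hy).mdifferentiableAt (n := ∞) (by simp)
  have hd := (contMDiffAt_trChristoffel hD hy).mdifferentiableAt (n := ∞) (by simp)
  rw [← mvfderiv_apply_const hd, ← mvfderiv_apply_const hΓ]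
  exact mvfderiv_clm_comp (trL E) (hΓ.clm_apply mdifferentiableAt_const) t

lemma extForm_add {F : Type*} [NormedAddCommGroup F] [NormedSpace ℝ F] {θ θ' : OneForm I M F}
    {X Y : VField I M} {p : M} (hθ : SmoothFormAt θ p) (hθ' : SmoothFormAt θ' p)
    (hX : DiffVFAt X p) (hY : DiffVFAt Y p) :
    extForm (fun q => θ q + θ' q) X Y p = extForm θ X Y p + extForm θ' X Y p := by
  have h : ∀ V : VField I M, DiffVFAt V p → ∀ t : TangentSpace I p,
      mvfderiv I (fun y => (θ y + θ' y) (V y)) p t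
        = mvfderiv I (fun y => θ y (V y)) p t + mvfderiv I (fun y => θ' y (V y)) p t :=
    fun V hV t => mvfderiv_fun_add_apply (hθ.diff_apply hV) (hθ'.diff_apply hV) t
  unfold extForm
  rw [h Y hY, h X hX, add_apply]
  abel

lemma extForm_clm {F F' : Type*} [NormedAddCommGroup F] [NormedSpace ℝ F] [NormedAddCommGroup F']
    [NormedSpace ℝ F'] (L : F →L[ℝ] F') {θ : OneForm I M F}
    {X Y : VField I M} {p : M} (hθ : SmoothFormAt θ p) (hX : DiffVFAt X p) (hY : DiffVFAt Y p) :
    extForm (fun q => L ∘L θ q) X Y p = L (extForm θ X Y p) := by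
  unfold extForm
  rw [map_sub, map_sub, ← mvfderiv_clm_comp L (hθ.diff_apply hY), ← mvfderiv_clm_comp L
    (hθ.diff_apply hX)]
  rfl

/-- Locally, the trace of the curvature is the exterior derivative of the trace of the Christoffel
symbols. -/
lemma extForm_trChristoffel {D : AffConn I M} (hD : IsSmoothTorsionFree D) {x₀ y : M}
    (hy : y ∈ (chartAt H x₀).source) {X Y : VField I M} (hX : DiffVFAt X y) (hY : DiffVFAt Y y) :
    extForm (fun q => trChristoffel D x₀ q ∘L toChart (I := I) x₀ q) X Y y
      = trCurv D x₀ y (toChart x₀ y (X y)) (toChart x₀ y (Y y)) := by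
  have hd := (contMDiffAt_trChristoffel hD hy).mdifferentiableAt (n := ∞) (by simp)
  have hα := smoothFormAt_toChart (I := I) hy
  have h1 := extForm_clm_comp (α := fun q => toChart (I := I) x₀ q) hd (hα.diff_apply hX)
    (hα.diff_apply hY)
  rw [extForm_toChart hy hX hY, map_zero, add_zero, mvfderiv_trChristoffel hD hy,
    mvfderiv_trChristoffel hD hy, ← map_sub] at h1
  refine h1.trans ?_
  obtain ⟨u, hu⟩ : ∃ u : E, toChart x₀ y (X y) = u := ⟨_, rfl⟩
  obtain ⟨v, hv⟩ : ∃ v : E, toChart x₀ y (Y y) = v := ⟨_, rfl⟩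
  have hu' : X y = ofChart (I := I) x₀ y u := by rw [← hu, ofChart_toChart hy]
  have hv' : Y y = ofChart (I := I) x₀ y v := by rw [← hv, ofChart_toChart hy]
  rw [hu, hv, hu', hv']
  have h3 : trCurv D x₀ y u v = trL E (mvfderiv I (christoffel D x₀) y (ofChart x₀ y u) v
      - mvfderiv I (christoffel D x₀) y (ofChart x₀ y v) u
      + christoffel D x₀ y u ∘L christoffel D x₀ y v
      - christoffel D x₀ y v ∘L christoffel D x₀ y u) := by
    rw [trL_eq_sum]
    rfl
  simp only [h3, map_sub, map_add]
  rw [trL_comm (christoffel D x₀ y u), add_sub_cancel_right]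

variable [SigmaCompactSpace M]

/-- The trace of the curvature of a torsion-free connection is exact. -/
lemma exists_trCurv_primitive {D : AffConn I M} (hD : IsSmoothTorsionFree D) :
    ∃ κ : OneForm I M ℝ, (∀ y, SmoothFormAt κ y) ∧ ∀ (y : M) (X Y : VField I M),
      DiffVFAt X y → DiffVFAt Y y → extForm κ X Y y = trCurv D y y (X y) (Y y) := by
  obtain ⟨φ, hφ⟩ := SmoothPartitionOfUnity.exists_isSubordinate_chartAt_source I M
  let Λ : M → M → ℝ := fun x₀ y => ∑ᶠ i, φ i y • logJac I x₀ i y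
  have hsm : ∀ x₀ y, y ∈ (chartAt H x₀).source → ContMDiffAt I 𝓘(ℝ, ℝ) ∞ (Λ x₀) y :=
    fun x₀ y hy => φ.contMDiffAt_finsum fun i hi => contMDiffAt_logJac hy (hφ i hi)
  have hΛ : ∀ x₀ x₁ y, y ∈ (chartAt H x₀).source → y ∈ (chartAt H x₁).source →
      Λ x₀ y = logJac I x₀ x₁ y + Λ x₁ y := fun x₀ x₁ y h₀ h₁ => by
    have h1 : logJac I x₀ x₁ y = ∑ᶠ i, φ i y • logJac I x₀ x₁ y := by
      rw [← finsum_smul, φ.sum_eq_one (Set.mem_univ y), one_smul]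
    have hfin : (Function.support fun i => φ i y).Finite := φ.locallyFinite.point_finite y
    have hf : ∀ g : M → ℝ, (Function.support fun i => φ i y • g i).Finite := fun g =>
      hfin.subset (Function.support_smul_subset_left (fun i => φ i y) g)
    rw [h1, ← finsum_add_distrib (hf _) (hf _)]
    refine finsum_congr fun i => ?_
    by_cases hi : φ i y = 0
    · rw [hi, zero_smul, zero_smul, zero_smul, add_zero]
    · have h2 : y ∈ (chartAt H i).source := hφ i (subset_closure hi)
      rw [← smul_add, logJac_add h₀ h₁ h2]
  let κ : OneForm I M ℝ := fun y =>
    trChristoffel D y y ∘L toChart (I := I) y y - mvfderiv I (Λ y) y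
  have hκ : ∀ x₀ y, y ∈ (chartAt H x₀).source →
      κ y = trChristoffel D x₀ y ∘L toChart (I := I) x₀ y - mvfderiv I (Λ x₀) y :=
    fun x₀ y h₀ => by
      have h₁ := mem_chart_source H y
      ext v
      have h1 := trChristoffel_transMap (D := D) h₀ h₁ v
      have h2 : Λ x₀ =ᶠ[𝓝 y] fun q => logJac I x₀ y q + Λ y q := by
        filter_upwards [(chartAt H x₀).open_source.mem_nhds h₀,
          (chartAt H y).open_source.mem_nhds h₁] with q hq hq' using hΛ x₀ y q hq hq'
      have h3 := congrArg (fun L => L v) (mvfderiv_congr (I := I) h2)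
      have h4 := mvfderiv_fun_add_apply
        ((contMDiffAt_logJac (I := I) h₀ h₁).mdifferentiableAt (n := ∞) (by simp))
        ((hsm y y h₁).mdifferentiableAt (n := ∞) (by simp)) v
      have h5 := h3.trans h4
      change trChristoffel D y y (toChart (I := I) y y v) - mvfderiv I (Λ y) y v
        = trChristoffel D x₀ y (toChart (I := I) x₀ y v) - mvfderiv I (Λ x₀) y v
      rw [h1, h5]
      ring
  have hev : ∀ y, ∀ᶠ q in 𝓝 y, κ q
      = trChristoffel D y q ∘L toChart (I := I) y q - mvfderiv I (Λ y) q := fun y => by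
    filter_upwards [(chartAt H y).open_source.mem_nhds (mem_chart_source H y)] with q hq
      using hκ y q hq
  have hΓ : ∀ y, SmoothFormAt (fun q => trChristoffel D y q ∘L toChart (I := I) y q) y := fun y => by
    have hy := mem_chart_source H y
    exact smoothFormAt_of_apply fun V hV => (contMDiffAt_trChristoffel hD hy).clm_apply
      ((contMDiffAt_vf_iff hy).1 hV.self_of_nhds)
  have hL : ∀ y, SmoothFormAt (fun q => - mvfderiv I (Λ y) q) y := fun y =>
    smoothFormAt_of_apply fun V hV => (contMDiffAt_mvfderiv_apply (hsm y y (mem_chart_source H y))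
      hV.self_of_nhds).neg
  refine ⟨κ, fun y => smoothFormAt_of_apply fun V hV => ?_, fun y X Y hX hY => ?_⟩
  · have hV0 := hV.self_of_nhds
    refine (((hΓ y).apply hV0).add ((hL y).apply hV0)).congr_of_eventuallyEq ?_
    filter_upwards [hev y] with q hq
    rw [hq, sub_eq_add_neg]
    rfl
  · have hy := mem_chart_source H y
    have h1 : ∀ᶠ q in 𝓝 y, κ q = trChristoffel D y q ∘L toChart (I := I) y q
        + -mvfderiv I (Λ y) q := by
      filter_upwards [hev y] with q hq
      rw [hq, sub_eq_add_neg]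
    have h2 : extForm (fun q => - mvfderiv I (Λ y) q) X Y y = 0 := by
      have h3 := extForm_clm (-ContinuousLinearMap.id ℝ ℝ) (θ := fun q => mvfderiv I (Λ y) q)
        (smoothFormAt_of_apply fun V hV => contMDiffAt_mvfderiv_apply (hsm y y hy)
          hV.self_of_nhds) hX hY
      rw [extForm_mvfderiv ((hsm y y hy).of_le (WithTop.coe_le_coe.2 le_top)) hX hY, map_zero] at h3
      refine Eq.trans ?_ h3
      refine extForm_congr (Filter.Eventually.of_forall fun q => ?_)
      ext v
      simp
    rw [extForm_congr h1, extForm_add (hΓ y) (hL y) hX hY, extForm_trChristoffel hD hy hX hY, h2,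
      add_zero]
    exact congrArg₂ (fun u v : E => trCurv D y y u v) (toChart_self (E := E) (I := I) y (X y))
      (toChart_self (E := E) (I := I) y (Y y))

end TracePrimitive

section Pullback

variable {E : Type*} [NormedAddCommGroup E] [NormedSpace ℝ E] [FiniteDimensional ℝ E]
  [CompleteSpace E] {H : Type*} [TopologicalSpace H] {I : ModelWithCorners ℝ E H} [I.Boundaryless]
  {M : Type*} [TopologicalSpace M] [T2Space M] [ChartedSpace H M] [IsManifold I ∞ M]
  {E' : Type*} [NormedAddCommGroup E'] [NormedSpace ℝ E'] [FiniteDimensional ℝ E']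
  [CompleteSpace E'] {H' : Type*} [TopologicalSpace H'] {I' : ModelWithCorners ℝ E' H'}
  [I'.Boundaryless]
  {N : Type*} [TopologicalSpace N] [T2Space N] [ChartedSpace H' N] [IsManifold I' ∞ N]
  {F : Type*} [NormedAddCommGroup F] [NormedSpace ℝ F]

variable (I I') in
/-- The pullback of a one-form. -/
def pullForm (f : N → M) (κ : OneForm I M F) : OneForm I' N F := fun q =>
  κ (f q) ∘L mfderiv I' I f q

lemma pullForm_eventuallyEq {f : N → M} (hf : ContMDiff I' I ∞ f) (κ : OneForm I M F) (p : N) :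
    ∀ᶠ q in 𝓝 p, pullForm I I' f κ q
      = (κ (f q) ∘L ofChart (f p) (f q) : E →L[ℝ] F)
          ∘L (toChart (I := I) (f p) (f q) ∘L mfderiv I' I f q : _ →L[ℝ] E) := by
  filter_upwards [((chartAt H (f p)).open_source.preimage hf.continuous).mem_nhds
    (mem_chart_source H (f p))] with q hq
  ext v
  exact (congrArg (κ (f q)) (ofChart_toChart hq (mfderiv I' I f q v))).symm

lemma SmoothFormAt.pull {f : N → M} (hf : ContMDiff I' I ∞ f) {κ : OneForm I M F} {p : N}
    (hκ : SmoothFormAt κ (f p)) : SmoothFormAt (pullForm I I' f κ) p := by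
  refine smoothFormAt_of_apply fun V hV => ?_
  have h1 := (ContMDiffAt.comp p hκ (hf p)).clm_apply
    (contMDiffAt_toChart_mfderiv hf (mem_chart_source H (f p)) hV.self_of_nhds)
  refine h1.congr_of_eventuallyEq ?_
  filter_upwards [pullForm_eventuallyEq hf κ p] with q hq
  rw [hq]
  rfl

lemma toChart_eventuallyEq (κ : OneForm I M F) (x : M) :
    ∀ᶠ q in 𝓝 x, κ q = (κ q ∘L ofChart x q : E →L[ℝ] F) ∘L toChart (I := I) x q := by
  filter_upwards [(chartAt H x).open_source.mem_nhds (mem_chart_source H x)] with q hq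
  ext v
  exact (congrArg (κ q) (ofChart_toChart hq v)).symm

lemma smoothFormAt_toChart_mfderiv {f : N → M} (hf : ContMDiff I' I ∞ f) (p : N) :
    SmoothFormAt (fun q => (toChart (I := I) (f p) (f q) ∘L mfderiv I' I f q : _ →L[ℝ] E)) p :=
  smoothFormAt_of_apply fun _ hV =>
    contMDiffAt_toChart_mfderiv hf (mem_chart_source H (f p)) hV.self_of_nhds

/-- The exterior derivative commutes with pullbacks. -/
lemma extForm_pullForm {f : N → M} (hf : ContMDiff I' I ∞ f) {κ : OneForm I M F} {p : N}
    (hκ : SmoothFormAt κ (f p)) {X Y : VField I' N} (hX : DiffVFAt X p) (hY : DiffVFAt Y p)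
    {X₁ Y₁ : VField I M} (hX₁ : DiffVFAt X₁ (f p)) (hY₁ : DiffVFAt Y₁ (f p))
    (hXX : X₁ (f p) = mfderiv I' I f p (X p)) (hYY : Y₁ (f p) = mfderiv I' I f p (Y p)) :
    extForm (pullForm I I' f κ) X Y p = extForm κ X₁ Y₁ (f p) := by
  have hx := mem_chart_source H (f p)
  have hd := ContMDiffAt.mdifferentiableAt hκ (n := ∞) (by simp)
  have hfd := (hf p).mdifferentiableAt (n := ∞) (by simp)
  have hc : MDifferentiableAt I' 𝓘(ℝ, E →L[ℝ] F)
      (fun q => (κ (f q) ∘L ofChart (f p) (f q) : E →L[ℝ] F)) p := hd.comp p hfd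
  rw [extForm_congr (pullForm_eventuallyEq hf κ p), extForm_congr (toChart_eventuallyEq κ (f p)),
    extForm_clm_comp hc
      ((smoothFormAt_toChart_mfderiv hf p).diff_apply hX)
      ((smoothFormAt_toChart_mfderiv hf p).diff_apply hY),
    extForm_clm_comp hd ((mdifferentiableAt_vf_iff hx).1 hX₁) ((mdifferentiableAt_vf_iff hx).1 hY₁),
    extForm_toChart hx hX₁ hY₁, extForm_toChart_mfderiv hf hx hX hY, hXX, hYY]
  simp only [map_zero, add_zero]
  have h := fun v : TangentSpace I' p => mvfderiv_mcomp (I := I)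
    (g := fun y => (κ y ∘L ofChart (f p) y : E →L[ℝ] F)) hd hfd v
  have h1 := h (X p)
  have h2 := h (Y p)
  exact congrArg₂ (fun A B : E →L[ℝ] F => A (toChart (I := I) (f p) (f p) (mfderiv I' I f p (Y p)))
    - B (toChart (I := I) (f p) (f p) (mfderiv I' I f p (X p)))) h1 h2

end Pullback

section RhoPrimitive

variable {E : Type*} [NormedAddCommGroup E] [NormedSpace ℝ E] [FiniteDimensional ℝ E]
  [CompleteSpace E] {H : Type*} [TopologicalSpace H] {I : ModelWithCorners ℝ E H} [I.Boundaryless]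
  {M : Type*} [TopologicalSpace M] [T2Space M] [SigmaCompactSpace M] [ChartedSpace H M]
  [IsManifold I ∞ M]

/-- The antisymmetric part of the Rho tensor of a torsion-free connection is exact. -/
lemma exists_rho_primitive (n : ℕ) (J : EndField I M) {D : AffConn I M}
    (hD : IsSmoothTorsionFree D) :
    ∃ κ : OneForm I M ℝ, (∀ x, SmoothFormAt κ x) ∧ ∀ x (X Y : VField I M), DiffVFAt X x →
      DiffVFAt Y x → extForm κ X Y x = antisymm (rho n J D) x (X x) (Y x) := by
  obtain ⟨κ, hκ, h⟩ := exists_trCurv_primitive hD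
  let r : ℝ := -(1 / (2 * ((n : ℝ) + 1)))
  refine ⟨fun x => (r • ContinuousLinearMap.id ℝ ℝ) ∘L κ x, fun x => smoothFormAt_of_apply
    fun V hV => ((r • ContinuousLinearMap.id ℝ ℝ).contMDiff.contMDiffAt.comp x
      ((hκ x).apply hV.self_of_nhds)), fun x X Y hX hY => ?_⟩
  rw [extForm_clm _ (hκ x) hX hY, h x X Y hX hY, antisymm_rho,
    antisymm_ricci hD (mem_chart_source H x)]
  have h1 : trCurv D x x (toChart x x (X x)) (toChart x x (Y x)) = trCurv D x x (X x : E) (Y x : E) :=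
    congrArg₂ (fun u v : E => trCurv D x x u v) (toChart_self (E := E) (I := I) x (X x))
      (toChart_self (E := E) (I := I) x (Y x))
  rw [h1]
  have : (n : ℝ) + 1 ≠ 0 := by positivity
  simp only [smul_apply, ContinuousLinearMap.id_apply, smul_eq_mul, r]
  field_simp

end RhoPrimitive

section Maps

variable {E₁ : Type*} [NormedAddCommGroup E₁] [NormedSpace ℝ E₁]
  {H₁ : Type*} [TopologicalSpace H₁] {I₁ : ModelWithCorners ℝ E₁ H₁}
  {M₁ : Type*} [TopologicalSpace M₁] [ChartedSpace H₁ M₁]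
  {E₂ : Type*} [NormedAddCommGroup E₂] [NormedSpace ℝ E₂]
  {H₂ : Type*} [TopologicalSpace H₂] {I₂ : ModelWithCorners ℝ E₂ H₂}
  {M₂ : Type*} [TopologicalSpace M₂] [ChartedSpace H₂ M₂]
  {E₃ : Type*} [NormedAddCommGroup E₃] [NormedSpace ℝ E₃]
  {H₃ : Type*} [TopologicalSpace H₃] {I₃ : ModelWithCorners ℝ E₃ H₃}
  {M₃ : Type*} [TopologicalSpace M₃] [ChartedSpace H₃ M₃]

variable (I₁ I₂) in
/-- The derivative of a map between manifolds, as a map between the model spaces. -/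
def dmap (f : M₁ → M₂) (x : M₁) : E₁ →L[ℝ] E₂ := mfderiv I₁ I₂ f x

lemma dmap_comp {g : M₂ → M₃} {f : M₁ → M₂} {x : M₁} (hg : MDifferentiableAt I₂ I₃ g (f x))
    (hf : MDifferentiableAt I₁ I₂ f x) (v : E₁) :
    dmap I₁ I₃ (fun y => g (f y)) x v = dmap I₂ I₃ g (f x) (dmap I₁ I₂ f x v) :=
  mfderiv_comp_apply x hg hf v

lemma dmap_congr {f g : M₁ → M₂} {x : M₁} (h : f =ᶠ[𝓝 x] g) : dmap I₁ I₂ f x = dmap I₁ I₂ g x :=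
  h.mfderiv_eq

lemma dmap_id (x : M₁) (v : E₁) : dmap I₁ I₁ (fun y => y) x v = v :=
  congrArg (fun L : E₁ →L[ℝ] E₁ => L v) (mfderiv_id (I := I₁) (x := x))

lemma dmap_const (x : M₁) (y : M₂) (v : E₁) : dmap I₁ I₂ (fun _ => y) x v = 0 :=
  congrArg (fun L : E₁ →L[ℝ] E₂ => L v) (mfderiv_const (I := I₁) (I' := I₂) (x := x) (c := y))

lemma dmap_prod {f : M₁ × M₂ → M₃} {x : M₁} {y : M₂}
    (hf : MDifferentiableAt (I₁.prod I₂) I₃ f (x, y)) (v : E₁) (w : E₂) :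
    dmap (I₁.prod I₂) I₃ f (x, y) (v, w)
      = dmap I₁ I₃ (fun z => f (z, y)) x v + dmap I₂ I₃ (fun z => f (x, z)) y w :=
  mfderiv_prod_eq_add_apply (v := (v, w)) hf

lemma dmap_prodMk {f : M₁ → M₂} {g : M₁ → M₃} {x : M₁} (hf : MDifferentiableAt I₁ I₂ f x)
    (hg : MDifferentiableAt I₁ I₃ g x) (v : E₁) :
    dmap I₁ (I₂.prod I₃) (fun y => (f y, g y)) x v = (dmap I₁ I₂ f x v, dmap I₁ I₃ g x v) :=
  congrArg (fun L : E₁ →L[ℝ] E₂ × E₃ => L v) (mfderiv_prodMk hf hg)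

variable {F : Type*} [NormedAddCommGroup F] [NormedSpace ℝ F] {G : Type*} [CommGroup G]
  [MulAction G M₁] {ex : F → G}

variable (I₁) in
/-- The fundamental vector field, with values in the model space. -/
abbrev fundAt (ex : F → G) (ζ : F) (x : M₁) : E₁ := fundVF I₁ ex ζ x

lemma fundAt_eq_dmap {x : M₁}
    (hA : MDifferentiableAt 𝓘(ℝ, F) I₁ (fun t => ex t • x) 0) (ζ : F) :
    fundAt I₁ ex ζ x = dmap 𝓘(ℝ, F) I₁ (fun t => ex t • x) 0 ζ := by
  have h1 : MDifferentiableAt 𝓘(ℝ, ℝ) 𝓘(ℝ, F) (fun t : ℝ => t • ζ) 0 :=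
    (differentiableAt_id.smul_const ζ).mdifferentiableAt
  have h2 : dmap 𝓘(ℝ, ℝ) 𝓘(ℝ, F) (fun t : ℝ => t • ζ) 0 (1 : ℝ) = ζ := by
    have h3 : HasFDerivAt (fun t : ℝ => t • ζ) ((ContinuousLinearMap.id ℝ ℝ).smulRight ζ) 0 :=
      ((ContinuousLinearMap.id ℝ ℝ).smulRight ζ).hasFDerivAt
    refine (congrArg (fun L : ℝ →L[ℝ] F => L 1) (mfderiv_eq_fderiv.trans h3.fderiv)).trans ?_
    simp
  have h0' : (0 : ℝ) • ζ = 0 := zero_smul ℝ ζ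
  have hA' : MDifferentiableAt 𝓘(ℝ, F) I₁ (fun t => ex t • x) ((0 : ℝ) • ζ) := by rwa [h0']
  have h4 := dmap_comp (f := fun t : ℝ => t • ζ) hA' h1 (1 : ℝ)
  rw [h2, h0'] at h4
  exact h4

/-- If `x = exp(t(x)) • σ(pr x)` near `x₀`, where `t` vanishes at `x₀`, then this gives a
decomposition of the tangent vectors at `x₀`. -/
lemma fundAt_add_dmap (h0 : ex 0 = 1) {x₀ : M₁}
    (hA : MDifferentiableAt (𝓘(ℝ, F).prod I₁) I₁ (fun q : F × M₁ => ex q.1 • q.2) (0, x₀))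
    {t : M₁ → F} (ht : MDifferentiableAt I₁ 𝓘(ℝ, F) t x₀) (ht0 : t x₀ = 0)
    {pr : M₁ → M₂} (hpr : MDifferentiableAt I₁ I₂ pr x₀) {σ : M₂ → M₁}
    (hσ : MDifferentiableAt I₂ I₁ σ (pr x₀)) (hσ0 : σ (pr x₀) = x₀)
    (h : ∀ᶠ x in 𝓝 x₀, ex (t x) • σ (pr x) = x) (w : E₁) :
    w = fundAt I₁ ex (mvfderiv I₁ t x₀ w) x₀
      + dmap I₂ I₁ σ (pr x₀) (dmap I₁ I₂ pr x₀ w) := by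
  have h1 : MDifferentiableAt I₁ (𝓘(ℝ, F).prod I₁) (fun x => (t x, σ (pr x))) x₀ :=
    ht.prodMk (hσ.comp x₀ hpr)
  have hA' : MDifferentiableAt (𝓘(ℝ, F).prod I₁) I₁ (fun q : F × M₁ => ex q.1 • q.2)
      (t x₀, σ (pr x₀)) := by rwa [ht0, hσ0]
  have h2 := dmap_comp (f := fun x => (t x, σ (pr x))) hA' h1 w
  rw [dmap_congr (g := fun x => x) h, dmap_id, dmap_prodMk (g := fun x => σ (pr x)) ht
    (hσ.comp x₀ hpr), dmap_comp hσ hpr] at h2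
  simp only [ht0, hσ0] at h2
  rw [dmap_prod hA] at h2
  have h3 : MDifferentiableAt 𝓘(ℝ, F) I₁ (fun t => ex t • x₀) 0 :=
    hA.comp (0 : F) (f := fun t : F => (t, x₀)) (mdifferentiableAt_id.prodMk mdifferentiableAt_const)
  rw [fundAt_eq_dmap h3]
  simp only [h0, one_smul] at h2
  rw [dmap_id] at h2
  exact h2

end Maps

section CircleBundle

variable {E : Type*} [NormedAddCommGroup E] [NormedSpace ℝ E]
  {H : Type*} [TopologicalSpace H] {I : ModelWithCorners ℝ E H}
  {M : Type*} [TopologicalSpace M] [ChartedSpace H M] [IsManifold I ∞ M]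
  {E' : Type*} [NormedAddCommGroup E'] [NormedSpace ℝ E']
  {H' : Type*} [TopologicalSpace H'] {I' : ModelWithCorners ℝ E' H'}
  {S : Type*} [TopologicalSpace S] [ChartedSpace H' S] [IsManifold I' ∞ S] [MulAction Circle S]
  {πS : S → M} {η : OneForm I' S ℝ}

lemma contMDiff_coe_circle : ContMDiff (𝓡 1) 𝓘(ℝ, ℂ) ∞ (fun z : Circle => (z : ℂ)) :=
  haveI : Fact (Module.finrank ℝ ℂ = 1 + 1) := Complex.finrank_real_complex_fact
  contMDiff_coe_sphere

/-- A one-form as a function with values in a fixed space. -/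
abbrev formE {F : Type*} [NormedAddCommGroup F] [NormedSpace ℝ F] (θ : OneForm I' S F) (s : S) :
    E' →L[ℝ] F := θ s

lemma IsPrincipalBundle.contMDiff_smul {EG : Type*} [NormedAddCommGroup EG] [NormedSpace ℝ EG]
    {HG : Type*} [TopologicalSpace HG] {IG : ModelWithCorners ℝ EG HG}
    {G : Type*} [TopologicalSpace G] [ChartedSpace HG G] [CommGroup G] [MulAction G S]
    (hS : IsPrincipalBundle I I' IG G πS) (g : G) : ContMDiff I' I' ∞ (fun s : S => g • s) :=
  hS.smooth_action.comp (contMDiff_const.prodMk contMDiff_id)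

/-- The logarithm of the group coordinate, and its derivative. -/
lemma exists_log_coord (hS : IsPrincipalBundle I I' (𝓡 1) Circle πS)
    (hη : IsPrincipalConnection I' Circle.exp η) (τ : LocalTriv I I' (𝓡 1) Circle πS) {s₀ : S}
    (hs : πS s₀ ∈ τ.U) :
    ∃ t : S → ℝ, MDifferentiableAt I' 𝓘(ℝ, ℝ) t s₀ ∧ t s₀ = 0 ∧
      (∀ᶠ s in 𝓝 s₀, τ.coord s = Circle.exp (t s) * τ.coord s₀) ∧
      ∀ w, mvfderiv I' t s₀ w = formE η s₀ w - localForm τ η (πS s₀) (dmap I' I πS s₀ w) := by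
  have hU : τ.U ∈ 𝓝 (πS s₀) := τ.isOpen.mem_nhds hs
  have hV : πS ⁻¹' τ.U ∈ 𝓝 s₀ := hS.smooth_proj.continuous.continuousAt hU
  let φ : S → ℂ := fun s => (τ.coord s : ℂ) * ((τ.coord s₀)⁻¹ : Circle)
  have hφ0 : φ s₀ = 1 := by
    change (τ.coord s₀ : ℂ) * ((τ.coord s₀)⁻¹ : Circle) = 1
    rw [← Circle.coe_mul, mul_inv_cancel, Circle.coe_one]
  have hφ : MDifferentiableAt I' 𝓘(ℝ, ℂ) φ s₀ := by
    have h1 : ContMDiffAt I' 𝓘(ℝ, ℂ) ∞ (fun s => (τ.coord s : ℂ)) s₀ :=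
      (contMDiff_coe_circle _).comp s₀ (τ.smooth_coord.contMDiffAt hV)
    exact (((ContinuousLinearMap.mul ℝ ℂ).flip ((τ.coord s₀)⁻¹ : Circle)).contMDiff.contMDiffAt.comp
      s₀ h1).mdifferentiableAt (n := ∞) (by simp)
  have hφlog : MDifferentiableAt I' 𝓘(ℝ, ℝ) (fun s => (Complex.log (φ s)).im) s₀ := by
    have h1 : DifferentiableAt ℝ (fun z : ℂ => (Complex.log z).im) (φ s₀) := by
      have h2 : DifferentiableAt ℂ Complex.log (φ s₀) :=
        Complex.differentiableAt_log (by rw [hφ0]; exact Complex.one_mem_slitPlane)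
      exact Complex.imCLM.differentiableAt.comp _ (h2.restrictScalars ℝ)
    exact h1.mdifferentiableAt.comp s₀ hφ
  have hcoord : ∀ s, τ.coord s = Circle.exp ((Complex.log (φ s)).im) * τ.coord s₀ := fun s => by
    have h1 : φ s = ((τ.coord s * (τ.coord s₀)⁻¹ : Circle) : ℂ) := by
      rw [Circle.coe_mul]
    rw [h1, Complex.log_im, Circle.exp_arg, inv_mul_cancel_right]
  have ht0 : (Complex.log (φ s₀)).im = 0 := by rw [hφ0]; simp
  refine ⟨fun s => (Complex.log (φ s)).im, hφlog, ht0, Filter.Eventually.of_forall hcoord, fun w => ?_⟩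
  have hsec : MDifferentiableAt I I' τ.sec (πS s₀) :=
    (τ.smooth_sec.contMDiffAt hU).mdifferentiableAt (n := ∞) (by simp)
  have hg := ((hS.contMDiff_smul (τ.coord s₀)) (τ.sec (πS s₀))).mdifferentiableAt (n := ∞) (by simp)
  have hσ0 : τ.coord s₀ • τ.sec (πS s₀) = s₀ := τ.coord_smul s₀ hs
  have hA : MDifferentiableAt (𝓘(ℝ, ℝ).prod I') I'
      (fun q : ℝ × S => Circle.exp q.1 • q.2) (0, s₀) := by
    have h1 : ContMDiff (𝓘(ℝ, ℝ).prod I') ((𝓡 1).prod I') ∞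
        (fun q : ℝ × S => (Circle.exp q.1, q.2)) :=
      (contMDiff_circleExp.comp contMDiff_fst).prodMk contMDiff_snd
    exact ((hS.smooth_action.comp h1) (0, s₀)).mdifferentiableAt (n := ∞) (by simp)
  have h1 := fundAt_add_dmap (ex := Circle.exp) (Circle.exp_zero) hA hφlog ht0
    ((hS.smooth_proj s₀).mdifferentiableAt (n := ∞) (by simp))
    (σ := fun x => τ.coord s₀ • τ.sec x) (hg.comp _ hsec) hσ0 (by
      filter_upwards [hV] with s hs'
      rw [smul_smul, ← hcoord s]
      exact τ.coord_smul s hs') w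
  rw [dmap_comp (g := fun s => τ.coord s₀ • s) hg hsec] at h1
  have h2 := hη.invariant (τ.coord s₀) (τ.sec (πS s₀))
    (dmap I I' τ.sec (πS s₀) (dmap I' I πS s₀ w))
  have h3 : formE η s₀ (dmap I' I' (fun s => τ.coord s₀ • s) (τ.sec (πS s₀))
      (dmap I I' τ.sec (πS s₀) (dmap I' I πS s₀ w)))
      = localForm τ η (πS s₀) (dmap I' I πS s₀ w) := by
    have h4 : ∀ s, s = s₀ → formE η s₀ (dmap I' I' (fun s => τ.coord s₀ • s) (τ.sec (πS s₀))
        (dmap I I' τ.sec (πS s₀) (dmap I' I πS s₀ w)))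
        = formE η s (dmap I' I' (fun s => τ.coord s₀ • s) (τ.sec (πS s₀))
        (dmap I I' τ.sec (πS s₀) (dmap I' I πS s₀ w))) := by
      rintro s rfl
      rfl
    exact (h4 _ hσ0).trans h2
  have h4 := congrArg (formE η s₀) h1
  rw [map_add, h3] at h4
  rw [h4]
  have h5 := hη.reproduces (mvfderiv I' (fun s => (Complex.log (φ s)).im) s₀ w) s₀
  rw [show formE η s₀ (fundAt I' Circle.exp (mvfderiv I' (fun s => (Complex.log (φ s)).im) s₀ w) s₀)
    = _ from h5]
  ring

end CircleBundle

section PositiveReals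

variable {E : Type*} [NormedAddCommGroup E] [NormedSpace ℝ E]
  {H : Type*} [TopologicalSpace H] {I : ModelWithCorners ℝ E H}
  {M : Type*} [TopologicalSpace M] [ChartedSpace H M]

lemma contMDiff_posReal_iff {f : M → PosReal} :
    ContMDiff I 𝓘(ℝ, ℝ) ∞ f ↔ ContMDiff I 𝓘(ℝ, ℝ) ∞ (fun x => (f x : ℝ)) :=
  (ContMDiff.subtypeVal_comp_iff (I := I) (I' := 𝓘(ℝ, ℝ)) PosReal f).symm

lemma contMDiff_posReal_val : ContMDiff 𝓘(ℝ, ℝ) 𝓘(ℝ, ℝ) ∞ (fun r : PosReal => (r : ℝ)) :=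
  contMDiff_subtype_val

lemma contMDiff_phase : ContMDiff 𝓘(ℝ, ℂ) (𝓡 1) ∞ phase := by
  have : Fact (Module.finrank ℝ ℂ = 1 + 1) := Complex.finrank_real_complex_fact
  have h1 : ContMDiff 𝓘(ℝ, ℂ) 𝓘(ℝ, ℂ) ∞ (fun z : ℂˣ => (z : ℂ)) := Units.contMDiff_val
  have h2 : ContMDiff 𝓘(ℝ, ℂ) 𝓘(ℝ, ℂ) ∞ (fun z : ℂˣ => (z : ℂ) / (‖(z : ℂ)‖ : ℂ)) := fun z => by
    have h3 : ContDiffAt ℝ ∞ (fun w : ℂ => ‖w‖⁻¹ • w) (z : ℂ) :=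
      ((contDiffAt_norm ℝ z.ne_zero).inv (norm_ne_zero_iff.2 z.ne_zero)).smul contDiffAt_id
    refine (h3.contMDiffAt.comp z (h1 z)).congr_of_eventuallyEq (Filter.Eventually.of_forall
      fun w => ?_)
    simp [div_eq_inv_mul]
  exact h2.codRestrict_sphere _

lemma contMDiff_norm_units : ContMDiff 𝓘(ℝ, ℂ) 𝓘(ℝ, ℝ) ∞ (fun z : ℂˣ => ‖(z : ℂ)‖) := fun z =>
  (contDiffAt_norm ℝ z.ne_zero).contMDiffAt.comp z
    (Units.contMDiff_val (𝕜 := ℝ) (R := ℂ) (n := ∞) z)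

end PositiveReals

section ConeForm

variable {E : Type*} [NormedAddCommGroup E] [NormedSpace ℝ E] [FiniteDimensional ℝ E]
  [CompleteSpace E] {H : Type*} [TopologicalSpace H] {I : ModelWithCorners ℝ E H} [I.Boundaryless]
  {M : Type*} [TopologicalSpace M] [T2Space M] [ChartedSpace H M] [IsManifold I ∞ M]
  {E' : Type*} [NormedAddCommGroup E'] [NormedSpace ℝ E'] [FiniteDimensional ℝ E']
  [CompleteSpace E'] {H' : Type*} [TopologicalSpace H'] {I' : ModelWithCorners ℝ E' H'}
  [I'.Boundaryless]
  {S : Type*} [TopologicalSpace S] [T2Space S] [ChartedSpace H' S] [IsManifold I' ∞ S]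
  {πS : S → M} {η : OneForm I' S ℝ} {κ : OneForm I M ℝ}

/-- The projection of the cone. -/
abbrev coneProj (πS : S → M) : S × PosReal → M := fun p => πS p.1

/-- The logarithm of the radius. -/
def logRadius (p : S × PosReal) : ℝ := Real.log (p.2 : ℝ)

lemma contMDiff_logRadius :
    ContMDiff (I'.prod 𝓘(ℝ, ℝ)) 𝓘(ℝ, ℝ) ∞ (logRadius : S × PosReal → ℝ) := fun p =>
  (Real.contDiffAt_log.2 (ne_of_gt p.2.2)).contMDiffAt.comp p
    ((contMDiff_posReal_val p.2).comp p contMDiffAt_snd)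

/-- The connection form on the cone. -/
def coneOneForm (πS : S → M) (κ : OneForm I M ℝ) (η : OneForm I' S ℝ) :
    OneForm (I'.prod 𝓘(ℝ, ℝ)) (S × PosReal) ℂ := fun p =>
  Complex.ofRealCLM ∘L (pullForm I (I'.prod 𝓘(ℝ, ℝ)) (coneProj πS) κ p
      + mvfderiv (I'.prod 𝓘(ℝ, ℝ)) logRadius p)
    + (Complex.I • Complex.ofRealCLM) ∘L pullForm I' (I'.prod 𝓘(ℝ, ℝ)) Prod.fst η p

lemma coneOneForm_apply (p : S × PosReal) (v : E' × ℝ) :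
    formE (coneOneForm πS κ η) p v
      = ((formE κ (πS p.1) (dmap (I'.prod 𝓘(ℝ, ℝ)) I (coneProj πS) p v)
          + dmap (I'.prod 𝓘(ℝ, ℝ)) 𝓘(ℝ, ℝ) logRadius p v : ℝ) : ℂ)
        + Complex.I * ((formE η p.1 (dmap (I'.prod 𝓘(ℝ, ℝ)) I' Prod.fst p v) : ℝ) : ℂ) := rfl

lemma coneOneForm_im (p : S × PosReal) (v : E' × ℝ) :
    (formE (coneOneForm πS κ η) p v).im
      = formE η p.1 (dmap (I'.prod 𝓘(ℝ, ℝ)) I' Prod.fst p v) := by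
  rw [coneOneForm_apply]
  simp

lemma contMDiff_coneProj (hπ : ContMDiff I' I ∞ πS) :
    ContMDiff (I'.prod 𝓘(ℝ, ℝ)) I ∞ (coneProj πS) := hπ.comp contMDiff_fst

lemma smoothFormAt_mvfderiv_logRadius (p : S × PosReal) :
    SmoothFormAt (fun q : S × PosReal => mvfderiv (I'.prod 𝓘(ℝ, ℝ)) logRadius q) p :=
  smoothFormAt_of_apply fun _ hV =>
    contMDiffAt_mvfderiv_apply (contMDiff_logRadius p) hV.self_of_nhds

lemma smoothFormAt_add {N : Type*} [TopologicalSpace N] [ChartedSpace H' N] [IsManifold I' ∞ N]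
    {F : Type*} [NormedAddCommGroup F] [NormedSpace ℝ F] {θ θ' : OneForm I' N F} {p : N}
    (h : SmoothFormAt θ p) (h' : SmoothFormAt θ' p) : SmoothFormAt (fun q => θ q + θ' q) p :=
  smoothFormAt_of_apply fun _ hV => (h.apply hV.self_of_nhds).add (h'.apply hV.self_of_nhds)

lemma smoothFormAt_clm {N : Type*} [TopologicalSpace N] [ChartedSpace H' N] [IsManifold I' ∞ N]
    {F : Type*} [NormedAddCommGroup F] [NormedSpace ℝ F] {F' : Type*} [NormedAddCommGroup F']
    [NormedSpace ℝ F'] (L : F →L[ℝ] F') {θ : OneForm I' N F} {p : N}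
    (h : SmoothFormAt θ p) : SmoothFormAt (fun q => L ∘L θ q) p :=
  smoothFormAt_of_apply fun _ hV => L.contMDiff.contMDiffAt.comp p (h.apply hV.self_of_nhds)

lemma smoothFormAt_coneOneForm (hπ : ContMDiff I' I ∞ πS) (hκ : ∀ x, SmoothFormAt κ x)
    (hη : ∀ s, SmoothFormAt η s) (p : S × PosReal) :
    SmoothFormAt (coneOneForm πS κ η) p :=
  smoothFormAt_add (smoothFormAt_clm _ (smoothFormAt_add
      (SmoothFormAt.pull (contMDiff_coneProj hπ) (hκ _)) (smoothFormAt_mvfderiv_logRadius p)))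
    (smoothFormAt_clm _ (SmoothFormAt.pull contMDiff_fst (hη _)))

lemma extForm_coneOneForm (hπ : ContMDiff I' I ∞ πS) (hκ : ∀ x, SmoothFormAt κ x)
    (hη : ∀ s, SmoothFormAt η s) {p : S × PosReal} {X Y : VField (I'.prod 𝓘(ℝ, ℝ)) (S × PosReal)}
    (hX : DiffVFAt X p) (hY : DiffVFAt Y p) {r i : E → E → ℝ}
    (hr : ∀ X₁ Y₁ : VField I M, SmoothVF X₁ → SmoothVF Y₁ →
      extForm κ X₁ Y₁ (πS p.1) = r (X₁ (πS p.1)) (Y₁ (πS p.1)))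
    (hi : ∀ X₁ Y₁ : VField I' S, SmoothVF X₁ → SmoothVF Y₁ →
      extForm η X₁ Y₁ p.1 = i (dproj I I' πS p.1 (X₁ p.1)) (dproj I I' πS p.1 (Y₁ p.1))) :
    extForm (coneOneForm πS κ η) X Y p
      = (r (dproj I (I'.prod 𝓘(ℝ, ℝ)) (coneProj πS) p (X p))
          (dproj I (I'.prod 𝓘(ℝ, ℝ)) (coneProj πS) p (Y p)) : ℂ)
        + Complex.I * (i (dproj I (I'.prod 𝓘(ℝ, ℝ)) (coneProj πS) p (X p))
          (dproj I (I'.prod 𝓘(ℝ, ℝ)) (coneProj πS) p (Y p)) : ℂ) := by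
  have hpr := contMDiff_coneProj hπ
  have s1 := SmoothFormAt.pull (p := p) hpr (hκ (πS p.1))
  have s2 := smoothFormAt_mvfderiv_logRadius (I' := I') p
  have s3 := SmoothFormAt.pull (I' := I'.prod 𝓘(ℝ, ℝ)) (p := p) contMDiff_fst (hη p.1)
  have h1 := extForm_add (smoothFormAt_clm Complex.ofRealCLM (smoothFormAt_add s1 s2))
    (smoothFormAt_clm (Complex.I • Complex.ofRealCLM) s3) hX hY
  refine h1.trans ?_
  rw [extForm_clm _ (smoothFormAt_add s1 s2) hX hY, extForm_clm _ s3 hX hY,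
    extForm_add s1 s2 hX hY, extForm_mvfderiv ((contMDiff_logRadius p).of_le
      (WithTop.coe_le_coe.2 le_top)) hX hY]
  obtain ⟨X₁, hX₁, hXX₁⟩ := exists_smoothVF_apply (I := I) (πS p.1)
    (mfderiv (I'.prod 𝓘(ℝ, ℝ)) I (coneProj πS) p (X p))
  obtain ⟨Y₁, hY₁, hYY₁⟩ := exists_smoothVF_apply (I := I) (πS p.1)
    (mfderiv (I'.prod 𝓘(ℝ, ℝ)) I (coneProj πS) p (Y p))
  obtain ⟨X₂, hX₂, hXX₂⟩ := exists_smoothVF_apply (I := I') p.1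
    (mfderiv (I'.prod 𝓘(ℝ, ℝ)) I' Prod.fst p (X p))
  obtain ⟨Y₂, hY₂, hYY₂⟩ := exists_smoothVF_apply (I := I') p.1
    (mfderiv (I'.prod 𝓘(ℝ, ℝ)) I' Prod.fst p (Y p))
  rw [extForm_pullForm hpr (hκ _) hX hY (hX₁.at _).diff (hY₁.at _).diff hXX₁ hYY₁,
    extForm_pullForm contMDiff_fst (hη _) hX hY (hX₂.at _).diff (hY₂.at _).diff hXX₂ hYY₂,
    hr X₁ Y₁ hX₁ hY₁, hi X₂ Y₂ hX₂ hY₂, hXX₁, hYY₁, hXX₂, hYY₂]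
  have hd : ∀ v, dproj I I' πS p.1 (mfderiv (I'.prod 𝓘(ℝ, ℝ)) I' Prod.fst p v)
      = dproj I (I'.prod 𝓘(ℝ, ℝ)) (coneProj πS) p v := fun v =>
    (dmap_comp ((hπ p.1).mdifferentiableAt (n := ∞) (by simp)) mdifferentiableAt_fst v).symm
  rw [hd, hd, add_zero]
  rfl

end ConeForm

section FundamentalFields

variable {E₁ : Type*} [NormedAddCommGroup E₁] [NormedSpace ℝ E₁]
  {H₁ : Type*} [TopologicalSpace H₁] {I₁ : ModelWithCorners ℝ E₁ H₁}
  {M₁ : Type*} [TopologicalSpace M₁] [ChartedSpace H₁ M₁]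
  {E₂ : Type*} [NormedAddCommGroup E₂] [NormedSpace ℝ E₂]
  {H₂ : Type*} [TopologicalSpace H₂] {I₂ : ModelWithCorners ℝ E₂ H₂}
  {M₂ : Type*} [TopologicalSpace M₂] [ChartedSpace H₂ M₂]
  {F : Type*} [NormedAddCommGroup F] [NormedSpace ℝ F] {G : Type*} [CommGroup G]
  [MulAction G M₁] {ex : F → G}

lemma dmap_fundAt (h0 : ex 0 = 1) {f : M₁ → M₂} {x : M₁} {ζ : F}
    (hf : MDifferentiableAt I₁ I₂ f x)
    (hc : MDifferentiableAt 𝓘(ℝ, ℝ) I₁ (fun t : ℝ => ex (t • ζ) • x) 0) :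
    dmap I₁ I₂ f x (fundAt I₁ ex ζ x)
      = dmap 𝓘(ℝ, ℝ) I₂ (fun t : ℝ => f (ex (t • ζ) • x)) 0 (1 : ℝ) := by
  have h1 : ex ((0 : ℝ) • ζ) • x = x := by rw [zero_smul, h0, one_smul]
  have hf' : MDifferentiableAt I₁ I₂ f (ex ((0 : ℝ) • ζ) • x) := by rwa [h1]
  have h2 := dmap_comp (f := fun t : ℝ => ex (t • ζ) • x) hf' hc (1 : ℝ)
  rw [h1] at h2
  exact h2.symm

end FundamentalFields

lemma phase_expUnits (z : ℂ) : phase (expUnits z) = Circle.exp z.im := by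
  apply Circle.ext
  change Complex.exp z / (‖Complex.exp z‖ : ℂ) = Circle.exp z.im
  have h : Complex.exp z = Complex.exp z.re * Complex.exp (z.im * Complex.I) := by
    rw [← Complex.exp_add, Complex.re_add_im]
  rw [Complex.norm_exp, Circle.coe_exp, h, Complex.ofReal_exp,
    mul_div_cancel_left₀ _ (Complex.exp_ne_zero _)]

lemma expUnits_zero : expUnits 0 = 1 := by
  ext
  simp [expUnits]

lemma contMDiff_expUnits : ContMDiff 𝓘(ℝ, ℂ) 𝓘(ℝ, ℂ) ∞ expUnits := by
  refine ContMDiff.of_comp_isOpenEmbedding Units.isOpenEmbedding_val ?_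
  have h : ContDiff ℝ ∞ Complex.exp := Complex.contDiff_exp
  exact h.contMDiff

section ConeAction

variable {E : Type*} [NormedAddCommGroup E] [NormedSpace ℝ E] [FiniteDimensional ℝ E]
  [CompleteSpace E] {H : Type*} [TopologicalSpace H] {I : ModelWithCorners ℝ E H} [I.Boundaryless]
  {M : Type*} [TopologicalSpace M] [T2Space M] [ChartedSpace H M] [IsManifold I ∞ M]
  {E' : Type*} [NormedAddCommGroup E'] [NormedSpace ℝ E'] [FiniteDimensional ℝ E']
  [CompleteSpace E'] {H' : Type*} [TopologicalSpace H'] {I' : ModelWithCorners ℝ E' H'}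
  [I'.Boundaryless]
  {S : Type*} [TopologicalSpace S] [T2Space S] [ChartedSpace H' S] [IsManifold I' ∞ S]
  [MulAction Circle S] {πS : S → M} {η : OneForm I' S ℝ} {κ : OneForm I M ℝ}

lemma coneAction_fst (z : ℂˣ) (p : S × PosReal) : (z • p).1 = phase z • p.1 := rfl

lemma coneAction_snd (z : ℂˣ) (p : S × PosReal) : ((z • p).2 : ℝ) = ‖(z : ℂ)‖ * p.2 := rfl

lemma logRadius_smul (z : ℂˣ) (p : S × PosReal) :
    logRadius (z • p) = Real.log ‖(z : ℂ)‖ + logRadius p := by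
  unfold logRadius
  rw [coneAction_snd, Real.log_mul (norm_ne_zero_iff.2 z.ne_zero) (ne_of_gt p.2.2)]

lemma contMDiff_coneAction (hS : IsPrincipalBundle I I' (𝓡 1) Circle πS) :
    ContMDiff (𝓘(ℝ, ℂ).prod (I'.prod 𝓘(ℝ, ℝ))) (I'.prod 𝓘(ℝ, ℝ)) ∞
      (fun q : ℂˣ × (S × PosReal) => q.1 • q.2) := by
  have h1 : ContMDiff (𝓘(ℝ, ℂ).prod (I'.prod 𝓘(ℝ, ℝ))) I' ∞
      (fun q : ℂˣ × (S × PosReal) => phase q.1 • q.2.1) :=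
    hS.smooth_action.comp ((contMDiff_phase.comp contMDiff_fst).prodMk
      (contMDiff_fst.comp contMDiff_snd))
  have h2 : ContMDiff (𝓘(ℝ, ℂ).prod (I'.prod 𝓘(ℝ, ℝ))) 𝓘(ℝ, ℝ) ∞
      (fun q : ℂˣ × (S × PosReal) => (q.1 • q.2).2) :=
    contMDiff_posReal_iff.2 ((contMDiff_norm_units.comp contMDiff_fst).mul
      (contMDiff_posReal_val.comp (contMDiff_snd.comp contMDiff_snd)))
  exact h1.prodMk h2

lemma contMDiff_cone_smul (hS : IsPrincipalBundle I I' (𝓡 1) Circle πS) (z : ℂˣ) :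
    ContMDiff (I'.prod 𝓘(ℝ, ℝ)) (I'.prod 𝓘(ℝ, ℝ)) ∞ (fun p : S × PosReal => z • p) :=
  (contMDiff_coneAction hS).comp (contMDiff_const.prodMk contMDiff_id)

lemma coneProj_smul (hS : IsPrincipalBundle I I' (𝓡 1) Circle πS) (z : ℂˣ) (p : S × PosReal) :
    coneProj πS (z • p) = coneProj πS p := hS.proj_smul _ _

lemma mdifferentiableAt_fund_curve (hS : IsPrincipalBundle I I' (𝓡 1) Circle πS) (ζ : ℂ)
    (p : S × PosReal) : MDifferentiableAt 𝓘(ℝ, ℝ) (I'.prod 𝓘(ℝ, ℝ))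
      (fun t : ℝ => expUnits (t • ζ) • p) 0 := by
  have h1 : ContMDiff 𝓘(ℝ, ℝ) 𝓘(ℝ, ℂ) ∞ (fun t : ℝ => t • ζ) :=
    ((ContinuousLinearMap.id ℝ ℝ).smulRight ζ).contMDiff
  exact ((contMDiff_coneAction hS).comp ((contMDiff_expUnits.comp h1).prodMk
    contMDiff_const) 0).mdifferentiableAt (n := ∞) (by simp)

lemma dmap_coneProj_fundAt (hS : IsPrincipalBundle I I' (𝓡 1) Circle πS) (ζ : ℂ)
    (p : S × PosReal) :
    dmap (I'.prod 𝓘(ℝ, ℝ)) I (coneProj πS) p (fundAt (I'.prod 𝓘(ℝ, ℝ)) expUnits ζ p) = 0 := by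
  rw [dmap_fundAt expUnits_zero ((contMDiff_coneProj hS.smooth_proj p).mdifferentiableAt
    (n := ∞) (by simp)) (mdifferentiableAt_fund_curve hS ζ p)]
  simp only [coneProj_smul hS]
  exact dmap_const _ _ _

lemma coneOneForm_fundAt (hS : IsPrincipalBundle I I' (𝓡 1) Circle πS)
    (hη : IsPrincipalConnection I' Circle.exp η) (ζ : ℂ) (p : S × PosReal) :
    formE (coneOneForm πS κ η) p (fundAt (I'.prod 𝓘(ℝ, ℝ)) expUnits ζ p) = ζ := by
  have hc := mdifferentiableAt_fund_curve hS ζ p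
  have h1 : dmap (I'.prod 𝓘(ℝ, ℝ)) 𝓘(ℝ, ℝ) logRadius p
      (fundAt (I'.prod 𝓘(ℝ, ℝ)) expUnits ζ p) = ζ.re := by
    refine (dmap_fundAt (I₂ := 𝓘(ℝ, ℝ)) (f := logRadius) expUnits_zero
      ((contMDiff_logRadius p).mdifferentiableAt (n := ∞) (by simp)) hc).trans ?_
    have h2 : (fun t : ℝ => logRadius (expUnits (t • ζ) • p))
        = fun t : ℝ => t * ζ.re + logRadius p := by
      funext t
      rw [logRadius_smul]
      change Real.log ‖Complex.exp (t • ζ)‖ + _ = _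
      rw [Complex.norm_exp, Real.log_exp]
      simp
    rw [h2]
    have h3 : HasDerivAt (fun t : ℝ => t * ζ.re + logRadius p) (1 * ζ.re) 0 :=
      ((hasDerivAt_id (0 : ℝ)).mul_const _).add_const _
    refine (congrArg (fun L : ℝ →L[ℝ] ℝ => L 1)
      (mfderiv_eq_fderiv.trans h3.hasFDerivAt.fderiv)).trans ?_
    simp
  have h2 : dmap (I'.prod 𝓘(ℝ, ℝ)) I' Prod.fst p (fundAt (I'.prod 𝓘(ℝ, ℝ)) expUnits ζ p)
      = fundAt I' Circle.exp ζ.im p.1 := by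
    rw [dmap_fundAt expUnits_zero mdifferentiableAt_fst hc]
    simp only [coneAction_fst, phase_expUnits, Complex.smul_im]
    rfl
  have h3 : formE η p.1 (fundAt I' Circle.exp ζ.im p.1) = ζ.im := hη.reproduces ζ.im p.1
  rw [coneOneForm_apply, dmap_coneProj_fundAt hS, h1, h2, h3, map_zero, zero_add, mul_comm]
  exact Complex.re_add_im ζ

lemma dmap_coneProj_smul (hS : IsPrincipalBundle I I' (𝓡 1) Circle πS) (z : ℂˣ)
    (p : S × PosReal) (v : E' × ℝ) :
    dmap (I'.prod 𝓘(ℝ, ℝ)) I (coneProj πS) (z • p)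
      (dmap (I'.prod 𝓘(ℝ, ℝ)) (I'.prod 𝓘(ℝ, ℝ)) (fun q => z • q) p v)
      = dmap (I'.prod 𝓘(ℝ, ℝ)) I (coneProj πS) p v := by
  have h := dmap_comp (g := coneProj πS) (f := fun q : S × PosReal => z • q)
    ((contMDiff_coneProj hS.smooth_proj (z • p)).mdifferentiableAt (n := ∞) (by simp))
    ((contMDiff_cone_smul hS z p).mdifferentiableAt (n := ∞) (by simp)) v
  simp only [coneProj_smul hS] at h
  exact h.symm

lemma coneOneForm_smul (hS : IsPrincipalBundle I I' (𝓡 1) Circle πS)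
    (hη : IsPrincipalConnection I' Circle.exp η) (z : ℂˣ) (p : S × PosReal) (v : E' × ℝ) :
    formE (coneOneForm πS κ η) (z • p)
      (dmap (I'.prod 𝓘(ℝ, ℝ)) (I'.prod 𝓘(ℝ, ℝ)) (fun q => z • q) p v)
      = formE (coneOneForm πS κ η) p v := by
  have hz := (contMDiff_cone_smul hS z p).mdifferentiableAt (n := ∞) (by simp)
  have h1 : dmap (I'.prod 𝓘(ℝ, ℝ)) 𝓘(ℝ, ℝ) logRadius (z • p)
      (dmap (I'.prod 𝓘(ℝ, ℝ)) (I'.prod 𝓘(ℝ, ℝ)) (fun q => z • q) p v)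
      = dmap (I'.prod 𝓘(ℝ, ℝ)) 𝓘(ℝ, ℝ) logRadius p v := by
    have h := dmap_comp (g := logRadius) (I₃ := 𝓘(ℝ, ℝ)) (f := fun q : S × PosReal => z • q)
      ((contMDiff_logRadius (z • p)).mdifferentiableAt (n := ∞) (by simp)) hz v
    simp only [logRadius_smul] at h
    refine Eq.trans h.symm ((mvfderiv_fun_add_apply mdifferentiableAt_const
      ((contMDiff_logRadius p).mdifferentiableAt (n := ∞) (by simp)) v).trans ?_)
    exact (congrArg (· + _) (dmap_const (I₂ := 𝓘(ℝ, ℝ)) p _ v)).trans (zero_add _)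
  have h2 : dmap (I'.prod 𝓘(ℝ, ℝ)) I' Prod.fst (z • p)
      (dmap (I'.prod 𝓘(ℝ, ℝ)) (I'.prod 𝓘(ℝ, ℝ)) (fun q => z • q) p v)
      = dmap I' I' (fun s => phase z • s) p.1 (dmap (I'.prod 𝓘(ℝ, ℝ)) I' Prod.fst p v) := by
    rw [← dmap_comp mdifferentiableAt_fst hz, ← dmap_comp (g := fun s : S => phase z • s)
      (((hS.contMDiff_smul (phase z)) p.1).mdifferentiableAt (n := ∞) (by simp))
      mdifferentiableAt_fst]
    rfl
  have h3 : formE η (phase z • p.1) (dmap I' I' (fun s => phase z • s) p.1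
      (dmap (I'.prod 𝓘(ℝ, ℝ)) I' Prod.fst p v))
      = formE η p.1 (dmap (I'.prod 𝓘(ℝ, ℝ)) I' Prod.fst p v) := hη.invariant _ _ _
  rw [coneOneForm_apply, coneOneForm_apply, dmap_coneProj_smul hS, h1, h2, coneAction_fst,
    hS.proj_smul, h3]

end ConeAction

section ConeFrame

variable {E : Type*} [NormedAddCommGroup E] [NormedSpace ℝ E] [FiniteDimensional ℝ E]
  [CompleteSpace E] {H : Type*} [TopologicalSpace H] {I : ModelWithCorners ℝ E H} [I.Boundaryless]
  {M : Type*} [TopologicalSpace M] [T2Space M] [ChartedSpace H M] [IsManifold I ∞ M]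
  {E' : Type*} [NormedAddCommGroup E'] [NormedSpace ℝ E'] [FiniteDimensional ℝ E']
  [CompleteSpace E'] {H' : Type*} [TopologicalSpace H'] {I' : ModelWithCorners ℝ E' H'}
  [I'.Boundaryless]
  {S : Type*} [TopologicalSpace S] [T2Space S] [ChartedSpace H' S] [IsManifold I' ∞ S]
  [MulAction Circle S] {πS : S → M} {η : OneForm I' S ℝ} {κ : OneForm I M ℝ}

lemma exists_lift_coneProj (hS : IsPrincipalBundle I I' (𝓡 1) Circle πS) (p : S × PosReal) (u : E) :
    ∃ v : E' × ℝ, dmap (I'.prod 𝓘(ℝ, ℝ)) I (coneProj πS) p v = u := by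
  obtain ⟨τ, hτ⟩ := hS.locallyTrivial (πS p.1)
  have hU : τ.U ∈ 𝓝 (πS p.1) := τ.isOpen.mem_nhds hτ
  let σ : M → S × PosReal := fun x => (τ.coord p.1 • τ.sec x, p.2)
  have hσ0 : σ (πS p.1) = p := Prod.ext (τ.coord_smul p.1 hτ) rfl
  have hσ : MDifferentiableAt I (I'.prod 𝓘(ℝ, ℝ)) σ (πS p.1) := by
    have h1 : ContMDiffAt I I' ∞ (fun x => τ.coord p.1 • τ.sec x) (πS p.1) :=
      (hS.contMDiff_smul (τ.coord p.1) _).comp _ (τ.smooth_sec.contMDiffAt hU)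
    exact (h1.prodMk contMDiffAt_const).mdifferentiableAt (n := ∞) (by simp)
  have hpr : MDifferentiableAt (I'.prod 𝓘(ℝ, ℝ)) I (coneProj πS) (σ (πS p.1)) :=
    (contMDiff_coneProj hS.smooth_proj _).mdifferentiableAt (n := ∞) (by simp)
  have h1 := dmap_comp hpr hσ u
  rw [dmap_congr (g := fun x => x) (by
    filter_upwards [hU] with x hx using τ.proj_smul_sec x hx _), dmap_id, hσ0] at h1
  exact ⟨_, h1.symm⟩

lemma exists_coneFrame (hS : IsPrincipalBundle I I' (𝓡 1) Circle πS)
    (hη : IsPrincipalConnection I' Circle.exp η) (κ : OneForm I M ℝ)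
    (hE : Module.finrank ℝ E' = Module.finrank ℝ E + 1) :
    ∃ ε : Π p : S × PosReal, (E × ℂ) →L[ℝ] TangentSpace (I'.prod 𝓘(ℝ, ℝ)) p,
      (∀ p v, ε p (dproj I (I'.prod 𝓘(ℝ, ℝ)) (coneProj πS) p v, coneOneForm πS κ η p v) = v) ∧
      (∀ p z, dproj I (I'.prod 𝓘(ℝ, ℝ)) (coneProj πS) p (ε p z) = z.1) ∧
      ∀ p z, coneOneForm πS κ η p (ε p z) = z.2 := by
  have hp : ∀ p : S × PosReal, ∃ e : (E × ℂ) →L[ℝ] (E' × ℝ),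
      (∀ v, e (dmap (I'.prod 𝓘(ℝ, ℝ)) I (coneProj πS) p v, formE (coneOneForm πS κ η) p v) = v) ∧
      ∀ z, (dmap (I'.prod 𝓘(ℝ, ℝ)) I (coneProj πS) p (e z), formE (coneOneForm πS κ η) p (e z)) = z :=
      fun p => by
    let Φ : (E' × ℝ) →L[ℝ] (E × ℂ) :=
      (dmap (I'.prod 𝓘(ℝ, ℝ)) I (coneProj πS) p).prod (formE (coneOneForm πS κ η) p)
    have hsurj : Function.Surjective Φ := by
      rintro ⟨u, ζ⟩
      obtain ⟨v, hv⟩ := exists_lift_coneProj hS p u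
      refine ⟨v + fundAt (I'.prod 𝓘(ℝ, ℝ)) expUnits (ζ - formE (coneOneForm πS κ η) p v) p,
        Prod.ext ?_ ?_⟩
      · refine (map_add (dmap (I'.prod 𝓘(ℝ, ℝ)) I (coneProj πS) p) _ _).trans ?_
        rw [hv, dmap_coneProj_fundAt hS]
        exact add_zero _
      · refine (map_add (formE (coneOneForm πS κ η) p) _ _).trans ?_
        rw [coneOneForm_fundAt hS hη]
        exact add_sub_cancel _ _
    have hdim : Module.finrank ℝ (E' × ℝ) = Module.finrank ℝ (E × ℂ) := by
      rw [Module.finrank_prod, Module.finrank_prod, Complex.finrank_real_complex,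
        Module.finrank_self, hE]
    have hinj : Function.Injective Φ :=
      (LinearMap.injective_iff_surjective_of_finrank_eq_finrank (f := Φ.toLinearMap) hdim).2 hsurj
    let e := LinearEquiv.ofBijective Φ.toLinearMap ⟨hinj, hsurj⟩
    exact ⟨LinearMap.toContinuousLinearMap e.symm.toLinearMap, fun v => e.symm_apply_apply v,
      fun z => e.apply_symm_apply z⟩
  choose e he₁ he₂ using hp
  exact ⟨e, he₁, fun p z => congrArg Prod.fst (he₂ p z), fun p z => congrArg Prod.snd (he₂ p z)⟩

/-- The function `g⁻²` on the cone, where `g` is the group coordinate of a local trivialization. -/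
def conePhase (τ : LocalTriv I I' (𝓡 1) Circle πS) (p : S × PosReal) : ℂ :=
  (((τ.coord p.1)⁻¹ ^ 2 : Circle) : ℂ)

lemma conePhase_mul_conj (τ : LocalTriv I I' (𝓡 1) Circle πS) (p : S × PosReal) :
    conePhase τ p * starRingEnd ℂ (conePhase τ p) = 1 := by
  unfold conePhase
  rw [← Circle.coe_inv_eq_conj, ← Circle.coe_mul, mul_inv_cancel, Circle.coe_one]

lemma contMDiffAt_conePhase (hS : IsPrincipalBundle I I' (𝓡 1) Circle πS)
    (τ : LocalTriv I I' (𝓡 1) Circle πS) {p : S × PosReal} (hp : πS p.1 ∈ τ.U) :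
    ContMDiffAt (I'.prod 𝓘(ℝ, ℝ)) 𝓘(ℝ, ℂ) ∞ (conePhase τ) p := by
  have hV : πS ⁻¹' τ.U ∈ 𝓝 p.1 :=
    hS.smooth_proj.continuous.continuousAt (τ.isOpen.mem_nhds hp)
  have h1 : ContMDiffAt (I'.prod 𝓘(ℝ, ℝ)) 𝓘(ℝ, ℂ) ∞
      (fun q : S × PosReal => (τ.coord q.1 : ℂ)) p :=
    (contMDiff_coe_circle _).comp p ((τ.smooth_coord.contMDiffAt hV).comp p contMDiffAt_fst)
  have h2 : ContDiff ℝ ∞ (fun z : ℂ => (starRingEnd ℂ z) ^ 2) :=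
    Complex.conjCLE.contDiff.pow 2
  refine (h2.contMDiff.contMDiffAt.comp p h1).congr_of_eventuallyEq
    (Filter.Eventually.of_forall fun q => ?_)
  change (((τ.coord q.1)⁻¹ ^ 2 : Circle) : ℂ) = (starRingEnd ℂ (τ.coord q.1 : ℂ)) ^ 2
  rw [Circle.coe_pow, Circle.coe_inv_eq_conj]

lemma mvfderiv_conePhase (hS : IsPrincipalBundle I I' (𝓡 1) Circle πS)
    (hη : IsPrincipalConnection I' Circle.exp η)
    (τ : LocalTriv I I' (𝓡 1) Circle πS) {p : S × PosReal} (hp : πS p.1 ∈ τ.U) (V : E' × ℝ) :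
    dmap (I'.prod 𝓘(ℝ, ℝ)) 𝓘(ℝ, ℂ) (conePhase τ) p V
      = -(2 * Complex.I * ((formE (coneOneForm πS κ η) p V).im
        - localForm τ η (πS p.1) (dmap (I'.prod 𝓘(ℝ, ℝ)) I (coneProj πS) p V) : ℝ)
          * conePhase τ p) := by
  obtain ⟨t, ht, ht0, hev, htd⟩ := exists_log_coord hS hη τ hp
  let g : ℝ → ℂ := fun x => Complex.exp (-(2 * Complex.I) * x) * conePhase τ p
  have hg : HasDerivAt g (-(2 * Complex.I) * conePhase τ p) 0 := by
    have h1 : HasDerivAt (fun x : ℝ => -(2 * Complex.I) * (x : ℂ)) (-(2 * Complex.I) * 1) 0 :=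
      (Complex.ofRealCLM.hasDerivAt (x := (0 : ℝ))).const_mul _
    have h2 := (h1.cexp).mul_const (conePhase τ p)
    simpa [g] using h2
  have hgd : MDifferentiableAt 𝓘(ℝ, ℝ) 𝓘(ℝ, ℂ) g (t p.1) := by
    rw [ht0]
    exact hg.differentiableAt.mdifferentiableAt
  have h1 : conePhase τ =ᶠ[𝓝 p] fun q => g (t q.1) := by
    filter_upwards [continuousAt_fst.eventually hev] with q hq
    change (((τ.coord q.1)⁻¹ ^ 2 : Circle) : ℂ)
      = Complex.exp (-(2 * Complex.I) * t q.1) * (((τ.coord p.1)⁻¹ ^ 2 : Circle) : ℂ)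
    rw [hq, mul_inv, mul_pow, Circle.coe_mul, ← Circle.exp_neg, Circle.coe_pow, Circle.coe_exp,
      ← Complex.exp_nat_mul]
    congr 2
    push_cast
    ring
  have ht' : MDifferentiableAt (I'.prod 𝓘(ℝ, ℝ)) 𝓘(ℝ, ℝ) (fun q : S × PosReal => t q.1) p :=
    ht.comp p mdifferentiableAt_fst
  have h2 := dmap_comp (g := t) (f := (Prod.fst : S × PosReal → S)) (I₃ := 𝓘(ℝ, ℝ)) ht
    (mdifferentiableAt_fst (I := I') (I' := 𝓘(ℝ, ℝ)) (x := p)) V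
  have h3 : dmap I' I πS p.1 (dmap (I'.prod 𝓘(ℝ, ℝ)) I' Prod.fst p V)
      = dmap (I'.prod 𝓘(ℝ, ℝ)) I (coneProj πS) p V :=
    (dmap_comp ((hS.smooth_proj p.1).mdifferentiableAt (n := ∞) (by simp))
      mdifferentiableAt_fst V).symm
  have h4 : dmap I' 𝓘(ℝ, ℝ) t p.1 (dmap (I'.prod 𝓘(ℝ, ℝ)) I' Prod.fst p V)
      = (formE (coneOneForm πS κ η) p V).im
        - localForm τ η (πS p.1) (dmap (I'.prod 𝓘(ℝ, ℝ)) I (coneProj πS) p V) := by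
    rw [coneOneForm_im, ← h3]
    exact htd _
  have h5 : ∀ r : ℝ, dmap 𝓘(ℝ, ℝ) 𝓘(ℝ, ℂ) g 0 r = r • (-(2 * Complex.I) * conePhase τ p) := fun r => by
    refine (congrArg (fun L : ℝ →L[ℝ] ℂ => L r)
      (mfderiv_eq_fderiv.trans hg.hasFDerivAt.fderiv)).trans ?_
    simp
  rw [dmap_congr h1, dmap_comp (g := g) (f := fun q : S × PosReal => t q.1) hgd ht', h2, h4, ht0,
    h5, Complex.real_smul]
  ring

lemma conePhase_trans (τ₁ τ₂ : LocalTriv I I' (𝓡 1) Circle πS) {p : S × PosReal}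
    (h₁ : πS p.1 ∈ τ₁.U) (h₂ : πS p.1 ∈ τ₂.U) :
    conePhase τ₂ p * transFactor τ₁ τ₂ (πS p.1) = conePhase τ₁ p := by
  have h3 : πS (τ₂.sec (πS p.1)) = πS p.1 := by
    simpa using τ₂.proj_smul_sec (πS p.1) h₂ 1
  have h4 : τ₁.coord (τ₂.sec (πS p.1)) • τ₁.sec (πS p.1) = τ₂.sec (πS p.1) := by
    have h := τ₁.coord_smul (τ₂.sec (πS p.1)) (by rwa [h3])
    rwa [h3] at h
  have h5 : τ₁.coord p.1 = τ₂.coord p.1 * transition τ₁ τ₂ (πS p.1) := by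
    have h := τ₂.coord_smul p.1 h₂
    rw [← h4, smul_smul] at h
    have h6 := τ₁.coord_smul_sec (πS p.1) h₁ (τ₂.coord p.1 * τ₁.coord (τ₂.sec (πS p.1)))
    rwa [h] at h6
  unfold conePhase transFactor
  rw [h5, ← Circle.coe_mul]
  congr 1
  rw [mul_inv, mul_pow]

variable {n : ℕ} {J : EndField I M} {P : Set (AffConn I M)} {Λ : Type*}
  {τ : Λ → LocalTriv I I' (𝓡 1) Circle πS} {B : Λ → Tensor12 I M} {c : Λ → Tensor02 I M}
  {D : AffConn I M} {a : M → E →L[ℝ] E →L[ℝ] ℝ}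

lemma fundTensor_antisymm {α : Λ} {x : M} {u v : E}
    (ha : ∀ u v : E, fundTensor n J D (B α) x u v = a x u v) :
    a x v u - a x u v = antisymm (rho n J D) x u v := by
  have h1 : traceSq (B α) x u v = traceSq (B α) x v u := by
    rw [traceSq_eq (B α) x u v, traceSq_eq (B α) x v u, trL_comm]
  rw [← ha, ← ha]
  unfold fundTensor antisymm
  rw [h1]
  ring

/-- The total space of the cone carries the data of a `ConeTotal`. -/
lemma IsPSCB.coneTotal (h : IsPSCB n J P πS η τ B c) (hJ : IsComplexStructure J)
    (hS : IsPrincipalBundle I I' (𝓡 1) Circle πS)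
    (hη : IsPrincipalConnection I' Circle.exp η)
    (ha : ∀ α, ∀ x ∈ (τ α).U, ∀ u v : E, fundTensor n J D (B α) x u v = a x u v)
    (hcurv : ∀ α, ∀ V W : VField I' S, SmoothVF V → SmoothVF W → ∀ s : S, πS s ∈ (τ α).U →
        extD η V W s = 2 * antisymm (twist J (fundTensor n J D (B α))) (πS s)
          (mfderiv I' I πS s (V s)) (mfderiv I' I πS s (W s)))
    (hκ : ∀ x, SmoothFormAt κ x)
    (hdκ : ∀ x (X Y : VField I M), DiffVFAt X x → DiffVFAt Y x →
      extForm κ X Y x = antisymm (rho n J D) x (X x) (Y x))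
    {ε : Π p : S × PosReal, (E × ℂ) →L[ℝ] TangentSpace (I'.prod 𝓘(ℝ, ℝ)) p}
    (hε₁ : ∀ p v, ε p (dproj I (I'.prod 𝓘(ℝ, ℝ)) (coneProj πS) p v, coneOneForm πS κ η p v) = v)
    (hε₂ : ∀ p z, dproj I (I'.prod 𝓘(ℝ, ℝ)) (coneProj πS) p (ε p z) = z.1)
    (hε₃ : ∀ p z, coneOneForm πS κ η p (ε p z) = z.2) :
    ConeTotal (coneProj πS) (coneOneForm πS κ η) ε J (fun α => (τ α).U)
      (fun α x u => localForm (τ α) η x u) a (fun α => tensorAt (B α)) (fun α => formAt (c α))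
      (fun α => conePhase (τ α)) where
  smooth_proj := contMDiff_coneProj hS.smooth_proj
  smooth_form p := smoothFormAt_coneOneForm hS.smooth_proj hκ
    (fun _ => smoothFormAt_of_global fun V hV => hη.smooth V hV _) p
  left_inv := hε₁
  proj_frame := hε₂
  form_frame := hε₃
  extForm_form p X Y hX hY := by
    obtain ⟨α, hα⟩ := h.cover (πS p.1)
    have hηs : ∀ s, SmoothFormAt η s :=
      fun s => smoothFormAt_of_global fun V hV => hη.smooth V hV _
    rw [extForm_coneOneForm hS.smooth_proj hκ hηs hX hY
      (r := fun u v => a (πS p.1) v u - a (πS p.1) u v)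
      (i := fun u v => a (πS p.1) u (endAt J (πS p.1) v) - a (πS p.1) v (endAt J (πS p.1) u))
      (fun X₁ Y₁ hX₁ hY₁ => ?_) (fun X₁ Y₁ hX₁ hY₁ => ?_)]
    · rw [complexify_apply, complexify_apply]
      push_cast
      ring
    · rw [hdκ _ X₁ Y₁ (hX₁.at _).diff (hY₁.at _).diff]
      exact (fundTensor_antisymm (E := E) (I := I) (u := X₁ (πS p.1)) (v := Y₁ (πS p.1)) (ha α _ hα)).symm
    · refine (hcurv α X₁ Y₁ hX₁ hY₁ p.1 hα).trans ?_
      have h1 : ∀ u v : E, 2 * antisymm (twist J (fundTensor n J D (B α))) (πS p.1) u v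
          = a (πS p.1) u (endAt J (πS p.1) v) - a (πS p.1) v (endAt J (πS p.1) u) := fun u v => by
        rw [← ha α _ hα, ← ha α _ hα]
        unfold antisymm twist
        exact mul_div_cancel₀ _ two_ne_zero
      exact h1 _ _
  smooth_phase α p hp := contMDiffAt_conePhase hS (τ α) hp
  phase_mul_conj α p _ := conePhase_mul_conj (τ α) p
  mvfderiv_phase α p hp V := mvfderiv_conePhase hS hη (τ α) hp V
  tensor_trans α β p hα hβ v w := by
    have h1 : tensorAt (B β) (πS p.1) v w
        = cmul (endAt J (πS p.1)) (transFactor (τ α) (τ β) (πS p.1))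
          (tensorAt (B α) (πS p.1) v w) := h.B_trans α β _ ⟨hα, hβ⟩ v w
    have hJ2 : ∀ u : E, endAt J (πS p.1) (endAt J (πS p.1) u) = -u := hJ.sq (πS p.1)
    rw [h1, cmul_cmul hJ2]
    exact congrArg (fun z => cmul (endAt J (πS p.1)) z (tensorAt (B α) (πS p.1) v w))
      (conePhase_trans (τ α) (τ β) hα hβ)
  form_trans α β p hα hβ v w := by
    have h1 := h.c_trans α β _ ⟨hα, hβ⟩ v w
    have h2 := conePhase_trans (τ α) (τ β) hα hβ
    have h3 : ∀ δ, complexify 1 (endAt J (πS p.1)) (formAt (c δ) (πS p.1)) v w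
        = (c δ (πS p.1) v w : ℂ) + Complex.I * (c δ (πS p.1) v (J (πS p.1) w) : ℂ) := fun δ => by
      rw [complexify_apply, Complex.ofReal_one, one_mul]
      rfl
    rw [h3, h3, h1, ← h2, mul_assoc]

end ConeFrame

section Units

variable {E : Type*} [NormedAddCommGroup E] [NormedSpace ℝ E]
  {H : Type*} [TopologicalSpace H] {I : ModelWithCorners ℝ E H}
  {M : Type*} [TopologicalSpace M] [ChartedSpace H M]

lemma contMDiffAt_units {f : M → ℂˣ} {x : M}
    (hf : ContMDiffAt I 𝓘(ℝ, ℂ) ∞ (fun y => (f y : ℂ)) x) : ContMDiffAt I 𝓘(ℝ, ℂ) ∞ f x :=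
  contMDiffAt_iff_target.2
    ⟨Units.isOpenEmbedding_val.isEmbedding.isInducing.continuousAt_iff.2 hf.continuousAt, hf⟩

end Units

section ConePrincipal

variable {E : Type*} [NormedAddCommGroup E] [NormedSpace ℝ E] [FiniteDimensional ℝ E]
  [CompleteSpace E] {H : Type*} [TopologicalSpace H] {I : ModelWithCorners ℝ E H} [I.Boundaryless]
  {M : Type*} [TopologicalSpace M] [T2Space M] [ChartedSpace H M] [IsManifold I ∞ M]
  {E' : Type*} [NormedAddCommGroup E'] [NormedSpace ℝ E'] [FiniteDimensional ℝ E']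
  [CompleteSpace E'] {H' : Type*} [TopologicalSpace H'] {I' : ModelWithCorners ℝ E' H'}
  [I'.Boundaryless]
  {S : Type*} [TopologicalSpace S] [T2Space S] [ChartedSpace H' S] [IsManifold I' ∞ S]
  [MulAction Circle S] {πS : S → M} {η : OneForm I' S ℝ} {κ : OneForm I M ℝ}

lemma ofReal_mul_circle_ne_zero (r : PosReal) (g : Circle) : ((r : ℝ) : ℂ) * (g : ℂ) ≠ 0 :=
  mul_ne_zero (Complex.ofReal_ne_zero.2 (ne_of_gt r.2)) g.coe_ne_zero

lemma norm_ofReal_mul_circle (r : PosReal) (g : Circle) : ‖((r : ℝ) : ℂ) * (g : ℂ)‖ = r := by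
  rw [norm_mul, Circle.norm_coe, mul_one, Complex.norm_real, Real.norm_of_nonneg (le_of_lt r.2)]

lemma phase_mk0 (r : PosReal) (g : Circle) :
    phase (Units.mk0 (((r : ℝ) : ℂ) * (g : ℂ)) (ofReal_mul_circle_ne_zero r g)) = g := by
  apply Circle.ext
  change ((r : ℝ) : ℂ) * (g : ℂ) / (‖((r : ℝ) : ℂ) * (g : ℂ)‖ : ℂ) = g
  rw [norm_ofReal_mul_circle, mul_div_cancel_left₀ _ (Complex.ofReal_ne_zero.2 (ne_of_gt r.2))]

/-- The local trivialization of the cone defined by a local trivialization of the circle bundle. -/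
def LocalTriv.cone (hS : IsPrincipalBundle I I' (𝓡 1) Circle πS)
    (τ : LocalTriv I I' (𝓡 1) Circle πS) :
    LocalTriv I (I'.prod 𝓘(ℝ, ℝ)) 𝓘(ℝ, ℂ) ℂˣ (coneProj πS) where
  U := τ.U
  isOpen := τ.isOpen
  sec x := (τ.sec x, ⟨1, Set.mem_Ioi.2 one_pos⟩)
  coord p := Units.mk0 (((p.2 : ℝ) : ℂ) * (τ.coord p.1 : ℂ)) (ofReal_mul_circle_ne_zero _ _)
  smooth_sec := τ.smooth_sec.prodMk contMDiffOn_const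
  smooth_coord := by
    intro p hp
    have hV : πS ⁻¹' τ.U ∈ 𝓝 p.1 :=
      hS.smooth_proj.continuous.continuousAt (τ.isOpen.mem_nhds hp)
    have h1 : ContMDiffAt (I'.prod 𝓘(ℝ, ℝ)) 𝓘(ℝ, ℂ) ∞
        (fun q : S × PosReal => (τ.coord q.1 : ℂ)) p :=
      (contMDiff_coe_circle _).comp p ((τ.smooth_coord.contMDiffAt hV).comp p contMDiffAt_fst)
    have h2 : ContMDiffAt (I'.prod 𝓘(ℝ, ℝ)) 𝓘(ℝ, ℝ) ∞ (fun q : S × PosReal => (q.2 : ℝ)) p :=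
      (contMDiff_posReal_val p.2).comp p contMDiffAt_snd
    have h3 : ContMDiffAt (I'.prod 𝓘(ℝ, ℝ)) 𝓘(ℝ, ℂ) ∞
        (fun q : S × PosReal => ((q.2 : ℝ) : ℂ) * (τ.coord q.1 : ℂ)) p := by
      refine (h2.smul h1).congr_of_eventuallyEq (Filter.Eventually.of_forall fun q => ?_)
      exact (Complex.real_smul).symm
    exact (contMDiffAt_units h3).contMDiffWithinAt
  proj_smul_sec x hx z := τ.proj_smul_sec x hx (phase z)
  coord_smul_sec x hx z := by
    apply Units.ext
    change ((‖(z : ℂ)‖ * (1 : ℝ) : ℝ) : ℂ) * (τ.coord (phase z • τ.sec x) : ℂ) = z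
    rw [τ.coord_smul_sec x hx, mul_one]
    exact mul_div_cancel₀ _ (Complex.ofReal_ne_zero.2 (norm_ne_zero_iff.2 z.ne_zero))
  coord_smul p hp := by
    refine Prod.ext ?_ (Subtype.ext ?_)
    · rw [coneAction_fst, phase_mk0]
      exact τ.coord_smul p.1 hp
    · rw [coneAction_snd]
      change ‖((p.2 : ℝ) : ℂ) * (τ.coord p.1 : ℂ)‖ * 1 = _
      rw [norm_ofReal_mul_circle, mul_one]

lemma isPrincipalBundle_cone (hS : IsPrincipalBundle I I' (𝓡 1) Circle πS) :
    IsPrincipalBundle I (I'.prod 𝓘(ℝ, ℝ)) 𝓘(ℝ, ℂ) ℂˣ (coneProj πS) where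
  smooth_proj := contMDiff_coneProj hS.smooth_proj
  smooth_action := contMDiff_coneAction hS
  proj_smul := coneProj_smul hS
  locallyTrivial x := by
    obtain ⟨τ, hτ⟩ := hS.locallyTrivial x
    exact ⟨τ.cone hS, hτ⟩

variable {ε : Π p : S × PosReal, (E × ℂ) →L[ℝ] TangentSpace (I'.prod 𝓘(ℝ, ℝ)) p}
  {J : EndField I M} {D : AffConn I M} {h : M → E →L[ℝ] E →L[ℝ] ℂ}
  {b : S × PosReal → E →L[ℝ] E →L[ℝ] E} {k : S × PosReal → E →L[ℝ] E →L[ℝ] ℂ}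

lemma ConeData.fundVF_eq (C : ConeData (coneProj πS) (coneOneForm πS κ η) ε J D h b k)
    (hS : IsPrincipalBundle I I' (𝓡 1) Circle πS)
    (hη : IsPrincipalConnection I' Circle.exp η) (ζ : ℂ) (p : S × PosReal) :
    fundVF (I'.prod 𝓘(ℝ, ℝ)) expUnits ζ p = ε p (0, ζ) :=
  C.frame_injective ((dmap_coneProj_fundAt hS ζ p).trans (C.proj_frame p (0, ζ)).symm)
    ((coneOneForm_fundAt hS hη ζ p).trans (C.form_frame p (0, ζ)).symm)

lemma ConeData.isConnectionOfType (C : ConeData (coneProj πS) (coneOneForm πS κ η) ε J D h b k)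
    (hS : IsPrincipalBundle I I' (𝓡 1) Circle πS)
    (hη : IsPrincipalConnection I' Circle.exp η) :
    IsConnectionOfType (coneJ (coneProj πS) (coneOneForm πS κ η) ε J) (coneOneForm πS κ η) := by
  refine ⟨⟨fun V hV p => (C.smooth_form p).apply (hV.at p), coneOneForm_smul hS hη,
    coneOneForm_fundAt hS hη⟩, fun p v hv => ?_⟩
  rw [C.form_coneJ, hv, mul_zero]

lemma ConeData.isProjectiveSpecialComplex
    (C : ConeData (coneProj πS) (coneOneForm πS κ η) ε J D h b k)
    (hS : IsPrincipalBundle I I' (𝓡 1) Circle πS)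
    (hη : IsPrincipalConnection I' Circle.exp η) :
    IsProjectiveSpecialComplex J (coneProj πS) (coneJ (coneProj πS) (coneOneForm πS κ η) ε J)
      (coneConn C) (coneEuler ε) where
  conical := C.isConicalSpecialComplex
  principal := isPrincipalBundle_cone hS
  fund_one p := C.fundVF_eq hS hη 1 p
  fund_I p := by
    refine C.frame_injective ?_ ?_
    · rw [C.dproj_coneJ, C.fundVF_eq hS hη, coneEuler, C.proj_frame, C.proj_frame, map_zero]
    · rw [C.form_coneJ, C.fundVF_eq hS hη, coneEuler, C.form_frame, C.form_frame, mul_one]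
  holomorphic_action z p v := by
    refine C.frame_injective ?_ ?_
    · rw [C.dproj_coneJ]
      refine (dmap_coneProj_smul hS z p _).trans ((C.dproj_coneJ p v).trans ?_)
      rw [coneProj_smul hS]
      exact congrArg (endAt J (πS p.1)) (dmap_coneProj_smul hS z p v).symm
    · rw [C.form_coneJ]
      refine (coneOneForm_smul hS hη z p _).trans ((C.form_coneJ p v).trans ?_)
      exact congrArg (Complex.I * ·) (coneOneForm_smul hS hη z p v).symm
  complexBase := C.complexBase
  holomorphic_proj := C.dproj_coneJ

end ConePrincipal

section CProjShift

variable {E : Type*} [NormedAddCommGroup E] [NormedSpace ℝ E]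

/-- The symmetric bilinear map `(v, w) ↦ l(v) w + l(w) v`, where complex numbers act by means
of `J`. -/
def cmulForm (J : E →L[ℝ] E) (l : E →L[ℝ] ℂ) : E →L[ℝ] E →L[ℝ] E :=
  (Complex.reCLM.smulRight (ContinuousLinearMap.id ℝ E) + Complex.imCLM.smulRight J) ∘L l
    + ((Complex.reCLM.smulRight (ContinuousLinearMap.id ℝ E) + Complex.imCLM.smulRight J) ∘L l).flip

lemma cmulForm_apply (J : E →L[ℝ] E) (l : E →L[ℝ] ℂ) (v w : E) :
    cmulForm J l v w = cmul J (l v) w + cmul J (l w) v := by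
  simp [cmulForm, cmul]

lemma cmulForm_symm (J : E →L[ℝ] E) (l : E →L[ℝ] ℂ) (v w : E) :
    cmulForm J l v w = cmulForm J l w v := by
  rw [cmulForm_apply, cmulForm_apply, add_comm]

lemma sub_cmulForm (J : E →L[ℝ] E) (l : E →L[ℝ] ℂ) (u v w : E) :
    u - cmulForm J l w v = u + cmul J (-l v) w + cmul J (-l w) v := by
  rw [cmulForm_apply]
  simp only [cmul, Complex.neg_re, Complex.neg_im]
  module

lemma cmulForm_J {J : E →L[ℝ] E} {l : E →L[ℝ] ℂ} (hJ : ∀ v, J (J v) = -v)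
    (hl : ∀ v, l (J v) = Complex.I * l v) (v w : E) :
    cmulForm J l (J v) w = J (cmulForm J l v w) := by
  rw [cmulForm_apply, cmulForm_apply, hl, map_add, map_cmul, map_cmul, ← cmul_cmul hJ, cmul_I,
    map_cmul]

variable [FiniteDimensional ℝ E]
  [CompleteSpace E] {H : Type*} [TopologicalSpace H] {I : ModelWithCorners ℝ E H} [I.Boundaryless]
  {M : Type*} [TopologicalSpace M] [T2Space M] [ChartedSpace H M] [IsManifold I ∞ M]
  {J : EndField I M} {D : AffConn I M} {l : OneForm I M ℂ}

/-- The connection `D_X Y - l(X) Y - l(Y) X`. -/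
def cprojShift (J : EndField I M) (D : AffConn I M) (l : OneForm I M ℂ) : AffConn I M :=
  D.addOneForm fun x => (-cmulForm (endAt J x) (formE l x) : E →L[ℝ] E →L[ℝ] E)

/-- The covariant derivative of a vector field, with values in the model space. -/
abbrev covE (D : AffConn I M) (Y : VField I M) (x : M) : E →L[ℝ] E := D Y x

/-- The covariant derivative of the velocity of a curve, with values in the model space. -/
abbrev accelE (D : AffConn I M) (c : ℝ → M) (t : ℝ) : E := accel D c t

lemma cprojShift_apply (J : EndField I M) (D : AffConn I M) (l : OneForm I M ℂ) (Y : VField I M)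
    (x : M) (v : E) : covE (cprojShift J D l) Y x v
      = covE D Y x v - cmulForm (endAt J x) (formE l x) (Y x) v := by
  change covE D Y x v + -(cmulForm (endAt J x) (formE l x) (Y x) v) = _
  rw [sub_eq_add_neg]

lemma smoothVFAt_cmulForm (hJ : IsComplexStructure J) (hl : ∀ x, SmoothFormAt l x)
    {Y Z : VField I M} (hY : SmoothVF Y) (hZ : SmoothVF Z) (x : M) :
    SmoothVFAt (I := I) (fun y => cmulForm (endAt J y) (formE l y) (Y y : E) (Z y : E)) x := by
  have h1 : ∀ {Y Z : VField I M}, SmoothVF Y → SmoothVF Z →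
      SmoothVFAt (I := I) (fun y => (l y (Y y)).re • Z y + (l y (Y y)).im • J y (Z y)) x :=
    fun {Y Z} hY hZ => by
      have hlY := (hl x).apply (hY.at x)
      have hre := Complex.reCLM.contMDiff.contMDiffAt.comp x hlY
      have him := Complex.imCLM.contMDiff.contMDiffAt.comp x hlY
      exact (hre.smul_section (hZ.at x)).add_section (him.smul_section ((hJ.smooth Z hZ).at x))
  refine ((h1 hY hZ).add_section (h1 hZ hY)).congr_of_eventuallyEq
    (Filter.Eventually.of_forall fun y => ?_)
  exact congrArg (fun v : E => (⟨y, v⟩ : TangentBundle I M)) (cmulForm_apply _ _ _ _)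

lemma isConnForm_cprojShift (hJ : IsComplexStructure J) (hD : IsTorsionFreeComplex J D)
    (hl : ∀ x, SmoothFormAt l x) (x₀ : M) :
    IsConnForm (cprojShift J D l) (fun y => toChart x₀ y)
      (fun y => christoffel D x₀ y - conj₂ I x₀ y (cmulForm (endAt J y) (formE l y)))
      (chartAt H x₀).source where
  eq q hq V hV v := by
    have h1 : covE (cprojShift J D l) V q v
        = covE D V q v - cmulForm (endAt J q) (formE l q) v (V q) :=
      (cprojShift_apply J D l V q v).trans
        (congrArg (fun e : E => covE D V q v - e) (cmulForm_symm _ _ _ _))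
    refine (congrArg (fun e : E => toChart (I := I) x₀ q e) h1).trans ?_
    refine (map_sub (toChart (I := I) x₀ q) _ _).trans ?_
    refine (congrArg₂ (fun a b : E => a - b) (toChart_affConn D hq hV v)
      (conj₂_toChart hq _ _ _).symm).trans ?_
    exact add_sub_assoc _ _ _
  smooth q hq := (contMDiffAt_christoffel hD.smooth hq).sub
    (contMDiffAt_conj₂ hq fun _ _ hY hZ => smoothVFAt_cmulForm hJ hl hY hZ q)

lemma isTorsionFreeComplex_cprojShift (hJ : IsComplexStructure J) (hD : IsTorsionFreeComplex J D)
    (hl : ∀ x, SmoothFormAt l x) (hlJ : ∀ x (v : E), formE l x (endAt J x v) = Complex.I * formE l x v) :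
    IsTorsionFreeComplex J (cprojShift J D l) where
  smooth := contMDiffCovariantDerivative_of_connForm fun q =>
    ⟨_, _, _, _, mem_chart_source H q, isCoframe_toChart q, isConnForm_cprojShift hJ hD hl q⟩
  torsion_eq_zero := by
    rw [CovariantDerivative.torsion_eq_zero_iff]
    intro X Y x hX hY
    have h := (CovariantDerivative.torsion_eq_zero_iff (cov := D)).1 hD.torsion_eq_zero hX hY
    have h1 := cprojShift_apply J D l Y x (X x)
    have h2 := cprojShift_apply J D l X x (Y x)
    have h3 := cmulForm_symm (endAt J x) (formE l x) (Y x) (X x)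
    refine Eq.trans ?_ h
    refine (congrArg₂ (fun a b : E => a - b) h1 h2).trans ?_
    simp only [h3]
    exact sub_sub_sub_cancel_right _ _ _
  parallel X Y hX hY x := by
    have h := hD.parallel X Y hX hY x
    have h1 := cprojShift_apply J D l (appEnd J Y) x (X x)
    have h2 := cprojShift_apply J D l Y x (X x)
    have h3 : cmulForm (endAt J x) (formE l x) (endAt J x (Y x)) (X x)
      = endAt J x (cmulForm (endAt J x) (formE l x) (Y x) (X x)) :=
      cmulForm_J (E := E) (J := endAt J x) (hJ.sq x) (hlJ x) _ _
    have h4 : endAt J x (covE (cprojShift J D l) Y x (X x)) = endAt J x (covE D Y x (X x))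
        - endAt J x (cmulForm (endAt J x) (formE l x) (Y x) (X x)) :=
      (congrArg (endAt J x) h2).trans (map_sub (endAt J x) _ _)
    exact h1.trans ((congrArg₂ (fun a b : E => a - b) h h3).trans h4.symm)

lemma chartField_chartVel {c : ℝ → M} (hc : ContMDiff 𝓘(ℝ, ℝ) I ∞ c) (t : ℝ) :
    chartField (I := I) (c t) (chartVel (I := I) (c t) c t) (c t) = (dmap 𝓘(ℝ, ℝ) I c t 1 : E) := by
  have hx := mem_chart_source H (c t)
  have h1 := mvfderiv_mcomp (mdifferentiableAt_extChartAt (I := I) hx)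
    ((hc t).mdifferentiableAt (n := ∞) (by simp)) (1 : ℝ)
  rw [← toChart_eq_mvfderiv hx, toChart_self] at h1
  rw [chartField_eq hx, ofChart_self]
  refine Eq.trans ?_ h1
  exact (congrArg (fun L : ℝ →L[ℝ] E => L 1) mfderiv_eq_fderiv).symm

lemma accel_cprojShift {c : ℝ → M} (hc : ContMDiff 𝓘(ℝ, ℝ) I ∞ c) (t : ℝ) :
    accelE (cprojShift J D l) c t = accelE D c t
      - (2 : ℝ) • cmul (endAt J (c t)) (formE l (c t) (dmap 𝓘(ℝ, ℝ) I c t 1))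
        (dmap 𝓘(ℝ, ℝ) I c t 1) := by
  have h1 := cprojShift_apply J D l (chartField (c t) (chartVel (I := I) (c t) c t)) (c t)
    (dmap 𝓘(ℝ, ℝ) I c t 1)
  have h2 : chartField (c t) (chartVel (I := I) (c t) c t) (c t) = dmap 𝓘(ℝ, ℝ) I c t 1 :=
    chartField_chartVel hc t
  rw [h2, cmulForm_apply] at h1
  refine (congrArg (fun e : E => (show E from
    chartField (c t) (deriv (chartVel (I := I) (c t) c) t) (c t)) + e) h1).trans ?_
  rw [two_smul]
  exact (add_sub_assoc _ _ _).symm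

lemma isJPlanar_cprojShift (c : ℝ → M) : IsJPlanar J (cprojShift J D l) c ↔ IsJPlanar J D c := by
  constructor
  · rintro ⟨hc, h⟩
    refine ⟨hc, fun t => ?_⟩
    obtain ⟨a, b, hab⟩ := h t
    have h1 := accel_cprojShift (J := J) (D := D) (l := l) hc t
    let z := formE l (c t) (dmap 𝓘(ℝ, ℝ) I c t 1)
    refine ⟨a + 2 * z.re, b + 2 * z.im, ?_⟩
    have hab' : accelE (cprojShift J D l) c t = a • dmap 𝓘(ℝ, ℝ) I c t 1
      + b • endAt J (c t) (dmap 𝓘(ℝ, ℝ) I c t 1) := hab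
    have h2 : accelE D c t = (a + 2 * z.re) • dmap 𝓘(ℝ, ℝ) I c t 1
      + (b + 2 * z.im) • endAt J (c t) (dmap 𝓘(ℝ, ℝ) I c t 1) := by
      rw [hab'] at h1
      rw [eq_sub_iff_add_eq] at h1
      rw [← h1, cmul]
      module
    exact h2
  · rintro ⟨hc, h⟩
    refine ⟨hc, fun t => ?_⟩
    obtain ⟨a, b, hab⟩ := h t
    have h1 := accel_cprojShift (J := J) (D := D) (l := l) hc t
    let z := formE l (c t) (dmap 𝓘(ℝ, ℝ) I c t 1)
    refine ⟨a - 2 * z.re, b - 2 * z.im, ?_⟩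
    have hab' : accelE D c t = a • dmap 𝓘(ℝ, ℝ) I c t 1
      + b • endAt J (c t) (dmap 𝓘(ℝ, ℝ) I c t 1) := hab
    have h2 : accelE (cprojShift J D l) c t = (a - 2 * z.re) • dmap 𝓘(ℝ, ℝ) I c t 1
      + (b - 2 * z.im) • endAt J (c t) (dmap 𝓘(ℝ, ℝ) I c t 1) := by
      rw [h1, hab', cmul]
      module
    exact h2

lemma cprojClass_cprojShift : cprojClass J (cprojShift J D l) = cprojClass J D := by
  ext D'
  exact and_congr_right fun _ => forall_congr' fun c => by rw [isJPlanar_cprojShift]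

end CProjShift

section CanonicalClass

variable {E : Type*} [NormedAddCommGroup E] [NormedSpace ℝ E] [FiniteDimensional ℝ E]
  [CompleteSpace E] {H : Type*} [TopologicalSpace H] {I : ModelWithCorners ℝ E H} [I.Boundaryless]
  {M : Type*} [TopologicalSpace M] [T2Space M] [ChartedSpace H M] [IsManifold I ∞ M]
  {E' : Type*} [NormedAddCommGroup E'] [NormedSpace ℝ E'] [FiniteDimensional ℝ E']
  [CompleteSpace E'] {H' : Type*} [TopologicalSpace H'] {I' : ModelWithCorners ℝ E' H'}
  [I'.Boundaryless]
  {N : Type*} [TopologicalSpace N] [T2Space N] [ChartedSpace H' N] [IsManifold I' ∞ N]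
  [MulAction ℂˣ N]
  {pr : N → M} {θ θ' : OneForm I' N ℂ} {ε : Π p : N, (E × ℂ) →L[ℝ] TangentSpace I' p}
  {J : EndField I M} {D : AffConn I M} {h : M → E →L[ℝ] E →L[ℝ] ℂ} {b : N → E →L[ℝ] E →L[ℝ] E}
  {k : N → E →L[ℝ] E →L[ℝ] ℂ}

lemma IsPrincipalBundle.exists_smul_eq (hN : IsPrincipalBundle I I' 𝓘(ℝ, ℂ) ℂˣ pr) {p q : N}
    (hpq : pr p = pr q) : ∃ z : ℂˣ, z • p = q := by
  obtain ⟨τ, hτ⟩ := hN.locallyTrivial (pr p)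
  refine ⟨τ.coord q * (τ.coord p)⁻¹, ?_⟩
  have h1 := τ.coord_smul p hτ
  have h2 := τ.coord_smul q (hpq ▸ hτ)
  rw [← hpq] at h2
  have h3 : (τ.coord q * (τ.coord p)⁻¹) • τ.coord p • τ.sec (pr p) = q := by
    rw [smul_smul, inv_mul_cancel_right, h2]
  rwa [h1] at h3

lemma IsPrincipalBundle.exists_section (hN : IsPrincipalBundle I I' 𝓘(ℝ, ℂ) ℂˣ pr) (x : M) :
    ∃ σ : M → N, ContMDiffAt I I' ∞ σ x ∧ ∀ᶠ y in 𝓝 x, pr (σ y) = y := by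
  obtain ⟨τ, hτ⟩ := hN.locallyTrivial x
  have hU := τ.isOpen.mem_nhds hτ
  refine ⟨τ.sec, τ.smooth_sec.contMDiffAt hU, ?_⟩
  filter_upwards [hU] with y hy
  simpa using τ.proj_smul_sec y hy 1

lemma ConeData.smoothVF_lift (C : ConeData pr θ ε J D h b k) {V : VField I M} (hV : SmoothVF V) :
    SmoothVF (I := I') (fun q => ε q ((V (pr q) : E), 0)) := by
  intro q
  have hq := mem_chart_source H (pr q)
  refine (C.isCoframe (pr q)).smoothVFAt_of_form hq ?_
  have h1 : ContMDiffAt I' 𝓘(ℝ, E) ∞ (fun y => toChart (I := I) (pr q) (pr y) (V (pr y))) q :=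
    ContMDiffAt.comp q ((contMDiffAt_vf_iff hq).1 (hV.at (pr q))) (C.smooth_proj q)
  refine (h1.prodMk_space (contMDiffAt_const (c := (0 : ℂ)))).congr_of_eventuallyEq
    (Filter.Eventually.of_forall fun y => ?_)
  exact Prod.ext (congrArg (fun e : E => toChart (I := I) (pr q) (pr y) e) (C.proj_frame y _))
    (C.form_frame y _)

/-- The difference of a connection form with `J`-invariant kernel and the form `θ` descends to the
base. -/
lemma ConeData.exists_difference (C : ConeData pr θ ε J D h b k)
    (hN : IsPrincipalBundle I I' 𝓘(ℝ, ℂ) ℂˣ pr) (hθ : IsPrincipalConnection I' expUnits θ)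
    (hfund : ∀ ζ p, fundVF I' expUnits ζ p = ε p (0, ζ))
    (hθ' : IsConnectionOfType (coneJ pr θ ε J) θ') :
    ∃ l : OneForm I M ℂ, (∀ x, SmoothFormAt l x) ∧
      (∀ x (v : E), formE l x (endAt J x v) = Complex.I * formE l x v) ∧
      ∀ p (v : TangentSpace I' p), θ' p v = formE l (pr p) (dproj I I' pr p v) + θ p v := by
  have hsec : ∀ x, ∃ p, pr p = x := fun x => by
    obtain ⟨σ, -, h⟩ := hN.exists_section x
    exact ⟨σ x, h.self_of_nhds⟩
  choose s hs using hsec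
  let l : OneForm I M ℂ := fun x =>
    (formE θ' (s x) ∘L (ε (s x) : E × ℂ →L[ℝ] E') ∘L ContinuousLinearMap.inl ℝ E ℂ : E →L[ℝ] ℂ)
  have hvert : ∀ p ζ, θ' p (ε p (0, ζ)) = ζ := fun p ζ => by
    rw [← hfund, hθ'.1.reproduces]
  have hdpr : ∀ (z : ℂˣ) p (v : TangentSpace I' p),
      dproj I I' pr (z • p) (mfderiv I' I' (fun q => z • q) p v) = dproj I I' pr p v := fun z p v => by
    have h1 := dmap_comp (g := pr) (f := fun q : N => z • q) (I₃ := I)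
      ((C.smooth_proj (z • p)).mdifferentiableAt (n := ∞) (by simp))
      (((hN.smooth_action.comp (contMDiff_const.prodMk contMDiff_id) :
        ContMDiff I' I' ∞ (fun q : N => z • q)) p).mdifferentiableAt (n := ∞) (by simp)) v
    simp only [hN.proj_smul] at h1
    exact h1.symm
  have hl : ∀ p (u : E), θ' p (ε p (u, 0)) = formE l (pr p) u := fun p u => by
    obtain ⟨z, hz⟩ := hN.exists_smul_eq (hs (pr p))
    have h1 : mfderiv I' I' (fun q => z • q) (s (pr p)) (ε (s (pr p)) (u, 0))
        = ε (z • s (pr p)) (u, 0) := by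
      refine C.frame_injective ?_ ?_
      · rw [hdpr, C.proj_frame, C.proj_frame]
      · rw [hθ.invariant, C.form_frame, C.form_frame]
    have h2 := hθ'.1.invariant z (s (pr p)) (ε (s (pr p)) (u, 0))
    rw [h1] at h2
    have h3 : ∀ q, q = p → θ' q (ε q (u, 0)) = θ' p (ε p (u, 0)) := by
      rintro q rfl
      rfl
    exact (h3 _ hz).symm.trans h2
  have hdiff : ∀ p (v : TangentSpace I' p),
      θ' p v = formE l (pr p) (dproj I I' pr p v) + θ p v := fun p v => by
    have h1 : (dproj I I' pr p v, θ p v) = ((dproj I I' pr p v, 0) + (0, θ p v) : E × ℂ) := by simp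
    have h2 := C.left_inv p v
    rw [h1, map_add] at h2
    rw [← hl, ← hvert p (θ p v), ← map_add, h2]
  refine ⟨l, fun x => smoothFormAt_of_global fun V hV => ?_, fun x v => ?_, hdiff⟩
  · obtain ⟨σ, hσ, hσx⟩ := hN.exists_section x
    have h1 := (hθ'.1.smooth _ (C.smoothVF_lift hV) (σ x)).comp x hσ
    refine h1.congr_of_eventuallyEq ?_
    filter_upwards [hσx] with y hy
    have h2 : ∀ z, z = y → formE l z (V z) = formE l y (V y) := by
      rintro z rfl
      rfl
    exact (h2 _ hy).symm.trans (hl (σ y) _).symm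
  · obtain ⟨p, hp⟩ : ∃ p, pr p = x := ⟨s x, hs x⟩
    subst hp
    have h1 : θ' p (ε p (v, - formE l (pr p) v)) = 0 := by
      rw [hdiff, C.proj_frame, C.form_frame]
      exact add_neg_cancel _
    have h2 := hθ'.2 p _ h1
    rw [hdiff, C.dproj_coneJ, C.form_coneJ, C.proj_frame, C.form_frame] at h2
    linear_combination h2

lemma ConeData.isCanonicalCProj (C : ConeData pr θ ε J D h b k)
    (hN : IsPrincipalBundle I I' 𝓘(ℝ, ℂ) ℂˣ pr)
    (hθ : IsConnectionOfType (coneJ pr θ ε J) θ)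
    (hfund : ∀ ζ p, fundVF I' expUnits ζ p = ε p (0, ζ)) :
    IsCanonicalCProj J pr (coneJ pr θ ε J) (coneConn C) (cprojClass J D) := by
  refine ⟨⟨θ, hθ⟩, fun θ' hθ' => ?_⟩
  obtain ⟨l, hl, hlJ, hdiff⟩ := C.exists_difference hN hθ.1 hfund hθ'
  refine ⟨cprojShift J D l, isTorsionFreeComplex_cprojShift C.complexBase C.conn hl hlJ, ?_,
    cprojClass_cprojShift.symm⟩
  intro X Y Xt Yt hX hY hXt hYt hXX hYY p
  have h1 := C.dproj_specialCovD (X := Xt) (hYt.at p) (hY.at (pr p)) (fun q => (hYY q).2)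
  have hθl : ∀ {Z : VField I M} {Zt : VField I' N}, IsHorizontalLift pr θ' Z Zt →
      dproj I I' pr p (Zt p) = Z (pr p) ∧ θ p (Zt p) = - formE l (pr p) (Z (pr p)) :=
    fun {Z Zt} hZ => by
      have h2 : dproj I I' pr p (Zt p) = Z (pr p) := (hZ p).2
      refine ⟨h2, ?_⟩
      have h3 := hdiff p (Zt p)
      rw [(hZ p).1, h2] at h3
      linear_combination -h3
  obtain ⟨hX₁, hX₂⟩ := hθl hXX
  obtain ⟨hY₁, hY₂⟩ := hθl hYY
  have h2 : toChart (I := I) (pr p) (pr p) (D Y (pr p) (mfderiv I' I pr p (Xt p)))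
      = covE D Y (pr p) (X (pr p)) :=
    (toChart_self (E := E) (I := I) (pr p) _).trans (congrArg (covE D Y (pr p)) hX₁)
  rw [h2, hX₁, hX₂, hY₁, hY₂] at h1
  have h3 := cprojShift_apply J D l Y (pr p) (X (pr p))
  exact h1.trans ((sub_cmulForm _ _ _ _ _).symm.trans h3.symm)

end CanonicalClass

end PSC

end


theorem theorem3p10 (n : ℕ) (hn : 2 ≤ n)
    {Mb : Type*} [TopologicalSpace Mb] [T2Space Mb] [SecondCountableTopology Mb]
    [ChartedSpace (EuclideanSpace ℝ (Fin (2 * n))) Mb] [IsManifold (𝓡 (2 * n)) ∞ Mb]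
    {S : Type*} [TopologicalSpace S] [T2Space S] [SecondCountableTopology S]
    [ChartedSpace (EuclideanSpace ℝ (Fin (2 * n + 1))) S] [IsManifold (𝓡 (2 * n + 1)) ∞ S]
    [MulAction Circle S]
    (Jb : PSC.EndField (𝓡 (2 * n)) Mb) (hJb : PSC.IsComplexStructure Jb)
    (P : Set (PSC.AffConn (𝓡 (2 * n)) Mb)) (hP : PSC.IsCProjStructure Jb P)
    (πS : S → Mb) (hS : PSC.IsPrincipalBundle (𝓡 (2 * n)) (𝓡 (2 * n + 1)) (𝓡 1) Circle πS)
    (η : PSC.OneForm (𝓡 (2 * n + 1)) S ℝ)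
    (hη : PSC.IsPrincipalConnection (𝓡 (2 * n + 1)) Circle.exp η)
    {Λ : Type*} (τ : Λ → PSC.LocalTriv (𝓡 (2 * n)) (𝓡 (2 * n + 1)) (𝓡 1) Circle πS)
    (B : Λ → PSC.Tensor12 (𝓡 (2 * n)) Mb) (c : Λ → PSC.Tensor02 (𝓡 (2 * n)) Mb)
    (hPSCB : PSC.IsPSCB n Jb P πS η τ B c) :
    ∃ (J : PSC.EndField ((𝓡 (2 * n + 1)).prod 𝓘(ℝ, ℝ)) (S × PSC.PosReal))
      (D : PSC.AffConn ((𝓡 (2 * n + 1)).prod 𝓘(ℝ, ℝ)) (S × PSC.PosReal))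
      (ξ : PSC.VField ((𝓡 (2 * n + 1)).prod 𝓘(ℝ, ℝ)) (S × PSC.PosReal)),
      PSC.IsConicalSpecialComplex J D ξ ∧
      PSC.IsProjectiveSpecialComplex Jb (fun p : S × PSC.PosReal => πS p.1) J D ξ ∧
      PSC.IsCanonicalCProj Jb (fun p : S × PSC.PosReal => πS p.1) J D P := by
  obtain ⟨D, hDP, a, ha, hb, hcurv⟩ := hPSCB.exists_coneBase hJb hP
  have : LocallyCompactSpace Mb := ChartedSpace.locallyCompactSpace (EuclideanSpace ℝ (Fin (2 * n))) Mb
  have : SigmaCompactSpace Mb := inferInstance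
  obtain ⟨κ, hκ, hdκ⟩ := PSC.exists_rho_primitive n Jb hb.conn.toIsSmoothTorsionFree
  obtain ⟨ε, hε₁, hε₂, hε₃⟩ := PSC.exists_coneFrame hS hη κ (by simp)
  have C := (hPSCB.coneTotal hJb hS hη ha hcurv hκ hdκ hε₁ hε₂ hε₃).coneData hb
  refine ⟨_, _, _, C.isConicalSpecialComplex, C.isProjectiveSpecialComplex hS hη, ?_⟩
  rw [hP.eq_cprojClass hDP]
  exact C.isCanonicalCProj (PSC.isPrincipalBundle_cone hS) (C.isConnectionOfType hS hη)
    (C.fundVF_eq hS hη)
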